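/- **Setting.** Let $q=e^{h}$ with $h\in\mathbb C$, $q^4\neq1$; put $q^{z}=e^{hz}$, $\lambda=q-q^{-1}$, $[z]=(q^z-q^{-z})/\lambda$, and use the same notation for exponentials of diagonalizable operators. $U_q(g\ell(m))$ is the algebra with generators $q^{\pm N_i/2}$ ($1\le i\le m$), $e_i,f_i$ ($1\le i<m$) and relations: the $q^{\pm N_i/2}$ commute and are mutually inverse, $q^{N_i/2}e_j=q^{(\delta_{ij}-\delta_{i,j+1})/2}e_jq^{N_i/2}$, $q^{N_i/2}f_j=q^{-(\delta_{ij}-\delta_{i,j+1})/2}f_jq^{N_i/2}$, $[e_i,f_j]=\delta_{ij}[N_i-N_{i+1}]$, $[e_i,e_j]=[f_i,f_j]=0$ for $|i-j|>1$, and $e_i^2e_j-(q+q^{-1})e_ie_je_i+e_je_i^2=0$ for $|i-j|=1$, likewise for $f$. The Cartan–Weyl generators are $E_{i,i+1}=e_i$, $E_{i+1,i}=f_i$, $E_{ij}=E_{i,j-1}E_{j-1,j}-qE_{j-1,j}E_{i,j-1}$ ($i+1<j$), $E_{ij}=E_{i,i-1}E_{i-1,j}-q^{-1}E_{i-1,j}E_{i,i-1}$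 ($i>j+1$), $E_{ii}=N_i$. The Lax matrix is $$L_{ij}(u)=q^{\pm(u-\frac12+\frac12(E_{ii}+E_{jj}))}E_{ji}\quad(+\text{ for }i<j,\ -\text{ for }i>j),\qquad L_{ii}(u)=[u+E_{ii}],$$ and $L_\pm$ (upper/lower triangular, independent of $u$) are defined by $\lambda L(u)=q^uL_+-q^{-u}L_-$. Let $n\ge0$, and let $x_i,\partial_i$, $i=1,\dots,n+1$, be Heisenberg pairs ($[\partial_i,x_j]=\delta_{ij}$, $[x_i,x_j]=[\partial_i,\partial_j]=0$) on a complex vector space $F$, with all $x_i$ invertible and all $N_i=x_i\partial_i$ diagonalizable. Let $L^x(u)$, $L^x_\pm$ be composed, by the above rules, of the Jordan–Schwinger generators $e_i=\frac{x_i}{x_{i+1}}[N_{i+1}]$, $f_i=\frac{x_{i+1}}{x_i}[N_i]$, $q^{\pm N_i/2}$. For $i\le n$ put $N_{i,n+1}=\frac12N_i+N_{i+1}+\dots+N_n+\frac12N_{n+1}$, $X_i=q^{-N_{i,n+1}}x_i$, and $X_{n+1}=x_{n+1}$. Define $(n+1)\times(n+1)$ matrices: * $D^{(x)}=\mathrm{diag}(X_1,\dots,X_{n+1})$;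 $m_1$ has entries $1$ on the diagonal and on the last row, and $0$ elsewhere; * $D_L(u)=\mathrm{diag}(q^{\alpha_1},\dots,q^{\alpha_n},1)$ with $\alpha_i=2(1-u)-N_{n+1}-2N_1-\dots-2N_{i-1}-N_i$; $D_R(u)=\mathrm{diag}(q^{2(1-u)},\dots,q^{2(1-u)},1)$; * $\widetilde K(u)$ is upper triangular; for $i\le n$: $\widetilde K_{ii}=[u-1]q^{N_i}$, $\widetilde K_{ij}=\lambda[u-1][N_i]$ for $i<j\le n$, $\widetilde K_{i,n+1}=q^{u-1}[N_i]$; and $\widetilde K_{n+1,n+1}=[u-1+N_1+\dots+N_{n+1}]\,q^{-N_1-\dots-N_n}$; * $M_L=D^{(x)-1}\bigl(D_L^{-1}m_1^{-1}D_L\bigr)D^{(x)}$, $M_R=D^{(x)-1}\bigl(D_R^{-1}m_1D_R\bigr)D^{(x)}$, $K=D^{(x)-1}\widetilde KD^{(x)}$ (all at $u$). Let $V$ be any representation of $U_q(g\ell(n))$. On $F\otimes V$ let $L^n(u)$ be the block diagonal $(n+1)\times(n+1)$ matrix with upper $n\times n$ block the Lax matrix of $V$ and last diagonal entry $[u]$,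 and let $L^n_\pm$ be defined by $\lambda L^n(u)=q^uL^n_+-q^{-u}L^n_-$ (their last diagonal entries are $1$). Let $L'_+=L^n_+$, and let $L'_-$ be obtained from $L^n_-$ by changing its last-row entries with column index $i\le n$ to $-\lambda\widetilde{\mathcal E}_{i,n+1}$, where $\widetilde{\mathcal E}_{i,n+1}=-x_{n+1}^{-1}\sum_{s\le n}X_s\,L^n_{si}(0)$. Put $\lambda L'(u)=q^uL'_+-q^{-u}L'_-$. The Lax matrix of the reduced tensor product is $$L^{(12')}(u)=\lambda^{-1}\bigl(q^uL^x_+L'_+-q^{-u}L^x_-L'_-\bigr).$$ Finally put $M'=I+\bigl(L_-^n-M_R(u+1)^{-1}L_-^nM_R(u+1)\bigr)$. **Proposition.** For all $u\in\mathbb C$: 1. The Jordan–Schwinger generators define a representation of $U_q(g\ell(n+1))$ on $F$, and its Lax matrix factorises as $L^x(u)=M_L(u)K(u)M_R(u)$. Here $M_L$ and $M_R$ are lower triangular with units on the diagonal and non-zero off-diagonal entries only on the last row, and $K$ is upper triangular. 2. $L^{(12')}(u)$ is the Lax matrix (for all $u$ simultaneously) of a representation of $U_q(g\ell(n+1))$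 on $F\otimes V$. In it $q^{N_i/2}$ acts as the product of the actions of $q^{N_i/2}$ on $F$ and on $V$ for $i\le n$, and $q^{N_{n+1}/2}$ acts through $F$ only. For $i<n$ and $g=e,f$ the generator $g_i$ acts by the co-product $g_i\otimes q^{\frac12(N_{i+1}-N_i)}+q^{\frac12(N_i-N_{i+1})}\otimes g_i$. Moreover $L^x(u+1)L'(u)=[u]\,L^{(12')}(u+1)$. 3. The Lax matrix of this representation factorises as $$[u]\,L^{(12')}(u+1)=M_L(u+1)\,K(u+1)\,L^n(u)\,M'\,M_R(u+1),$$ where $M'$ is lower triangular with units on the diagonal and non-zero off-diagonal entries only on the last row. -/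

import Mathlib

open scoped TensorProduct

noncomputable section

namespace QLax

/-! ### Scalars: `q = exp h`, `q ^ z = exp (h z)`, `λ = q - q⁻¹`, `[z] = (q ^ z - q ^ (-z)) / λ` -/

/-- `q ^ z`, where `q = exp h`. -/
def qExp (h z : ℂ) : ℂ := Complex.exp (h * z)

/-- `λ = q - q⁻¹`. -/
def lam (h : ℂ) : ℂ := qExp h 1 - qExp h (-1)

/-- The `q`-number `[z]`. -/
def qNum (h z : ℂ) : ℂ := (qExp h z - qExp h (-z)) / lam h

/-! ### The algebra `U_q(gl(m))`, presented by Chevalley generators -/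

/-- A family of elements indexed like the Chevalley generators of `U_q(gl(m))`:
`k i` stands for `q ^ (N_i / 2)`, `kInv i` for `q ^ (- N_i / 2)`; the indices are `0, …, m - 1`,
and `e i`, `f i` exist for `i, i + 1 < m`. -/
structure ChevalleyData (m : ℕ) (A : Type*) where
  k : Fin m → A
  kInv : Fin m → A
  e : (i : ℕ) → i + 1 < m → A
  f : (i : ℕ) → i + 1 < m → A

/-- The image of a family under an algebra homomorphism. -/
def ChevalleyData.map {m : ℕ} {A B : Type*} [Ring A] [Algebra ℂ A] [Ring B] [Algebra ℂ B]
    (c : ChevalleyData m A) (φ : A →ₐ[ℂ] B) : ChevalleyData m B where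
  k i := φ (c.k i)
  kInv i := φ (c.kInv i)
  e i hi := φ (c.e i hi)
  f i hi := φ (c.f i hi)

/-- Names of the generators of `U_q(gl(m))`. -/
inductive Gen (m : ℕ) : Type
  | k (i : Fin m) : Gen m
  | kInv (i : Fin m) : Gen m
  | e (i : ℕ) (hi : i + 1 < m) : Gen m
  | f (i : ℕ) (hi : i + 1 < m) : Gen m

/-- The generators in the free algebra. -/
def freeData (m : ℕ) : ChevalleyData m (FreeAlgebra ℂ (Gen m)) where
  k i := FreeAlgebra.ι ℂ (Gen.k i)
  kInv i := FreeAlgebra.ι ℂ (Gen.kInv i)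
  e i hi := FreeAlgebra.ι ℂ (Gen.e i hi)
  f i hi := FreeAlgebra.ι ℂ (Gen.f i hi)

/-- Half the weight of `e j` with respect to `N_i`: `q ^ (N_i / 2) e_j = q ^ w e_j q ^ (N_i / 2)`
with `w = (δ_{i,j} - δ_{i,j+1}) / 2`. -/
def halfWeight (i j : ℕ) : ℂ := if i = j then 1 / 2 else if i = j + 1 then -(1 / 2) else 0

/-- The defining relations of `U_q(gl(m))`. -/
inductive UqRel (h : ℂ) (m : ℕ) : FreeAlgebra ℂ (Gen m) → FreeAlgebra ℂ (Gen m) → Prop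
  | k_kInv (i : Fin m) : UqRel h m ((freeData m).k i * (freeData m).kInv i) 1
  | kInv_k (i : Fin m) : UqRel h m ((freeData m).kInv i * (freeData m).k i) 1
  | k_k (i j : Fin m) : UqRel h m
      ((freeData m).k i * (freeData m).k j) ((freeData m).k j * (freeData m).k i)
  | k_e (i : Fin m) (j : ℕ) (hj : j + 1 < m) : UqRel h m
      ((freeData m).k i * (freeData m).e j hj)
      (qExp h (halfWeight i j) • ((freeData m).e j hj * (freeData m).k i))
  | k_f (i : Fin m) (j : ℕ) (hj : j + 1 < m) : UqRel h m
      ((freeData m).k i * (freeData m).f j hj)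
      (qExp h (-halfWeight i j) • ((freeData m).f j hj * (freeData m).k i))
  | e_f_self (i : ℕ) (hi : i + 1 < m) : UqRel h m
      ((freeData m).e i hi * (freeData m).f i hi - (freeData m).f i hi * (freeData m).e i hi)
      ((lam h)⁻¹ •
        ((freeData m).k ⟨i, by omega⟩ ^ 2 * (freeData m).kInv ⟨i + 1, hi⟩ ^ 2
          - (freeData m).kInv ⟨i, by omega⟩ ^ 2 * (freeData m).k ⟨i + 1, hi⟩ ^ 2))
  | e_f_ne (i j : ℕ) (hi : i + 1 < m) (hj : j + 1 < m) (hij : i ≠ j) : UqRel h m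
      ((freeData m).e i hi * (freeData m).f j hj) ((freeData m).f j hj * (freeData m).e i hi)
  | e_e (i j : ℕ) (hi : i + 1 < m) (hj : j + 1 < m) (hij : i + 1 < j) : UqRel h m
      ((freeData m).e i hi * (freeData m).e j hj) ((freeData m).e j hj * (freeData m).e i hi)
  | f_f (i j : ℕ) (hi : i + 1 < m) (hj : j + 1 < m) (hij : i + 1 < j) : UqRel h m
      ((freeData m).f i hi * (freeData m).f j hj) ((freeData m).f j hj * (freeData m).f i hi)
  | serre_e (i j : ℕ) (hi : i + 1 < m) (hj : j + 1 < m) (hij : i + 1 = j ∨ j + 1 = i) : UqRel h m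
      ((freeData m).e i hi ^ 2 * (freeData m).e j hj
        - (qExp h 1 + qExp h (-1)) •
            ((freeData m).e i hi * (freeData m).e j hj * (freeData m).e i hi)
        + (freeData m).e j hj * (freeData m).e i hi ^ 2) 0
  | serre_f (i j : ℕ) (hi : i + 1 < m) (hj : j + 1 < m) (hij : i + 1 = j ∨ j + 1 = i) : UqRel h m
      ((freeData m).f i hi ^ 2 * (freeData m).f j hj
        - (qExp h 1 + qExp h (-1)) •
            ((freeData m).f i hi * (freeData m).f j hj * (freeData m).f i hi)
        + (freeData m).f j hj * (freeData m).f i hi ^ 2) 0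

/-- The algebra `U_q(gl(m))`. A representation on `V` is an algebra homomorphism
`UqGL h m →ₐ[ℂ] Module.End ℂ V`. -/
abbrev UqGL (h : ℂ) (m : ℕ) : Type := RingQuot (UqRel h m)

/-- The Chevalley generators of `U_q(gl(m))`. -/
def gens (h : ℂ) (m : ℕ) : ChevalleyData m (UqGL h m) :=
  (freeData m).map (RingQuot.mkAlgHom ℂ (UqRel h m))

/-! ### Cartan-Weyl generators and the Lax matrix -/

section Lax

variable {m : ℕ} {A : Type*} [Ring A] [Algebra ℂ A]

/-- `[a, b]_t = a b - t b a`. -/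
def qComm (t : ℂ) (a b : A) : A := a * b - t • (b * a)

/-- `raising h c i d = E_{i, i+d+1}`: `E_{i,i+1} = e_i`, `E_{ij} = [E_{i,j-1}, E_{j-1,j}]_q`. -/
def raising (h : ℂ) (c : ChevalleyData m A) (i : ℕ) : (d : ℕ) → i + d + 1 < m → A
  | 0, hd => c.e i hd
  | d + 1, hd => qComm (qExp h 1) (raising h c i d (by omega)) (c.e (i + d + 1) (by omega))

/-- `lowering h c j d = E_{j+d+1, j}`:
`E_{j+1,j} = f_j`, `E_{ij} = [E_{i,i-1}, E_{i-1,j}]_{q⁻¹}`. -/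
def lowering (h : ℂ) (c : ChevalleyData m A) (j : ℕ) : (d : ℕ) → j + d + 1 < m → A
  | 0, hd => c.f j hd
  | d + 1, hd => qComm (qExp h (-1)) (c.f (j + d + 1) (by omega)) (lowering h c j d (by omega))

/-- The Cartan-Weyl generator `E_{ij}`, `i ≠ j` (the value at `i = j` is never used). -/
def cartanWeyl (h : ℂ) (c : ChevalleyData m A) (i j : Fin m) : A :=
  if hij : i.val < j.val then raising h c i (j - i - 1) (by omega)
  else if hji : j.val < i.val then lowering h c j (i - j - 1) (by omega)
  else 0

/-- The Lax matrix `L(u)` composed of the Cartan-Weyl generators: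
`L_ij = q ^ (u - 1/2 + (E_ii + E_jj)/2) E_ji` for `i < j`,
`L_ij = q ^ (-(u - 1/2) - (E_ii + E_jj)/2) E_ji` for `i > j`, and `L_ii = [u + E_ii]`. -/
def laxMatrix (h : ℂ) (c : ChevalleyData m A) (u : ℂ) : Matrix (Fin m) (Fin m) A :=
  Matrix.of fun i j =>
    if i < j then qExp h (u - 1 / 2) • (c.k i * c.k j * cartanWeyl h c j i)
    else if j < i then qExp h (-(u - 1 / 2)) • (c.kInv i * c.kInv j * cartanWeyl h c j i)
    else (lam h)⁻¹ • (qExp h u • c.k i ^ 2 - qExp h (-u) • c.kInv i ^ 2)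

/-- The upper triangular matrix `L_+` in `λ L(u) = q ^ u L_+ - q ^ (-u) L_-`. -/
def laxPlus (h : ℂ) (c : ChevalleyData m A) : Matrix (Fin m) (Fin m) A :=
  Matrix.of fun i j =>
    if i < j then (lam h * qExp h (-(1 / 2))) • (c.k i * c.k j * cartanWeyl h c j i)
    else if j < i then 0
    else c.k i ^ 2

/-- The lower triangular matrix `L_-` in `λ L(u) = q ^ u L_+ - q ^ (-u) L_-`. -/
def laxMinus (h : ℂ) (c : ChevalleyData m A) : Matrix (Fin m) (Fin m) A :=
  Matrix.of fun i j =>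
    if i < j then 0
    else if j < i then -((lam h * qExp h (1 / 2)) • (c.kInv i * c.kInv j * cartanWeyl h c j i))
    else c.kInv i ^ 2

/-- `λ⁻¹ (q ^ u L_+ - q ^ (-u) L_-)`. -/
def spectralCombine (h : ℂ) (Lp Lm : Matrix (Fin m) (Fin m) A) (u : ℂ) :
    Matrix (Fin m) (Fin m) A :=
  (lam h)⁻¹ • (qExp h u • Lp - qExp h (-u) • Lm)

theorem qExp_add (h a b : ℂ) : qExp h (a + b) = qExp h a * qExp h b := by
  simp only [qExp, mul_add, Complex.exp_add]

/-- The standard decomposition of the Lax matrix. -/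
theorem laxMatrix_eq (h : ℂ) (hl : lam h ≠ 0) (c : ChevalleyData m A) (u : ℂ) :
    laxMatrix h c u = spectralCombine h (laxPlus h c) (laxMinus h c) u := by
  have e1 : qExp h (u - 1 / 2) = qExp h u * qExp h (-(1 / 2)) := by
    rw [← qExp_add]; ring_nf
  have e2 : qExp h (-(u - 1 / 2)) = qExp h (-u) * qExp h (1 / 2) := by
    rw [← qExp_add]; ring_nf
  ext i j
  by_cases h1 : i < j
  · simp only [laxMatrix, laxPlus, laxMinus, spectralCombine, Matrix.of_apply, Matrix.smul_apply,
      Matrix.sub_apply, h1, if_true, smul_zero, sub_zero, smul_smul, e1]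
    congr 1
    field_simp
  · by_cases h2 : j < i
    · simp only [laxMatrix, laxPlus, laxMinus, spectralCombine, Matrix.of_apply,
        Matrix.smul_apply, Matrix.sub_apply, h1, h2, if_true, if_false, smul_zero, zero_sub,
        smul_neg, neg_neg, smul_smul, e2]
      congr 1
      field_simp
    · simp only [laxMatrix, laxPlus, laxMinus, spectralCombine, Matrix.of_apply,
        Matrix.smul_apply, Matrix.sub_apply, h1, h2, if_false]

end Lax

/-! ### Heisenberg pairs -/

/-- `r` Heisenberg pairs `x_i, ∂_i` acting on a complex vector space `F`. The `x_i` are invertible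
and the operators `N_i = x_i ∂_i` are diagonalizable, so that `x_i⁻¹` and `q ^ (c N_i)` make
sense. -/
structure HeisenbergPairs (r : ℕ) (F : Type*) [AddCommGroup F] [Module ℂ F] where
  x : Fin r → (Module.End ℂ F)ˣ
  del : Fin r → Module.End ℂ F
  x_comm : ∀ i j, (x i : Module.End ℂ F) * x j = x j * x i
  del_comm : ∀ i j, del i * del j = del j * del i
  del_x : ∀ i j, del i * x j - x j * del i = if i = j then 1 else 0
  diagonalizable : ∀ i, ⨆ μ : ℂ, Module.End.eigenspace ((x i : Module.End ℂ F) * del i) μ = ⊤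

section FunctionalCalculus

variable {F : Type*} [AddCommGroup F] [Module ℂ F]

theorem eigenspace_bijective (N : Module.End ℂ F) (hN : ⨆ μ : ℂ, N.eigenspace μ = ⊤) :
    Function.Bijective (DirectSum.coeLinearMap fun μ : ℂ => N.eigenspace μ) :=
  DirectSum.isInternal_submodule_of_iSupIndep_of_iSup_eq_top N.eigenspaces_iSupIndep hN

/-- `q ^ (c N)` for a diagonalizable operator `N`: multiplication by `q ^ (c μ)` on the eigenspace
of `N` of eigenvalue `μ`. -/
def qPow (h : ℂ) (N : Module.End ℂ F) (hN : ⨆ μ : ℂ, N.eigenspace μ = ⊤) (c : ℂ) :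
    Module.End ℂ F :=
  (DirectSum.toModule ℂ ℂ F fun μ : ℂ => qExp h (c * μ) • (N.eigenspace μ).subtype) ∘ₗ
    (LinearEquiv.ofBijective (DirectSum.coeLinearMap fun μ : ℂ => N.eigenspace μ)
      (eigenspace_bijective N hN)).symm.toLinearMap

theorem qPow_apply (h : ℂ) (N : Module.End ℂ F) (hN : ⨆ μ : ℂ, N.eigenspace μ = ⊤) (c μ : ℂ)
    (v : F) (hv : N v = μ • v) : qPow h N hN c v = qExp h (c * μ) • v := by
  have hv' : v ∈ N.eigenspace μ := Module.End.mem_eigenspace_iff.mpr hv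
  have key : (LinearEquiv.ofBijective (DirectSum.coeLinearMap fun μ : ℂ => N.eigenspace μ)
      (eigenspace_bijective N hN)).symm v
      = DirectSum.lof ℂ ℂ (fun μ : ℂ => N.eigenspace μ) μ ⟨v, hv'⟩ := by
    rw [LinearEquiv.symm_apply_eq]
    simp [DirectSum.coeLinearMap_lof]
  simp [qPow, key, DirectSum.toModule_lof]

end FunctionalCalculus

/-! ### The Jordan-Schwinger representation and the factors of its Lax matrix -/

namespace HeisenbergPairs

section General

variable {r : ℕ} {F : Type*} [AddCommGroup F] [Module ℂ F]

/-- `q ^ (c N_i)`, where `N_i = x_i ∂_i`. -/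
def qN (P : HeisenbergPairs r F) (h : ℂ) (i : Fin r) (c : ℂ) : Module.End ℂ F :=
  qPow h ((P.x i : Module.End ℂ F) * P.del i) (P.diagonalizable i) c

/-- `q ^ (∑ a_i N_i)`, the product of the (commuting) operators `q ^ (a_i N_i)`. -/
def qWeight (P : HeisenbergPairs r F) (h : ℂ) (a : Fin r → ℂ) : Module.End ℂ F :=
  (List.ofFn fun i => P.qN h i (a i)).prod

/-- `[N_i]`. -/
def numN (P : HeisenbergPairs r F) (h : ℂ) (i : Fin r) : Module.End ℂ F :=
  (lam h)⁻¹ • (P.qN h i 1 - P.qN h i (-1))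

/-- The Jordan-Schwinger generators: `e_i = (x_i / x_{i+1}) [N_{i+1}]`,
`f_i = (x_{i+1} / x_i) [N_i]`, and `q ^ (± N_i / 2)` with `N_i = x_i ∂_i`. -/
def jsData (P : HeisenbergPairs r F) (h : ℂ) : ChevalleyData r (Module.End ℂ F) where
  k i := P.qN h i (1 / 2)
  kInv i := P.qN h i (-(1 / 2))
  e i hi := P.x ⟨i, by omega⟩ * ↑(P.x ⟨i + 1, hi⟩)⁻¹ * P.numN h ⟨i + 1, hi⟩
  f i hi := P.x ⟨i + 1, hi⟩ * ↑(P.x ⟨i, by omega⟩)⁻¹ * P.numN h ⟨i, by omega⟩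

end General

section Factors

variable {n : ℕ} {F : Type*} [AddCommGroup F] [Module ℂ F]

/-- The coefficients of `N_{i,n+1} = N_i / 2 + N_{i+1} + ⋯ + N_n + N_{n+1} / 2`, for `i ≤ n`. -/
def nuWeight (i s : Fin (n + 1)) : ℂ :=
  if s = i ∨ s = Fin.last n then 1 / 2 else if i < s then 1 else 0

/-- `X_i = q ^ (-N_{i,n+1}) x_i` for `i ≤ n`, and `X_{n+1} = x_{n+1}`. -/
def bigX (P : HeisenbergPairs (n + 1) F) (h : ℂ) (i : Fin (n + 1)) : Module.End ℂ F :=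
  if i = Fin.last n then P.x i else P.qWeight h (fun s => -nuWeight i s) * P.x i

/-- The diagonal matrix `D^{(x)}`. -/
def Dx (P : HeisenbergPairs (n + 1) F) (h : ℂ) :
    Matrix (Fin (n + 1)) (Fin (n + 1)) (Module.End ℂ F) :=
  Matrix.diagonal (P.bigX h)

/-- The matrix `m_1`: ones on the diagonal and on the last row, zeros elsewhere. -/
def m1 (n : ℕ) (F : Type*) [AddCommGroup F] [Module ℂ F] :
    Matrix (Fin (n + 1)) (Fin (n + 1)) (Module.End ℂ F) :=
  Matrix.of fun i j => if i = j ∨ i = Fin.last n then 1 else 0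

/-- The coefficients of `- N_{n+1} - 2 N_1 - ⋯ - 2 N_{i-1} - N_i`, for `i ≤ n`. -/
def alphaWeight (i s : Fin (n + 1)) : ℂ :=
  if s = i ∨ s = Fin.last n then -1 else if s < i then -2 else 0

/-- `D_L(u)`: the diagonal matrix with entries `q ^ α_i`,
`α_i = 2 (1 - u) - N_{n+1} - 2 N_1 - ⋯ - 2 N_{i-1} - N_i` for `i ≤ n`, and last entry `1`. -/
def DL (P : HeisenbergPairs (n + 1) F) (h u : ℂ) :
    Matrix (Fin (n + 1)) (Fin (n + 1)) (Module.End ℂ F) :=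
  Matrix.diagonal fun i =>
    if i = Fin.last n then 1 else qExp h (2 * (1 - u)) • P.qWeight h (alphaWeight i)

/-- `D_R(u)`: the diagonal matrix with entries `q ^ (2 (1 - u))` for `i ≤ n`, and last
entry `1`. -/
def DR (n : ℕ) (F : Type*) [AddCommGroup F] [Module ℂ F] (h u : ℂ) :
    Matrix (Fin (n + 1)) (Fin (n + 1)) (Module.End ℂ F) :=
  Matrix.diagonal fun i => if i = Fin.last n then 1 else qExp h (2 * (1 - u)) • 1

/-- `M_L(u)`, obtained by conjugating `D_L⁻¹ m_1⁻¹ D_L` with `D^{(x)}`. All matrices inverted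
here and below are invertible, so that `Ring.inverse` is the two-sided inverse. -/
def ML (P : HeisenbergPairs (n + 1) F) (h u : ℂ) :
    Matrix (Fin (n + 1)) (Fin (n + 1)) (Module.End ℂ F) :=
  Ring.inverse (P.Dx h) * (Ring.inverse (P.DL h u) * Ring.inverse (m1 n F) * P.DL h u) * P.Dx h

/-- `M_R(u)`, obtained by conjugating `D_R⁻¹ m_1 D_R` with `D^{(x)}`. -/
def MR (P : HeisenbergPairs (n + 1) F) (h u : ℂ) :
    Matrix (Fin (n + 1)) (Fin (n + 1)) (Module.End ℂ F) :=
  Ring.inverse (P.Dx h) * (Ring.inverse (DR n F h u) * m1 n F * DR n F h u) * P.Dx h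

/-- The upper triangular matrix `K̃(u)`. Its rows `i ≤ n` are
`(0, …, 0, [u-1] q ^ N_i, λ [u-1] [N_i], …, λ [u-1] [N_i], q ^ (u-1) [N_i])`, and its last
diagonal entry is `[u - 1 + N_1 + ⋯ + N_{n+1}] q ^ (-N_1 - ⋯ - N_n)`. -/
def Ktilde (P : HeisenbergPairs (n + 1) F) (h u : ℂ) :
    Matrix (Fin (n + 1)) (Fin (n + 1)) (Module.End ℂ F) :=
  Matrix.of fun i j =>
    if i = Fin.last n then
      if j = Fin.last n then
        ((lam h)⁻¹ • (qExp h (u - 1) • P.qWeight h (fun _ => 1)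
            - qExp h (-(u - 1)) • P.qWeight h (fun _ => -1)))
          * P.qWeight h (fun s => if s = Fin.last n then 0 else -1)
      else 0
    else if j = Fin.last n then qExp h (u - 1) • P.numN h i
    else if i = j then qNum h (u - 1) • P.qN h i 1
    else if i < j then (lam h * qNum h (u - 1)) • P.numN h i
    else 0

/-- `K(u) = D^{(x)-1} K̃(u) D^{(x)}`. -/
def K (P : HeisenbergPairs (n + 1) F) (h u : ℂ) :
    Matrix (Fin (n + 1)) (Fin (n + 1)) (Module.End ℂ F) :=
  Ring.inverse (P.Dx h) * P.Ktilde h u * P.Dx h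

end Factors

end HeisenbergPairs

/-! ### The reduced tensor product -/

section Reduced

variable {n : ℕ}

/-- The block diagonal matrix with upper `n × n` block `M` and last diagonal entry `a`. -/
def extendBlock {A : Type*} [Zero A] (M : Matrix (Fin n) (Fin n) A) (a : A) :
    Matrix (Fin (n + 1)) (Fin (n + 1)) A :=
  Matrix.of fun i j =>
    if hi : i.val < n then
      if hj : j.val < n then M ⟨i, hi⟩ ⟨j, hj⟩ else 0
    else if j.val < n then 0 else a

/-- Lower triangular matrices with units on the diagonal whose only other non-zero elements are
on the last row. -/
def IsLastRowUnitriangular {A : Type*} [Zero A] [One A]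
    (M : Matrix (Fin (n + 1)) (Fin (n + 1)) A) : Prop :=
  (∀ i, M i i = 1) ∧ ∀ i j, i ≠ Fin.last n → i ≠ j → M i j = 0

variable {F V : Type*} [AddCommGroup F] [Module ℂ F] [AddCommGroup V] [Module ℂ V]

/-- An operator on `F` acting on the first factor of `F ⊗ V`. -/
abbrev onF (F V : Type*) [AddCommGroup F] [Module ℂ F] [AddCommGroup V] [Module ℂ V] :
    Module.End ℂ F →ₐ[ℂ] Module.End ℂ (F ⊗[ℂ] V) :=
  Module.End.rTensorAlgHom ℂ F V

/-- An operator on `V` acting on the second factor of `F ⊗ V`. -/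
abbrev onV (F V : Type*) [AddCommGroup F] [Module ℂ F] [AddCommGroup V] [Module ℂ V] :
    Module.End ℂ V →ₐ[ℂ] Module.End ℂ (F ⊗[ℂ] V) :=
  Module.End.lTensorAlgHom ℂ V F

/-- The generators of `U_q(gl(n))` acting on the second factor of `F ⊗ V`. -/
def secondData (F : Type*) [AddCommGroup F] [Module ℂ F] {h : ℂ}
    (ρ : UqGL h n →ₐ[ℂ] Module.End ℂ V) : ChevalleyData n (Module.End ℂ (F ⊗[ℂ] V)) :=
  (gens h n).map ((onV F V).comp ρ)

/-- The Jordan-Schwinger generators acting on the first factor of `F ⊗ V`. -/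
def firstData (V : Type*) [AddCommGroup V] [Module ℂ V] (P : HeisenbergPairs (n + 1) F) (h : ℂ) :
    ChevalleyData (n + 1) (Module.End ℂ (F ⊗[ℂ] V)) :=
  (P.jsData h).map (onF F V)

/-- `L^n(u)`: block diagonal, with the `U_q(gl(n))` Lax matrix as upper `n × n` block and last
diagonal element `[u]`. -/
def Ln (F : Type*) [AddCommGroup F] [Module ℂ F] {h : ℂ} (ρ : UqGL h n →ₐ[ℂ] Module.End ℂ V)
    (u : ℂ) : Matrix (Fin (n + 1)) (Fin (n + 1)) (Module.End ℂ (F ⊗[ℂ] V)) :=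
  extendBlock (laxMatrix h (secondData F ρ) u) (qNum h u • 1)

/-- `L_+^n`, from `λ L^n(u) = q ^ u L_+^n - q ^ (-u) L_-^n`. -/
def LnPlus (F : Type*) [AddCommGroup F] [Module ℂ F] {h : ℂ}
    (ρ : UqGL h n →ₐ[ℂ] Module.End ℂ V) :
    Matrix (Fin (n + 1)) (Fin (n + 1)) (Module.End ℂ (F ⊗[ℂ] V)) :=
  extendBlock (laxPlus h (secondData F ρ)) 1

/-- `L_-^n`, from `λ L^n(u) = q ^ u L_+^n - q ^ (-u) L_-^n`. -/
def LnMinus (F : Type*) [AddCommGroup F] [Module ℂ F] {h : ℂ}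
    (ρ : UqGL h n →ₐ[ℂ] Module.End ℂ V) :
    Matrix (Fin (n + 1)) (Fin (n + 1)) (Module.End ℂ (F ⊗[ℂ] V)) :=
  extendBlock (laxMinus h (secondData F ρ)) 1

/-- `ℰ̃_{i,n+1} = - x_{n+1}⁻¹ ∑_{s ≤ n} X_s ℰ_{is}`, where `ℰ_{is} = L_{si}(0)` are the elements of
the `U_q(gl(n))` Lax matrix at `u = 0`: the solution of the constraints
`∑_{s ≤ n+1} X_s ℰ_{is} = 0` for `ℰ_{i,n+1}`. -/
def reducedE (P : HeisenbergPairs (n + 1) F) {h : ℂ} (ρ : UqGL h n →ₐ[ℂ] Module.End ℂ V)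
    (i : Fin n) : Module.End ℂ (F ⊗[ℂ] V) :=
  -(onF F V ↑(P.x (Fin.last n))⁻¹ *
    ∑ s : Fin n, onF F V (P.bigX h s.castSucc) * laxMatrix h (secondData F ρ) 0 s i)

/-- `L'_+`: the matrix `L_+` of the second tensor factor, reduced by setting the generators
`E_{n+1,i}`, `i = 1, …, n+1`, to zero. -/
def reducedPlus (F : Type*) [AddCommGroup F] [Module ℂ F] {h : ℂ}
    (ρ : UqGL h n →ₐ[ℂ] Module.End ℂ V) :
    Matrix (Fin (n + 1)) (Fin (n + 1)) (Module.End ℂ (F ⊗[ℂ] V)) :=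
  LnPlus F ρ

/-- `L'_-`: the matrix `L_-` of the second tensor factor, reduced by setting `E_{n+1,n+1}` to zero
and replacing the entries `-λ ℰ_{i,n+1}` of the last row by `-λ ℰ̃_{i,n+1}`. -/
def reducedMinus (P : HeisenbergPairs (n + 1) F) {h : ℂ} (ρ : UqGL h n →ₐ[ℂ] Module.End ℂ V) :
    Matrix (Fin (n + 1)) (Fin (n + 1)) (Module.End ℂ (F ⊗[ℂ] V)) :=
  Matrix.of fun i j =>
    if hj : i = Fin.last n ∧ j.val < n then -(lam h • reducedE P ρ ⟨j, hj.2⟩)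
    else LnMinus F ρ i j

/-- `L'(u)`, the reduced Lax matrix of the second tensor factor. -/
def reducedSecondLax (P : HeisenbergPairs (n + 1) F) {h : ℂ}
    (ρ : UqGL h n →ₐ[ℂ] Module.End ℂ V) (u : ℂ) :
    Matrix (Fin (n + 1)) (Fin (n + 1)) (Module.End ℂ (F ⊗[ℂ] V)) :=
  spectralCombine h (reducedPlus F ρ) (reducedMinus P ρ) u

/-- `L^{(12')}(u)`, the Lax matrix of the reduced tensor product:
`λ L^{(12')}(u) = q ^ u L^x_+ L'_+ - q ^ (-u) L^x_- L'_-`. -/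
def reducedLax (P : HeisenbergPairs (n + 1) F) {h : ℂ} (ρ : UqGL h n →ₐ[ℂ] Module.End ℂ V)
    (u : ℂ) : Matrix (Fin (n + 1)) (Fin (n + 1)) (Module.End ℂ (F ⊗[ℂ] V)) :=
  spectralCombine h (laxPlus h (firstData V P h) * reducedPlus F ρ)
    (laxMinus h (firstData V P h) * reducedMinus P ρ) u

/-- `M' = I + (L_-^n - M_R(u+1)⁻¹ L_-^n M_R(u+1))`. -/
def Mprime (P : HeisenbergPairs (n + 1) F) {h : ℂ} (ρ : UqGL h n →ₐ[ℂ] Module.End ℂ V) (u : ℂ) :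
    Matrix (Fin (n + 1)) (Fin (n + 1)) (Module.End ℂ (F ⊗[ℂ] V)) :=
  1 + (LnMinus F ρ
    - Ring.inverse ((P.MR h (u + 1)).map (onF F V)) * LnMinus F ρ
        * (P.MR h (u + 1)).map (onF F V))

end Reduced

end QLax

end

open QLax

open scoped TensorProduct

noncomputable section

namespace QLax

/-! Indices run from 0 to n, so n is the last one. Everything is rewritten in terms of the entries
of L_±: a_i = q^{N_i} and b_i = q^{-N_i} on the diagonals, f_i next to the diagonal of L_+, and e_i
next to that of L_- (`TriangularData`). Up to invertible Cartan factors these are the Chevalley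
generators, so the defining relations turn into `Relations` (`IsUq.relations`, `isUq_of_relations`).
All further entries of L_+ come from the recursion [f_j, L_{sj}] = λ a_j L_{s,j+1} (`upper`). If a
row r obeys this recursion for one family, then r L_+ obeys it for the co-product with a second,
commuting family (`rowMul_step`); hence the co-product multiplies the matrices L_+
(`upper_coproduct`). Exchanging a with b and f with e, and reversing the order of the two families,
gives the statements on L_-.

Jordan–Schwinger part. F is spanned by joint eigenvectors of the N_i, so identities between
operators φ(N) x^d reduce to scalar identities (`HeisenbergPairs.end_ext`, `Acts`). Conjugated by
D^{(x)}, the Lax matrix has row i equal to q^{1-u}[N_i] left of the diagonal, [u-1+N_i] on it and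
q^{u-1}[N_i] right of it. The right factor adds a multiple of the last column of K̃ to the other
columns; the left factor changes only the last row, where the sums telescope (`Ltilde_eq`).

Product relation. L^x(u+1) L'(u) - [u] L^{(12')}(u+1) equals λ^{-2} (q L^x_+ - q^{-1} L^x_-)(L'_+ -
L'_-). The first bracket is λ L^x(1), with entries X_i^{-1}(a_i - b_i) X_j, of rank one
(`spectral_one_firstData`); and the reduced last row is chosen so that Σ_j X_j (L'_+ - L'_-)_{jk} =
0 (`sum_bigX_reduced`). The factorisation then needs only M_R(u+1) L'(u) = L^n(u) M' M_R(u+1), an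
identity between last rows.

The representation is the main work. All generators except e_{n-1} are given by the co-product. The
last row of L^x_- L'_- is G·XL_+ - H·XL_-, where G = q^{-N_n} x_n^{-1}, H = q^{2+N_n} x_n^{-1}, and
L_± now belong to V. Its entry n-1 has to serve as e_{n-1}, and the remaining ones have to obey the
column recursion. The rows XL_+ and XL_- are covariant under the co-product of U_q(gl(n)). For XL_+
the axioms `IsRow` yield, through the Serre relations, the q-plane relations and the commutation
with distant generators; this is where 1 + q² ≠ 0 enters (`comm_of_serre`). Acting with e_{n-2} on
the commutation of the last entries of the two rows gives the exchange relation `plus_last_minus`,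
which with GH = q²HG gives a q-plane relation in the last row (`lastRow_qplane`). Since [e_{n-1},
e_{n-2}] is λ b_{n-1} times the preceding entry of that row, both Serre relations with e_{n-1}
follow (`reduced_relations`). Finally the column recursion determines its solution, which identifies
L_- of the new representation with L^x_- L'_- (`reduced_upper_last`, `laxMinus_tensorData`). -/

theorem mul_comm_assoc {A : Type*} [Semigroup A] {x y : A} (h : x * y = y * x) (z : A) :
    x * (y * z) = y * (x * z) := by
  rw [← mul_assoc, h, mul_assoc]

/-! ### Sorting noncommutative words; consequences of q-Serre relations. -/

section NoncommutativeAlgebra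

variable {A : Type*} [Ring A] [Algebra ℂ A]

/-- Exchange relations are needed as rewriting rules inside right-associated words. With this and
`mul_comm_assoc`, `simp` sorts both sides into the same monomials, and only scalar coefficients
remain to be compared. -/
theorem mul_qcomm_assoc {c : ℂ} {x y : A} (h : x * y = c • (y * x)) (z : A) :
    x * (y * z) = c • (y * (x * z)) := by
  rw [← mul_assoc, h, smul_mul_assoc, mul_assoc]

/-- The (rescaled) `q`-Serre expression is additive under `q`-commuting perturbations. -/
theorem serre_add (t : ℂ) (ht : t ≠ 0) (u v s r : A)
    (vu : v * u = t • (u * v)) (ru : r * u = u * r) (vs : v * s = t⁻¹ • (s * v))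
    (h1 : s * u * u - (1 + t) • (u * s * u) + t • (u * u * s) = 0)
    (h2 : r * v * v - (1 + t) • (v * r * v) + t • (v * v * r) = 0) :
    (s + r) * (u + v) * (u + v) - (1 + t) • ((u + v) * (s + r) * (u + v))
      + t • ((u + v) * (u + v) * (s + r)) = 0 := by
  simp only [mul_assoc] at h1 h2
  simp only [mul_add, add_mul, mul_assoc, smul_add, mul_smul_comm, smul_mul_assoc, smul_smul,
    vu, ru, vs, mul_qcomm_assoc vu, mul_comm_assoc ru, mul_qcomm_assoc vs]
  -- After sorting, the words in s, u alone and in r, v alone form `h1` and `h2`; the coefficient of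
  -- every other word vanishes, for instance 1 - (1+t)t⁻¹ + t·t⁻² = 0 for s v v.
  linear_combination (norm := skip) h1 + h2
  match_scalars <;> field_simp <;> ring

/-- The companion of `serre_add` for the Serre expression in which the sum s + r occurs twice; r and
s have to q-commute here instead of v and u. -/
theorem serre_add' (t : ℂ) (ht : t ≠ 0) (u v s r : A)
    (ru : r * u = u * r) (vs : v * s = t⁻¹ • (s * v)) (rs : r * s = t • (s * r))
    (h1 : s * s * u - (1 + t) • (s * u * s) + t • (u * s * s) = 0)
    (h2 : r * r * v - (1 + t) • (r * v * r) + t • (v * r * r) = 0) :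
    (s + r) * (s + r) * (u + v) - (1 + t) • ((s + r) * (u + v) * (s + r))
      + t • ((u + v) * (s + r) * (s + r)) = 0 := by
  simp only [mul_assoc] at h1 h2
  simp only [mul_add, add_mul, mul_assoc, smul_add, mul_smul_comm, smul_mul_assoc, smul_smul,
    rs, ru, vs, mul_qcomm_assoc rs, mul_comm_assoc ru, mul_qcomm_assoc vs]
  linear_combination (norm := skip) h1 + h2
  match_scalars <;> field_simp <;> ring

/-- The Jacobi identity [g,[f,x]] = [[g,f],x], its third term vanishing because g and x commute. -/
theorem commutator_assoc {A : Type*} [Ring A] {f g x : A} (hx : g * x = x * g) :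
    g * (f * x - x * f) - (f * x - x * f) * g = (g * f - f * g) * x - x * (g * f - f * g) := by
  simp only [mul_sub, sub_mul, mul_assoc, hx, mul_comm_assoc hx]; abel

/-- Let z = [g, y], which by Jacobi is also [w, x]. Moving f through the second form gives t·fz = zf
+ D, and through the first one D = t·zf - fz, with the same D = wy - t·yw. Adding, (1+t)(zf - fz) =
0. With t = q² this is the source of the condition 1 + q² ≠ 0. -/
theorem comm_of_serre (t : ℂ) (ht : 1 + t ≠ 0) (f g x y w : A)
    (hx : g * x = x * g) (hy : y = f * x - x * f) (hw : w = g * f - f * g)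
    (h1 : f * y = t • (y * f)) (h2 : w * f = t • (f * w)) :
    f * (g * y - y * g) = (g * y - y * g) * f := by
  have z : g * y - y * g = w * x - x * w := by subst hy hw; exact commutator_assoc hx
  have e1 : t • (f * (g * y - y * g)) = (g * y - y * g) * f + w * y - t • (y * w) := by
    have h3 : (w * x - x * w) * f = w * (x * f) - x * (w * f) := by
      simp only [sub_mul, mul_assoc]
    have h4 : x * f = f * x - y := by rw [hy]; abel
    have h5 : x * (w * f) = t • ((f * x - y) * w) := by rw [h2, mul_smul_comm, ← mul_assoc, h4]
    rw [z, h3, h5, h4]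
    simp only [mul_sub, sub_mul, mul_assoc, smul_sub, mul_qcomm_assoc h2]
    abel
  have e2 : w * y - t • (y * w) = t • ((g * y - y * g) * f) - f * (g * y - y * g) := by
    rw [hw]
    simp only [mul_sub, sub_mul, mul_assoc, mul_qcomm_assoc h1, h1, mul_smul_comm, smul_sub]
    abel
  have : (1 + t) • ((g * y - y * g) * f - f * (g * y - y * g)) = 0 := by
    linear_combination (norm := module) - e1 - e2
  rw [smul_eq_zero, sub_eq_zero] at this
  exact (this.resolve_left ht).symm

end NoncommutativeAlgebra

/-! ### Borel subalgebras in terms of the elements of `L_±` -/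

section Borel

variable {A : Type*} [Ring A] [Algebra ℂ A]

/-- The relations between `a_i = L_{+,ii}`, `b_i = a_i⁻¹` and `f_i = L_{+,i,i+1}`. They are also
satisfied by `L_{-,ii}`, `L_{+,ii}` and `L_{-,i+1,i}`. -/
structure IsBorel (q : ℂ) (a b f : ℕ → A) : Prop where
  ab : ∀ i, a i * b i = 1
  ba : ∀ i, b i * a i = 1
  a_a : ∀ i j, a i * a j = a j * a i
  a_f_self : ∀ i, a i * f i = q⁻¹ • (f i * a i)
  a_f_succ : ∀ i, a (i + 1) * f i = q • (f i * a (i + 1))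
  a_f : ∀ i j, i ≠ j → i ≠ j + 1 → a i * f j = f j * a i
  f_f : ∀ i j, i + 1 < j → f j * f i = f i * f j
  serre : ∀ i, f (i + 1) * f i * f i - (1 + q ^ 2) • (f i * f (i + 1) * f i)
    + q ^ 2 • (f i * f i * f (i + 1)) = 0
  serre' : ∀ i, f (i + 1) * f (i + 1) * f i - (1 + q ^ 2) • (f (i + 1) * f i * f (i + 1))
    + q ^ 2 • (f i * f (i + 1) * f (i + 1)) = 0

theorem inv_qcomm {c : ℂ} (hc : c ≠ 0) {a b f : A} (ab : a * b = 1) (ba : b * a = 1)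
    (h : a * f = c • (f * a)) : b * f = c⁻¹ • (f * b) := by
  calc b * f = b * f * (a * b) := by rw [ab, mul_one]
    _ = c⁻¹ • (b * (c • (f * a)) * b) := by
      simp only [mul_smul_comm, smul_mul_assoc, smul_smul, inv_mul_cancel₀ hc, one_smul, mul_assoc]
    _ = c⁻¹ • (f * b) := by rw [← h, ← mul_assoc, ba, one_mul]

theorem inv_comm {a b f : A} (ab : a * b = 1) (ba : b * a = 1)
    (h : a * f = f * a) : b * f = f * b := by
  simpa using inv_qcomm (c := 1) one_ne_zero ab ba (by simpa using h)

namespace IsBorel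

variable {q : ℂ} {a b f : ℕ → A}

theorem b_f_self (H : IsBorel q a b f) (hq : q ≠ 0) (i : ℕ) : b i * f i = q • (f i * b i) := by
  simpa using inv_qcomm (inv_ne_zero hq) (H.ab i) (H.ba i) (H.a_f_self i)

theorem b_f_succ (H : IsBorel q a b f) (hq : q ≠ 0) (i : ℕ) :
    b (i + 1) * f i = q⁻¹ • (f i * b (i + 1)) :=
  inv_qcomm hq (H.ab _) (H.ba _) (H.a_f_succ i)

theorem b_f (H : IsBorel q a b f) (i j : ℕ) (h : i ≠ j) (h' : i ≠ j + 1) :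
    b i * f j = f j * b i :=
  inv_comm (H.ab _) (H.ba _) (H.a_f i j h h')

theorem b_a (H : IsBorel q a b f) (i j : ℕ) : b i * a j = a j * b i :=
  inv_comm (H.ab _) (H.ba _) (H.a_a i j)

theorem mul_left_cancel_a (H : IsBorel q a b f) {i : ℕ} {x y : A} (h : a i * x = a i * y) :
    x = y := by
  rw [← one_mul x, ← H.ba i, mul_assoc, h, ← mul_assoc, H.ba, one_mul]

theorem mul_left_cancel_b (H : IsBorel q a b f) {i : ℕ} {x y : A} (h : b i * x = b i * y) :
    x = y := by
  rw [← one_mul x, ← H.ab i, mul_assoc, h, ← mul_assoc, H.ab, one_mul]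

end IsBorel

/-- The elements `L_{+,s,s+d}` generated by `a_i = L_{+,ii}` and `f_i = L_{+,i,i+1}`. -/
def upperAux (l : ℂ) (a b f : ℕ → A) (s : ℕ) : ℕ → A
  | 0 => a s
  | 1 => f s
  | d + 2 => l⁻¹ • (b (s + d + 1) *
      (f (s + d + 1) * upperAux l a b f s (d + 1) - upperAux l a b f s (d + 1) * f (s + d + 1)))

/-- The matrix elements `L_{+,s,j}` generated by `a_i = L_{+,ii}` and `f_i = L_{+,i,i+1}`. -/
def upper (l : ℂ) (a b f : ℕ → A) (s j : ℕ) : A :=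
  if s ≤ j then upperAux l a b f s (j - s) else 0

/-! ### The entries of L_+ generated from the diagonal and the first off-diagonal. -/

section Upper

variable {l q : ℂ} {a b f : ℕ → A}

theorem upper_self (s : ℕ) : upper l a b f s s = a s := by simp [upper, upperAux]

theorem upper_succ (s : ℕ) : upper l a b f s (s + 1) = f s := by simp [upper, upperAux]

theorem upper_of_lt {s j : ℕ} (h : j < s) : upper l a b f s j = 0 := by
  simp [upper, not_le.mpr h]

theorem upper_add_two (s d : ℕ) : upper l a b f s (s + d + 2) = l⁻¹ • (b (s + d + 1) *
    (f (s + d + 1) * upper l a b f s (s + d + 1) - upper l a b f s (s + d + 1) * f (s + d + 1))) :=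
        by
  have e1 : s + d + 2 - s = d + 2 := by omega
  have e2 : s + d + 1 - s = d + 1 := by omega
  simp only [upper, e1, e2, upperAux, show s ≤ s + d + 2 by omega, show s ≤ s + d + 1 by omega,
    if_true]

theorem upper_step (hl : l ≠ 0) (ab : ∀ i, a i * b i = 1) {s j : ℕ} (h : s < j) :
    f j * upper l a b f s j - upper l a b f s j * f j = l • (a j * upper l a b f s (j + 1)) := by
  obtain ⟨d, rfl⟩ : ∃ d, j = s + d + 1 := ⟨j - s - 1, by omega⟩
  rw [upper_add_two, mul_smul_comm, smul_smul, mul_inv_cancel₀ hl, one_smul, ← mul_assoc, ab,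
    one_mul]

/-- Induction along a row of `L_+`. -/
theorem upper_induction {P : ℕ → A → Prop} {s : ℕ} (h1 : P (s + 1) (f s))
    (h2 : ∀ j, s < j → P j (upper l a b f s j) → P (j + 1) (l⁻¹ • (b j *
      (f j * upper l a b f s j - upper l a b f s j * f j)))) {j : ℕ} (hj : s < j) :
    P j (upper l a b f s j) := by
  obtain ⟨d, rfl⟩ : ∃ d, j = s + d + 1 := ⟨j - s - 1, by omega⟩
  clear hj
  induction d with
  | zero => simpa [upper_succ] using h1
  | succ d ih =>
    have := h2 _ (by omega) ih
    rwa [← upper_add_two] at this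

/-- An element which commutes with everything that generates `L_{+,sj}` commutes with it. -/
theorem upper_comm {x : A} {s j : ℕ} (hs : s ≤ j) (ha : s = j → x * a s = a s * x)
    (hb : ∀ i, s < i → i < j → x * b i = b i * x)
    (hf : ∀ i, s ≤ i → i < j → x * f i = f i * x) :
    x * upper l a b f s j = upper l a b f s j * x := by
  rcases hs.eq_or_lt with rfl | hs
  · rw [upper_self]; exact ha rfl
  have := upper_induction (l := l) (a := a) (b := b) (f := f) (s := s)
    (P := fun k y => k ≤ j → x * y = y * x)
    (fun h => hf _ le_rfl (by omega)) (fun k hk ih hkj => by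
      have h3 := ih (by omega)
      have h4 := hb k hk (by omega)
      have h5 := hf k hk.le (by omega)
      simp only [mul_smul_comm, smul_mul_assoc, mul_sub, sub_mul, mul_assoc, mul_comm_assoc h4,
        mul_comm_assoc h5, mul_comm_assoc h3, h3, h5]) hs
  exact this le_rfl

theorem upper_f_comm (H : IsBorel q a b f) {s j i : ℕ} (h : s ≤ j) (hi : j < i) :
    f i * upper l a b f s j = upper l a b f s j * f i :=
  upper_comm h (fun _ => (H.a_f _ _ (by omega) (by omega)).symm)
    (fun k _ _ => (H.b_f _ _ (by omega) (by omega)).symm)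
    (fun k _ _ => H.f_f k i (by omega))

theorem upper_a_comm (H : IsBorel q a b f) {s j i : ℕ} (h : s ≤ j) (hi : j < i) :
    a i * upper l a b f s j = upper l a b f s j * a i :=
  upper_comm h (fun _ => H.a_a _ _)
    (fun k _ _ => (H.b_a _ _).symm)
    (fun k _ _ => H.a_f _ _ (by omega) (by omega))

theorem upper_a_comm' (H : IsBorel q a b f) {s j i : ℕ} (h : s ≤ j) (hi : i < s) :
    a i * upper l a b f s j = upper l a b f s j * a i :=
  upper_comm h (fun _ => H.a_a _ _)
    (fun k _ _ => (H.b_a _ _).symm)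
    (fun k _ _ => H.a_f _ _ (by omega) (by omega))

/-- L_{sj} carries the weight of its right index: in the step from j to j+1 the factor a_{j+1}
commutes with b_j and L_{sj}, and only f_j contributes q. -/
theorem upper_a_right (H : IsBorel q a b f) {s j : ℕ} (h : s < j) :
    a j * upper l a b f s j = q • (upper l a b f s j * a j) :=
  upper_induction (P := fun j y => a j * y = q • (y * a j)) (H.a_f_succ s) (fun j hj _ => by
    have h1 := (H.b_a j (j + 1)).symm
    have h2 := H.a_f_succ j
    have h3 := upper_a_comm (l := l) H hj.le (Nat.lt_succ_self j)
    simp only [mul_smul_comm, smul_mul_assoc, mul_sub, sub_mul, mul_assoc, mul_comm_assoc h1,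
      mul_qcomm_assoc h2, mul_comm_assoc h3, h3, h2, ← smul_sub]
    rw [smul_comm]) h

theorem upper_a_left (H : IsBorel q a b f) {s j : ℕ} (h : s < j) :
    a s * upper l a b f s j = q⁻¹ • (upper l a b f s j * a s) :=
  upper_induction (P := fun _ y => a s * y = q⁻¹ • (y * a s)) (H.a_f_self s) (fun j hj ih => by
    have h1 := (H.b_a j s).symm
    have h2 := H.a_f s j (by omega) (by omega)
    simp only [mul_smul_comm, smul_mul_assoc, mul_sub, sub_mul, mul_assoc, mul_comm_assoc h1,
      mul_qcomm_assoc ih, mul_comm_assoc h2, ih, h2, ← smul_sub]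
    rw [smul_comm]) h

theorem upper_a_mid (H : IsBorel q a b f) (hq : q ≠ 0) {s i j : ℕ} (h : s < i) (hj : i < j) :
    a i * upper l a b f s j = upper l a b f s j * a i := by
  refine upper_induction (P := fun j y => i < j → a i * y = y * a i) (by omega)
    (fun j hj ih hij => ?_) (h.trans hj) hj
  have h1 := (H.b_a j i).symm
  -- In the step that passes index i, the factor q⁻¹ of f_i cancels the factor q of L_{si};
  -- afterwards a_i commutes with every new generator.
  rcases (Nat.lt_succ_iff.mp hij).eq_or_lt with rfl | hij
  · have h2 := H.a_f_self i
    have h3 := upper_a_right (l := l) H h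
    simp only [mul_smul_comm, smul_mul_assoc, mul_sub, sub_mul, mul_assoc, mul_comm_assoc h1,
      mul_qcomm_assoc h2, mul_qcomm_assoc h3, h2, h3, smul_smul, mul_inv_cancel₀ hq,
      inv_mul_cancel₀ hq, one_smul]
  · have h2 := H.a_f i j (by omega) (by omega)
    have h3 := ih hij
    simp only [mul_smul_comm, smul_mul_assoc, mul_sub, sub_mul, mul_assoc, mul_comm_assoc h1,
      mul_comm_assoc h2, mul_comm_assoc h3, h2, h3]

/-- The recursion for the elements of `L_+` along a column. -/
theorem upper_step_left (H : IsBorel q a b f) (hl : l ≠ 0) {s j : ℕ} (h : s + 1 < j) :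
    upper l a b f (s + 1) j * f s - f s * upper l a b f (s + 1) j
      = l • (a (s + 1) * upper l a b f s j) := by
  refine upper_induction (P := fun j y => y * f s - f s * y
    = l • (a (s + 1) * upper l a b f s j)) ?_ ?_ h
  · rw [← upper_step hl H.ab (Nat.lt_succ_self s), upper_succ]
  · intro j hj ih
    have h1 := H.f_f s j hj
    have h2 := H.b_f j s (by omega) (by omega)
    have h3 := H.a_f (s + 1) j (by omega) (by omega)
    have h4 := H.b_a j (s + 1)
    have h5 : f j * upper l a b f s j - upper l a b f s j * f j
      = l • (a j * upper l a b f s (j + 1)) := upper_step hl H.ab (by omega)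
    set y := upper l a b f (s + 1) j
    -- For j > s+1 the generator f_s commutes with b_j and f_j, so the commutator with f_s can be
    -- taken inside the recursion step from j to j+1.
    have e : (l⁻¹ • (b j * (f j * y - y * f j))) * f s - f s * (l⁻¹ • (b j * (f j * y - y * f j)))
        = l⁻¹ • (b j * (f j * (y * f s - f s * y) - (y * f s - f s * y) * f j)) := by
      simp only [mul_smul_comm, smul_mul_assoc, mul_sub, sub_mul, mul_assoc, h1,
        ← mul_comm_assoc h2, mul_comm_assoc h1]
      module
    rw [e, ih]
    have e' : f j * l • (a (s + 1) * upper l a b f s j) - l • (a (s + 1) * upper l a b f s j) * f j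
        = l • (a (s + 1) * (f j * upper l a b f s j - upper l a b f s j * f j)) := by
      simp only [mul_smul_comm, smul_mul_assoc, mul_sub, mul_assoc, ← mul_comm_assoc h3, smul_sub]
    rw [e', h5]
    simp only [mul_smul_comm, mul_comm_assoc h4, smul_smul, ← mul_assoc (b j), H.ba, one_mul]
    field_simp

/-- Only generators with index below j enter L_{sj}. This lets the modified last raising generator
of the reduced product be ignored outside the last row of L_-. -/
theorem upper_congr {f' : ℕ → A} {s j : ℕ} (h : ∀ i, i < j → f i = f' i) :
    upper l a b f s j = upper l a b f' s j := by
  rcases lt_trichotomy s j with hs | rfl | hs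
  · refine upper_induction (P := fun k y => k ≤ j → y = upper l a b f' s k) (fun hk => ?_)
      (fun k hk ih hkj => ?_) hs le_rfl
    · rw [upper_succ, h s (by omega)]
    · obtain ⟨d, rfl⟩ : ∃ d, k = s + d + 1 := ⟨k - s - 1, by omega⟩
      rw [upper_add_two s d, ih (by omega), h _ (by omega)]
  · rw [upper_self, upper_self]
  · rw [upper_of_lt hs, upper_of_lt hs]

/-- The elements of a column of `L_+` are determined by the recursion along the column. -/
theorem upper_unique_left (H : IsBorel q a b f) (hl : l ≠ 0) {p : ℕ} {r : ℕ → A} (h0 : r p = f p)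
    (h : ∀ s, s < p → r (s + 1) * f s - f s * r (s + 1) = l • (a (s + 1) * r s)) {s : ℕ}
    (hs : s ≤ p) : upper l a b f s (p + 1) = r s := by
  obtain ⟨d, rfl⟩ : ∃ d, p = s + d := ⟨p - s, by omega⟩
  clear hs
  induction d generalizing s with
  | zero => rw [add_zero] at h0; rw [h0, add_zero, upper_succ]
  | succ d ih =>
    have h1 := upper_step_left H hl (s := s) (j := s + (d + 1) + 1) (by omega)
    have e : s + (d + 1) = s + 1 + d := by ring
    have h2 : upper l a b f (s + 1) (s + (d + 1) + 1) = r (s + 1) := by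
      rw [e] at h0 h ⊢; exact ih h0 h
    rw [h2, h s (by omega)] at h1
    refine (H.mul_left_cancel_a (i := s + 1) ?_).symm
    exact smul_right_injective A hl h1

end Upper

end Borel

/-! ### Rows covariant under the lower Borel half, and the action of the raising half on them. -/

section Vectors

variable {A : Type*} [Ring A] [Algebra ℂ A]

/-- The relations between `L_{+,i,i+1}` and `L_{-,i+1,i}`, the diagonal ones for `i + 1 < m`. -/
structure IsMixed (q l : ℂ) (m : ℕ) (a b e f : ℕ → A) : Prop where
  ef_self : ∀ i, i + 1 < m →
    e i * f i - f i * e i = -(l • (a i * b (i + 1) - b i * a (i + 1)))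
  ef_succ : ∀ i, e i * f (i + 1) = q • (f (i + 1) * e i)
  fe_succ : ∀ i, f i * e (i + 1) = q • (e (i + 1) * f i)
  ef : ∀ i j, i ≠ j → i + 1 ≠ j → j + 1 ≠ i → e i * f j = f j * e i

/-- `y_0, …, y_{n-1}` behaves like a row of `L_+` with respect to the lower Borel subalgebra. -/
structure IsRow (q l : ℂ) (n : ℕ) (a f y : ℕ → A) : Prop where
  step : ∀ j, j + 1 < n → f j * y j - y j * f j = l • (a j * y (j + 1))
  a_y_self : ∀ j, j < n → a j * y j = q • (y j * a j)
  a_y : ∀ i j, i ≠ j → j < n → a i * y j = y j * a i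
  far_zero : ∀ i, 0 < i → i + 1 < n → f i * y 0 = y 0 * f i
  f_zero : 1 < n → f 0 * y 1 = q • (y 1 * f 0)
  y_zero : 1 < n → y 1 * y 0 = q • (y 0 * y 1)

namespace IsRow

variable {q l : ℂ} {n : ℕ} {a b f y e : ℕ → A}

theorem eq_step (Y : IsRow q l n a f y) (H : IsBorel q a b f) (hl : l ≠ 0) (j : ℕ)
    (hj : j + 1 < n) : y (j + 1) = l⁻¹ • (b j * (f j * y j - y j * f j)) := by
  rw [Y.step j hj, mul_smul_comm, smul_smul, inv_mul_cancel₀ hl, one_smul, ← mul_assoc, H.ba,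
    one_mul]

theorem b_y (Y : IsRow q l n a f y) (H : IsBorel q a b f) (i j : ℕ) (hij : i ≠ j) (hj : j < n) :
    b i * y j = y j * b i :=
  inv_comm (H.ab _) (H.ba _) (Y.a_y i j hij hj)

theorem b_y_self (Y : IsRow q l n a f y) (H : IsBorel q a b f) (hq : q ≠ 0) (j : ℕ) (hj : j < n) :
    b j * y j = q⁻¹ • (y j * b j) :=
  inv_qcomm hq (H.ab _) (H.ba _) (Y.a_y_self j hj)

theorem far (Y : IsRow q l n a f y) (H : IsBorel q a b f) (hl : l ≠ 0) {i j : ℕ} (hi : i + 1 < n)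
    (hij : j < i) : f i * y j = y j * f i := by
  induction j with
  | zero => exact Y.far_zero i hij hi
  | succ j ih =>
    have h1 := ih (by omega)
    have h2 := H.b_f j i (by omega) (by omega)
    have h3 := H.f_f j i (by omega)
    rw [Y.eq_step H hl j (by omega)]
    simp only [mul_smul_comm, smul_mul_assoc, mul_sub, sub_mul, mul_assoc, ← mul_comm_assoc h2,
      mul_comm_assoc h1, mul_comm_assoc h3, h1, h3]

/-- For j = 0 this is an axiom. Beyond that, Jacobi writes y_{j+2} as a multiple of b_{j+1} b_j
[[f_{j+1}, f_j], y_j]; the Serre relation quadratic in f_{j+1} says that f_{j+1} passes the inner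
commutator with the factor q², and passing b_{j+1} costs q⁻¹. -/
theorem f_y_succ (Y : IsRow q l n a f y) (H : IsBorel q a b f) (hl : l ≠ 0) (hq : q ≠ 0) {j : ℕ}
    (hj : j + 1 < n) : f j * y (j + 1) = q • (y (j + 1) * f j) := by
  cases j with
  | zero => exact Y.f_zero hj
  | succ j =>
    set f' := f (j + 1) with hf'
    set f₀ := f j with hf₀
    set x := y j with hx
    have h1 : f' * x = x * f' := Y.far H hl (by omega) (by omega)
    have e1 : y (j + 1) = l⁻¹ • (b j * (f₀ * x - x * f₀)) := Y.eq_step H hl j (by omega)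
    have h2 : b j * f' = f' * b j := H.b_f j (j + 1) (by omega) (by omega)
    have h3 : b (j + 1) * f' = q • (f' * b (j + 1)) := H.b_f_self hq (j + 1)
    have e2 : y (j + 2) = l⁻¹ • (b (j + 1) * l⁻¹ • (b j *
        ((f' * f₀ - f₀ * f') * x - x * (f' * f₀ - f₀ * f')))) := by
      rw [Y.eq_step H hl (j + 1) hj, e1, ← commutator_assoc h1, ← hf']
      simp only [mul_smul_comm, smul_mul_assoc, mul_sub, sub_mul, mul_assoc, ← mul_comm_assoc h2]
      module
    have h5 : f' * (f' * f₀ - f₀ * f') = q ^ 2 • ((f' * f₀ - f₀ * f') * f') := by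
      have := H.serre' j
      simp only [← hf', ← hf₀] at this
      simp only [mul_sub, sub_mul, ← mul_assoc]
      linear_combination (norm := module) this
    set w := f' * f₀ - f₀ * f'
    have h6 : f' * b (j + 1) = q⁻¹ • (b (j + 1) * f') := by
      rw [h3, smul_smul, inv_mul_cancel₀ hq, one_smul]
    rw [e2]
    simp only [mul_smul_comm, smul_mul_assoc, mul_sub, sub_mul, mul_assoc, mul_qcomm_assoc h6,
      ← mul_comm_assoc h2, mul_qcomm_assoc h5, mul_comm_assoc h1, h5, ← h1]
    match_scalars <;> field_simp

/-- For j = i+2 the double commutator [f_{i+1}, [f_i, y_i]] is λ² a_i a_{i+1} y_{i+2}, and it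
commutes with f_i by `comm_of_serre`. The factors q and q⁻¹ from moving f_i past a_i and a_{i+1}
cancel, so f_i commutes with y_{i+2} itself. Larger j follow from the recursion, as f_i commutes
with what it adds. -/
theorem mid (Y : IsRow q l n a f y) (H : IsBorel q a b f) (hl : l ≠ 0) (hq : q ≠ 0)
    (hq2 : 1 + q ^ 2 ≠ 0) {i j : ℕ} (hij : i + 1 < j) (hj : j < n) :
    f i * y j = y j * f i := by
  obtain ⟨d, rfl⟩ : ∃ d, j = i + 2 + d := ⟨j - (i + 2), by omega⟩
  clear hij
  induction d with
  | zero =>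
    rw [add_zero] at hj ⊢
    have h1 := Y.step i (by omega)
    have h2 := Y.step (i + 1) (by omega)
    have h3 := Y.f_y_succ H hl hq (j := i) (by omega)
    have h4 := H.a_f_self i
    have h5 := H.a_f_succ i
    have h6 := H.a_f i (i + 1) (by omega) (by omega)
    have h4' : f i * a i = q • (a i * f i) := by
      rw [h4, smul_smul, mul_inv_cancel₀ hq, one_smul]
    have h5' : f i * a (i + 1) = q⁻¹ • (a (i + 1) * f i) := by
      rw [h5, smul_smul, inv_mul_cancel₀ hq, one_smul]
    have key := comm_of_serre (q ^ 2) hq2 (f i) (f (i + 1)) (y i) (l • (a i * y (i + 1)))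
      (f (i + 1) * f i - f i * f (i + 1)) (Y.far H hl (by omega) (by omega)) h1.symm rfl
      (by
        simp only [mul_smul_comm, smul_mul_assoc, mul_assoc, mul_qcomm_assoc h4', h3]
        module)
      (by
        have := H.serre i
        simp only [mul_sub, sub_mul, ← mul_assoc]
        linear_combination (norm := module) this)
    have e : f (i + 1) * l • (a i * y (i + 1)) - l • (a i * y (i + 1)) * f (i + 1)
        = (l * l) • (a i * (a (i + 1) * y (i + 2))) := by
      have : f (i + 1) * l • (a i * y (i + 1)) - l • (a i * y (i + 1)) * f (i + 1)
        = l • (a i * (f (i + 1) * y (i + 1) - y (i + 1) * f (i + 1))) := by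
        simp only [mul_smul_comm, smul_mul_assoc, mul_sub, mul_assoc, ← mul_comm_assoc h6,
          smul_sub]
      rw [this, h2, mul_smul_comm, smul_smul]
    rw [e] at key
    simp only [mul_smul_comm, smul_mul_assoc, mul_assoc, mul_qcomm_assoc h4', mul_qcomm_assoc h5']
      at key
    have key2 := smul_right_injective A (mul_ne_zero hl hl) key
    rw [smul_smul, mul_inv_cancel₀ hq, one_smul] at key2
    exact H.mul_left_cancel_a (H.mul_left_cancel_a key2)
  | succ d ih =>
    have h1 := ih (by omega)
    have h2 := H.b_f (i + 2 + d) i (by omega) (by omega)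
    have h3 := H.f_f i (i + 2 + d) (by omega)
    rw [← add_assoc] at hj ⊢
    rw [Y.eq_step H hl _ hj]
    simp only [mul_smul_comm, smul_mul_assoc, mul_sub, sub_mul, mul_assoc, ← mul_comm_assoc h2,
      mul_comm_assoc h1, ← mul_comm_assoc h3, h1, ← h3]

/-- The relation for (j, j+1) gives the one for (j, j+2), because y_{j+2} is built from y_{j+1} by
b_{j+1} and f_{j+1}, which commute with y_j. Writing y_{j+1} through [f_j, y_j], where b_j and f_j
commute with y_{j+2} by `mid`, then yields (j+1, j+2). -/
theorem qplane (Y : IsRow q l n a f y) (H : IsBorel q a b f) (hl : l ≠ 0) (hq : q ≠ 0)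
    (hq2 : 1 + q ^ 2 ≠ 0) {j : ℕ} (hj : j + 1 < n) :
    y (j + 1) * y j = q • (y j * y (j + 1)) := by
  induction j with
  | zero => exact Y.y_zero hj
  | succ j ih =>
    have h0 := ih (by omega)
    have e1 := Y.eq_step H hl j (by omega)
    have e2 := Y.eq_step H hl (j + 1) hj
    have h1 : y (j + 2) * y j = q • (y j * y (j + 2)) := by
      have c1 : f (j + 1) * y j = y j * f (j + 1) := Y.far H hl (by omega) (by omega)
      have c2 : b (j + 1) * y j = y j * b (j + 1) := Y.b_y H _ _ (by omega) (by omega)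
      rw [e2]
      simp only [mul_smul_comm, smul_mul_assoc, mul_sub, sub_mul, mul_assoc,
        ← mul_comm_assoc c2, mul_qcomm_assoc h0, h0, c1, ← mul_comm_assoc c1]
      module
    have c1 : b j * y (j + 2) = y (j + 2) * b j := Y.b_y H _ _ (by omega) (by omega)
    have c2 : f j * y (j + 2) = y (j + 2) * f j := Y.mid H hl hq hq2 (by omega) hj
    have c2' := fun z => (mul_comm_assoc c2 z).symm
    rw [e1]
    simp only [mul_smul_comm, smul_mul_assoc, mul_sub, sub_mul, mul_assoc, ← mul_comm_assoc c1,
      c2', mul_qcomm_assoc h1, h1, c2]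
    module

/-- How the opposite Borel subalgebra acts on a row of `L_+`. -/
theorem e_far (Y : IsRow q l n a f y) (H : IsBorel q a b f) (He : IsBorel q b a e)
    (M : IsMixed q l n a b e f) (hl : l ≠ 0) (he0 : ∀ i, 0 < i → i + 1 < n → e i * y 0 = y 0 * e i)
    {i j : ℕ} (hi : i + 1 < n) (hij : j < i) : e i * y j = y j * e i := by
  induction j with
  | zero => exact he0 i hij hi
  | succ j ih =>
    have h1 := ih (by omega)
    have h2 := He.a_f j i (by omega) (by omega)
    have h3 := M.ef i j (by omega) (by omega) (by omega)
    rw [Y.eq_step H hl j (by omega)]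
    simp only [mul_smul_comm, smul_mul_assoc, mul_sub, sub_mul, mul_assoc, ← mul_comm_assoc h2,
      mul_comm_assoc h1, mul_comm_assoc h3, h1, h3]

/-- For j > 0 the factor q⁻¹ arises solely from exchanging e_j with the generator f_{j-1} used to
build y_j; e_j commutes with b_{j-1} and y_{j-1}. -/
theorem e_self (Y : IsRow q l n a f y) (H : IsBorel q a b f) (He : IsBorel q b a e)
    (M : IsMixed q l n a b e f) (hl : l ≠ 0) (hq : q ≠ 0)
    (he0 : ∀ i, 0 < i → i + 1 < n → e i * y 0 = y 0 * e i)
    (he : 1 < n → e 0 * y 0 = q⁻¹ • (y 0 * e 0)) {j : ℕ} (hj : j + 1 < n) :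
    e j * y j = q⁻¹ • (y j * e j) := by
  cases j with
  | zero => exact he hj
  | succ j =>
    have h1 : e (j + 1) * y j = y j * e (j + 1) :=
      Y.e_far H He M hl he0 hj (Nat.lt_succ_self j)
    have h2 := He.a_f j (j + 1) (by omega) (by omega)
    have h3 : e (j + 1) * f j = q⁻¹ • (f j * e (j + 1)) := by
      rw [M.fe_succ, smul_smul, inv_mul_cancel₀ hq, one_smul]
    rw [Y.eq_step H hl j (by omega)]
    simp only [mul_smul_comm, smul_mul_assoc, mul_sub, sub_mul, mul_assoc, ← mul_comm_assoc h2,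
      mul_comm_assoc h1, mul_qcomm_assoc h3, h1, h3]
    module

/-- In y_{j+1} = λ⁻¹ b_j [f_j, y_j] the terms where e_j passes f_j reproduce y_{j+1} e_j. What
remains comes from the Cartan value of [e_j, f_j]: its part b_j a_{j+1} drops out because y_j b_j =
q b_j y_j, and the part a_j b_{j+1} contributes the coefficient q - q⁻¹ = λ. -/
theorem e_step (Y : IsRow q l n a f y) (H : IsBorel q a b f) (He : IsBorel q b a e)
    (M : IsMixed q l n a b e f) (hlq : l = q - q⁻¹) (hl : l ≠ 0) (hq : q ≠ 0)
    (he0 : ∀ i, 0 < i → i + 1 < n → e i * y 0 = y 0 * e i)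
    (he : 1 < n → e 0 * y 0 = q⁻¹ • (y 0 * e 0)) {j : ℕ} (hj : j + 1 < n) :
    e j * y (j + 1) - y (j + 1) * e j = -(l • (b (j + 1) * y j)) := by
  have h1 := Y.e_self H He M hl hq he0 he hj
  have h2 : e j * b j = q • (b j * e j) := by
    rw [He.a_f_self, smul_smul, mul_inv_cancel₀ hq, one_smul]
  have h3 : e j * f j = f j * e j + -(l • (a j * b (j + 1) - b j * a (j + 1))) := by
    rw [← M.ef_self j hj]; abel
  have h3' : ∀ z, e j * (f j * z) = f j * (e j * z) -
      l • (a j * (b (j + 1) * z) - b j * (a (j + 1) * z)) := fun z => by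
    rw [← mul_assoc, h3]
    simp only [add_mul, neg_mul, sub_mul, smul_mul_assoc, mul_assoc]; abel
  have h4 := Y.a_y_self j (by omega)
  have h5 := Y.b_y_self H hq j (by omega)
  have h4' : y j * a j = q⁻¹ • (a j * y j) := by
    rw [h4, smul_smul, inv_mul_cancel₀ hq, one_smul]
  have h5' : y j * b j = q • (b j * y j) := by
    rw [h5, smul_smul, mul_inv_cancel₀ hq, one_smul]
  have h6 := Y.a_y (j + 1) j (by omega) (by omega)
  have h7 := Y.b_y H (j + 1) j (by omega) (by omega)
  have h8 : ∀ z, b j * (a j * z) = z := fun z => by rw [← mul_assoc, H.ba, one_mul]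
  rw [Y.eq_step H hl j hj]
  simp only [mul_smul_comm, smul_mul_assoc, mul_sub, sub_mul, mul_assoc, mul_qcomm_assoc h2,
    h3', h3, mul_qcomm_assoc h1, h1, mul_add, mul_neg, smul_sub, smul_add, smul_neg,
    mul_qcomm_assoc h4', mul_qcomm_assoc h5', h8, ← h6, ← h7]
  have hlq' : q ^ 2 - 1 = l * q := by rw [hlq]; field_simp
  match_scalars <;> field_simp <;> first | ring1 | linear_combination -hlq'

/-- For j = i+2 the extra term -λ b_{i+1} y_i of `e_step` enters the commutator with f_{i+1}. It
cancels, because f_{i+1} commutes with y_i and its factor with b_{i+1} compensates the one from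
exchanging e_i with f_{i+1}. The recursion carries this to larger j. -/
theorem e_mid (Y : IsRow q l n a f y) (H : IsBorel q a b f) (He : IsBorel q b a e)
    (M : IsMixed q l n a b e f) (hlq : l = q - q⁻¹) (hl : l ≠ 0) (hq : q ≠ 0)
    (he0 : ∀ i, 0 < i → i + 1 < n → e i * y 0 = y 0 * e i)
    (he : 1 < n → e 0 * y 0 = q⁻¹ • (y 0 * e 0)) {i j : ℕ} (hij : i + 1 < j) (hj : j < n) :
    e i * y j = y j * e i := by
  obtain ⟨d, rfl⟩ : ∃ d, j = i + 2 + d := ⟨j - (i + 2), by omega⟩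
  clear hij
  induction d with
  | zero =>
    rw [add_zero] at hj ⊢
    have h0 : e i * y (i + 1) = y (i + 1) * e i + -(l • (b (i + 1) * y i)) := by
      rw [← Y.e_step H He M hlq hl hq he0 he (j := i) (by omega)]; abel
    have h0' : ∀ z, e i * (y (i + 1) * z) = y (i + 1) * (e i * z)
        + -(l • (b (i + 1) * (y i * z))) := fun z => by
      rw [← mul_assoc, h0]
      simp only [add_mul, neg_mul, smul_mul_assoc, mul_assoc]
    have h1 : e i * b (i + 1) = q⁻¹ • (b (i + 1) * e i) := by
      rw [He.a_f_succ, smul_smul, inv_mul_cancel₀ hq, one_smul]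
    have h2 := M.ef_succ i
    have h3 : f (i + 1) * b (i + 1) = q⁻¹ • (b (i + 1) * f (i + 1)) := by
      rw [H.b_f_self hq, smul_smul, inv_mul_cancel₀ hq, one_smul]
    have h4 : f (i + 1) * y i = y i * f (i + 1) := Y.far H hl (by omega) (by omega)
    rw [Y.eq_step H hl _ hj]
    simp only [mul_smul_comm, smul_mul_assoc, mul_sub, sub_mul, mul_assoc, mul_qcomm_assoc h1,
      h0, h0', mul_qcomm_assoc h2, h2, mul_add, mul_neg, smul_sub, smul_add, smul_neg,
      mul_qcomm_assoc h3, h4]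
    match_scalars <;> field_simp
    ring
  | succ d ih =>
    have h1 := ih (by omega)
    have h2 := He.a_f (i + 2 + d) i (by omega) (by omega)
    have h3 := M.ef i (i + 2 + d) (by omega) (by omega) (by omega)
    rw [← add_assoc] at hj ⊢
    rw [Y.eq_step H hl _ hj]
    simp only [mul_smul_comm, smul_mul_assoc, mul_sub, sub_mul, mul_assoc, ← mul_comm_assoc h2,
      mul_comm_assoc h1, mul_comm_assoc h3, h1, h3]

end IsRow

end Vectors

/-! ### The co-product -/

section Coproduct

variable {A : Type*} [Ring A] [Algebra ℂ A]

/-- The factors α, α' commute with φ, φ' and with each other, so they come out on the left of the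
whole Serre expression. This handles the part of a co-product in which all off-diagonal generators
belong to one family. -/
theorem serre_mul {c d : ℂ} {α α' φ φ' : A} (hα : α * α' = α' * α) (h1 : φ * α = α * φ)
    (h2 : φ * α' = α' * φ) (h3 : φ' * α = α * φ')
    (h : φ' * φ * φ - c • (φ * φ' * φ) + d • (φ * φ * φ') = 0) :
    (α' * φ') * (α * φ) * (α * φ) - c • ((α * φ) * (α' * φ') * (α * φ))
      + d • ((α * φ) * (α * φ) * (α' * φ')) = 0 := by
  have : (α' * φ') * (α * φ) * (α * φ) - c • ((α * φ) * (α' * φ') * (α * φ))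
      + d • ((α * φ) * (α * φ) * (α' * φ'))
      = α' * α * α * (φ' * φ * φ - c • (φ * φ' * φ) + d • (φ * φ * φ')) := by
    simp only [mul_add, mul_sub, mul_smul_comm, mul_assoc, mul_comm_assoc h1, mul_comm_assoc h2,
      mul_comm_assoc h3, mul_comm_assoc hα]
  rw [this, h, mul_zero]

theorem serre_mul' {c d : ℂ} {α α' φ φ' : A} (hα : α * α' = α' * α)
    (h1 : φ * α' = α' * φ) (h2 : φ' * α = α * φ') (h3 : φ' * α' = α' * φ')
    (h : φ' * φ' * φ - c • (φ' * φ * φ') + d • (φ * φ' * φ') = 0) :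
    (α' * φ') * (α' * φ') * (α * φ) - c • ((α' * φ') * (α * φ) * (α' * φ'))
      + d • ((α * φ) * (α' * φ') * (α' * φ')) = 0 := by
  have : (α' * φ') * (α' * φ') * (α * φ) - c • ((α' * φ') * (α * φ) * (α' * φ'))
      + d • ((α * φ) * (α' * φ') * (α' * φ'))
      = α' * α' * α * (φ' * φ' * φ - c • (φ' * φ * φ') + d • (φ * φ' * φ')) := by
    simp only [mul_add, mul_sub, mul_smul_comm, mul_assoc, mul_comm_assoc h1,
      mul_comm_assoc h2, mul_comm_assoc h3, mul_comm_assoc hα]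
  rw [this, h, mul_zero]

/-- Two families `a¹, f¹` and `a², f²` which commute with each other. -/
structure CommutingFamilies {A : Type*} [Mul A] (a₁ f₁ a₂ f₂ : ℕ → A) : Prop where
  aa : ∀ i j, a₁ i * a₂ j = a₂ j * a₁ i
  af : ∀ i j, a₁ i * f₂ j = f₂ j * a₁ i
  fa : ∀ i j, f₁ i * a₂ j = a₂ j * f₁ i
  ff : ∀ i j, f₁ i * f₂ j = f₂ j * f₁ i

theorem CommutingFamilies.symm {A : Type*} [Mul A] {a₁ f₁ a₂ f₂ : ℕ → A}
    (C : CommutingFamilies a₁ f₁ a₂ f₂) :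
    CommutingFamilies a₂ f₂ a₁ f₁ :=
  ⟨fun i j => (C.aa j i).symm, fun i j => (C.fa j i).symm, fun i j => (C.af j i).symm,
    fun i j => (C.ff j i).symm⟩

/-- The two summands of the co-product of f_i q²-commute, and they exchange with those of f_{i+1} as
`serre_add` and `serre_add'` require. The Serre expression of the sum therefore splits into those of
the two families, each dressed by Cartan factors of the other. -/
theorem IsBorel.coproduct {q : ℂ} (hq : q ≠ 0) {a₁ b₁ f₁ a₂ b₂ f₂ : ℕ → A}
    (H₁ : IsBorel q a₁ b₁ f₁) (H₂ : IsBorel q a₂ b₂ f₂) (C : CommutingFamilies a₁ f₁ a₂ f₂) :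
    IsBorel q (fun i => a₁ i * a₂ i) (fun i => b₁ i * b₂ i)
      (fun i => a₁ i * f₂ i + f₁ i * a₂ (i + 1)) := by
  have cba : ∀ i j, b₁ i * a₂ j = a₂ j * b₁ i := fun i j =>
    inv_comm (H₁.ab i) (H₁.ba i) (C.aa i j)
  have vu : ∀ i, f₁ i * a₂ (i + 1) * (a₁ i * f₂ i)
      = q ^ 2 • (a₁ i * f₂ i * (f₁ i * a₂ (i + 1))) := fun i => by
    have h1 : f₁ i * a₁ i = q • (a₁ i * f₁ i) := by
      rw [H₁.a_f_self, smul_smul, mul_inv_cancel₀ hq, one_smul]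
    simp only [mul_assoc, ← mul_comm_assoc (C.aa _ _), mul_qcomm_assoc h1, H₂.a_f_succ i,
      ← mul_comm_assoc (C.ff _ _), mul_smul_comm, smul_smul]
    rw [sq]
  have ru : ∀ i, f₁ (i + 1) * a₂ (i + 1 + 1) * (a₁ i * f₂ i)
      = a₁ i * f₂ i * (f₁ (i + 1) * a₂ (i + 1 + 1)) := fun i => by
    have h1 := H₁.a_f i (i + 1) (by omega) (by omega)
    have h2 := H₂.a_f (i + 1 + 1) i (by omega) (by omega)
    simp only [mul_assoc, ← mul_comm_assoc (C.aa _ _), ← mul_comm_assoc h1, h2,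
      ← mul_comm_assoc (C.ff _ _)]
  have vs : ∀ i, f₁ i * a₂ (i + 1) * (a₁ (i + 1) * f₂ (i + 1))
      = (q ^ 2)⁻¹ • (a₁ (i + 1) * f₂ (i + 1) * (f₁ i * a₂ (i + 1))) := fun i => by
    have h1 : f₁ i * a₁ (i + 1) = q⁻¹ • (a₁ (i + 1) * f₁ i) := by
      rw [H₁.a_f_succ, smul_smul, inv_mul_cancel₀ hq, one_smul]
    have h2 := H₂.a_f_self (i + 1)
    simp only [mul_assoc, ← mul_comm_assoc (C.aa _ _), mul_qcomm_assoc h1, h2,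
      ← mul_comm_assoc (C.ff _ _), mul_smul_comm, smul_smul]
    rw [sq, mul_inv]
  have c1 : ∀ i j, a₁ i * a₂ j = a₂ j * a₁ i := C.aa
  refine ⟨fun i => ?_, fun i => ?_, fun i j => ?_, fun i => ?_, fun i => ?_, fun i j h1 h2 => ?_,
    fun i j h => ?_, fun i => ?_, fun i => ?_⟩
  · show a₁ i * a₂ i * (b₁ i * b₂ i) = 1
    rw [mul_assoc, ← mul_comm_assoc (cba _ _), H₂.ab, mul_one, H₁.ab]
  · show b₁ i * b₂ i * (a₁ i * a₂ i) = 1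
    rw [C.aa, mul_assoc, ← mul_assoc (b₂ i), H₂.ba, one_mul, H₁.ba]
  · show a₁ i * a₂ i * (a₁ j * a₂ j) = a₁ j * a₂ j * (a₁ i * a₂ i)
    simp only [mul_assoc, ← mul_comm_assoc (C.aa _ _), H₂.a_a i j, mul_comm_assoc (H₁.a_a i j)]
  · simp only [mul_add, add_mul, smul_add, mul_assoc, ← mul_comm_assoc (C.aa _ _),
      ← mul_comm_assoc (C.af _ _), ← mul_comm_assoc (C.fa _ _), H₂.a_f_self i,
      mul_qcomm_assoc (H₁.a_f_self i), mul_smul_comm, H₂.a_a (i + 1) i]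
  · simp only [mul_add, add_mul, smul_add, mul_assoc, ← mul_comm_assoc (C.aa _ _),
      ← mul_comm_assoc (C.af _ _), ← mul_comm_assoc (C.fa _ _), H₂.a_f_succ i,
      mul_qcomm_assoc (H₁.a_f_succ i), mul_comm_assoc (H₁.a_a (i + 1) i), mul_smul_comm]
  · simp only [mul_add, add_mul, mul_assoc, ← mul_comm_assoc (C.aa _ _),
      ← mul_comm_assoc (C.af _ _), ← mul_comm_assoc (C.fa _ _), H₂.a_f i j h1 h2,
      mul_comm_assoc (H₁.a_f i j h1 h2), mul_comm_assoc (H₁.a_a i j), H₂.a_a i (j + 1)]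
  · have e1 : a₁ j * f₂ j * (a₁ i * f₂ i) = a₁ i * f₂ i * (a₁ j * f₂ j) := by
      simp only [mul_assoc, ← mul_comm_assoc (C.af _ _), H₂.f_f i j h, mul_comm_assoc (H₁.a_a i j)]
    have e2 : f₁ j * a₂ (j + 1) * (f₁ i * a₂ (i + 1))
        = f₁ i * a₂ (i + 1) * (f₁ j * a₂ (j + 1)) := by
      simp only [mul_assoc, ← mul_comm_assoc (C.fa _ _), mul_comm_assoc (H₁.f_f i j h),
        H₂.a_a (j + 1) (i + 1)]
    have e3 : a₁ j * f₂ j * (f₁ i * a₂ (i + 1)) = f₁ i * a₂ (i + 1) * (a₁ j * f₂ j) := by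
      simp only [mul_assoc, ← mul_comm_assoc (C.ff _ _), ← mul_comm_assoc (C.aa _ _),
        mul_comm_assoc (H₁.a_f j i (by omega) (by omega)), H₂.a_f (i + 1) j (by omega) (by omega)]
    have e4 : f₁ j * a₂ (j + 1) * (a₁ i * f₂ i) = a₁ i * f₂ i * (f₁ j * a₂ (j + 1)) := by
      simp only [mul_assoc, ← mul_comm_assoc (C.ff _ _), ← mul_comm_assoc (C.aa _ _),
        mul_comm_assoc (H₁.a_f i j (by omega) (by omega)), H₂.a_f (j + 1) i (by omega) (by omega)]
    simp only [mul_add, add_mul, e1, e2, e3, e4]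
    abel
  · refine serre_add (q ^ 2) (pow_ne_zero 2 hq) _ _ _ _ (vu i) (ru i) (vs i) ?_ ?_
    · exact serre_mul (H₁.a_a _ _) (C.af _ _).symm (C.af _ _).symm (C.af _ _).symm
        (H₂.serre i)
    · simp only [C.fa]
      exact serre_mul (H₂.a_a _ _) (C.fa _ _) (C.fa _ _) (C.fa _ _) (H₁.serre i)
  · refine serre_add' (q ^ 2) (pow_ne_zero 2 hq) _ _ _ _ (ru i) (vs i) (vu (i + 1)) ?_ ?_
    · exact serre_mul' (H₁.a_a _ _) (C.af _ _).symm (C.af _ _).symm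
        (C.af _ _).symm (H₂.serre' i)
    · simp only [C.fa]
      exact serre_mul' (H₂.a_a _ _) (C.fa _ _) (C.fa _ _) (C.fa _ _) (H₁.serre' i)

end Coproduct

/-! ### The co-product of the mixed relations and of the entries of L_±. -/

section CoproductElements

variable {A : Type*} [Ring A] [Algebra ℂ A]

theorem one_qcomm {x y : A} (h : x * y = y * x) : x * y = (1 : ℂ) • (y * x) := by
  rw [h, one_smul]

theorem qcomm_symm {c : ℂ} (hc : c ≠ 0) {x y : A} (h : x * y = c • (y * x)) :
    y * x = c⁻¹ • (x * y) := by
  rw [h, smul_smul, inv_mul_cancel₀ hc, one_smul]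

theorem qcomm_mul {c d : ℂ} {x₁ x₂ y₁ y₂ : A} (h₁ : x₁ * y₁ = c • (y₁ * x₁))
    (h₂ : x₂ * y₂ = d • (y₂ * x₂)) (h₃ : x₂ * y₁ = y₁ * x₂) (h₄ : x₁ * y₂ = y₂ * x₁) :
    x₁ * x₂ * (y₁ * y₂) = (c * d) • (y₁ * y₂ * (x₁ * x₂)) := by
  have h₄' := fun z => (mul_comm_assoc h₄ z).symm
  simp only [mul_assoc, mul_comm_assoc h₃, mul_qcomm_assoc h₁, h₂, h₄', mul_smul_comm, smul_smul,
    mul_comm d c]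

theorem qcomm_add_add {c : ℂ} {x₁ x₂ y₁ y₂ : A} (h₁₁ : x₁ * y₁ = c • (y₁ * x₁))
    (h₁₂ : x₁ * y₂ = c • (y₂ * x₁)) (h₂₁ : x₂ * y₁ = c • (y₁ * x₂))
    (h₂₂ : x₂ * y₂ = c • (y₂ * x₂)) :
    (x₁ + x₂) * (y₁ + y₂) = c • ((y₁ + y₂) * (x₁ + x₂)) := by
  simp only [mul_add, add_mul, h₁₁, h₁₂, h₂₁, h₂₂, smul_add]; abel

/-- The co-product preserves the relations between raising and lowering generators. -/
theorem IsMixed.coproduct {q l : ℂ} {m : ℕ} (hq : q ≠ 0) {a₁ b₁ e₁ f₁ a₂ b₂ e₂ f₂ : ℕ → A}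
    (H₁ : IsBorel q a₁ b₁ f₁) (H₂ : IsBorel q a₂ b₂ f₂)
    (G₁ : IsBorel q b₁ a₁ e₁) (G₂ : IsBorel q b₂ a₂ e₂)
    (M₁ : IsMixed q l m a₁ b₁ e₁ f₁) (M₂ : IsMixed q l m a₂ b₂ e₂ f₂)
    (C : CommutingFamilies a₁ f₁ a₂ f₂) (D : CommutingFamilies b₁ e₁ b₂ e₂)
    (hef : ∀ i j, e₁ i * f₂ j = f₂ j * e₁ i) (hfe : ∀ i j, f₁ i * e₂ j = e₂ j * f₁ i) :
    IsMixed q l m (fun i => a₁ i * a₂ i) (fun i => b₁ i * b₂ i)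
      (fun i => e₁ i * b₂ i + b₁ (i + 1) * e₂ i) (fun i => a₁ i * f₂ i + f₁ i * a₂ (i + 1)) := by
  have ab : ∀ i j, a₁ i * b₂ j = b₂ j * a₁ i := fun i j =>
    inv_comm (G₁.ab i) (G₁.ba i) (D.aa i j)
  have ba : ∀ i j, b₁ i * a₂ j = a₂ j * b₁ i := fun i j =>
    inv_comm (H₁.ab i) (H₁.ba i) (C.aa i j)
  have ae : ∀ i j, a₁ i * e₂ j = e₂ j * a₁ i := fun i j =>
    inv_comm (G₁.ab i) (G₁.ba i) (D.af i j)
  have bf : ∀ i j, b₁ i * f₂ j = f₂ j * b₁ i := fun i j =>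
    inv_comm (H₁.ab i) (H₁.ba i) (C.af i j)
  have ea : ∀ i j, e₁ i * a₂ j = a₂ j * e₁ i := fun i j =>
    (inv_comm (G₂.ab j) (G₂.ba j) (D.fa i j).symm).symm
  have fb : ∀ i j, f₁ i * b₂ j = b₂ j * f₁ i := fun i j =>
    (inv_comm (H₂.ab j) (H₂.ba j) (C.fa i j).symm).symm
  refine ⟨fun i hi => ?_, fun i => ?_, fun i => ?_, fun i j h1 h2 h3 => ?_⟩
  -- The two cross terms commute exactly, their factors q and q⁻¹ cancelling. The diagonal
  -- commutators `t3`, `t4` survive, and in their sum the intermediate Cartan term a₁(i) b₁(i+1)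
  -- b₂(i) a₂(i+1) cancels.
  · have t1 : e₁ i * b₂ i * (a₁ i * f₂ i) = a₁ i * f₂ i * (e₁ i * b₂ i) := by
      rw [qcomm_mul (qcomm_symm hq (G₁.b_f_self hq i)) (H₂.b_f_self hq i) (ab _ _).symm
        (hef _ _), inv_mul_cancel₀ hq, one_smul]
    have t2 : b₁ (i + 1) * e₂ i * (f₁ i * a₂ (i + 1)) = f₁ i * a₂ (i + 1) * (b₁ (i + 1) * e₂ i) :=
        by
      rw [qcomm_mul (H₁.b_f_succ hq i) (qcomm_symm (inv_ne_zero hq) (G₂.b_f_succ hq i))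
        (hfe _ _).symm (ba _ _), mul_inv_cancel₀ (inv_ne_zero hq), one_smul]
    have t3 : e₁ i * b₂ i * (f₁ i * a₂ (i + 1)) - f₁ i * a₂ (i + 1) * (e₁ i * b₂ i)
        = (e₁ i * f₁ i - f₁ i * e₁ i) * (b₂ i * a₂ (i + 1)) := by
      simp only [sub_mul, mul_assoc, ← mul_comm_assoc (fb _ _), ← mul_comm_assoc (ea _ _),
        H₂.b_a i (i + 1)]
    have t4 : b₁ (i + 1) * e₂ i * (a₁ i * f₂ i) - a₁ i * f₂ i * (b₁ (i + 1) * e₂ i)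
        = (a₁ i * b₁ (i + 1)) * (e₂ i * f₂ i - f₂ i * e₂ i) := by
      simp only [mul_sub, mul_assoc, ← mul_comm_assoc (ae _ _), ← mul_comm_assoc (bf _ _),
        mul_comm_assoc (H₁.b_a (i + 1) i)]
    have t5 : (e₁ i * b₂ i + b₁ (i + 1) * e₂ i) * (a₁ i * f₂ i + f₁ i * a₂ (i + 1))
        - (a₁ i * f₂ i + f₁ i * a₂ (i + 1)) * (e₁ i * b₂ i + b₁ (i + 1) * e₂ i)
        = (e₁ i * f₁ i - f₁ i * e₁ i) * (b₂ i * a₂ (i + 1))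
          + (a₁ i * b₁ (i + 1)) * (e₂ i * f₂ i - f₂ i * e₂ i) := by
      rw [← t3, ← t4]
      simp only [mul_add, add_mul, t1, t2]; abel
    show (e₁ i * b₂ i + b₁ (i + 1) * e₂ i) * (a₁ i * f₂ i + f₁ i * a₂ (i + 1))
        - (a₁ i * f₂ i + f₁ i * a₂ (i + 1)) * (e₁ i * b₂ i + b₁ (i + 1) * e₂ i) = _
    rw [t5, M₁.ef_self i hi, M₂.ef_self i hi]
    simp only [mul_neg, neg_mul, mul_sub, sub_mul, smul_mul_assoc, mul_smul_comm, mul_assoc,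
      ← mul_comm_assoc (ba _ _), ← mul_comm_assoc (ab _ _), H₂.b_a i (i + 1)]
    module
  · refine qcomm_add_add ?_ ?_ ?_ ?_
    · simpa using qcomm_mul (qcomm_symm (inv_ne_zero hq) (G₁.b_f_succ hq i))
        (one_qcomm (H₂.b_f i (i + 1) (by omega) (by omega))) (ab _ _).symm (hef _ _)
    · simpa using qcomm_mul (M₁.ef_succ i) (one_qcomm (H₂.b_a _ _)) (fb _ _).symm (ea _ _)
    · simpa using qcomm_mul (one_qcomm (H₁.b_a _ _)) (M₂.ef_succ i) (ae _ _).symm (bf _ _)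
    · simpa using qcomm_mul (H₁.b_f_self hq (i + 1))
        (one_qcomm (G₂.b_f (i + 1 + 1) i (by omega) (by omega)).symm) (hfe _ _).symm (ba _ _)
  · refine qcomm_add_add ?_ ?_ ?_ ?_
    · simpa using qcomm_mul (one_qcomm (G₁.b_f i (i + 1) (by omega) (by omega)))
        (qcomm_symm (inv_ne_zero hq) (H₂.b_f_succ hq i)) (hef _ _).symm (ab _ _)
    · simpa using qcomm_mul (one_qcomm (H₁.b_a _ _).symm) (M₂.fe_succ i) (bf _ _).symm (ae _ _)
    · simpa using qcomm_mul (M₁.fe_succ i) (one_qcomm (H₂.b_a _ _).symm) (ea _ _).symm (fb _ _)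
    · simpa using qcomm_mul (one_qcomm (H₁.b_f (i + 1 + 1) i (by omega) (by omega)).symm)
        (G₂.b_f_self hq (i + 1)) (ba _ _).symm (hfe _ _)
  · have key := qcomm_add_add (c := 1) (x₁ := e₁ i * b₂ i) (x₂ := b₁ (i + 1) * e₂ i)
      (y₁ := a₁ j * f₂ j) (y₂ := f₁ j * a₂ (j + 1)) ?_ ?_ ?_ ?_
    · simpa using key
    · simpa using qcomm_mul (one_qcomm (G₁.b_f j i (by omega) (by omega)).symm)
        (one_qcomm (H₂.b_f i j (by omega) (by omega))) (ab _ _).symm (hef _ _)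
    · simpa using qcomm_mul (one_qcomm (M₁.ef i j h1 h2 h3)) (one_qcomm (H₂.b_a _ _))
        (fb _ _).symm (ea _ _)
    · simpa using qcomm_mul (one_qcomm (H₁.b_a _ _)) (one_qcomm (M₂.ef i j h1 h2 h3))
        (ae _ _).symm (bf _ _)
    · simpa using qcomm_mul (one_qcomm (H₁.b_f (i + 1) j (by omega) (by omega)))
        (one_qcomm (G₂.b_f (j + 1) i (by omega) (by omega)).symm) (hfe _ _).symm (ba _ _)

/-- The product of a row vector with the matrix `L_+` of a commuting family. -/
def rowMul (l : ℂ) (r a b f : ℕ → A) (j : ℕ) : A :=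
  ∑ k ∈ Finset.range (j + 1), r k * upper l a b f k j

theorem rowMul_zero (l : ℂ) (r a b f : ℕ → A) : rowMul l r a b f 0 = r 0 * a 0 := by
  simp [rowMul, upper_self]

theorem rowMul_one (l : ℂ) (r a b f : ℕ → A) :
    rowMul l r a b f 1 = r 0 * f 0 + r 1 * a 1 := by
  simp [rowMul, Finset.sum_range_succ, upper_self]
  rw [upper_succ]

/-- In Σ_k r_k L_{kj} the terms with k < j see only the action of f₂, which turns L_{kj} into
L_{k,j+1}. The term k = j gives two contributions: r_j L_{j,j+1}, with coefficient q - q⁻¹ from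
reordering the Cartan factors, and r_{j+1} L_{j+1,j+1} from the action of f₁ on r. Together they are
column j+1. The lemma serves both for rows of L_+ and for the row X. -/
theorem rowMul_step {q l : ℂ} (hlq : l = q - q⁻¹) (hl : l ≠ 0) (hq : q ≠ 0)
    {r a₁ f₁ a₂ b₂ f₂ : ℕ → A} (H : IsBorel q a₂ b₂ f₂)
    (C : CommutingFamilies a₁ f₁ a₂ f₂) (ra : ∀ k i, r k * a₂ i = a₂ i * r k)
    (rf : ∀ k i, r k * f₂ i = f₂ i * r k) {j : ℕ}
    (h1 : ∀ k, k < j → a₁ j * r k = r k * a₁ j) (h2 : a₁ j * r j = q • (r j * a₁ j))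
    (h3 : ∀ k, k < j → f₁ j * r k = r k * f₁ j)
    (h4 : f₁ j * r j - r j * f₁ j = l • (a₁ j * r (j + 1))) :
    (a₁ j * f₂ j + f₁ j * a₂ (j + 1)) * rowMul l r a₂ b₂ f₂ j
        - rowMul l r a₂ b₂ f₂ j * (a₁ j * f₂ j + f₁ j * a₂ (j + 1))
      = l • (a₁ j * a₂ j * rowMul l r a₂ b₂ f₂ (j + 1)) := by
  have key : ∀ k, k < j → (a₁ j * f₂ j + f₁ j * a₂ (j + 1)) * (r k * upper l a₂ b₂ f₂ k j)
        - r k * upper l a₂ b₂ f₂ k j * (a₁ j * f₂ j + f₁ j * a₂ (j + 1))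
      = l • (a₁ j * a₂ j * (r k * upper l a₂ b₂ f₂ k (j + 1))) := fun k hk => by
    have c1 : a₁ j * upper l a₂ b₂ f₂ k j = upper l a₂ b₂ f₂ k j * a₁ j :=
      upper_comm hk.le (fun _ => C.aa _ _)
        (fun i _ _ => (inv_comm (H.ab i) (H.ba i) (C.aa j i).symm).symm) (fun i _ _ => C.af _ _)
    have c2 : f₁ j * upper l a₂ b₂ f₂ k j = upper l a₂ b₂ f₂ k j * f₁ j :=
      upper_comm hk.le (fun _ => C.fa _ _)
        (fun i _ _ => (inv_comm (H.ab i) (H.ba i) (C.fa j i).symm).symm) (fun i _ _ => C.ff _ _)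
    have c3 := upper_a_comm (l := l) H hk.le (Nat.lt_succ_self j)
    have s := upper_step hl H.ab hk (f := f₂)
    have e1 : (a₁ j * f₂ j + f₁ j * a₂ (j + 1)) * (r k * upper l a₂ b₂ f₂ k j)
        - r k * upper l a₂ b₂ f₂ k j * (a₁ j * f₂ j + f₁ j * a₂ (j + 1))
        = a₁ j * (r k * (f₂ j * upper l a₂ b₂ f₂ k j - upper l a₂ b₂ f₂ k j * f₂ j)) := by
      simp only [mul_add, add_mul, mul_sub, mul_assoc, ← mul_comm_assoc (rf _ _),
        ← mul_comm_assoc (ra _ _), ← mul_comm_assoc c1, ← mul_comm_assoc c2,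
        mul_comm_assoc (h3 k hk), mul_comm_assoc (h1 k hk), c3]
      abel
    rw [e1, s]
    simp only [mul_smul_comm, mul_assoc, ← mul_comm_assoc (ra _ _)]
  have last : (a₁ j * f₂ j + f₁ j * a₂ (j + 1)) * (r j * a₂ j)
        - r j * a₂ j * (a₁ j * f₂ j + f₁ j * a₂ (j + 1))
      = l • (a₁ j * a₂ j * (r j * f₂ j)) + l • (a₁ j * a₂ j * (r (j + 1) * a₂ (j + 1))) := by
    have e1 : a₁ j * f₂ j * (r j * a₂ j) - r j * a₂ j * (a₁ j * f₂ j)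
        = l • (a₁ j * a₂ j * (r j * f₂ j)) := by
      have c1 := qcomm_symm hq h2
      have c2 := H.a_f_self j
      have c3 := qcomm_symm (inv_ne_zero hq) c2
      simp only [mul_assoc, ← mul_comm_assoc (rf _ _), ← mul_comm_assoc (ra _ _),
        ← mul_comm_assoc (C.aa _ _), mul_qcomm_assoc c1, c3, mul_smul_comm]
      rw [hlq, inv_inv]; module
    have e2 : f₁ j * a₂ (j + 1) * (r j * a₂ j) - r j * a₂ j * (f₁ j * a₂ (j + 1))
        = (f₁ j * r j - r j * f₁ j) * (a₂ j * a₂ (j + 1)) := by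
      simp only [sub_mul, mul_assoc, ← mul_comm_assoc (ra _ _), ← mul_comm_assoc (C.fa _ _),
        H.a_a (j + 1) j]
    rw [h4] at e2
    have e3 : l • (a₁ j * r (j + 1)) * (a₂ j * a₂ (j + 1))
        = l • (a₁ j * a₂ j * (r (j + 1) * a₂ (j + 1))) := by
      simp only [smul_mul_assoc, mul_assoc, ← mul_comm_assoc (ra _ _)]
    rw [← e1, ← e3, ← e2]
    simp only [mul_add, add_mul]; abel
  generalize a₁ j * f₂ j + f₁ j * a₂ (j + 1) = F at key last ⊢
  rw [rowMul, rowMul, Finset.sum_range_succ, Finset.sum_range_succ _ (j + 1),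
    Finset.sum_range_succ _ j, upper_self, upper_self, upper_succ]
  simp only [mul_add, add_mul, Finset.mul_sum, Finset.sum_mul]
  rw [add_sub_add_comm, ← Finset.sum_sub_distrib, last, smul_add, smul_add, ← add_assoc,
    Finset.smul_sum]
  congr 2
  exact Finset.sum_congr rfl fun k hk => key k (Finset.mem_range.mp hk)

/-- The co-product of the elements of `L_+` is given by the matrix product. -/
theorem upper_coproduct {q l : ℂ} (hlq : l = q - q⁻¹) (hl : l ≠ 0) (hq : q ≠ 0)
    {a₁ b₁ f₁ a₂ b₂ f₂ : ℕ → A} (H₁ : IsBorel q a₁ b₁ f₁) (H₂ : IsBorel q a₂ b₂ f₂)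
    (C : CommutingFamilies a₁ f₁ a₂ f₂) {s j : ℕ} (hs : s ≤ j) :
    upper l (fun i => a₁ i * a₂ i) (fun i => b₁ i * b₂ i)
        (fun i => a₁ i * f₂ i + f₁ i * a₂ (i + 1)) s j
      = rowMul l (upper l a₁ b₁ f₁ s) a₂ b₂ f₂ j := by
  have H := H₁.coproduct hq H₂ C
  -- `rowMul` sums from 0, but row s of a triangular matrix vanishes before s.
  have hsum : ∀ t, rowMul l (upper l a₁ b₁ f₁ s) a₂ b₂ f₂ (s + t)
      = ∑ k ∈ Finset.range (t + 1), upper l a₁ b₁ f₁ s (s + k) * upper l a₂ b₂ f₂ (s + k) (s + t) :=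
    fun t => by
      rw [rowMul, show s + t + 1 = s + (t + 1) by ring, Finset.sum_range_add,
        Finset.sum_eq_zero, zero_add]
      intro k hk
      rw [upper_of_lt (Finset.mem_range.mp hk), zero_mul]
  rcases hs.eq_or_lt with rfl | hs
  · have := hsum 0
    simp only [add_zero, zero_add, Finset.sum_range_one] at this
    rw [this, upper_self, upper_self, upper_self]
  refine upper_induction (P := fun j y => y = rowMul l (upper l a₁ b₁ f₁ s) a₂ b₂ f₂ j)
    ?_ ?_ hs
  · rw [hsum 1]
    simp only [Finset.sum_range_succ, Finset.sum_range_zero, add_zero, zero_add]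
    rw [upper_self, upper_self, upper_succ, upper_succ]
  · intro j hj ih
    have ra : ∀ k i, upper l a₁ b₁ f₁ s k * a₂ i = a₂ i * upper l a₁ b₁ f₁ s k := fun k i => by
      by_cases hk : s ≤ k
      · exact (upper_comm hk (fun _ => (C.aa _ _).symm)
          (fun i' _ _ => (inv_comm (H₁.ab i') (H₁.ba i') (C.aa i' i)).symm)
          (fun i' _ _ => (C.fa _ _).symm)).symm
      · rw [upper_of_lt (by omega)]; simp
    have rf : ∀ k i, upper l a₁ b₁ f₁ s k * f₂ i = f₂ i * upper l a₁ b₁ f₁ s k := fun k i => by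
      by_cases hk : s ≤ k
      · exact (upper_comm hk (fun _ => (C.af _ _).symm)
          (fun i' _ _ => (inv_comm (H₁.ab i') (H₁.ba i') (C.af i' i)).symm)
          (fun i' _ _ => (C.ff _ _).symm)).symm
      · rw [upper_of_lt (by omega)]; simp
    rw [ih, rowMul_step hlq hl hq H₂ C ra rf (r := upper l a₁ b₁ f₁ s) (j := j)
      (fun k hk => ?_) (upper_a_right H₁ hj) (fun k hk => ?_) (upper_step hl H₁.ab hj)]
    · rw [mul_smul_comm, smul_smul, inv_mul_cancel₀ hl, one_smul, ← mul_assoc, H.ba j, one_mul]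
    · by_cases hk' : s ≤ k
      · exact upper_a_comm H₁ hk' hk
      · rw [upper_of_lt (by omega)]; simp
    · by_cases hk' : s ≤ k
      · exact upper_f_comm H₁ hk' hk
      · rw [upper_of_lt (by omega)]; simp

end CoproductElements

/-! ### Triangular data -/

/-- The elements `a_i = L_{+,ii}`, `b_i = L_{-,ii}`, `e_i = L_{-,i+1,i}`, `f_i = L_{+,i,i+1}`. -/
structure TriangularData (A : Type*) where
  a : ℕ → A
  b : ℕ → A
  e : ℕ → A
  f : ℕ → A

namespace TriangularData

/-- The co-product of two commuting families. -/
def mul {A : Type*} [Ring A] (x v : TriangularData A) : TriangularData A where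
  a i := x.a i * v.a i
  b i := x.b i * v.b i
  e i := x.e i * v.b i + x.b (i + 1) * v.e i
  f i := x.a i * v.f i + x.f i * v.a (i + 1)

/-- All elements of the two families commute. -/
structure Commuting {A : Type*} [Mul A] (x v : TriangularData A) : Prop where
  af : CommutingFamilies x.a x.f v.a v.f
  be : CommutingFamilies x.b x.e v.b v.e
  ef : ∀ i j, x.e i * v.f j = v.f j * x.e i
  fe : ∀ i j, x.f i * v.e j = v.e j * x.f i

variable {A : Type*} [Ring A] [Algebra ℂ A]

/-- The relations of `U_q(gl(m))`. -/
structure Relations (q l : ℂ) (m : ℕ) (x : TriangularData A) : Prop where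
  lower : IsBorel q x.a x.b x.f
  raise : IsBorel q x.b x.a x.e
  mixed : IsMixed q l m x.a x.b x.e x.f

theorem Commuting.ab {q l : ℂ} {m : ℕ} {x v : TriangularData A} (C : Commuting x v)
    (hx : Relations q l m x) (i j : ℕ) : x.a i * v.b j = v.b j * x.a i :=
  inv_comm (hx.lower.ba i) (hx.lower.ab i) (C.be.aa i j)

theorem Commuting.ba {q l : ℂ} {m : ℕ} {x v : TriangularData A} (C : Commuting x v)
    (hx : Relations q l m x) (i j : ℕ) : x.b i * v.a j = v.a j * x.b i :=
  inv_comm (hx.lower.ab i) (hx.lower.ba i) (C.af.aa i j)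

theorem mul_lower {q l : ℂ} (hq : q ≠ 0) {m m' : ℕ} {x v : TriangularData A}
    (hx : Relations q l m x) (hv : Relations q l m' v) (C : Commuting x v) :
    IsBorel q (mul x v).a (mul x v).b (mul x v).f :=
  hx.lower.coproduct hq hv.lower C.af

/-- L_- is lower triangular, so the transposed entries used for it multiply in the opposite order.
With the second family written first, the raising half has exactly the form of `IsBorel.coproduct`.
-/
theorem mul_raise_swap {x v : TriangularData A} (C : Commuting x v) :
    (mul x v).b = (fun i => v.b i * x.b i) ∧ (mul x v).a = (fun i => v.a i * x.a i) ∧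
      (mul x v).e = (fun i => v.b i * x.e i + v.e i * x.b (i + 1)) := by
  refine ⟨funext fun i => C.be.aa i i, funext fun i => C.af.aa i i, funext fun i => ?_⟩
  show x.e i * v.b i + x.b (i + 1) * v.e i = _
  rw [C.be.fa, C.be.af]

theorem mul_raise {q l : ℂ} (hq : q ≠ 0) {m m' : ℕ} {x v : TriangularData A}
    (hx : Relations q l m x) (hv : Relations q l m' v) (C : Commuting x v) :
    IsBorel q (mul x v).b (mul x v).a (mul x v).e := by
  obtain ⟨h1, h2, h3⟩ := mul_raise_swap C
  rw [h1, h2, h3]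
  exact hv.raise.coproduct hq hx.raise C.be.symm

theorem Relations.mul {q l : ℂ} (hq : q ≠ 0) {m : ℕ} {x v : TriangularData A}
    (hx : Relations q l m x) (hv : Relations q l m v) (C : Commuting x v) :
    Relations q l m (mul x v) where
  lower := mul_lower hq hx hv C
  raise := mul_raise hq hx hv C
  mixed := IsMixed.coproduct hq hx.lower hv.lower hx.raise hv.raise hx.mixed hv.mixed C.af C.be
    C.ef C.fe

/-- Only the diagonal commutators [e_i, f_i] depend on the rank. The Jordan–Schwinger data of rank
n+1 are used at rank n while the co-product of U_q(gl(n)) is studied. -/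
theorem Relations.mono {q l : ℂ} {m m' : ℕ} (h : m ≤ m') {x : TriangularData A}
    (hx : Relations q l m' x) : Relations q l m x :=
  ⟨hx.lower, hx.raise, ⟨fun i hi => hx.mixed.ef_self i (by omega), hx.mixed.ef_succ,
    hx.mixed.fe_succ, hx.mixed.ef⟩⟩

end TriangularData

open TriangularData

/-! ### The reduced tensor product in terms of triangular data -/

section ReducedTriangular

variable {A : Type*} [Ring A] [Algebra ℂ A]

/-- The relations satisfied by the Jordan-Schwinger elements `X_k`, `k < n`, and by
`G = q ^ (-N_n) x_n⁻¹`, `H = q ^ (2 + N_n) x_n⁻¹`, where the last index is `n`, and their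
compatibility with a commuting representation `v` of `U_q(gl(n))`. -/
structure ReducedSetting (q l c : ℂ) (n : ℕ) (x v : TriangularData A) (X : ℕ → A) (G H : A) :
    Prop where
  hx : Relations q l n x
  hv : Relations q l n v
  comm : Commuting x v
  x_f_last : ∀ i, n ≤ i → x.f i = 0
  x_e_last : ∀ i, n ≤ i → x.e i = 0
  v_f_last : ∀ i, n ≤ i + 1 → v.f i = 0
  v_e_last : ∀ i, n ≤ i + 1 → v.e i = 0
  v_a_last : ∀ i, n ≤ i → v.a i = 1
  v_b_last : ∀ i, n ≤ i → v.b i = 1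
  X_v : ∀ k i, X k * v.a i = v.a i * X k ∧ X k * v.b i = v.b i * X k ∧ X k * v.e i = v.e i * X k ∧
    X k * v.f i = v.f i * X k
  G_v : ∀ i, G * v.a i = v.a i * G ∧ G * v.b i = v.b i * G ∧ G * v.e i = v.e i * G ∧
    G * v.f i = v.f i * G
  H_v : ∀ i, H * v.a i = v.a i * H ∧ H * v.b i = v.b i * H ∧ H * v.e i = v.e i * H ∧
    H * v.f i = v.f i * H
  a_X_self : ∀ k, k < n → x.a k * X k = q • (X k * x.a k)
  a_X : ∀ i k, i ≠ k → k < n → x.a i * X k = X k * x.a i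
  f_X : ∀ i k, i ≠ k → i + 1 ≠ k → i + 1 < n → k < n → x.f i * X k = X k * x.f i
  f_X_succ : ∀ k, k + 1 < n → x.f k * X (k + 1) = q • (X (k + 1) * x.f k)
  f_X_self : ∀ k, k + 1 < n → x.f k * X k - X k * x.f k = l • (x.a k * X (k + 1))
  e_X : ∀ i k, i ≠ k → i + 1 ≠ k → i + 1 < n → k < n → x.e i * X k = X k * x.e i
  e_X_self : ∀ k, k + 1 < n → x.e k * X k = q⁻¹ • (X k * x.e k)
  e_X_succ : ∀ k, k + 1 < n →
    x.e k * X (k + 1) - X (k + 1) * x.e k = -(l • (x.b (k + 1) * X k))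
  X_X : ∀ i k, i < k → k < n → X k * X i = q • (X i * X k)
  G_a : ∀ i, i ≠ n → x.a i * G = G * x.a i
  H_a : ∀ i, i ≠ n → x.a i * H = H * x.a i
  G_a_last : x.a n * G = q⁻¹ • (G * x.a n)
  H_a_last : x.a n * H = q⁻¹ • (H * x.a n)
  G_f : ∀ i, i + 1 < n → G * x.f i = x.f i * G
  H_f : ∀ i, i + 1 < n → H * x.f i = x.f i * H
  G_e : ∀ i, i + 1 < n → G * x.e i = x.e i * G
  H_e : ∀ i, i + 1 < n → H * x.e i = x.e i * H
  c_ne : c ≠ 0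
  G_X : ∀ k, k < n → G * X k = c • (X k * G)
  H_X : ∀ k, k < n → H * X k = c • (X k * H)
  G_H : G * H = q ^ 2 • (H * G)
  GX_f : ∀ k i, k < i → i + 1 = n → G * X k * x.f i = x.f i * (G * X k)
  GX_f_last : ∀ i, i + 1 = n →
    G * X i * x.f i - x.f i * (G * X i) = -(l • (x.a i * x.b (i + 1)))
  HX_f_last : ∀ i, i + 1 = n →
    H * X i * x.f i - x.f i * (H * X i) = -(l • (x.b i * x.a (i + 1)))

/-- The row `X L_+`. -/
def plusRow (l : ℂ) (v : TriangularData A) (X : ℕ → A) (j : ℕ) : A :=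
  rowMul l X v.a v.b v.f j

/-- The row `X L_-`. -/
def minusRow (l : ℂ) (n : ℕ) (v : TriangularData A) (X : ℕ → A) (j : ℕ) : A :=
  ∑ k ∈ Finset.Ico j n, X k * upper l v.b v.a v.e j k

/-- The last row of `L_-` of the reduced tensor product. -/
def lastRow (l : ℂ) (n : ℕ) (v : TriangularData A) (X : ℕ → A) (G H : A) (j : ℕ) : A :=
  G * plusRow l v X j - H * minusRow l n v X j

/-- The triangular data of the reduced tensor product. -/
def reducedTriangular (l : ℂ) (n : ℕ) (x v : TriangularData A) (X : ℕ → A) (G H : A) :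
    TriangularData A where
  a := (mul x v).a
  b := (mul x v).b
  e i := if i + 1 = n then lastRow l n v X G H i else (mul x v).e i
  f := (mul x v).f

namespace ReducedSetting

variable {q l c : ℂ} {n : ℕ} {x v : TriangularData A} {X : ℕ → A} {G H : A}

theorem mul_rel (D : ReducedSetting q l c n x v X G H) (hq : q ≠ 0) :
    Relations q l n (mul x v) := D.hx.mul hq D.hv D.comm

theorem b_X_self (D : ReducedSetting q l c n x v X G H) (hq : q ≠ 0) (k : ℕ) (hk : k < n) :
    x.b k * X k = q⁻¹ • (X k * x.b k) :=
  inv_qcomm hq (D.hx.lower.ab k) (D.hx.lower.ba k) (D.a_X_self k hk)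

theorem b_X (D : ReducedSetting q l c n x v X G H) (i k : ℕ) (hik : i ≠ k) (hk : k < n) :
    x.b i * X k = X k * x.b i :=
  inv_comm (D.hx.lower.ab i) (D.hx.lower.ba i) (D.a_X i k hik hk)

/-- The row `X L_+` is covariant under the co-product of the lower generators. -/
theorem plus_isRow (D : ReducedSetting q l c n x v X G H) (hlq : l = q - q⁻¹) (hl : l ≠ 0)
    (hq : q ≠ 0) : IsRow q l n (mul x v).a (mul x v).f (plusRow l v X) := by
  have ra : ∀ k i, X k * v.a i = v.a i * X k := fun k i => (D.X_v k i).1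
  have rf : ∀ k i, X k * v.f i = v.f i * X k := fun k i => (D.X_v k i).2.2.2
  have hV := D.hv.lower
  refine ⟨fun j hj => ?_, fun j hj => ?_, fun i j hij hj => ?_, fun i hi hi' => ?_, fun hn => ?_,
    fun hn => ?_⟩
  · exact rowMul_step hlq hl hq hV D.comm.af ra rf (fun k hk => D.a_X _ _ (by omega) (by omega))
      (D.a_X_self j (by omega)) (fun k hk => D.f_X _ _ (by omega) (by omega) hj (by omega))
      (D.f_X_self j hj)
  · show x.a j * v.a j * rowMul l X v.a v.b v.f j = q • (rowMul l X v.a v.b v.f j * (x.a j * v.a j))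
    rw [rowMul, Finset.mul_sum, Finset.sum_mul, Finset.smul_sum]
    refine Finset.sum_congr rfl fun k hk => ?_
    have hk' : k ≤ j := by simpa [Nat.lt_succ_iff] using hk
    have c1 : x.a j * upper l v.a v.b v.f k j = upper l v.a v.b v.f k j * x.a j :=
      upper_comm hk' (fun _ => D.comm.af.aa _ _) (fun i _ _ => D.comm.ab D.hx _ _)
        (fun i _ _ => D.comm.af.af _ _)
    rcases hk'.eq_or_lt with rfl | hk'
    · rw [upper_self] at c1 ⊢
      simp only [mul_assoc, ← mul_comm_assoc (ra _ _), mul_qcomm_assoc (D.a_X_self k hj),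
        mul_comm_assoc c1]
    · have c2 := upper_a_right (l := l) hV hk'
      simp only [mul_assoc, ← mul_comm_assoc (ra _ _), mul_comm_assoc (D.a_X j k (by omega)
        (by omega)), c2, mul_smul_comm, mul_comm_assoc c1]
  · show x.a i * v.a i * rowMul l X v.a v.b v.f j = rowMul l X v.a v.b v.f j * (x.a i * v.a i)
    rw [rowMul, Finset.mul_sum, Finset.sum_mul]
    refine Finset.sum_congr rfl fun k hk => ?_
    have hk' : k ≤ j := by simpa [Nat.lt_succ_iff] using hk
    have c1 : x.a i * upper l v.a v.b v.f k j = upper l v.a v.b v.f k j * x.a i :=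
      upper_comm hk' (fun _ => D.comm.af.aa _ _) (fun i _ _ => D.comm.ab D.hx _ _)
        (fun i _ _ => D.comm.af.af _ _)
    -- For i = k < j the factor q of X_i cancels the factor q⁻¹ which a_i picks up from the left
    -- index of L_{ij}.
    by_cases hik : i = k
    · subst hik
      have hk'' : i < j := by omega
      have c2 := upper_a_left (l := l) hV hk''
      simp only [mul_assoc, ← mul_comm_assoc (ra _ _), mul_qcomm_assoc (D.a_X_self i (by omega)),
        c2, mul_smul_comm, mul_comm_assoc c1, smul_smul, inv_mul_cancel₀ hq,
        one_smul]
    · have c2 : v.a i * upper l v.a v.b v.f k j = upper l v.a v.b v.f k j * v.a i := by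
        rcases lt_trichotomy i k with h | h | h
        · exact upper_a_comm' hV hk' h
        · exact absurd h hik
        · rcases lt_trichotomy i j with h' | h' | h'
          · exact upper_a_mid hV hq h h'
          · exact absurd h' hij
          · exact upper_a_comm hV hk' h'
      simp only [mul_assoc, ← mul_comm_assoc (ra _ _), mul_comm_assoc (D.a_X i k hik (by omega)),
        c2, mul_comm_assoc c1]
  · show (x.a i * v.f i + x.f i * v.a (i + 1)) * rowMul l X v.a v.b v.f 0
      = rowMul l X v.a v.b v.f 0 * (x.a i * v.f i + x.f i * v.a (i + 1))
    rw [rowMul_zero]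
    simp only [add_mul, mul_add, mul_assoc, ← mul_comm_assoc (ra _ _), ← mul_comm_assoc (rf _ _),
      mul_comm_assoc (D.a_X i 0 (by omega) (by omega)),
      mul_comm_assoc (D.f_X i 0 (by omega) (by omega) hi' (by omega)),
      ← mul_comm_assoc (D.comm.af.aa _ _), ← mul_comm_assoc (D.comm.af.fa _ _),
      ← hV.a_f 0 i (by omega) (by omega), hV.a_a 0 (i + 1)]
  · show (x.a 0 * v.f 0 + x.f 0 * v.a 1) * rowMul l X v.a v.b v.f 1
      = q • (rowMul l X v.a v.b v.f 1 * (x.a 0 * v.f 0 + x.f 0 * v.a 1))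
    have h1 := D.a_X_self 0 (by omega)
    have h2 := D.a_X 0 1 (by omega) hn
    have h3 := D.f_X_succ 0 hn
    have h4 : ∀ z, x.f 0 * (X 0 * z) = X 0 * (x.f 0 * z) + l • (X 1 * (x.a 0 * z)) := fun z => by
      have := congrArg (· * z) (D.f_X_self 0 hn)
      rw [h2] at this
      simp only [sub_mul, mul_assoc, smul_mul_assoc] at this
      rw [← this]; abel
    have h5 := hV.a_f_succ 0
    simp only [zero_add] at h3 h4 h5
    rw [rowMul_one]
    simp only [add_mul, mul_add, mul_assoc, ← mul_comm_assoc (ra _ _), ← mul_comm_assoc (rf _ _),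
      mul_qcomm_assoc h1, mul_comm_assoc h2, mul_qcomm_assoc h3, h4, h5,
      ← mul_comm_assoc (D.comm.af.af _ _), ← mul_comm_assoc (D.comm.af.fa _ _),
      ← mul_comm_assoc (D.comm.af.aa _ _), ← mul_comm_assoc (D.comm.af.ff _ _),
      mul_smul_comm, smul_add, smul_smul]
    rw [hlq]
    match_scalars <;> field_simp
    ring
  · show rowMul l X v.a v.b v.f 1 * rowMul l X v.a v.b v.f 0
      = q • (rowMul l X v.a v.b v.f 0 * rowMul l X v.a v.b v.f 1)
    have h1 := D.X_X 0 1 (by omega) hn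
    have h2 := qcomm_symm (inv_ne_zero hq) (hV.a_f_self 0)
    rw [inv_inv] at h2
    rw [rowMul_one, rowMul_zero]
    simp only [add_mul, mul_add, mul_assoc, ← mul_comm_assoc (ra _ _), ← mul_comm_assoc (rf _ _),
      mul_qcomm_assoc h1, h2, hV.a_a 1 0, smul_add, mul_smul_comm]

/-- The first entry of XL_+ is just X_0 a_0. This lemma and `e_plus_zero_self` are the initial
conditions from which the `IsRow` lemmas propagate the action of the raising generators along the
row. -/
theorem e_plus_zero (D : ReducedSetting q l c n x v X G H) (i : ℕ) (hi : 0 < i)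
    (hi' : i + 1 < n) : (mul x v).e i * plusRow l v X 0 = plusRow l v X 0 * (mul x v).e i := by
  show (x.e i * v.b i + x.b (i + 1) * v.e i) * rowMul l X v.a v.b v.f 0
      = rowMul l X v.a v.b v.f 0 * (x.e i * v.b i + x.b (i + 1) * v.e i)
  have r1 : ∀ k i, X k * v.b i = v.b i * X k := fun k i => (D.X_v k i).2.1
  have r2 : ∀ k i, X k * v.e i = v.e i * X k := fun k i => (D.X_v k i).2.2.1
  have c1 : ∀ i j, x.e i * v.a j = v.a j * x.e i := fun i j =>
    (inv_comm (D.hv.raise.ab j) (D.hv.raise.ba j) (D.comm.be.fa i j).symm).symm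
  rw [rowMul_zero]
  simp only [add_mul, mul_add, mul_assoc, ← mul_comm_assoc (r1 _ _), ← mul_comm_assoc (r2 _ _),
    mul_comm_assoc (D.e_X i 0 (by omega) (by omega) hi' (by omega)),
    mul_comm_assoc (D.b_X (i + 1) 0 (by omega) (by omega)), ← mul_comm_assoc (c1 _ _),
    ← mul_comm_assoc (D.comm.ba D.hx _ _), D.hv.lower.b_a i 0,
    D.hv.raise.b_f 0 i (by omega) (by omega)]

theorem e_plus_zero_self (D : ReducedSetting q l c n x v X G H) (hq : q ≠ 0) (hn : 1 < n) :
    (mul x v).e 0 * plusRow l v X 0 = q⁻¹ • (plusRow l v X 0 * (mul x v).e 0) := by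
  show (x.e 0 * v.b 0 + x.b 1 * v.e 0) * rowMul l X v.a v.b v.f 0
      = q⁻¹ • (rowMul l X v.a v.b v.f 0 * (x.e 0 * v.b 0 + x.b 1 * v.e 0))
  have r1 : ∀ k i, X k * v.b i = v.b i * X k := fun k i => (D.X_v k i).2.1
  have r2 : ∀ k i, X k * v.e i = v.e i * X k := fun k i => (D.X_v k i).2.2.1
  have c1 : ∀ i j, x.e i * v.a j = v.a j * x.e i := fun i j =>
    (inv_comm (D.hv.raise.ab j) (D.hv.raise.ba j) (D.comm.be.fa i j).symm).symm
  have h1 := qcomm_symm hq (D.hv.raise.b_f_self hq 0)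
  rw [rowMul_zero]
  simp only [add_mul, mul_add, mul_assoc, ← mul_comm_assoc (r1 _ _), ← mul_comm_assoc (r2 _ _),
    mul_qcomm_assoc (D.e_X_self 0 hn), h1,
    mul_comm_assoc (D.b_X 1 0 (by omega) (by omega)), ← mul_comm_assoc (c1 _ _),
    ← mul_comm_assoc (D.comm.ba D.hx _ _), D.hv.lower.b_a 0 0, mul_smul_comm, smul_add]

end ReducedSetting

end ReducedTriangular

/-! ### The row XL_- and its exchange with the row XL_+. -/

section ReducedTriangularLast

variable {A : Type*} [Ring A] [Algebra ℂ A]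

theorem qcomm_sum {ι : Type*} {c : ℂ} {s : Finset ι} {X u : ι → A} {g : A}
    (h : ∀ k ∈ s, g * (X k * u k) = c • (X k * u k * g)) :
    g * ∑ k ∈ s, X k * u k = c • ((∑ k ∈ s, X k * u k) * g) := by
  rw [Finset.mul_sum, Finset.sum_mul, Finset.smul_sum]
  exact Finset.sum_congr rfl h

theorem qcomm_mul_right {c : ℂ} {g X u : A} (h : g * X = c • (X * g)) (hu : g * u = u * g) :
    g * (X * u) = c • (X * u * g) := by
  rw [mul_qcomm_assoc h, hu, mul_assoc]

namespace ReducedSetting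

variable {q l c : ℂ} {n : ℕ} {x v : TriangularData A} {X : ℕ → A} {G H : A}

/-- Near its end the row XL_- is a short sum, since L_- is lower triangular. Apart from the
covariance under e_s, only its last two entries are ever computed with. -/
theorem minusRow_last (p : ℕ) : minusRow l (p + 1) v X p = X p * v.b p := by
  simp [minusRow, upper_self]

theorem minusRow_penultimate (t : ℕ) :
    minusRow l (t + 2) v X t = X t * v.b t + X (t + 1) * v.e t := by
  simp only [minusRow]
  rw [Finset.sum_Ico_eq_sum_range, show t + 2 - t = 2 by omega]
  simp [Finset.sum_range_succ, upper_self]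
  rw [upper_succ]

/-- G sees only the factor X_k, with the same scalar c for all k. The scalar is the same again for H
and for XL_-, so it drops out of homogeneous relations between entries of the last row. -/
theorem G_plus (D : ReducedSetting q l c n x v X G H) {j : ℕ} (hj : j < n) :
    G * plusRow l v X j = c • (plusRow l v X j * G) := by
  rw [plusRow, rowMul]
  refine qcomm_sum fun k hk => ?_
  have hk' : k ≤ j := by simpa [Nat.lt_succ_iff] using hk
  exact qcomm_mul_right (D.G_X k (by omega)) (upper_comm hk' (fun _ => (D.G_v _).1)
    (fun i _ _ => (D.G_v _).2.1) (fun i _ _ => (D.G_v _).2.2.2))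

theorem H_plus (D : ReducedSetting q l c n x v X G H) {j : ℕ} (hj : j < n) :
    H * plusRow l v X j = c • (plusRow l v X j * H) := by
  rw [plusRow, rowMul]
  refine qcomm_sum fun k hk => ?_
  have hk' : k ≤ j := by simpa [Nat.lt_succ_iff] using hk
  exact qcomm_mul_right (D.H_X k (by omega)) (upper_comm hk' (fun _ => (D.H_v _).1)
    (fun i _ _ => (D.H_v _).2.1) (fun i _ _ => (D.H_v _).2.2.2))

theorem G_minus (D : ReducedSetting q l c n x v X G H) (j : ℕ) :
    G * minusRow l n v X j = c • (minusRow l n v X j * G) := by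
  refine qcomm_sum fun k hk => ?_
  rw [Finset.mem_Ico] at hk
  exact qcomm_mul_right (D.G_X k (by omega)) (upper_comm hk.1 (fun _ => (D.G_v _).2.1)
    (fun i _ _ => (D.G_v _).1) (fun i _ _ => (D.G_v _).2.2.1))

theorem H_minus (D : ReducedSetting q l c n x v X G H) (j : ℕ) :
    H * minusRow l n v X j = c • (minusRow l n v X j * H) := by
  refine qcomm_sum fun k hk => ?_
  rw [Finset.mem_Ico] at hk
  exact qcomm_mul_right (D.H_X k (by omega)) (upper_comm hk.1 (fun _ => (D.H_v _).2.1)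
    (fun i _ _ => (D.H_v _).1) (fun i _ _ => (D.H_v _).2.2.1))

theorem G_mul_f (D : ReducedSetting q l c n x v X G H) {i : ℕ} (hi : i + 1 < n) :
    G * (mul x v).f i = (mul x v).f i * G := by
  show G * (x.a i * v.f i + x.f i * v.a (i + 1)) = (x.a i * v.f i + x.f i * v.a (i + 1)) * G
  simp only [mul_add, add_mul, mul_assoc, ← mul_comm_assoc (D.G_a i (by omega)),
    mul_comm_assoc (D.G_f i hi), (D.G_v _).2.2.2, (D.G_v _).1]

theorem H_mul_f (D : ReducedSetting q l c n x v X G H) {i : ℕ} (hi : i + 1 < n) :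
    H * (mul x v).f i = (mul x v).f i * H := by
  show H * (x.a i * v.f i + x.f i * v.a (i + 1)) = (x.a i * v.f i + x.f i * v.a (i + 1)) * H
  simp only [mul_add, add_mul, mul_assoc, ← mul_comm_assoc (D.H_a i (by omega)),
    mul_comm_assoc (D.H_f i hi), (D.H_v _).2.2.2, (D.H_v _).1]

theorem G_b (D : ReducedSetting q l c n x v X G H) (i : ℕ) (hi : i ≠ n) :
    x.b i * G = G * x.b i :=
  inv_comm (D.hx.lower.ab i) (D.hx.lower.ba i) (D.G_a i hi)

theorem H_b (D : ReducedSetting q l c n x v X G H) (i : ℕ) (hi : i ≠ n) :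
    x.b i * H = H * x.b i :=
  inv_comm (D.hx.lower.ab i) (D.hx.lower.ba i) (D.H_a i hi)

theorem G_mul_b (D : ReducedSetting q l c n x v X G H) (i : ℕ) (hi : i ≠ n) :
    G * (mul x v).b i = (mul x v).b i * G := by
  show G * (x.b i * v.b i) = x.b i * v.b i * G
  simp only [mul_assoc, ← mul_comm_assoc (D.G_b i hi), (D.G_v _).2.1]

theorem H_mul_b (D : ReducedSetting q l c n x v X G H) (i : ℕ) (hi : i ≠ n) :
    H * (mul x v).b i = (mul x v).b i * H := by
  show H * (x.b i * v.b i) = x.b i * v.b i * H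
  simp only [mul_assoc, ← mul_comm_assoc (D.H_b i hi), (D.H_v _).2.1]

theorem G_mul_e (D : ReducedSetting q l c n x v X G H) {i : ℕ} (hi : i + 1 < n) :
    G * (mul x v).e i = (mul x v).e i * G := by
  show G * (x.e i * v.b i + x.b (i + 1) * v.e i) = (x.e i * v.b i + x.b (i + 1) * v.e i) * G
  simp only [mul_add, add_mul, mul_assoc, ← mul_comm_assoc (D.G_b (i + 1) (by omega)),
    mul_comm_assoc (D.G_e i hi), (D.G_v _).2.2.1, (D.G_v _).2.1]

theorem H_mul_e (D : ReducedSetting q l c n x v X G H) {i : ℕ} (hi : i + 1 < n) :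
    H * (mul x v).e i = (mul x v).e i * H := by
  show H * (x.e i * v.b i + x.b (i + 1) * v.e i) = (x.e i * v.b i + x.b (i + 1) * v.e i) * H
  simp only [mul_add, add_mul, mul_assoc, ← mul_comm_assoc (D.H_b (i + 1) (by omega)),
    mul_comm_assoc (D.H_e i hi), (D.H_v _).2.2.1, (D.H_v _).2.1]

theorem X_b (D : ReducedSetting q l c n x v X G H) (k i : ℕ) : X k * v.b i = v.b i * X k :=
  (D.X_v k i).2.1

theorem X_e (D : ReducedSetting q l c n x v X G H) (k i : ℕ) : X k * v.e i = v.e i * X k :=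
  (D.X_v k i).2.2.1

/-- The row `X L_-` is covariant under the co-product of the raising generators. -/
theorem e_minus_step (D : ReducedSetting q l c n x v X G H) (hlq : l = q - q⁻¹) (hl : l ≠ 0)
    (hq : q ≠ 0) {s : ℕ} (hs : s + 1 < n) :
    (mul x v).e s * minusRow l n v X (s + 1) - minusRow l n v X (s + 1) * (mul x v).e s
      = -(l • ((mul x v).b (s + 1) * minusRow l n v X s)) := by
  show (x.e s * v.b s + x.b (s + 1) * v.e s) * minusRow l n v X (s + 1)
      - minusRow l n v X (s + 1) * (x.e s * v.b s + x.b (s + 1) * v.e s)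
      = -(l • (x.b (s + 1) * v.b (s + 1) * minusRow l n v X s))
  have hV := D.hv.raise
  have key : ∀ k ∈ Finset.Ico (s + 2) n,
      (x.e s * v.b s + x.b (s + 1) * v.e s) * (X k * upper l v.b v.a v.e (s + 1) k)
      - X k * upper l v.b v.a v.e (s + 1) k * (x.e s * v.b s + x.b (s + 1) * v.e s)
      = -(l • (x.b (s + 1) * v.b (s + 1) * (X k * upper l v.b v.a v.e s k))) := fun k hk => by
    rw [Finset.mem_Ico] at hk
    have c1 : x.e s * upper l v.b v.a v.e (s + 1) k = upper l v.b v.a v.e (s + 1) k * x.e s :=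
      upper_comm (by omega) (fun _ => D.comm.be.fa _ _)
        (fun i _ _ => (inv_comm (hV.ab i) (hV.ba i) (D.comm.be.fa s i).symm).symm)
        (fun i _ _ => D.comm.be.ff _ _)
    have c2 : x.b (s + 1) * upper l v.b v.a v.e (s + 1) k
        = upper l v.b v.a v.e (s + 1) k * x.b (s + 1) :=
      upper_comm (by omega) (fun _ => D.comm.be.aa _ _)
        (fun i _ _ => D.comm.ba D.hx _ _) (fun i _ _ => D.comm.be.af _ _)
    have c3 := upper_a_comm' (l := l) hV (s := s + 1) (j := k) (i := s) (by omega) (by omega)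
    have c4 := upper_step_left hV hl (s := s) (j := k) (by omega)
    have e1 : (x.e s * v.b s + x.b (s + 1) * v.e s) * (X k * upper l v.b v.a v.e (s + 1) k)
        - X k * upper l v.b v.a v.e (s + 1) k * (x.e s * v.b s + x.b (s + 1) * v.e s)
        = -(x.b (s + 1) * (X k * (upper l v.b v.a v.e (s + 1) k * v.e s
          - v.e s * upper l v.b v.a v.e (s + 1) k))) := by
      simp only [mul_add, add_mul, mul_sub, mul_assoc, ← mul_comm_assoc (D.X_b _ _),
        ← mul_comm_assoc (D.X_e _ _), ← mul_comm_assoc c1, ← mul_comm_assoc c2, c3,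
        mul_comm_assoc (D.e_X s k (by omega) (by omega) hs (by omega)),
        mul_comm_assoc (D.b_X (s + 1) k (by omega) (by omega))]
      abel
    rw [e1, c4]
    simp only [mul_assoc, mul_smul_comm, ← mul_comm_assoc (D.X_b _ _)]
  -- The terms k ≥ s+2 are handled by the column recursion. The single term k = s+1 has to supply
  -- both remaining terms, k = s and k = s+1, of the right-hand side.
  have first : (x.e s * v.b s + x.b (s + 1) * v.e s) * (X (s + 1) * v.b (s + 1))
      - X (s + 1) * v.b (s + 1) * (x.e s * v.b s + x.b (s + 1) * v.e s)
      = -(l • (x.b (s + 1) * v.b (s + 1) * (X s * v.b s)))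
        - l • (x.b (s + 1) * v.b (s + 1) * (X (s + 1) * v.e s)) := by
    have c1 : ∀ z, x.e s * (X (s + 1) * z) = X (s + 1) * (x.e s * z)
        - l • (x.b (s + 1) * (X s * z)) := fun z => by
      have := congrArg (· * z) (D.e_X_succ s hs)
      simp only [sub_mul, neg_mul, mul_assoc, smul_mul_assoc] at this
      rw [sub_eq_iff_eq_add] at this
      rw [this]; abel
    have c2 := qcomm_symm (inv_ne_zero hq) (D.b_X_self hq (s + 1) hs)
    have c3 := qcomm_symm hq (hV.a_f_succ s)
    have c4 := hV.a_f_succ s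
    simp only [mul_add, add_mul, mul_assoc, ← mul_comm_assoc (D.X_b _ _),
      ← mul_comm_assoc (D.X_e _ _), c1, ← mul_comm_assoc (D.comm.be.fa _ _),
      ← mul_comm_assoc (D.comm.be.aa _ _), mul_qcomm_assoc c2, c3, mul_smul_comm, hV.a_a s (s + 1)]
    rw [hlq, inv_inv]; module
  have e0 : minusRow l n v X (s + 1) = X (s + 1) * v.b (s + 1)
      + ∑ k ∈ Finset.Ico (s + 2) n, X k * upper l v.b v.a v.e (s + 1) k := by
    rw [minusRow, Finset.sum_eq_sum_Ico_succ_bot hs, upper_self]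
  have e1 : minusRow l n v X s = X s * v.b s + (X (s + 1) * v.e s
      + ∑ k ∈ Finset.Ico (s + 2) n, X k * upper l v.b v.a v.e s k) := by
    rw [minusRow, Finset.sum_eq_sum_Ico_succ_bot (by omega), Finset.sum_eq_sum_Ico_succ_bot hs,
      upper_self, upper_succ]
  rw [e0, e1]
  generalize x.e s * v.b s + x.b (s + 1) * v.e s = E at key first ⊢
  have e2 := Finset.sum_congr (rfl : Finset.Ico (s + 2) n = _) key
  rw [Finset.sum_sub_distrib, ← Finset.mul_sum, ← Finset.sum_mul, Finset.sum_neg_distrib,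
    ← Finset.smul_sum, ← Finset.mul_sum] at e2
  simp only [mul_add E, add_mul _ _ E, mul_add (x.b (s + 1) * v.b (s + 1)), smul_add]
  rw [add_sub_add_comm, first, e2]
  abel

theorem e_minus_last (D : ReducedSetting q l c n x v X G H) {i p : ℕ} (hi : i + 1 < p)
    (hp : p + 1 = n) :
    (mul x v).e i * minusRow l n v X p = minusRow l n v X p * (mul x v).e i := by
  subst hp
  show (x.e i * v.b i + x.b (i + 1) * v.e i) * _ = _ * (x.e i * v.b i + x.b (i + 1) * v.e i)
  rw [minusRow_last]
  simp only [mul_add, add_mul, mul_assoc, ← mul_comm_assoc (D.X_b _ _),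
    ← mul_comm_assoc (D.X_e _ _), ← mul_comm_assoc (D.comm.be.fa _ _),
    ← mul_comm_assoc (D.comm.be.aa _ _), D.hv.raise.a_a i p,
    ← D.hv.raise.a_f p i (by omega) (by omega),
    mul_comm_assoc (D.e_X i p (by omega) (by omega) (by omega) (by omega)),
    mul_comm_assoc (D.b_X (i + 1) p (by omega) (by omega))]

theorem e_minus_penultimate (D : ReducedSetting q l c n x v X G H) (hlq : l = q - q⁻¹)
    (hq : q ≠ 0) {t : ℕ} (ht : t + 2 = n) :
    (mul x v).e t * minusRow l n v X t = q⁻¹ • (minusRow l n v X t * (mul x v).e t) := by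
  subst ht
  show (x.e t * v.b t + x.b (t + 1) * v.e t) * _
    = q⁻¹ • (_ * (x.e t * v.b t + x.b (t + 1) * v.e t))
  rw [minusRow_penultimate]
  have hV := D.hv.raise
  have c1 : ∀ z, x.e t * (X (t + 1) * z) = X (t + 1) * (x.e t * z)
      - l • (X t * (x.b (t + 1) * z)) := fun z => by
    have := congrArg (· * z) (D.e_X_succ t (by omega))
    simp only [sub_mul, neg_mul, mul_assoc, smul_mul_assoc] at this
    rw [sub_eq_iff_eq_add] at this
    rw [this, ← mul_comm_assoc (D.b_X (t + 1) t (by omega) (by omega))]; abel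
  have c2 := D.e_X_self t (by omega)
  have c3 := D.b_X (t + 1) t (by omega) (by omega)
  have c4 := D.b_X_self hq (t + 1) (by omega)
  have c5 := hV.a_f_self t
  simp only [mul_add, add_mul, mul_assoc, ← mul_comm_assoc (D.X_b _ _),
    ← mul_comm_assoc (D.X_e _ _), c1, ← mul_comm_assoc (D.comm.be.fa _ _),
    ← mul_comm_assoc (D.comm.be.aa _ _), ← mul_comm_assoc (D.comm.be.ff _ _),
    ← mul_comm_assoc (D.comm.be.af _ _), mul_qcomm_assoc c2, mul_comm_assoc c3,
    mul_qcomm_assoc c4, c5, mul_smul_comm, smul_add]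
  rw [hlq]
  match_scalars <;> field_simp
  ring

theorem minus_qplane (D : ReducedSetting q l c n x v X G H) {t : ℕ}
    (ht : t + 2 = n) :
    minusRow l n v X (t + 1) * minusRow l n v X t
      = q • (minusRow l n v X t * minusRow l n v X (t + 1)) := by
  subst ht
  rw [minusRow_penultimate, minusRow_last (t + 1)]
  have c1 := D.X_X t (t + 1) (by omega) (by omega)
  have c2 := D.hv.raise.a_f_succ t
  simp only [mul_add, add_mul, mul_assoc, ← mul_comm_assoc (D.X_b _ _),
    ← mul_comm_assoc (D.X_e _ _), mul_qcomm_assoc c1, c2, D.hv.raise.a_a (t + 1) t, smul_add,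
    mul_smul_comm]

theorem f_minus_last (D : ReducedSetting q l c n x v X G H) {i p : ℕ} (hi : i + 1 < p)
    (hp : p + 1 = n) :
    (mul x v).f i * minusRow l n v X p = minusRow l n v X p * (mul x v).f i := by
  subst hp
  show (x.a i * v.f i + x.f i * v.a (i + 1)) * _ = _ * (x.a i * v.f i + x.f i * v.a (i + 1))
  rw [minusRow_last]
  have fb : ∀ i j, x.f i * v.b j = v.b j * x.f i := fun i j =>
    (inv_comm (D.hv.lower.ab j) (D.hv.lower.ba j) (D.comm.af.fa i j).symm).symm
  simp only [mul_add, add_mul, mul_assoc, ← mul_comm_assoc (D.X_v _ _).1,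
    ← mul_comm_assoc (D.X_v _ _).2.2.2, ← mul_comm_assoc (fb _ _),
    ← mul_comm_assoc (D.comm.ab D.hx _ _), D.hv.lower.b_a p (i + 1),
    ← D.hv.lower.b_f p i (by omega) (by omega),
    mul_comm_assoc (D.f_X i p (by omega) (by omega) (by omega) (by omega)),
    mul_comm_assoc (D.a_X i p (by omega) (by omega))]

theorem f_minus_last_self (D : ReducedSetting q l c n x v X G H) (hq : q ≠ 0) {t : ℕ}
    (ht : t + 2 = n) :
    (mul x v).f t * minusRow l n v X (t + 1)
      = q • (minusRow l n v X (t + 1) * (mul x v).f t) := by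
  subst ht
  show (x.a t * v.f t + x.f t * v.a (t + 1)) * _
    = q • (_ * (x.a t * v.f t + x.f t * v.a (t + 1)))
  rw [minusRow_last (t + 1)]
  have fb : ∀ i j, x.f i * v.b j = v.b j * x.f i := fun i j =>
    (inv_comm (D.hv.lower.ab j) (D.hv.lower.ba j) (D.comm.af.fa i j).symm).symm
  have c1 := qcomm_symm (inv_ne_zero hq) (D.hv.lower.b_f_succ hq t)
  rw [inv_inv] at c1
  simp only [mul_add, add_mul, mul_assoc, ← mul_comm_assoc (D.X_v _ _).1,
    ← mul_comm_assoc (D.X_v _ _).2.2.2, ← mul_comm_assoc (fb _ _),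
    ← mul_comm_assoc (D.comm.ab D.hx _ _), D.hv.lower.b_a (t + 1) (t + 1), c1,
    mul_qcomm_assoc (D.f_X_succ t (by omega)),
    mul_comm_assoc (D.a_X t (t + 1) (by omega) (by omega)), mul_smul_comm, smul_add]

/-- The last entry X_{t+1} b_{t+1} of XL_- passes every X_k with k ≤ t with the factor q, while
b_{t+1} commutes with all L_{kt}. -/
theorem minus_last_plus (D : ReducedSetting q l c n x v X G H) {t : ℕ} (ht : t + 2 = n) :
    minusRow l n v X (t + 1) * plusRow l v X t
      = q • (plusRow l v X t * minusRow l n v X (t + 1)) := by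
  subst ht
  rw [minusRow_last (t + 1), plusRow, rowMul]
  refine qcomm_sum fun k hk => ?_
  have hk' : k ≤ t := by simpa [Nat.lt_succ_iff] using hk
  have hV := D.hv.lower
  have c1 : v.b (t + 1) * upper l v.a v.b v.f k t = upper l v.a v.b v.f k t * v.b (t + 1) :=
    inv_comm (hV.ab _) (hV.ba _) (upper_a_comm hV hk' (Nat.lt_succ_self t))
  have c2 : X (t + 1) * upper l v.a v.b v.f k t = upper l v.a v.b v.f k t * X (t + 1) :=
    upper_comm hk' (fun _ => (D.X_v _ _).1) (fun i _ _ => (D.X_v _ _).2.1)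
      (fun i _ _ => (D.X_v _ _).2.2.2)
  have c3 := D.X_X k (t + 1) (by omega) (by omega)
  simp only [mul_assoc, ← mul_comm_assoc (D.X_b _ _), c1, ← mul_comm_assoc c2,
    mul_qcomm_assoc c3]

/-- In the terms k < p the factor q from exchanging X_p with X_k is cancelled by q⁻¹ from exchanging
b_p with L_{kp}; in the term k = p no factor arises. -/
theorem minus_last_plus_last (D : ReducedSetting q l c n x v X G H) (hq : q ≠ 0) {p : ℕ}
    (hp : p + 1 = n) :
    minusRow l n v X p * plusRow l v X p = plusRow l v X p * minusRow l n v X p := by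
  subst hp
  rw [minusRow_last]
  have : X p * v.b p * plusRow l v X p = (1 : ℂ) • (plusRow l v X p * (X p * v.b p)) := by
    rw [plusRow, rowMul]
    refine qcomm_sum fun k hk => ?_
    have hk' : k ≤ p := by simpa [Nat.lt_succ_iff] using hk
    have hV := D.hv.lower
    have c2 : X p * upper l v.a v.b v.f k p = upper l v.a v.b v.f k p * X p :=
      upper_comm hk' (fun _ => (D.X_v _ _).1) (fun i _ _ => (D.X_v _ _).2.1)
        (fun i _ _ => (D.X_v _ _).2.2.2)
    rcases hk'.eq_or_lt with rfl | hk'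
    · rw [upper_self] at c2 ⊢
      simp only [mul_assoc, ← mul_comm_assoc (D.X_b _ _), ← mul_comm_assoc c2, hV.b_a k k,
        one_smul]
    have c1 : v.b p * upper l v.a v.b v.f k p = q⁻¹ • (upper l v.a v.b v.f k p * v.b p) :=
      inv_qcomm hq (hV.ab _) (hV.ba _) (upper_a_right hV hk')
    have c3 := D.X_X k p (by omega) (by omega)
    simp only [mul_assoc, ← mul_comm_assoc (D.X_b _ _), c1, ← mul_comm_assoc c2,
      mul_qcomm_assoc c3, mul_smul_comm, smul_smul, inv_mul_cancel₀ hq]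
  rw [this, one_smul]

/-- The exchange relation between the rows `X L_+` and `X L_-`. -/
theorem plus_last_minus (D : ReducedSetting q l c n x v X G H) (hlq : l = q - q⁻¹) (hl : l ≠ 0)
    (hq : q ≠ 0) {t : ℕ} (ht : t + 2 = n) :
    minusRow l n v X t * plusRow l v X (t + 1)
        + q • (minusRow l n v X (t + 1) * plusRow l v X t)
      = plusRow l v X t * minusRow l n v X (t + 1)
        + q • (plusRow l v X (t + 1) * minusRow l n v X t) := by
  have R := D.mul_rel hq
  have Y := D.plus_isRow hlq hl hq
  have h1 := Y.e_step R.lower R.raise R.mixed hlq hl hq D.e_plus_zero (D.e_plus_zero_self hq)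
    (j := t) (by omega)
  have h2 := D.e_minus_step hlq hl hq (s := t) (by omega)
  have h3 := D.minus_last_plus_last hq (p := t + 1) (by omega)
  have h4 : (mul x v).b (t + 1) * minusRow l n v X (t + 1)
      = q⁻¹ • (minusRow l n v X (t + 1) * (mul x v).b (t + 1)) := by
    subst ht
    show x.b (t + 1) * v.b (t + 1) * _ = q⁻¹ • (_ * (x.b (t + 1) * v.b (t + 1)))
    rw [minusRow_last (t + 1)]
    simp only [mul_assoc, ← mul_comm_assoc (D.X_b _ _), mul_qcomm_assoc (D.b_X_self hq (t + 1)
      (by omega)), mul_comm_assoc (D.comm.be.aa _ _)]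
  have h5 := Y.b_y_self R.lower hq (t + 1) (by omega)
  set b' := (mul x v).b (t + 1)
  set e := (mul x v).e t
  set Y₁ := plusRow l v X (t + 1)
  set Y₀ := plusRow l v X t
  set Z₁ := minusRow l n v X (t + 1)
  set Z₀ := minusRow l n v X t
  have h4' := qcomm_symm (inv_ne_zero hq) h4
  have h5' := qcomm_symm (inv_ne_zero hq) h5
  rw [inv_inv] at h4' h5'
  -- Take the commutator of e with the identity Z₁Y₁ = Y₁Z₁. It sends Y₁ to -λ b' Y₀ and Z₁ to -λ b'
  -- Z₀; after moving b' to the left, λ and b' cancel and the exchange relation remains.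
  have k1 : e * (Z₁ * Y₁) - Z₁ * Y₁ * e = (e * Z₁ - Z₁ * e) * Y₁ + Z₁ * (e * Y₁ - Y₁ * e) := by
    noncomm_ring
  have k2 : e * (Y₁ * Z₁) - Y₁ * Z₁ * e = (e * Y₁ - Y₁ * e) * Z₁ + Y₁ * (e * Z₁ - Z₁ * e) := by
    noncomm_ring
  rw [h3, k2, h1, h2] at k1
  simp only [neg_mul, mul_neg, smul_mul_assoc, mul_smul_comm, mul_assoc, mul_qcomm_assoc h4',
    mul_qcomm_assoc h5'] at k1
  have k3 : l • (b' * (Z₀ * Y₁ + q • (Z₁ * Y₀)))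
      = l • (b' * (Y₀ * Z₁ + q • (Y₁ * Z₀))) := by
    simp only [mul_add, mul_smul_comm, smul_add]
    linear_combination (norm := module) k1
  exact R.lower.mul_left_cancel_b (smul_right_injective A hl k3)

end ReducedSetting

end ReducedTriangularLast

/-! ### The relations of U_q(gl(n+1)) for the reduced tensor product. -/

section ReducedRelations

variable {A : Type*} [Ring A] [Algebra ℂ A]

namespace ReducedSetting

variable {q l c : ℂ} {n : ℕ} {x v : TriangularData A} {X : ℕ → A} {G H : A}

theorem qcomm_lastRow {d : ℂ} {g : A} {j : ℕ} (hG : g * G = G * g)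
    (hH : g * H = H * g) (hY : g * plusRow l v X j = d • (plusRow l v X j * g))
    (hZ : g * minusRow l n v X j = d • (minusRow l n v X j * g)) :
    g * lastRow l n v X G H j = d • (lastRow l n v X G H j * g) := by
  simp only [lastRow, mul_sub, sub_mul, mul_assoc, mul_comm_assoc hG, mul_comm_assoc hH, hY, hZ,
    mul_smul_comm, smul_sub]

theorem comm_lastRow {g : A} {j : ℕ} (hG : g * G = G * g)
    (hH : g * H = H * g) (hY : g * plusRow l v X j = plusRow l v X j * g)
    (hZ : g * minusRow l n v X j = minusRow l n v X j * g) :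
    g * lastRow l n v X G H j = lastRow l n v X G H j * g := by
  simp only [lastRow, mul_sub, sub_mul, mul_assoc, mul_comm_assoc hG, mul_comm_assoc hH, hY, hZ]

/-- The raising generators act on both rows XL_± by the same formula and commute with G and H, so
the combination inherits it. This is the recursion down a column that the last row of L_- has to
satisfy. -/
theorem e_lastRow_step (D : ReducedSetting q l c n x v X G H) (hlq : l = q - q⁻¹) (hl : l ≠ 0)
    (hq : q ≠ 0) {s : ℕ} (hs : s + 1 < n) :
    lastRow l n v X G H (s + 1) * (mul x v).e s - (mul x v).e s * lastRow l n v X G H (s + 1)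
      = l • ((mul x v).b (s + 1) * lastRow l n v X G H s) := by
  have R := D.mul_rel hq
  have h1 := (D.plus_isRow hlq hl hq).e_step R.lower R.raise R.mixed hlq hl hq D.e_plus_zero
    (D.e_plus_zero_self hq) hs
  have h2 := D.e_minus_step hlq hl hq hs
  have h3 := D.G_mul_e hs
  have h4 := D.H_mul_e hs
  have h5 := D.G_mul_b (s + 1) (by omega)
  have h6 := D.H_mul_b (s + 1) (by omega)
  have e1 : lastRow l n v X G H (s + 1) * (mul x v).e s
      - (mul x v).e s * lastRow l n v X G H (s + 1)
      = H * ((mul x v).e s * minusRow l n v X (s + 1) - minusRow l n v X (s + 1) * (mul x v).e s)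
      - G * ((mul x v).e s * plusRow l v X (s + 1) - plusRow l v X (s + 1) * (mul x v).e s) := by
    simp only [lastRow, mul_sub, sub_mul, mul_assoc, ← mul_comm_assoc h3, ← mul_comm_assoc h4]
    abel
  rw [e1, h1, h2]
  simp only [lastRow, mul_neg, mul_smul_comm, mul_sub, mul_comm_assoc h5, mul_comm_assoc h6,
    smul_sub]
  abel

theorem e_lastRow_far (D : ReducedSetting q l c n x v X G H) (hlq : l = q - q⁻¹) (hl : l ≠ 0)
    (hq : q ≠ 0) {i p : ℕ} (hi : i + 1 < p) (hp : p + 1 = n) :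
    (mul x v).e i * lastRow l n v X G H p = lastRow l n v X G H p * (mul x v).e i := by
  have R := D.mul_rel hq
  exact comm_lastRow (D.G_mul_e (by omega)).symm (D.H_mul_e (by omega)).symm
    ((D.plus_isRow hlq hl hq).e_mid R.lower R.raise R.mixed hlq hl hq D.e_plus_zero
    (D.e_plus_zero_self hq) hi (by omega)) (D.e_minus_last hi hp)

theorem e_lastRow_penultimate (D : ReducedSetting q l c n x v X G H) (hlq : l = q - q⁻¹)
    (hl : l ≠ 0) (hq : q ≠ 0) {t : ℕ} (ht : t + 2 = n) :
    (mul x v).e t * lastRow l n v X G H t = q⁻¹ • (lastRow l n v X G H t * (mul x v).e t) := by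
  have R := D.mul_rel hq
  exact qcomm_lastRow (D.G_mul_e (by omega)).symm (D.H_mul_e (by omega)).symm
    ((D.plus_isRow hlq hl hq).e_self R.lower R.raise R.mixed hl hq D.e_plus_zero
    (D.e_plus_zero_self hq) (by omega)) (D.e_minus_penultimate hlq hq ht)

theorem f_lastRow_far (D : ReducedSetting q l c n x v X G H) (hlq : l = q - q⁻¹) (hl : l ≠ 0)
    (hq : q ≠ 0) (hq2 : 1 + q ^ 2 ≠ 0) {i p : ℕ} (hi : i + 1 < p) (hp : p + 1 = n) :
    (mul x v).f i * lastRow l n v X G H p = lastRow l n v X G H p * (mul x v).f i :=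
  comm_lastRow (D.G_mul_f (by omega)).symm (D.H_mul_f (by omega)).symm
    ((D.plus_isRow hlq hl hq).mid (D.mul_rel hq).lower hl hq hq2 hi (by omega))
    (D.f_minus_last hi hp)

theorem f_lastRow_penultimate (D : ReducedSetting q l c n x v X G H) (hlq : l = q - q⁻¹)
    (hl : l ≠ 0) (hq : q ≠ 0) {t : ℕ} (ht : t + 2 = n) :
    (mul x v).f t * lastRow l n v X G H (t + 1)
      = q • (lastRow l n v X G H (t + 1) * (mul x v).f t) :=
  qcomm_lastRow (D.G_mul_f (by omega)).symm (D.H_mul_f (by omega)).symm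
    ((D.plus_isRow hlq hl hq).f_y_succ (D.mul_rel hq).lower hl hq (by omega))
    (D.f_minus_last_self hq ht)

/-- With G and H moved to the left, the GG and HH terms are the q-plane relations of XL_+ and XL_-.
The mixed terms match by GH = q²HG together with the exchange relation between the two rows. -/
theorem lastRow_qplane (D : ReducedSetting q l c n x v X G H) (hlq : l = q - q⁻¹) (hl : l ≠ 0)
    (hq : q ≠ 0) (hq2 : 1 + q ^ 2 ≠ 0) {t : ℕ} (ht : t + 2 = n) :
    lastRow l n v X G H (t + 1) * lastRow l n v X G H t
      = q • (lastRow l n v X G H t * lastRow l n v X G H (t + 1)) := by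
  have h1 := (D.plus_isRow hlq hl hq).qplane (D.mul_rel hq).lower hl hq hq2 (j := t) (by omega)
  have h2 := D.minus_qplane ht
  have h3 := D.minus_last_plus ht
  have h4 := D.plus_last_minus hlq hl hq ht
  have g1 := qcomm_symm D.c_ne (D.G_plus (j := t) (by omega))
  have g2 := qcomm_symm D.c_ne (D.G_plus (j := t + 1) (by omega))
  have g3 := qcomm_symm D.c_ne (D.H_plus (j := t) (by omega))
  have g4 := qcomm_symm D.c_ne (D.H_plus (j := t + 1) (by omega))
  have g5 := qcomm_symm D.c_ne (D.G_minus t)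
  have g6 := qcomm_symm D.c_ne (D.G_minus (t + 1))
  have g7 := qcomm_symm D.c_ne (D.H_minus t)
  have g8 := qcomm_symm D.c_ne (D.H_minus (t + 1))
  have hc := D.c_ne
  simp only [lastRow]
  set Y₁ := plusRow l v X (t + 1)
  set Y₀ := plusRow l v X t
  set Z₁ := minusRow l n v X (t + 1)
  set Z₀ := minusRow l n v X t
  rw [h3, smul_smul] at h4
  -- The exchange relation, solved for the only product not yet in the order Y before Z.
  have h5 : Z₀ * Y₁ = (1 - q * q) • (Y₀ * Z₁) + q • (Y₁ * Z₀) := by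
    linear_combination (norm := module) h4
  simp only [mul_sub, sub_mul, mul_assoc, mul_qcomm_assoc g1, mul_qcomm_assoc g2,
    mul_qcomm_assoc g3, mul_qcomm_assoc g4, mul_qcomm_assoc g5, mul_qcomm_assoc g6,
    mul_qcomm_assoc g7, mul_qcomm_assoc g8, mul_smul_comm, h1, h2, h3, h5,
    mul_qcomm_assoc D.G_H, smul_sub, smul_smul, mul_add, smul_add]
  match_scalars <;> field_simp
  ring

theorem a_lastRow_self (D : ReducedSetting q l c n x v X G H) (hlq : l = q - q⁻¹) (hl : l ≠ 0)
    (hq : q ≠ 0) {p : ℕ} (hp : p + 1 = n) :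
    (mul x v).a p * lastRow l n v X G H p = q • (lastRow l n v X G H p * (mul x v).a p) := by
  refine qcomm_lastRow ?_ ?_ ((D.plus_isRow hlq hl hq).a_y_self p (by omega)) ?_
  · show x.a p * v.a p * G = G * (x.a p * v.a p)
    simp only [mul_assoc, ← mul_comm_assoc (D.G_a p (by omega)), ← (D.G_v _).1]
  · show x.a p * v.a p * H = H * (x.a p * v.a p)
    simp only [mul_assoc, ← mul_comm_assoc (D.H_a p (by omega)), ← (D.H_v _).1]
  · subst hp
    show x.a p * v.a p * _ = q • (_ * (x.a p * v.a p))
    rw [minusRow_last]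
    simp only [mul_assoc, ← mul_comm_assoc (D.X_v _ _).1, ← D.hv.lower.b_a p p,
      mul_qcomm_assoc (D.a_X_self p (by omega)), mul_comm_assoc (D.comm.ab D.hx _ _)]

theorem a_lastRow_last (D : ReducedSetting q l c n x v X G H) (hlq : l = q - q⁻¹) (hl : l ≠ 0)
    (hq : q ≠ 0) {p : ℕ} (hp : p + 1 = n) :
    (mul x v).a n * lastRow l n v X G H p = q⁻¹ • (lastRow l n v X G H p * (mul x v).a n) := by
  have h1 : (mul x v).a n = x.a n := by
    show x.a n * v.a n = x.a n
    rw [D.v_a_last n le_rfl, mul_one]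
  have h2 := (D.plus_isRow hlq hl hq).a_y n p (by omega) (by omega)
  rw [h1] at h2 ⊢
  have h3 : x.a n * minusRow l n v X p = minusRow l n v X p * x.a n := by
    subst hp
    rw [minusRow_last, mul_comm_assoc (D.a_X _ p (by omega) (by omega)),
      D.comm.ab D.hx, mul_assoc]
  simp only [lastRow, mul_sub, sub_mul, mul_assoc, mul_qcomm_assoc D.G_a_last,
    mul_qcomm_assoc D.H_a_last, h2, h3, smul_sub]

theorem a_lastRow (D : ReducedSetting q l c n x v X G H) (hlq : l = q - q⁻¹) (hl : l ≠ 0)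
    (hq : q ≠ 0) {i p : ℕ} (hp : p + 1 = n) (h1 : i ≠ p) (h2 : i ≠ n) :
    (mul x v).a i * lastRow l n v X G H p = lastRow l n v X G H p * (mul x v).a i := by
  refine comm_lastRow ?_ ?_ ((D.plus_isRow hlq hl hq).a_y i p h1 (by omega)) ?_
  · show x.a i * v.a i * G = G * (x.a i * v.a i)
    simp only [mul_assoc, ← mul_comm_assoc (D.G_a i h2), ← (D.G_v _).1]
  · show x.a i * v.a i * H = H * (x.a i * v.a i)
    simp only [mul_assoc, ← mul_comm_assoc (D.H_a i h2), ← (D.H_v _).1]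
  · subst hp
    show x.a i * v.a i * _ = _ * (x.a i * v.a i)
    rw [minusRow_last]
    simp only [mul_assoc, ← mul_comm_assoc (D.X_v _ _).1, ← D.hv.lower.b_a p i,
      mul_comm_assoc (D.a_X i p h1 (by omega)), mul_comm_assoc (D.comm.ab D.hx _ _)]

/-- The second factor has no generator with index p = n-1 and is trivial at n, so the co-product of
f_p is the first-factor operator alone. Its commutator with G X_k vanishes for k < p. The k = p
terms of the G and H parts give the two Cartan terms. -/
theorem f_lastRow_last (D : ReducedSetting q l c n x v X G H) {p : ℕ} (hp : p + 1 = n) :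
    lastRow l n v X G H p * (mul x v).f p - (mul x v).f p * lastRow l n v X G H p
      = -(l • ((mul x v).a p * (mul x v).b (p + 1) - (mul x v).b p * (mul x v).a (p + 1))) := by
  have e1 : (mul x v).f p = x.f p := by
    show x.a p * v.f p + x.f p * v.a (p + 1) = x.f p
    rw [D.v_f_last p (by omega), D.v_a_last _ (by omega), mul_zero, mul_one, zero_add]
  have e2 : (mul x v).a (p + 1) = x.a (p + 1) := by
    show x.a (p + 1) * v.a (p + 1) = _
    rw [D.v_a_last _ (by omega), mul_one]
  have e3 : (mul x v).b (p + 1) = x.b (p + 1) := by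
    show x.b (p + 1) * v.b (p + 1) = _
    rw [D.v_b_last _ (by omega), mul_one]
  have fb : ∀ i j, x.f i * v.b j = v.b j * x.f i := fun i j =>
    (inv_comm (D.hv.lower.ab j) (D.hv.lower.ba j) (D.comm.af.fa i j).symm).symm
  have c1 : ∀ k, k ≤ p →
      x.f p * upper l v.a v.b v.f k p = upper l v.a v.b v.f k p * x.f p := fun k hk =>
    upper_comm hk (fun _ => D.comm.af.fa _ _) (fun i _ _ => fb _ _) (fun i _ _ => D.comm.af.ff _ _)
  have sum0 : ∀ k ∈ Finset.range p, G * (X k * upper l v.a v.b v.f k p) * x.f p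
      - x.f p * (G * (X k * upper l v.a v.b v.f k p)) = 0 := fun k hk => by
    have hk' := Finset.mem_range.mp hk
    have := D.GX_f k p hk' hp
    rw [← mul_assoc, mul_assoc, ← c1 k hk'.le, ← mul_assoc, this]
    simp only [mul_assoc, sub_self]
  have hY : G * plusRow l v X p * x.f p - x.f p * (G * plusRow l v X p)
      = -(l • (x.a p * x.b (p + 1))) * v.a p := by
    rw [← D.GX_f_last p hp, plusRow, rowMul, Finset.sum_range_succ, upper_self]
    have e := Finset.sum_eq_zero sum0
    rw [Finset.sum_sub_distrib, ← Finset.sum_mul, ← Finset.mul_sum, ← Finset.mul_sum,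
      ← Finset.mul_sum] at e
    rw [mul_add, add_mul, mul_add, add_sub_add_comm, e, zero_add]
    simp only [sub_mul, mul_assoc, D.comm.af.fa]
  have hZ : H * minusRow l n v X p * x.f p - x.f p * (H * minusRow l n v X p)
      = -(l • (x.b p * x.a (p + 1))) * v.b p := by
    rw [← D.HX_f_last p hp]
    subst hp
    rw [minusRow_last]
    simp only [sub_mul, mul_assoc, fb]
  rw [e1, e2, e3]
  show (G * plusRow l v X p - H * minusRow l n v X p) * x.f p
    - x.f p * (G * plusRow l v X p - H * minusRow l n v X p)
    = -(l • (x.a p * v.a p * x.b (p + 1) - x.b p * v.b p * x.a (p + 1)))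
  have e4 : (G * plusRow l v X p - H * minusRow l n v X p) * x.f p
    - x.f p * (G * plusRow l v X p - H * minusRow l n v X p)
    = (G * plusRow l v X p * x.f p - x.f p * (G * plusRow l v X p))
      - (H * minusRow l n v X p * x.f p - x.f p * (H * minusRow l n v X p)) := by
    simp only [mul_sub, sub_mul]; abel
  rw [e4, hY, hZ]
  simp only [neg_mul, smul_mul_assoc, mul_assoc, ← D.comm.ba D.hx, ← D.comm.ab D.hx]
  module

/-- The reduced tensor product satisfies the relations of `U_q(gl(n+1))`. -/
theorem reduced_relations (D : ReducedSetting q l c n x v X G H) (hlq : l = q - q⁻¹) (hl : l ≠ 0)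
    (hq : q ≠ 0) (hq2 : 1 + q ^ 2 ≠ 0) :
    Relations q l (n + 1) (reducedTriangular l n x v X G H) := by
  have R := D.mul_rel hq
  have eN : ∀ i, i + 1 = n → (reducedTriangular l n x v X G H).e i = lastRow l n v X G H i :=
    fun i hi => if_pos hi
  have e0 : ∀ i, i + 1 ≠ n → (reducedTriangular l n x v X G H).e i = (mul x v).e i :=
    fun i hi => if_neg hi
  -- The relations are stated for all natural indices; generators beyond the range are zero, so
  -- relations involving them are trivial.
  have ez : ∀ i, n ≤ i → (reducedTriangular l n x v X G H).e i = 0 := fun i hi => by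
    rw [e0 i (by omega)]
    show x.e i * v.b i + x.b (i + 1) * v.e i = 0
    rw [D.x_e_last i hi, D.v_e_last i (by omega), mul_zero, zero_mul, add_zero]
  have fz : ∀ i, n ≤ i → (reducedTriangular l n x v X G H).f i = 0 := fun i hi => by
    show x.a i * v.f i + x.f i * v.a (i + 1) = 0
    rw [D.x_f_last i hi, D.v_f_last i (by omega), mul_zero, zero_mul, add_zero]
  set r := reducedTriangular l n x v X G H with hr
  have ra : r.a = (mul x v).a := rfl
  have rb : r.b = (mul x v).b := rfl
  have rf : r.f = (mul x v).f := rfl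
  have key : ∀ t, t + 2 = n →
      lastRow l n v X G H (t + 1) * (mul x v).e t - (mul x v).e t * lastRow l n v X G H (t + 1)
      = l • ((mul x v).b (t + 1) * lastRow l n v X G H t) := fun t ht =>
    D.e_lastRow_step hlq hl hq (by omega)
  refine ⟨R.lower, ⟨R.raise.ab, R.raise.ba, R.raise.a_a, fun i => ?_, fun i => ?_,
    fun i j h1 h2 => ?_, fun i j hij => ?_, fun i => ?_, fun i => ?_⟩,
    ⟨fun i hi => ?_, fun i => ?_, fun i => ?_, fun i j h1 h2 h3 => ?_⟩⟩
  · by_cases hi : i + 1 = n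
    · rw [eN i hi]
      exact inv_qcomm hq (R.lower.ab _) (R.lower.ba _) (D.a_lastRow_self hlq hl hq hi)
    · rw [e0 i hi]; exact R.raise.a_f_self i
  · by_cases hi : i + 1 = n
    · rw [eN i hi, hi]
      have := inv_qcomm (inv_ne_zero hq) (R.lower.ab _) (R.lower.ba _)
        (D.a_lastRow_last hlq hl hq hi)
      rwa [inv_inv] at this
    · rw [e0 i hi]; exact R.raise.a_f_succ i
  · by_cases hj : j + 1 = n
    · rw [eN j hj]
      exact inv_comm (R.lower.ab _) (R.lower.ba _) (D.a_lastRow hlq hl hq hj h1 (by omega))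
    · rw [e0 j hj]; exact R.raise.a_f i j h1 h2
  · by_cases hj : j + 1 = n
    · rw [eN j hj, e0 i (by omega)]
      exact (D.e_lastRow_far hlq hl hq hij hj).symm
    · by_cases hi : i + 1 = n
      · rw [ez j (by omega), mul_zero, zero_mul]
      · rw [e0 j hj, e0 i hi]; exact R.raise.f_f i j hij
  · by_cases hi : i + 1 = n
    · rw [ez (i + 1) (by omega)]; simp
    by_cases hj : i + 2 = n
    · rw [eN (i + 1) hj, e0 i hi]
      have h1 := key i hj
      have h2 := D.e_lastRow_penultimate hlq hl hq hj
      have h3 := R.raise.a_f_succ i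
      set L := lastRow l n v X G H (i + 1)
      set e := (mul x v).e i
      -- This is the Serre relation quadratic in e: the commutator is λ b_{n-1} times the preceding
      -- entry of the last row, and each of these two factors contributes one q.
      have h4 : (L * e - e * L) * e = q ^ 2 • (e * (L * e - e * L)) := by
        have h2' := qcomm_symm (inv_ne_zero hq) h2
        have h3' := qcomm_symm hq h3
        rw [h1]
        simp only [smul_mul_assoc, mul_smul_comm, mul_assoc, h2', mul_qcomm_assoc h3']
        match_scalars; field_simp
      simp only [sub_mul, mul_sub, smul_sub, ← mul_assoc] at h4
      linear_combination (norm := module) h4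
    · rw [e0 (i + 1) (by omega), e0 i hi]; exact R.raise.serre i
  · by_cases hi : i + 1 = n
    · rw [ez (i + 1) (by omega)]; simp
    by_cases hj : i + 2 = n
    · rw [eN (i + 1) hj, e0 i hi]
      have h1 := key i hj
      have h2 := D.lastRow_qplane hlq hl hq hq2 hj
      have h3 := inv_qcomm hq (R.lower.ab _) (R.lower.ba _) (D.a_lastRow_self hlq hl hq hj)
      set L := lastRow l n v X G H (i + 1)
      set e := (mul x v).e i
      -- The Serre relation quadratic in the new generator. One q comes from moving L past b_{n-1},
      -- the other from the q-plane relation in the last row.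
      have h4 : L * (L * e - e * L) = q ^ 2 • ((L * e - e * L) * L) := by
        have h3' := qcomm_symm (inv_ne_zero hq) h3
        rw [h1]
        simp only [smul_mul_assoc, mul_smul_comm, mul_assoc, h2, mul_qcomm_assoc h3']
        match_scalars; field_simp
      simp only [sub_mul, mul_sub, smul_sub, ← mul_assoc] at h4
      linear_combination (norm := module) h4
    · rw [e0 (i + 1) (by omega), e0 i hi]; exact R.raise.serre' i
  · by_cases hj : i + 1 = n
    · rw [eN i hj]; exact D.f_lastRow_last hj
    · rw [e0 i hj]; exact R.mixed.ef_self i (by omega)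
  · by_cases hj : i + 1 = n
    · rw [fz (i + 1) (by omega)]; simp
    · rw [e0 i hj]; exact R.mixed.ef_succ i
  · by_cases hj : i + 2 = n
    · rw [eN (i + 1) hj]; exact D.f_lastRow_penultimate hlq hl hq hj
    · rw [e0 (i + 1) hj]; exact R.mixed.fe_succ i
  · by_cases hi : i + 1 = n
    · by_cases hj : n ≤ j
      · rw [fz j hj]; simp
      · rw [eN i hi]; exact (D.f_lastRow_far hlq hl hq hq2 (by omega) hi).symm
    · rw [e0 i hi]; exact R.mixed.ef i j h1 h2 h3

/-- The last row of `L_-` of the reduced tensor product. -/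
theorem reduced_upper_last (D : ReducedSetting q l c n x v X G H) (hlq : l = q - q⁻¹) (hl : l ≠ 0)
    (hq : q ≠ 0) (hq2 : 1 + q ^ 2 ≠ 0) {s : ℕ} (hs : s < n) :
    upper l (mul x v).b (mul x v).a (reducedTriangular l n x v X G H).e s n
      = lastRow l n v X G H s := by
  obtain ⟨p, rfl⟩ : ∃ p, n = p + 1 := ⟨n - 1, by omega⟩
  refine upper_unique_left (D.reduced_relations hlq hl hq hq2).raise hl
    (r := lastRow l (p + 1) v X G H) (if_pos rfl).symm (fun s hs => ?_) (by omega)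
  rw [show (reducedTriangular l (p + 1) x v X G H).e s = (mul x v).e s from if_neg (by omega)]
  exact D.e_lastRow_step hlq hl hq (by omega)

/-- The other elements of `L_-` of the reduced tensor product. -/
theorem reduced_upper_of_lt (D : ReducedSetting q l c n x v X G H) (hlq : l = q - q⁻¹)
    (hl : l ≠ 0) (hq : q ≠ 0) {s j : ℕ} (hs : s ≤ j) (hj : j < n) :
    upper l (mul x v).b (mul x v).a (reducedTriangular l n x v X G H).e s j
      = ∑ k ∈ Finset.range (j + 1), upper l x.b x.a x.e k j * upper l v.b v.a v.e s k := by
  have h0 : ∀ i, i < j → (reducedTriangular l n x v X G H).e i = (mul x v).e i := fun i hi =>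
    if_neg (by omega)
  rw [upper_congr h0]
  obtain ⟨h1, h2, h3⟩ := mul_raise_swap D.comm
  rw [h1, h2, h3, upper_coproduct hlq hl hq D.hv.raise D.hx.raise D.comm.be.symm hs, rowMul]
  -- The reversed co-product gives products with the second factor on the left; entries of the two
  -- commuting families are now exchanged.
  refine Finset.sum_congr rfl fun k hk => ?_
  have hk' : k ≤ j := by simpa [Nat.lt_succ_iff] using hk
  by_cases hsk : s ≤ k
  · have c1 : ∀ y, (∀ i, y * x.b i = x.b i * y) → (∀ i, y * x.a i = x.a i * y) →
        (∀ i, y * x.e i = x.e i * y) →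
        y * upper l x.b x.a x.e k j = upper l x.b x.a x.e k j * y := fun y h1 h2 h3 =>
      upper_comm hk' (fun _ => h1 _) (fun i _ _ => h2 i) (fun i _ _ => h3 i)
    have eb : ∀ i j, x.e i * v.a j = v.a j * x.e i := fun i j =>
      (inv_comm (D.hv.raise.ab j) (D.hv.raise.ba j) (D.comm.be.fa i j).symm).symm
    have ae : ∀ i j, x.a i * v.e j = v.e j * x.a i := fun i j =>
      inv_comm (D.hx.raise.ab i) (D.hx.raise.ba i) (D.comm.be.af i j)
    exact (upper_comm hsk
      (fun _ => (c1 _ (fun i => (D.comm.be.aa _ _).symm) (fun i => (D.comm.ab D.hx _ _).symm)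
        (fun i => (D.comm.be.fa _ _).symm)).symm)
      (fun i _ _ => (c1 _ (fun i => (D.comm.ba D.hx _ _).symm) (fun i => (D.comm.af.aa _ _).symm)
        (fun i => (eb _ _).symm)).symm)
      (fun i _ _ => (c1 _ (fun i => (D.comm.be.af _ _).symm) (fun i => (ae _ _).symm)
        (fun i => (D.comm.be.ff _ _).symm)).symm)).symm
  · rw [upper_of_lt (by omega), zero_mul, mul_zero]

end ReducedSetting

end ReducedRelations

/-! ### Chevalley generators and triangular data -/

section Torus

variable {A : Type*} [Ring A] [Algebra ℂ A]

/-- The relations between `k_i = q ^ (N_i / 2)`, their inverses and the lowering generators, with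
`s = q ^ (1/2)`; they are also satisfied by the inverses and the raising generators. -/
structure IsTorus (s : ℂ) (k k' f : ℕ → A) : Prop where
  kk' : ∀ i, k i * k' i = 1
  k'k : ∀ i, k' i * k i = 1
  k_k : ∀ i j, k i * k j = k j * k i
  k_f_self : ∀ i, k i * f i = s⁻¹ • (f i * k i)
  k_f_succ : ∀ i, k (i + 1) * f i = s • (f i * k (i + 1))
  k_f : ∀ i j, i ≠ j → i ≠ j + 1 → k i * f j = f j * k i

/-- Relations between entries of L_± are relations between Chevalley generators multiplied by
invertible Cartan factors; this cancels such a factor. -/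
theorem smul_mul_eq_zero_iff {κ : ℂ} (hκ : κ ≠ 0) {U V x : A} (h : V * U = 1) :
    κ • (U * x) = 0 ↔ x = 0 := by
  constructor
  · intro h1
    have h2 := (smul_eq_zero.mp h1).resolve_left hκ
    rw [← one_mul x, ← h, mul_assoc, h2, mul_zero]
  · rintro rfl; simp

namespace IsTorus

variable {s : ℂ} {k k' f : ℕ → A}

theorem k'_k (T : IsTorus s k k' f) (i j : ℕ) : k' i * k j = k j * k' i :=
  inv_comm (T.kk' i) (T.k'k i) (T.k_k i j)

theorem k'_k' (T : IsTorus s k k' f) (i j : ℕ) : k' i * k' j = k' j * k' i :=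
  inv_comm (T.kk' i) (T.k'k i) (T.k'_k j i).symm

theorem f_k_self (T : IsTorus s k k' f) (hs : s ≠ 0) (i : ℕ) : f i * k i = s • (k i * f i) := by
  simpa using qcomm_symm (inv_ne_zero hs) (T.k_f_self i)

theorem f_k_succ (T : IsTorus s k k' f) (hs : s ≠ 0) (i : ℕ) :
    f i * k (i + 1) = s⁻¹ • (k (i + 1) * f i) :=
  qcomm_symm hs (T.k_f_succ i)

theorem f_k'_self (T : IsTorus s k k' f) (hs : s ≠ 0) (i : ℕ) :
    f i * k' i = s⁻¹ • (k' i * f i) := by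
  simpa using qcomm_symm (inv_ne_zero (inv_ne_zero hs))
    (inv_qcomm (inv_ne_zero hs) (T.kk' i) (T.k'k i) (T.k_f_self i))

theorem f_k'_succ (T : IsTorus s k k' f) (hs : s ≠ 0) (i : ℕ) :
    f i * k' (i + 1) = s • (k' (i + 1) * f i) := by
  simpa using qcomm_symm (inv_ne_zero hs) (inv_qcomm hs (T.kk' _) (T.k'k _) (T.k_f_succ i))

theorem f_k' (T : IsTorus s k k' f) (i j : ℕ) (h : i ≠ j) (h' : i ≠ j + 1) :
    f j * k' i = k' i * f j :=
  (inv_comm (T.kk' i) (T.k'k i) (T.k_f i j h h')).symm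

theorem unit_mul {U U' V V' : A} (h : V * U = 1) (h' : V' * U' = 1) : V' * V * (U * U') = 1 := by
  rw [mul_assoc, ← mul_assoc V, h, one_mul, h']

theorem unit_pair (T : IsTorus s k k' f) (i j : ℕ) : k' j * k' i * (k i * k j) = 1 :=
  unit_mul (T.k'k i) (T.k'k j)

/-- The Borel relations in terms of the Chevalley generators. -/
theorem isBorel_iff (T : IsTorus s k k' f) (hs : s ≠ 0) {σ : ℂ} (hσ : σ ≠ 0) :
    IsBorel (s ^ 2) (fun i => k i ^ 2) (fun i => k' i ^ 2)
        (fun i => σ • (k i * k (i + 1) * f i)) ↔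
      (∀ i j, i + 1 < j → f j * f i = f i * f j) ∧
      (∀ i, f i ^ 2 * f (i + 1) - (s ^ 2 + (s ^ 2)⁻¹) • (f i * f (i + 1) * f i)
        + f (i + 1) * f i ^ 2 = 0) ∧
      (∀ i, f (i + 1) ^ 2 * f i - (s ^ 2 + (s ^ 2)⁻¹) • (f (i + 1) * f i * f (i + 1))
        + f i * f (i + 1) ^ 2 = 0) := by
  -- This and the next two identities show that each relation between dressed generators is an
  -- invertible Cartan factor times the same relation between bare generators, which gives both
  -- directions at once.
  have far : ∀ i j, i + 1 < j →
      σ • (k j * k (j + 1) * f j) * σ • (k i * k (i + 1) * f i)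
        - σ • (k i * k (i + 1) * f i) * σ • (k j * k (j + 1) * f j)
      = (σ * σ) • ((k i * k (i + 1) * (k j * k (j + 1))) * (f j * f i - f i * f j)) := by
    intro i j hij
    simp only [smul_mul_assoc, mul_smul_comm, smul_smul, mul_sub, smul_sub, mul_assoc,
      mul_comm_assoc (T.k_f i j (by omega) (by omega)).symm,
      mul_comm_assoc (T.k_f (i + 1) j (by omega) (by omega)).symm,
      mul_comm_assoc (T.k_f j i (by omega) (by omega)).symm,
      mul_comm_assoc (T.k_f (j + 1) i (by omega) (by omega)).symm,
      mul_comm_assoc (T.k_k j i), mul_comm_assoc (T.k_k j (i + 1)),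
      mul_comm_assoc (T.k_k (j + 1) i), mul_comm_assoc (T.k_k (j + 1) (i + 1))]
  have serre : ∀ i, σ • (k (i + 1) * k (i + 1 + 1) * f (i + 1)) * σ • (k i * k (i + 1) * f i)
        * σ • (k i * k (i + 1) * f i)
      - (1 + (s ^ 2) ^ 2) • (σ • (k i * k (i + 1) * f i)
        * σ • (k (i + 1) * k (i + 1 + 1) * f (i + 1)) * σ • (k i * k (i + 1) * f i))
      + (s ^ 2) ^ 2 • (σ • (k i * k (i + 1) * f i) * σ • (k i * k (i + 1) * f i)
        * σ • (k (i + 1) * k (i + 1 + 1) * f (i + 1)))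
      = (s ^ 2 * σ ^ 3) • ((k i * k (i + 1) * (k i * k (i + 1)) * (k (i + 1) * k (i + 1 + 1))) *
        (f i ^ 2 * f (i + 1) - (s ^ 2 + (s ^ 2)⁻¹) • (f i * f (i + 1) * f i)
        + f (i + 1) * f i ^ 2)) := by
    intro i
    simp only [smul_mul_assoc, mul_smul_comm, smul_smul, mul_sub, mul_add, smul_sub, smul_add,
      mul_assoc, sq (f i), mul_qcomm_assoc (T.f_k_self hs i), mul_qcomm_assoc (T.f_k_succ hs i),
      mul_qcomm_assoc (T.f_k_self hs (i + 1)),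
      mul_comm_assoc (T.k_f i (i + 1) (by omega) (by omega)).symm,
      mul_comm_assoc (T.k_f (i + 1 + 1) i (by omega) (by omega)).symm,
      mul_comm_assoc (T.k_k (i + 1) i), mul_comm_assoc (T.k_k (i + 1 + 1) (i + 1)),
      mul_comm_assoc (T.k_k (i + 1 + 1) i)]
    match_scalars <;> field_simp
    ring
  have serre' : ∀ i, σ • (k (i + 1) * k (i + 1 + 1) * f (i + 1))
        * σ • (k (i + 1) * k (i + 1 + 1) * f (i + 1)) * σ • (k i * k (i + 1) * f i)
      - (1 + (s ^ 2) ^ 2) • (σ • (k (i + 1) * k (i + 1 + 1) * f (i + 1))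
        * σ • (k i * k (i + 1) * f i) * σ • (k (i + 1) * k (i + 1 + 1) * f (i + 1)))
      + (s ^ 2) ^ 2 • (σ • (k i * k (i + 1) * f i)
        * σ • (k (i + 1) * k (i + 1 + 1) * f (i + 1))
        * σ • (k (i + 1) * k (i + 1 + 1) * f (i + 1)))
      = (s ^ 2 * σ ^ 3) • ((k i * k (i + 1) * (k (i + 1) * k (i + 1 + 1))
        * (k (i + 1) * k (i + 1 + 1))) *
        (f (i + 1) ^ 2 * f i - (s ^ 2 + (s ^ 2)⁻¹) • (f (i + 1) * f i * f (i + 1))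
        + f i * f (i + 1) ^ 2)) := by
    intro i
    simp only [smul_mul_assoc, mul_smul_comm, smul_smul, mul_sub, mul_add, smul_sub, smul_add,
      mul_assoc, sq (f (i + 1)),
      mul_qcomm_assoc (T.f_k_succ hs i), mul_qcomm_assoc (T.f_k_succ hs (i + 1)),
      mul_qcomm_assoc (T.f_k_self hs (i + 1)),
      mul_comm_assoc (T.k_f i (i + 1) (by omega) (by omega)).symm,
      mul_comm_assoc (T.k_f (i + 1 + 1) i (by omega) (by omega)).symm,
      mul_comm_assoc (T.k_k (i + 1) i), mul_comm_assoc (T.k_k (i + 1 + 1) (i + 1)),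
      mul_comm_assoc (T.k_k (i + 1 + 1) i)]
    match_scalars <;> field_simp
    ring
  have hs2 : s ^ 2 * σ ^ 3 ≠ 0 := mul_ne_zero (pow_ne_zero 2 hs) (pow_ne_zero 3 hσ)
  constructor
  · intro H
    refine ⟨fun i j hij => ?_, fun i => ?_, fun i => ?_⟩
    · have h1 := far i j hij
      rw [H.f_f i j hij, sub_self] at h1
      exact sub_eq_zero.mp ((smul_mul_eq_zero_iff (mul_ne_zero hσ hσ)
        (unit_mul (T.unit_pair _ _) (T.unit_pair _ _))).mp h1.symm)
    · exact (smul_mul_eq_zero_iff hs2 (unit_mul (unit_mul (T.unit_pair _ _) (T.unit_pair _ _))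
        (T.unit_pair _ _))).mp ((serre i).symm.trans (H.serre i))
    · exact (smul_mul_eq_zero_iff hs2 (unit_mul (unit_mul (T.unit_pair _ _) (T.unit_pair _ _))
        (T.unit_pair _ _))).mp ((serre' i).symm.trans (H.serre' i))
  · rintro ⟨h1, h2, h3⟩
    have h_sq : ∀ i, k i ^ 2 = k i * k i := fun i => sq _
    have h_sq' : ∀ i, k' i ^ 2 = k' i * k' i := fun i => sq _
    refine ⟨fun i => ?_, fun i => ?_, fun i j => ?_, fun i => ?_, fun i => ?_,
      fun i j hij hij' => ?_, fun i j hij => ?_, fun i => ?_, fun i => ?_⟩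
    · simp only [h_sq, h_sq']; exact unit_mul (T.kk' _) (T.kk' _)
    · simp only [h_sq, h_sq']; exact unit_mul (T.k'k _) (T.k'k _)
    · simp only [h_sq, mul_assoc, T.k_k i j, mul_comm_assoc (T.k_k i j)]
    · simp only [h_sq, smul_mul_assoc, mul_smul_comm, mul_assoc, mul_comm_assoc (T.k_k i (i + 1)),
        T.f_k_self hs i, mul_qcomm_assoc (T.f_k_self hs i)]
      match_scalars; field_simp
    · simp only [h_sq, smul_mul_assoc, mul_smul_comm, mul_assoc, mul_comm_assoc (T.k_k (i + 1) i),
        T.f_k_succ hs i, mul_qcomm_assoc (T.f_k_succ hs i)]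
      match_scalars; field_simp
    · simp only [h_sq, smul_mul_assoc, mul_smul_comm, mul_assoc, mul_comm_assoc (T.k_k i j),
        mul_comm_assoc (T.k_k i (j + 1)), mul_comm_assoc (T.k_f i j hij hij'),
        T.k_f i j hij hij']
    · rw [← sub_eq_zero, far i j hij, h1 i j hij, sub_self, mul_zero, smul_zero]
    · rw [serre i, h2, mul_zero, smul_zero]
    · rw [serre' i, h3, mul_zero, smul_zero]

/-- The relations between raising and lowering elements in terms of the Chevalley generators. -/
theorem isMixed_iff {e : ℕ → A} (T : IsTorus s k k' f) (T' : IsTorus s k' k e) (hs : s ≠ 0)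
    {l σ τ : ℂ} (hl : l ≠ 0) (hστ : τ * σ = -l ^ 2) (m : ℕ) :
    IsMixed (s ^ 2) l m (fun i => k i ^ 2) (fun i => k' i ^ 2)
        (fun i => τ • (k' (i + 1) * k' i * e i)) (fun i => σ • (k i * k (i + 1) * f i)) ↔
      (∀ i, i + 1 < m → e i * f i - f i * e i
        = l⁻¹ • (k i ^ 2 * k' (i + 1) ^ 2 - k' i ^ 2 * k (i + 1) ^ 2)) ∧
      (∀ i j, i ≠ j → e i * f j = f j * e i) := by
  have hσ : σ ≠ 0 := by rintro rfl; simp [hl] at hστ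
  have hτ : τ ≠ 0 := by rintro rfl; simp [hl] at hστ
  -- For equal indices the Cartan factors cancel completely, and τσ = -λ² is the normalisation that
  -- turns λ⁻¹ of the Chevalley relation into the -λ of `IsMixed`.
  have self : ∀ i, τ • (k' (i + 1) * k' i * e i) * σ • (k i * k (i + 1) * f i)
      - σ • (k i * k (i + 1) * f i) * τ • (k' (i + 1) * k' i * e i)
      = -(l ^ 2 • (e i * f i - f i * e i)) := by
    intro i
    have c1 := T'.f_k'_self hs i
    have c2 := T'.f_k'_succ hs i
    have c3 := T.f_k'_self hs i
    have c4 := T.f_k'_succ hs i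
    have u1 : ∀ z, k i * (k' i * z) = z := fun z => by rw [← mul_assoc, T.kk', one_mul]
    have u2 : ∀ z, k (i + 1) * (k' (i + 1) * z) = z := fun z => by
      rw [← mul_assoc, T.kk', one_mul]
    simp only [smul_mul_assoc, mul_smul_comm, smul_smul, mul_assoc, mul_qcomm_assoc c1,
      mul_qcomm_assoc c2, mul_qcomm_assoc c3, mul_qcomm_assoc c4,
      mul_comm_assoc (T.k'_k i i), mul_comm_assoc (T.k'_k (i + 1) i),
      mul_comm_assoc (T.k'_k (i + 1) (i + 1)), mul_comm_assoc (T.k'_k i (i + 1)), u1, u2]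
    match_scalars
    · field_simp; linear_combination hστ
    · field_simp; linear_combination -hστ
  -- For neighbouring indices the dressing by Cartan factors turns commuting generators into
  -- q-commuting ones, with q = s².
  have succ : ∀ i, τ • (k' (i + 1) * k' i * e i) * σ • (k (i + 1) * k (i + 1 + 1) * f (i + 1))
      - s ^ 2 • (σ • (k (i + 1) * k (i + 1 + 1) * f (i + 1)) * τ • (k' (i + 1) * k' i * e i))
      = (τ * σ * s) • ((k' (i + 1) * k' i * (k (i + 1) * k (i + 1 + 1)))
        * (e i * f (i + 1) - f (i + 1) * e i)) := by
    intro i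
    simp only [smul_mul_assoc, mul_smul_comm, smul_smul, mul_sub, smul_sub, mul_assoc,
      mul_qcomm_assoc (T'.f_k'_succ hs i), mul_comm_assoc (T'.f_k' (i + 1 + 1) i (by omega)
      (by omega)), mul_qcomm_assoc (T.f_k'_self hs (i + 1)),
      mul_comm_assoc (T.f_k' i (i + 1) (by omega) (by omega)),
      ← mul_comm_assoc (T.k'_k _ _)]
    match_scalars <;> field_simp
  have succ' : ∀ i, σ • (k i * k (i + 1) * f i) * τ • (k' (i + 1 + 1) * k' (i + 1) * e (i + 1))
      - s ^ 2 • (τ • (k' (i + 1 + 1) * k' (i + 1) * e (i + 1)) * σ • (k i * k (i + 1) * f i))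
      = (-(τ * σ * s)) • ((k' (i + 1 + 1) * k' (i + 1) * (k i * k (i + 1)))
        * (e (i + 1) * f i - f i * e (i + 1))) := by
    intro i
    simp only [smul_mul_assoc, mul_smul_comm, smul_smul, mul_sub, smul_sub, mul_assoc,
      mul_qcomm_assoc (T.f_k'_succ hs i), mul_comm_assoc (T.f_k' (i + 1 + 1) i (by omega)
      (by omega)), mul_qcomm_assoc (T'.f_k'_self hs (i + 1)),
      mul_comm_assoc (T'.f_k' i (i + 1) (by omega) (by omega)),
      ← mul_comm_assoc (T.k'_k _ _)]
    match_scalars <;> field_simp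
  have far : ∀ i j, i ≠ j → i + 1 ≠ j → j + 1 ≠ i →
      τ • (k' (i + 1) * k' i * e i) * σ • (k j * k (j + 1) * f j)
      - σ • (k j * k (j + 1) * f j) * τ • (k' (i + 1) * k' i * e i)
      = (τ * σ) • ((k' (i + 1) * k' i * (k j * k (j + 1))) * (e i * f j - f j * e i)) := by
    intro i j h1 h2 h3
    simp only [smul_mul_assoc, mul_smul_comm, smul_smul, mul_sub, smul_sub, mul_assoc,
      mul_comm_assoc (T.f_k' i j (by omega) (by omega)),
      mul_comm_assoc (T.f_k' (i + 1) j (by omega) (by omega)),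
      mul_comm_assoc (T'.f_k' j i (by omega) (by omega)),
      mul_comm_assoc (T'.f_k' (j + 1) i (by omega) (by omega)),
      ← mul_comm_assoc (T.k'_k _ _)]
    match_scalars <;> ring
  have hτσ : τ * σ ≠ 0 := mul_ne_zero hτ hσ
  have unit : ∀ i j, (k' (j + 1) * k' j * (k i * k (i + 1))) * (k' (i + 1) * k' i *
      (k j * k (j + 1)))
      = 1 := fun i j => by
    have e : k' (i + 1) * k' i * (k j * k (j + 1)) = k j * k (j + 1) * (k' (i + 1) * k' i) := by
      simp only [mul_assoc, T.k'_k i (j + 1), mul_comm_assoc (T.k'_k i j),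
        mul_comm_assoc (T.k'_k (i + 1) j),
        mul_comm_assoc (T.k'_k (i + 1) (j + 1))]
    have e2 : k' (j + 1) * k' j * (k i * k (i + 1)) = k i * k (i + 1) * (k' (j + 1) * k' j) := by
      simp only [mul_assoc, T.k'_k j (i + 1), mul_comm_assoc (T.k'_k j i),
        mul_comm_assoc (T.k'_k (j + 1) i),
        mul_comm_assoc (T.k'_k (j + 1) (i + 1))]
    rw [e, e2, mul_assoc, ← mul_assoc (k' (j + 1) * k' j), T.unit_pair, one_mul]
    have := T'.unit_pair (i + 1) i
    exact this
  have H1 : ∀ i, i + 1 < m → -(l ^ 2 • (l⁻¹ • (k i ^ 2 * k' (i + 1) ^ 2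
      - k' i ^ 2 * k (i + 1) ^ 2))) = -(l • (k i ^ 2 * k' (i + 1) ^ 2
      - k' i ^ 2 * k (i + 1) ^ 2)) := fun i _ => by
    rw [smul_smul]; congr 2; field_simp
  constructor
  · intro M
    refine ⟨fun i hi => ?_, fun i j hij => ?_⟩
    · have h1 := (self i).symm.trans (M.ef_self i hi)
      rw [← H1 i hi, neg_inj] at h1
      exact smul_right_injective A (pow_ne_zero 2 hl) h1
    · by_cases h1 : i + 1 = j
      · subst h1
        have h2 := (succ i).symm.trans (sub_eq_zero.mpr (M.ef_succ i))
        exact sub_eq_zero.mp ((smul_mul_eq_zero_iff (mul_ne_zero hτσ hs) (unit i (i + 1))).mp h2)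
      · by_cases h2 : j + 1 = i
        · subst h2
          have h2 := (succ' j).symm.trans (sub_eq_zero.mpr (M.fe_succ j))
          exact sub_eq_zero.mp ((smul_mul_eq_zero_iff (neg_ne_zero.mpr (mul_ne_zero hτσ hs))
            (unit (j + 1) j)).mp h2)
        · have h3 := (far i j hij h1 h2).symm.trans (sub_eq_zero.mpr (M.ef i j hij h1 h2))
          exact sub_eq_zero.mp ((smul_mul_eq_zero_iff hτσ (unit i j)).mp h3)
  · rintro ⟨h1, h2⟩
    refine ⟨fun i hi => ?_, fun i => ?_, fun i => ?_, fun i j h3 h4 h5 => ?_⟩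
    · rw [self i, h1 i hi, H1 i hi]
    · rw [← sub_eq_zero, succ i, h2 i (i + 1) (by omega), sub_self, mul_zero, smul_zero]
    · rw [← sub_eq_zero, succ' i, h2 (i + 1) i (by omega), sub_self, mul_zero, smul_zero]
    · rw [← sub_eq_zero, far i j h3 h4 h5, h2 i j h3, sub_self, mul_zero, smul_zero]

end IsTorus

end Torus

/-! ### Weights of the entries of L_±, and their expression through Cartan–Weyl generators. -/

section Weights

variable {A : Type*} [Ring A] [Algebra ℂ A]

/-- `s` at `t`, and `1` elsewhere. -/
def unitWeight (s : ℂ) (t i : ℕ) : ℂ := if i = t then s else 1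

theorem unitWeight_ne_zero {s : ℂ} (hs : s ≠ 0) (t i : ℕ) : unitWeight s t i ≠ 0 := by
  unfold unitWeight; split_ifs <;> simp [hs]

theorem IsTorus.k_f_weight {s : ℂ} {k k' f : ℕ → A} (T : IsTorus s k k' f)
    (t i : ℕ) : k t * f i = (unitWeight s t (i + 1) * (unitWeight s t i)⁻¹) • (f i * k t) := by
  by_cases h1 : i = t
  · subst h1
    rw [T.k_f_self]; simp [unitWeight]
  · by_cases h2 : i + 1 = t
    · subst h2
      rw [T.k_f_succ]; simp [unitWeight]
    · rw [T.k_f t i (Ne.symm h1) (Ne.symm h2)]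
      simp [unitWeight, h1, h2]

/-- The matrix elements of `L_+` are weight vectors. -/
theorem upper_weight {l : ℂ} {a b f : ℕ → A} {u : A} {z : ℕ → ℂ} (hz : ∀ i, z i ≠ 0)
    (ha : ∀ i, u * a i = a i * u) (hb : ∀ i, u * b i = b i * u)
    (hf : ∀ i, u * f i = (z (i + 1) * (z i)⁻¹) • (f i * u)) {s j : ℕ} (h : s ≤ j) :
    u * upper l a b f s j = (z j * (z s)⁻¹) • (upper l a b f s j * u) := by
  rcases h.eq_or_lt with rfl | h
  · rw [upper_self, mul_inv_cancel₀ (hz s), one_smul, ha]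
  refine upper_induction (P := fun j y => u * y = (z j * (z s)⁻¹) • (y * u)) (hf s)
    (fun j _ ih => ?_) h
  have := hz j
  simp only [mul_smul_comm, smul_mul_assoc, mul_sub, sub_mul, mul_assoc, mul_comm_assoc (hb j),
    mul_qcomm_assoc ih, mul_qcomm_assoc (hf j), ih, hf j, smul_sub, smul_smul]
  match_scalars <;> field_simp

/-- The elements of `L_±` in terms of the Cartan-Weyl generators. -/
theorem IsTorus.upper_eq {s l σ κ : ℂ} {k k' f : ℕ → A} (T : IsTorus s k k' f) (hs : s ≠ 0)
    (hl : l ≠ 0) (hσ : σ * s = l * κ) {i : ℕ} {E : ℕ → A} (h0 : E 0 = f i)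
    (h : ∀ d, E (d + 1) = κ • (f (i + d + 1) * E d - (s ^ 2)⁻¹ • (E d * f (i + d + 1)))) (d : ℕ) :
    upper l (fun i => k i ^ 2) (fun i => k' i ^ 2) (fun i => σ • (k i * k (i + 1) * f i)) i
      (i + d + 1) = σ • (k i * k (i + d + 1) * E d) := by
  have hE : ∀ t d, k t * E d = (unitWeight s t (i + d + 1) * (unitWeight s t i)⁻¹) •
      (E d * k t) := by
    intro t d
    induction d with
    | zero => rw [h0]; exact T.k_f_weight t i
    | succ d ih =>
      have w := T.k_f_weight t (i + d + 1)
      have h3 := unitWeight_ne_zero hs t (i + d + 1)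
      rw [h]
      simp only [mul_smul_comm, smul_mul_assoc, mul_sub, sub_mul, mul_assoc, mul_qcomm_assoc w,
        mul_qcomm_assoc ih, ih, w, smul_sub, smul_smul, ← add_assoc]
      match_scalars <;> field_simp
  induction d with
  | zero => rw [add_zero, upper_succ, h0]
  | succ d ih =>
    have c1 : E d * k (i + d + 1) = s⁻¹ • (k (i + d + 1) * E d) := by
      refine qcomm_symm hs ?_
      rw [hE, unitWeight, unitWeight, if_pos rfl, if_neg (by omega), inv_one, mul_one]
    have c2 : E d * k (i + d + 1 + 1) = k (i + d + 1 + 1) * E d := by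
      rw [hE, unitWeight, unitWeight, if_neg (by omega), if_neg (by omega), inv_one, mul_one,
        one_smul]
    have c3 := (T.k_f i (i + d + 1) (by omega) (by omega)).symm
    have c4 := T.f_k_self hs (i + d + 1)
    have u1 : ∀ z, k' (i + d + 1) * (k (i + d + 1) * z) = z := fun z => by
      rw [← mul_assoc, T.k'k, one_mul]
    -- The hypothesis σ s = λ κ makes the prefactor σ reproduce itself in the recursion: one σ of
    -- the product is absorbed into λ⁻¹.
    have h2 : l⁻¹ * σ = κ * s⁻¹ := by field_simp; rw [hσ]
    rw [show i + (d + 1) + 1 = i + d + 2 by omega, upper_add_two, ih, h]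
    simp only [smul_mul_assoc, mul_smul_comm, smul_smul, mul_sub, smul_sub, mul_assoc, sq (k' _),
      mul_qcomm_assoc c1, mul_comm_assoc c2, mul_comm_assoc c3, mul_qcomm_assoc c4,
      mul_comm_assoc (T.k_k i (i + d + 1)), mul_comm_assoc (T.k_k (i + d + 1 + 1) (i + d + 1)),
      mul_comm_assoc (T.k_k (i + d + 1 + 1) i),
      u1]
    match_scalars
    · linear_combination (σ * s) * h2 + (σ * κ) * mul_inv_cancel₀ hs
    · linear_combination (-σ * s⁻¹) * h2

end Weights

/-! ### Representations given by generators -/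

section Presentation

variable {m : ℕ} {A : Type*} [Ring A] [Algebra ℂ A]

/-- The defining relations of `U_q(gl(m))` for a family of elements of an algebra. -/
structure IsUq (h : ℂ) (c : ChevalleyData m A) : Prop where
  k_kInv : ∀ i, c.k i * c.kInv i = 1
  kInv_k : ∀ i, c.kInv i * c.k i = 1
  k_k : ∀ i j, c.k i * c.k j = c.k j * c.k i
  k_e : ∀ (i : Fin m) (j : ℕ) (hj : j + 1 < m),
    c.k i * c.e j hj = qExp h (halfWeight i j) • (c.e j hj * c.k i)
  k_f : ∀ (i : Fin m) (j : ℕ) (hj : j + 1 < m),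
    c.k i * c.f j hj = qExp h (-halfWeight i j) • (c.f j hj * c.k i)
  e_f_self : ∀ (i : ℕ) (hi : i + 1 < m), c.e i hi * c.f i hi - c.f i hi * c.e i hi =
    (lam h)⁻¹ • (c.k ⟨i, by omega⟩ ^ 2 * c.kInv ⟨i + 1, hi⟩ ^ 2
      - c.kInv ⟨i, by omega⟩ ^ 2 * c.k ⟨i + 1, hi⟩ ^ 2)
  e_f_ne : ∀ (i j : ℕ) (hi : i + 1 < m) (hj : j + 1 < m), i ≠ j →
    c.e i hi * c.f j hj = c.f j hj * c.e i hi
  e_e : ∀ (i j : ℕ) (hi : i + 1 < m) (hj : j + 1 < m), i + 1 < j →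
    c.e i hi * c.e j hj = c.e j hj * c.e i hi
  f_f : ∀ (i j : ℕ) (hi : i + 1 < m) (hj : j + 1 < m), i + 1 < j →
    c.f i hi * c.f j hj = c.f j hj * c.f i hi
  serre_e : ∀ (i j : ℕ) (hi : i + 1 < m) (hj : j + 1 < m), (i + 1 = j ∨ j + 1 = i) →
    c.e i hi ^ 2 * c.e j hj - (qExp h 1 + qExp h (-1)) • (c.e i hi * c.e j hj * c.e i hi)
      + c.e j hj * c.e i hi ^ 2 = 0
  serre_f : ∀ (i j : ℕ) (hi : i + 1 < m) (hj : j + 1 < m), (i + 1 = j ∨ j + 1 = i) →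
    c.f i hi ^ 2 * c.f j hj - (qExp h 1 + qExp h (-1)) • (c.f i hi * c.f j hj * c.f i hi)
      + c.f j hj * c.f i hi ^ 2 = 0

theorem mkAlgHom_eq {h : ℂ} {x y : FreeAlgebra ℂ (Gen m)} (r : UqRel h m x y) :
    RingQuot.mkAlgHom ℂ (UqRel h m) x = RingQuot.mkAlgHom ℂ (UqRel h m) y :=
  RingQuot.mkAlgHom_rel ℂ r

theorem IsUq.map {h : ℂ} {B : Type*} [Ring B] [Algebra ℂ B] {c : ChevalleyData m A}
    (H : IsUq h c) (φ : A →ₐ[ℂ] B) : IsUq h (c.map φ) where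
  k_kInv i := by simpa [ChevalleyData.map] using congrArg φ (H.k_kInv i)
  kInv_k i := by simpa [ChevalleyData.map] using congrArg φ (H.kInv_k i)
  k_k i j := by simpa [ChevalleyData.map] using congrArg φ (H.k_k i j)
  k_e i j hj := by simpa [ChevalleyData.map] using congrArg φ (H.k_e i j hj)
  k_f i j hj := by simpa [ChevalleyData.map] using congrArg φ (H.k_f i j hj)
  e_f_self i hi := by simpa [ChevalleyData.map] using congrArg φ (H.e_f_self i hi)
  e_f_ne i j hi hj hij := by simpa [ChevalleyData.map] using congrArg φ (H.e_f_ne i j hi hj hij)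
  e_e i j hi hj hij := by simpa [ChevalleyData.map] using congrArg φ (H.e_e i j hi hj hij)
  f_f i j hi hj hij := by simpa [ChevalleyData.map] using congrArg φ (H.f_f i j hi hj hij)
  serre_e i j hi hj hij := by simpa [ChevalleyData.map] using congrArg φ (H.serre_e i j hi hj hij)
  serre_f i j hi hj hij := by simpa [ChevalleyData.map] using congrArg φ (H.serre_f i j hi hj hij)

theorem isUq_gens (h : ℂ) (m : ℕ) : IsUq h (gens h m) where
  k_kInv i := by
    simpa [gens, ChevalleyData.map] using mkAlgHom_eq (UqRel.k_kInv (h := h) i)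
  kInv_k i := by
    simpa [gens, ChevalleyData.map] using mkAlgHom_eq (UqRel.kInv_k (h := h) i)
  k_k i j := by
    simpa [gens, ChevalleyData.map] using mkAlgHom_eq (UqRel.k_k (h := h) i j)
  k_e i j hj := by
    simpa [gens, ChevalleyData.map] using mkAlgHom_eq (UqRel.k_e (h := h) i j hj)
  k_f i j hj := by
    simpa [gens, ChevalleyData.map] using mkAlgHom_eq (UqRel.k_f (h := h) i j hj)
  e_f_self i hi := by
    simpa [gens, ChevalleyData.map] using mkAlgHom_eq (UqRel.e_f_self (h := h) i hi)
  e_f_ne i j hi hj hij := by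
    simpa [gens, ChevalleyData.map] using mkAlgHom_eq (UqRel.e_f_ne (h := h) i j hi hj hij)
  e_e i j hi hj hij := by
    simpa [gens, ChevalleyData.map] using mkAlgHom_eq (UqRel.e_e (h := h) i j hi hj hij)
  f_f i j hi hj hij := by
    simpa [gens, ChevalleyData.map] using mkAlgHom_eq (UqRel.f_f (h := h) i j hi hj hij)
  serre_e i j hi hj hij := by
    simpa [gens, ChevalleyData.map] using mkAlgHom_eq (UqRel.serre_e (h := h) i j hi hj hij)
  serre_f i j hi hj hij := by
    simpa [gens, ChevalleyData.map] using mkAlgHom_eq (UqRel.serre_f (h := h) i j hi hj hij)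

/-- The image of a generator. -/
def ChevalleyData.eval (c : ChevalleyData m A) : Gen m → A
  | .k i => c.k i
  | .kInv i => c.kInv i
  | .e i hi => c.e i hi
  | .f i hi => c.f i hi

/-- The universal property of the presented algebra: once the relations are checked, a family of
operators is a representation. -/
theorem IsUq.exists_hom {h : ℂ} {c : ChevalleyData m A} (H : IsUq h c) :
    ∃ ρ : UqGL h m →ₐ[ℂ] A, (gens h m).map ρ = c := by
  have hr : ∀ ⦃x y : FreeAlgebra ℂ (Gen m)⦄, UqRel h m x y →
      FreeAlgebra.lift ℂ c.eval x = FreeAlgebra.lift ℂ c.eval y := by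
    intro x y r
    cases r with
    | k_kInv i => simpa [freeData, ChevalleyData.eval] using H.k_kInv i
    | kInv_k i => simpa [freeData, ChevalleyData.eval] using H.kInv_k i
    | k_k i j => simpa [freeData, ChevalleyData.eval] using H.k_k i j
    | k_e i j hj => simpa [freeData, ChevalleyData.eval] using H.k_e i j hj
    | k_f i j hj => simpa [freeData, ChevalleyData.eval] using H.k_f i j hj
    | e_f_self i hi => simpa [freeData, ChevalleyData.eval] using H.e_f_self i hi
    | e_f_ne i j hi hj hij => simpa [freeData, ChevalleyData.eval] using H.e_f_ne i j hi hj hij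
    | e_e i j hi hj hij => simpa [freeData, ChevalleyData.eval] using H.e_e i j hi hj hij
    | f_f i j hi hj hij => simpa [freeData, ChevalleyData.eval] using H.f_f i j hi hj hij
    | serre_e i j hi hj hij => simpa [freeData, ChevalleyData.eval] using H.serre_e i j hi hj hij
    | serre_f i j hi hj hij => simpa [freeData, ChevalleyData.eval] using H.serre_f i j hi hj hij
  refine ⟨RingQuot.liftAlgHom ℂ ⟨FreeAlgebra.lift ℂ c.eval, hr⟩, ?_⟩
  simp [ChevalleyData.map, gens, freeData, RingQuot.liftAlgHom_mkAlgHom_apply,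
    ChevalleyData.eval]

end Presentation

/-! ### The matrices `L_±` -/

section LaxEntries

variable {m : ℕ} {A : Type*} [Ring A] [Algebra ℂ A]

/-- Extension of a family by `1`. -/
def extendOne (k : Fin m → A) (i : ℕ) : A := if hi : i < m then k ⟨i, hi⟩ else 1

/-- Extension of a family by `0`. -/
def extendZero (e : (i : ℕ) → i + 1 < m → A) (i : ℕ) : A :=
  if hi : i + 1 < m then e i hi else 0

theorem extendOne_of_lt (k : Fin m → A) {i : ℕ} (hi : i < m) : extendOne k i = k ⟨i, hi⟩ :=
  dif_pos hi

theorem extendOne_of_le (k : Fin m → A) {i : ℕ} (hi : m ≤ i) : extendOne k i = 1 :=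
  dif_neg (by omega)

theorem extendZero_of_lt (e : (i : ℕ) → i + 1 < m → A) {i : ℕ} (hi : i + 1 < m) :
    extendZero e i = e i hi :=
  dif_pos hi

theorem extendZero_of_le (e : (i : ℕ) → i + 1 < m → A) {i : ℕ} (hi : m ≤ i + 1) :
    extendZero e i = 0 :=
  dif_neg (by omega)

/-- The elements `L_{±,ii}`, `L_{-,i+1,i}`, `L_{+,i,i+1}`. -/
def ChevalleyData.triangular (h : ℂ) (c : ChevalleyData m A) : TriangularData A where
  a i := extendOne c.k i ^ 2
  b i := extendOne c.kInv i ^ 2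
  e i := (-(lam h * qExp h (1 / 2))) •
    (extendOne c.kInv (i + 1) * extendOne c.kInv i * extendZero c.e i)
  f i := (lam h * qExp h (-(1 / 2))) •
    (extendOne c.k i * extendOne c.k (i + 1) * extendZero c.f i)

theorem qExp_ne_zero (h z : ℂ) : qExp h z ≠ 0 := Complex.exp_ne_zero _

theorem qExp_zero (h : ℂ) : qExp h 0 = 1 := by simp [qExp]

theorem qExp_neg (h z : ℂ) : qExp h (-z) = (qExp h z)⁻¹ := by simp [qExp, Complex.exp_neg]

theorem qExp_half_sq (h : ℂ) : qExp h (1 / 2) ^ 2 = qExp h 1 := by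
  rw [sq, ← qExp_add]; norm_num

variable {h : ℂ} {c : ChevalleyData m A}

theorem halfWeight_self (i : ℕ) : halfWeight i i = 1 / 2 := if_pos rfl

theorem halfWeight_succ (i : ℕ) : halfWeight (i + 1) i = -(1 / 2) := by
  simp [halfWeight]

theorem halfWeight_of_ne {i j : ℕ} (h : i ≠ j) (h' : i ≠ j + 1) : halfWeight i j = 0 := by
  simp [halfWeight, h, h']

/-- Cartan elements are extended by 1 and raising or lowering generators by 0, so that the relations
hold for all natural indices without range conditions. -/
theorem IsUq.isTorus (H : IsUq h c) :
    IsTorus (qExp h (1 / 2)) (extendOne c.k) (extendOne c.kInv) (extendZero c.f) where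
  kk' i := by
    by_cases hi : i < m
    · simp [extendOne, hi, H.k_kInv]
    · simp [extendOne, hi]
  k'k i := by
    by_cases hi : i < m
    · simp [extendOne, hi, H.kInv_k]
    · simp [extendOne, hi]
  k_k i j := by
    by_cases hi : i < m <;> by_cases hj : j < m <;> simp [extendOne, hi, hj, H.k_k ⟨i, _⟩ ⟨j, _⟩]
  k_f_self i := by
    by_cases hi : i + 1 < m
    · rw [extendZero_of_lt _ hi, extendOne_of_lt _ (by omega), H.k_f, halfWeight_self, qExp_neg]
    · simp [extendZero_of_le _ (not_lt.mp hi)]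
  k_f_succ i := by
    by_cases hi : i + 1 < m
    · rw [extendZero_of_lt _ hi, extendOne_of_lt _ hi, H.k_f, halfWeight_succ, neg_neg]
    · simp [extendZero_of_le _ (not_lt.mp hi)]
  k_f i j hij hij' := by
    by_cases hj : j + 1 < m
    · by_cases hi : i < m
      · rw [extendZero_of_lt _ hj, extendOne_of_lt _ hi, H.k_f, halfWeight_of_ne hij hij', neg_zero,
          qExp_zero, one_smul]
      · simp [extendOne_of_le _ (not_lt.mp hi)]
    · simp [extendZero_of_le _ (not_lt.mp hj)]

/-- Replacing k by its inverse reverses weights, so the raising generators have the same weights for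
k⁻¹ as the lowering ones for k. Everything proved for L_+ thus applies to L_-. -/
theorem IsUq.isTorus' (H : IsUq h c) :
    IsTorus (qExp h (1 / 2)) (extendOne c.kInv) (extendOne c.k) (extendZero c.e) where
  kk' := H.isTorus.k'k
  k'k := H.isTorus.kk'
  k_k := H.isTorus.k'_k'
  k_f_self i := by
    by_cases hi : i + 1 < m
    · rw [extendZero_of_lt _ hi, extendOne_of_lt _ (by omega)]
      refine inv_qcomm (qExp_ne_zero _ _) (H.k_kInv _) (H.kInv_k _) ?_
      rw [H.k_e, halfWeight_self]
    · simp [extendZero_of_le _ (not_lt.mp hi)]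
  k_f_succ i := by
    by_cases hi : i + 1 < m
    · rw [extendZero_of_lt _ hi, extendOne_of_lt _ hi]
      have := inv_qcomm (inv_ne_zero (qExp_ne_zero h (1 / 2))) (H.k_kInv _) (H.kInv_k _)
        (f := c.e i hi) (by rw [H.k_e ⟨i + 1, hi⟩, halfWeight_succ, qExp_neg])
      rwa [inv_inv] at this
    · simp [extendZero_of_le _ (not_lt.mp hi)]
  k_f i j hij hij' := by
    by_cases hj : j + 1 < m
    · by_cases hi : i < m
      · rw [extendZero_of_lt _ hj, extendOne_of_lt _ hi]
        refine inv_comm (H.k_kInv _) (H.kInv_k _) ?_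
        rw [H.k_e, halfWeight_of_ne hij hij', qExp_zero, one_smul]
      · simp [extendOne_of_le _ (not_lt.mp hi)]
    · simp [extendZero_of_le _ (not_lt.mp hj)]

/-- Stripping the Cartan factors from [f_j, L_{sj}] turns the commutator into the q⁻¹-commutator
that defines the lowering Cartan–Weyl generators; here κ = 1. -/
theorem laxPlus_eq_upper (hl : lam h ≠ 0)
    (T : IsTorus (qExp h (1 / 2)) (extendOne c.k) (extendOne c.kInv) (extendZero c.f))
    (i j : Fin m) : laxPlus h c i j =
      upper (lam h) (c.triangular h).a (c.triangular h).b (c.triangular h).f i j := by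
  rcases lt_trichotomy i j with hij | rfl | hij
  · obtain ⟨i, hi⟩ := i
    obtain ⟨j, hj⟩ := j
    obtain ⟨d, rfl⟩ : ∃ d, j = i + d + 1 := ⟨j - i - 1, by simp at hij; omega⟩
    have key := T.upper_eq (qExp_ne_zero _ _) hl (σ := lam h * qExp h (-(1 / 2))) (κ := 1)
      (by rw [qExp_neg, mul_assoc, inv_mul_cancel₀ (qExp_ne_zero _ _)]) (i := i)
      -- Zero beyond the range, where the extended f vanishes as well, so that the recursion holds
      -- for every d.
      (E := fun d => if hd : i + d + 1 < m then lowering h c i d hd else 0) rfl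
      (fun d => by
        by_cases hd : i + (d + 1) + 1 < m
        · simp only [dif_pos hd, dif_pos (show i + d + 1 < m by omega), lowering, qComm, one_smul,
            extendZero_of_lt c.f (show i + d + 1 + 1 < m by omega), qExp_half_sq, ← qExp_neg]
        · simp only [dif_neg hd, extendZero_of_le c.f (show m ≤ i + d + 1 + 1 by omega), zero_mul,
            mul_zero, smul_zero, sub_zero]) d
    refine Eq.trans ?_ key.symm
    simp only [laxPlus, Matrix.of_apply, if_pos hij, cartanWeyl]
    rw [dif_neg (show ¬ i + d + 1 < i by omega), dif_pos (show i < i + d + 1 by omega), dif_pos hj,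
        extendOne_of_lt _ hi,
      extendOne_of_lt _ hj]
    congr 3
    omega
  · rw [upper_self]
    simp [laxPlus, ChevalleyData.triangular, extendOne]
  · rw [upper_of_lt hij]
    simp [laxPlus, hij, hij.not_gt]

/-- The raising generators obey E f - q f E = -q (f E - q⁻¹ E f), whence κ = -q, in accordance with
the prefactor σ = -λ q^{1/2} of L_-. -/
theorem laxMinus_eq_upper (hl : lam h ≠ 0)
    (T : IsTorus (qExp h (1 / 2)) (extendOne c.kInv) (extendOne c.k) (extendZero c.e))
    (i j : Fin m) : laxMinus h c i j =
      upper (lam h) (c.triangular h).b (c.triangular h).a (c.triangular h).e j i := by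
  rcases lt_trichotomy j i with hij | rfl | hij
  · obtain ⟨t, hj⟩ := i
    obtain ⟨i, hi⟩ := j
    obtain ⟨d, rfl⟩ : ∃ d, t = i + d + 1 := ⟨t - i - 1, by simp at hij; omega⟩
    have key := T.upper_eq (qExp_ne_zero _ _) hl (σ := -(lam h * qExp h (1 / 2)))
      (κ := -(qExp h 1)) (by rw [← qExp_half_sq]; ring) (i := i)
      (E := fun d => if hd : i + d + 1 < m then raising h c i d hd else 0) rfl
      (fun d => by
        by_cases hd : i + (d + 1) + 1 < m
        · simp only [dif_pos hd, dif_pos (show i + d + 1 < m by omega), raising, qComm,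
            extendZero_of_lt c.e (show i + d + 1 + 1 < m by omega), qExp_half_sq, smul_sub,
            smul_smul, neg_mul, mul_inv_cancel₀ (qExp_ne_zero h 1)]
          module
        · simp only [dif_neg hd, extendZero_of_le c.e (show m ≤ i + d + 1 + 1 by omega), zero_mul,
            mul_zero, smul_zero, sub_zero]) d
    have e : (c.triangular h).e = fun i => (-(lam h * qExp h (1 / 2))) •
        (extendOne c.kInv i * extendOne c.kInv (i + 1) * extendZero c.e i) := by
      funext i
      rw [T.k_k]; rfl
    rw [e]
    refine Eq.trans ?_ key.symm
    simp only [laxMinus, Matrix.of_apply, if_pos hij, if_neg hij.not_gt, cartanWeyl]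
    rw [dif_pos (show i < i + d + 1 by omega), dif_pos hj, T.k_k, extendOne_of_lt _ hi,
      extendOne_of_lt _ hj, neg_smul]
    congr 4
    omega
  · rw [upper_self]
    simp [laxMinus, ChevalleyData.triangular, extendOne]
  · rw [upper_of_lt hij]
    simp [laxMinus, hij]

theorem lam_eq (h : ℂ) : lam h = qExp h 1 - (qExp h 1)⁻¹ := by rw [lam, qExp_neg]

theorem IsUq.relations (hl : lam h ≠ 0) (H : IsUq h c) :
    Relations (qExp h 1) (lam h) m (c.triangular h) := by
  have hs := qExp_ne_zero h (1 / 2)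
  have hs' := qExp_ne_zero h (-(1 / 2))
  have T := H.isTorus
  have T' := H.isTorus'
  have e : (c.triangular h).e = fun i => (-(lam h * qExp h (1 / 2))) •
      (extendOne c.kInv i * extendOne c.kInv (i + 1) * extendZero c.e i) := by
    funext i
    rw [T'.k_k]; rfl
  refine ⟨?_, ?_, ?_⟩
  · rw [← qExp_half_sq]
    refine (T.isBorel_iff hs (mul_ne_zero hl hs')).mpr ⟨fun i j hij => ?_, fun i => ?_, fun i => ?_⟩
    · by_cases hj : j + 1 < m
      · rw [extendZero_of_lt _ hj, extendZero_of_lt _ (by omega : i + 1 < m), H.f_f _ _ _ _ hij]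
      · simp [extendZero_of_le _ (not_lt.mp hj)]
    · by_cases hj : i + 1 + 1 < m
      · rw [extendZero_of_lt _ hj, extendZero_of_lt _ (by omega : i + 1 < m), qExp_half_sq,
          ← qExp_neg]
        exact H.serre_f _ _ _ _ (Or.inl rfl)
      · simp [extendZero_of_le _ (not_lt.mp hj)]
    · by_cases hj : i + 1 + 1 < m
      · rw [extendZero_of_lt _ hj, extendZero_of_lt _ (by omega : i + 1 < m), qExp_half_sq,
          ← qExp_neg]
        exact H.serre_f _ _ _ _ (Or.inr rfl)
      · simp [extendZero_of_le _ (not_lt.mp hj)]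
  · rw [← qExp_half_sq, e]
    refine (T'.isBorel_iff hs (neg_ne_zero.mpr (mul_ne_zero hl hs))).mpr
      ⟨fun i j hij => ?_, fun i => ?_, fun i => ?_⟩
    · by_cases hj : j + 1 < m
      · rw [extendZero_of_lt _ hj, extendZero_of_lt _ (by omega : i + 1 < m), H.e_e _ _ _ _ hij]
      · simp [extendZero_of_le _ (not_lt.mp hj)]
    · by_cases hj : i + 1 + 1 < m
      · rw [extendZero_of_lt _ hj, extendZero_of_lt _ (by omega : i + 1 < m), qExp_half_sq,
          ← qExp_neg]
        exact H.serre_e _ _ _ _ (Or.inl rfl)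
      · simp [extendZero_of_le _ (not_lt.mp hj)]
    · by_cases hj : i + 1 + 1 < m
      · rw [extendZero_of_lt _ hj, extendZero_of_lt _ (by omega : i + 1 < m), qExp_half_sq,
          ← qExp_neg]
        exact H.serre_e _ _ _ _ (Or.inr rfl)
      · simp [extendZero_of_le _ (not_lt.mp hj)]
  · rw [← qExp_half_sq]
    refine (T.isMixed_iff T' hs hl (by rw [qExp_neg]; field_simp) m).mpr
      ⟨fun i hi => ?_, fun i j hij => ?_⟩
    · rw [extendZero_of_lt _ hi, extendZero_of_lt _ hi, H.e_f_self, extendOne_of_lt _ hi,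
        extendOne_of_lt _ hi, extendOne_of_lt _ (by omega : i < m),
        extendOne_of_lt _ (by omega : i < m)]
    · by_cases hi : i + 1 < m
      · by_cases hj : j + 1 < m
        · rw [extendZero_of_lt _ hi, extendZero_of_lt _ hj, H.e_f_ne _ _ _ _ hij]
        · simp [extendZero_of_le _ (not_lt.mp hj)]
      · simp [extendZero_of_le _ (not_lt.mp hi)]

/-- `Relations` contains the Cartan elements only as the squares q^{±N_i}. The weights with respect
to q^{N_i/2} are not determined by it and enter through the two torus hypotheses. -/
theorem isUq_of_relations (hl : lam h ≠ 0)
    (T : IsTorus (qExp h (1 / 2)) (extendOne c.k) (extendOne c.kInv) (extendZero c.f))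
    (T' : IsTorus (qExp h (1 / 2)) (extendOne c.kInv) (extendOne c.k) (extendZero c.e))
    (R : Relations (qExp h 1) (lam h) m (c.triangular h)) : IsUq h c := by
  have hs := qExp_ne_zero h (1 / 2)
  have hs' := qExp_ne_zero h (-(1 / 2))
  have e : (c.triangular h).e = fun i => (-(lam h * qExp h (1 / 2))) •
      (extendOne c.kInv i * extendOne c.kInv (i + 1) * extendZero c.e i) := by
    funext i
    rw [T'.k_k]; rfl
  obtain ⟨R1, R2, R3⟩ := R
  rw [← qExp_half_sq] at R1 R2 R3
  have R3 := (T.isMixed_iff T' hs hl (by rw [qExp_neg]; field_simp) m).mp R3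
  rw [e] at R2
  have R1 := (T.isBorel_iff hs (mul_ne_zero hl hs')).mp R1
  have R2 := (T'.isBorel_iff hs (neg_ne_zero.mpr (mul_ne_zero hl hs))).mp R2
  rw [qExp_half_sq, ← qExp_neg] at R1 R2
  refine ⟨fun i => ?_, fun i => ?_, fun i j => ?_, fun i j hj => ?_, fun i j hj => ?_,
    fun i hi => ?_, fun i j hi hj hij => ?_, fun i j hi hj hij => ?_, fun i j hi hj hij => ?_,
    fun i j hi hj hij => ?_, fun i j hi hj hij => ?_⟩
  · simpa [extendOne] using T.kk' i
  · simpa [extendOne] using T.k'k i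
  · simpa [extendOne] using T.k_k i j
  · have e1 : c.k i = extendOne c.k i := by simp [extendOne]
    rw [← extendZero_of_lt c.e hj, e1]
    by_cases h1 : (i : ℕ) = j
    · rw [h1, halfWeight_self]
      rw [T'.f_k'_self hs j, smul_smul, mul_inv_cancel₀ hs, one_smul]
    · by_cases h2 : (i : ℕ) = j + 1
      · rw [h2, halfWeight_succ, T'.f_k'_succ hs j, smul_smul, ← qExp_add]
        simp [qExp_zero]
      · rw [halfWeight_of_ne h1 h2, T'.f_k' _ _ h1 h2, qExp_zero, one_smul]
  · have e1 : c.k i = extendOne c.k i := by simp [extendOne]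
    rw [← extendZero_of_lt c.f hj, e1]
    by_cases h1 : (i : ℕ) = j
    · rw [h1, halfWeight_self, T.k_f_self, qExp_neg]
    · by_cases h2 : (i : ℕ) = j + 1
      · rw [h2, halfWeight_succ, T.k_f_succ, neg_neg]
      · rw [halfWeight_of_ne h1 h2, T.k_f _ _ h1 h2, neg_zero, qExp_zero, one_smul]
  · simpa only [extendZero_of_lt _ hi, extendOne_of_lt _ hi,
      extendOne_of_lt _ (show i < m by omega)] using R3.1 i hi
  · simpa only [extendZero_of_lt _ hi, extendZero_of_lt _ hj] using R3.2 i j hij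
  · simpa only [extendZero_of_lt _ hi, extendZero_of_lt _ hj] using (R2.1 i j hij).symm
  · simpa only [extendZero_of_lt _ hi, extendZero_of_lt _ hj] using (R1.1 i j hij).symm
  · rcases hij with rfl | rfl
    · simpa only [extendZero_of_lt _ hi, extendZero_of_lt _ hj] using R2.2.1 i
    · simpa only [extendZero_of_lt _ hi, extendZero_of_lt _ hj] using R2.2.2 j
  · rcases hij with rfl | rfl
    · simpa only [extendZero_of_lt _ hi, extendZero_of_lt _ hj] using R1.2.1 i
    · simpa only [extendZero_of_lt _ hi, extendZero_of_lt _ hj] using R1.2.2 j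

end LaxEntries

/-! ### Joint eigenvectors of the operators `N_i` -/

/-- Applying N - ν removes the ν-component from the sum and multiplies the others by nonzero
scalars, so induction on the number of eigenvalues separates the components inside an invariant
subspace. -/
theorem mem_of_sum_eigenvectors_mem {F : Type*} [AddCommGroup F] [Module ℂ F] (N : Module.End ℂ F)
    (p : Submodule ℂ F) (hp : ∀ x ∈ p, N x ∈ p) (s : Finset ℂ) (v : ℂ → F)
    (hv : ∀ μ ∈ s, N (v μ) = μ • v μ) (h : ∑ μ ∈ s, v μ ∈ p) : ∀ μ ∈ s, v μ ∈ p := by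
  induction s using Finset.induction_on generalizing v with
  | empty => simp
  | insert ν s hν ih =>
    have h1 : ∑ μ ∈ s, (μ - ν) • v μ ∈ p := by
      have h2 := p.sub_mem (hp _ h) (p.smul_mem ν h)
      rw [map_sum, Finset.smul_sum, ← Finset.sum_sub_distrib, Finset.sum_insert hν,
        hv ν (Finset.mem_insert_self _ _), sub_self, zero_add] at h2
      refine (congrArg (· ∈ p) (Finset.sum_congr rfl fun μ hμ => ?_)).mp h2
      rw [hv μ (Finset.mem_insert_of_mem hμ), sub_smul]
    have h2 : ∀ μ ∈ s, v μ ∈ p := fun μ hμ => by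
      have h3 := ih (fun μ => (μ - ν) • v μ) (fun μ hμ => by
        rw [map_smul, hv μ (Finset.mem_insert_of_mem hμ), smul_comm]) h1 μ hμ
      have h4 : μ - ν ≠ 0 := sub_ne_zero.mpr (by rintro rfl; exact hν hμ)
      exact (p.smul_mem_iff h4).mp h3
    intro μ hμ
    rcases Finset.mem_insert.mp hμ with rfl | hμ
    · rw [Finset.sum_insert hν] at h
      exact (p.add_mem_iff_left (p.sum_mem h2)).mp h
    · exact h2 μ hμ

namespace HeisenbergPairs

variable {r : ℕ} {F : Type*} [AddCommGroup F] [Module ℂ F] (P : HeisenbergPairs r F)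

/-- `N_i = x_i ∂_i`. -/
def number (i : Fin r) : Module.End ℂ F := (P.x i : Module.End ℂ F) * P.del i

theorem number_x (i j : Fin r) : P.number i * P.x j =
    P.x j * P.number i + if i = j then (P.x j : Module.End ℂ F) else 0 := by
  have h1 := P.del_x i j
  rw [sub_eq_iff_eq_add] at h1
  rw [number, mul_assoc, h1, ← mul_assoc, mul_add, ← mul_assoc, P.x_comm i j, add_comm]
  split_ifs with h
  · rw [h]; simp
  · simp

theorem number_comm (i j : Fin r) : P.number i * P.number j = P.number j * P.number i := by
  by_cases h : i = j
  · rw [h]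
  have h1 := P.del_x i j
  have h2 := P.del_x j i
  rw [if_neg h, sub_eq_zero] at h1
  rw [if_neg (Ne.symm h), sub_eq_zero] at h2
  simp only [number, mul_assoc, mul_comm_assoc h1, mul_comm_assoc h2, P.del_comm i j,
    mul_comm_assoc (P.x_comm i j)]

/-- `v` is a joint eigenvector of the operators `N_i`, with eigenvalues `μ_i`. -/
def IsJoint (μ : Fin r → ℂ) (v : F) : Prop := ∀ i, P.number i v = μ i • v

/-- Joint eigenvectors span F. The induction is on the set of indices for which v need not be an
eigenvector: v is split into N_i-eigenvectors, and the components remain in the chosen eigenspaces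
of the other N_j, because N_i preserves those. -/
theorem end_ext {T S : Module.End ℂ F} (h : ∀ μ v, P.IsJoint μ v → T v = S v) : T = S := by
  suffices H : ∀ (t : Finset (Fin r)) (μ : Fin r → ℂ) (v : F),
      (∀ i, i ∉ t → P.number i v = μ i • v) → v ∈ LinearMap.eqLocus T S from
    LinearMap.ext fun v => H Finset.univ 0 v (fun i hi => absurd (Finset.mem_univ i) hi)
  intro t
  induction t using Finset.induction_on with
  | empty => exact fun μ v hv => h μ v fun i => hv i (Finset.notMem_empty i)
  | insert i t hi ih =>
    intro μ v hv
    let p : Submodule ℂ F := ⨅ j : {j // j ∉ insert i t}, (P.number j).eigenspace (μ j)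
    have mem_p : ∀ w, w ∈ p ↔ ∀ j, j ∉ insert i t → P.number j w = μ j • w := fun w => by
      simp only [p, Submodule.mem_iInf, Module.End.mem_eigenspace_iff, Subtype.forall]
    have hp : ∀ w ∈ p, P.number i w ∈ p := fun w hw => by
      rw [mem_p] at hw ⊢
      intro j hj
      rw [← Module.End.mul_apply, P.number_comm, Module.End.mul_apply, hw j hj, map_smul]
    have h1 : v ∈ ⨆ ν : ℂ, (P.number i).eigenspace ν := by
      rw [show (⨆ ν : ℂ, (P.number i).eigenspace ν) = ⊤ from P.diagonalizable i]; trivial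
    obtain ⟨f, hf, hfv⟩ := (Submodule.mem_iSup_iff_exists_finsupp _ _).mp h1
    have hv' : ∑ ν ∈ f.support, f ν ∈ p := by
      have : ∑ ν ∈ f.support, f ν = v := hfv
      rw [this, mem_p]; exact hv
    have h2 := mem_of_sum_eigenvectors_mem (P.number i) p hp f.support f
      (fun ν _ => Module.End.mem_eigenspace_iff.mp (hf ν)) hv'
    rw [← hfv]
    refine Submodule.sum_mem _ fun ν hν => ih (Function.update μ i ν) _ fun j hj => ?_
    by_cases hji : j = i
    · subst hji
      rw [Function.update_self]
      exact Module.End.mem_eigenspace_iff.mp (hf ν)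
    · rw [Function.update_of_ne hji]
      exact (mem_p _).mp (h2 ν hν) j (by simp [hji, hj])

theorem pairwise_commute : Pairwise fun i j => ∀ a b : Multiplicative ℤ,
    Commute (zpowersHom (Module.End ℂ F)ˣ (P.x i) a) (zpowersHom (Module.End ℂ F)ˣ (P.x j) b) :=
  fun i j _ _ _ => Commute.zpow_zpow (Units.ext (P.x_comm i j)) _ _

/-- The monomial `∏ x_i ^ d_i`. -/
def monomial (d : Fin r → ℤ) : (Module.End ℂ F)ˣ :=
  MonoidHom.noncommPiCoprod (fun i => zpowersHom _ (P.x i)) P.pairwise_commute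
    (fun i => Multiplicative.ofAdd (d i))

theorem monomial_add (d d' : Fin r → ℤ) :
    P.monomial (d + d') = P.monomial d * P.monomial d' := by
  rw [monomial, monomial, monomial, ← map_mul]; rfl

theorem monomial_zero : P.monomial 0 = 1 := by
  rw [monomial]
  exact map_one _

theorem monomial_single (i : Fin r) (k : ℤ) : P.monomial (Pi.single i k) = P.x i ^ k := by
  have : (fun j => Multiplicative.ofAdd ((Pi.single i k : Fin r → ℤ) j))
      = Pi.mulSingle i (Multiplicative.ofAdd k) := by
    funext j
    by_cases h : j = i
    · subst h; simp
    · simp [h]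
  rw [monomial, this, MonoidHom.noncommPiCoprod_mulSingle]
  simp

/-- The exponents d for which this holds are closed under addition and negation and contain the unit
vectors, for which it is the Heisenberg relation. -/
theorem number_monomial (i : Fin r) (d : Fin r → ℤ) :
    P.number i * P.monomial d = P.monomial d * P.number i + (d i : ℂ) • (P.monomial d :
        Module.End ℂ F) := by
  have key : ∀ d d' : Fin r → ℤ,
      P.number i * P.monomial d = P.monomial d * P.number i + (d i : ℂ) • (P.monomial d :
          Module.End ℂ F) →
      P.number i * P.monomial d' = P.monomial d' * P.number i + (d' i : ℂ) • (P.monomial d' :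
          Module.End ℂ F) →
      P.number i * P.monomial (d + d') = P.monomial (d + d') * P.number i
        + ((d + d') i : ℂ) • (P.monomial (d + d') : Module.End ℂ F) := by
    intro d d' h1 h2
    rw [monomial_add, Units.val_mul, ← mul_assoc, h1, add_mul, mul_assoc, h2]
    simp only [mul_add, mul_smul_comm, smul_mul_assoc, mul_assoc, Pi.add_apply, Int.cast_add]
    module
  have neg : ∀ d : Fin r → ℤ,
      P.number i * P.monomial d = P.monomial d * P.number i + (d i : ℂ) • (P.monomial d :
          Module.End ℂ F) →
      P.number i * P.monomial (-d) = P.monomial (-d) * P.number i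
        + ((-d) i : ℂ) • (P.monomial (-d) : Module.End ℂ F) := by
    intro d h1
    have e : P.monomial (-d) = (P.monomial d)⁻¹ := by
      rw [eq_inv_iff_mul_eq_one, ← monomial_add, neg_add_cancel, monomial_zero]
    rw [e]
    apply (P.monomial d).isUnit.mul_left_cancel
    rw [mul_add, ← mul_assoc, ← mul_assoc, Units.mul_inv, one_mul]
    have h2 : (P.monomial d : Module.End ℂ F) * P.number i
        = P.number i * P.monomial d - (d i : ℂ) • (P.monomial d : Module.End ℂ F) := by
      rw [h1, add_sub_cancel_right]
    rw [h2, sub_mul, mul_assoc, Units.mul_inv, mul_one, smul_mul_assoc, Units.mul_inv,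
      mul_smul_comm, Units.mul_inv]
    simp only [Pi.neg_apply, Int.cast_neg]
    module
  have single : ∀ j (k : ℤ), P.number i * P.monomial (Pi.single j k)
      = P.monomial (Pi.single j k) * P.number i
        + ((Pi.single j k : Fin r → ℤ) i : ℂ) • (P.monomial (Pi.single j k) : Module.End ℂ F) := by
    intro j k
    have nat : ∀ k : ℕ, P.number i * P.monomial (Pi.single j (k : ℤ))
        = P.monomial (Pi.single j (k : ℤ)) * P.number i
        + ((Pi.single j (k : ℤ) : Fin r → ℤ) i : ℂ) • (P.monomial (Pi.single j (k : ℤ)) :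
            Module.End ℂ F) := by
      intro k
      induction k with
      | zero => simp [monomial_zero]
      | succ k ih =>
        rw [Nat.cast_succ, Pi.single_add]
        refine key _ _ ih ?_
        rw [monomial_single, zpow_one, number_x]
        by_cases h : i = j
        · subst h; simp
        · simp [h]
    obtain ⟨k, rfl | rfl⟩ := k.eq_nat_or_neg
    · exact nat k
    · rw [Pi.single_neg]; exact neg _ (nat k)
  rw [← Finset.univ_sum_single d]
  refine Finset.sum_induction _ (fun d => P.number i * P.monomial d
    = P.monomial d * P.number i + (d i : ℂ) • (P.monomial d : Module.End ℂ F)) key ?_ (fun j _ =>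
        single j _)
  simp [monomial_zero]

/-- Monomials in the x_i shift joint eigenvalues by integers; this makes the calculus of `Acts`
multiplicative. -/
theorem IsJoint.monomial {P : HeisenbergPairs r F} {μ : Fin r → ℂ} {v : F} (hv : P.IsJoint μ v)
    (d : Fin r → ℤ) : P.IsJoint (fun i => μ i + d i) ((P.monomial d : Module.End ℂ F) v) := by
  intro i
  rw [← Module.End.mul_apply, number_monomial]
  simp only [LinearMap.add_apply, Module.End.mul_apply, LinearMap.smul_apply, hv i, map_smul]
  module

/-- `T` acts on joint eigenvectors by `φ(N) x ^ d`. -/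
def Acts (T : Module.End ℂ F) (d : Fin r → ℤ) (φ : (Fin r → ℂ) → ℂ) : Prop :=
  ∀ μ v, P.IsJoint μ v → T v = φ μ • (P.monomial d : Module.End ℂ F) v

variable {P} {T S : Module.End ℂ F} {d d' : Fin r → ℤ} {φ ψ : (Fin r → ℂ) → ℂ}

/-- An operator identity is reduced to equality of the monomial exponents and of two scalar
functions of the eigenvalues. -/
theorem Acts.eq (hT : P.Acts T d φ) (hS : P.Acts S d' ψ) (hd : d = d') (h : ∀ μ, φ μ = ψ μ) :
    T = S :=
  P.end_ext fun μ v hv => by rw [hT μ v hv, hS μ v hv, hd, h]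

theorem Acts.mul (hT : P.Acts T d φ) (hS : P.Acts S d' ψ) :
    P.Acts (T * S) (d + d') (fun μ => ψ μ * φ (fun i => μ i + d' i)) := by
  intro μ v hv
  rw [Module.End.mul_apply, hS μ v hv, map_smul, hT _ _ (hv.monomial d'), monomial_add,
    Units.val_mul, Module.End.mul_apply, smul_smul]

theorem Acts.add (hT : P.Acts T d φ) (hS : P.Acts S d' ψ) (hd : d = d') :
    P.Acts (T + S) d (fun μ => φ μ + ψ μ) := by
  intro μ v hv
  rw [LinearMap.add_apply, hT μ v hv, hS μ v hv, hd, add_smul]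

theorem Acts.sub (hT : P.Acts T d φ) (hS : P.Acts S d' ψ) (hd : d = d') :
    P.Acts (T - S) d (fun μ => φ μ - ψ μ) := by
  intro μ v hv
  rw [LinearMap.sub_apply, hT μ v hv, hS μ v hv, hd, sub_smul]

theorem Acts.smul (hT : P.Acts T d φ) (c : ℂ) : P.Acts (c • T) d (fun μ => c * φ μ) := by
  intro μ v hv
  rw [LinearMap.smul_apply, hT μ v hv, smul_smul]

theorem Acts.zero (d : Fin r → ℤ) : P.Acts 0 d (fun _ => 0) := by
  intro μ v hv
  simp

theorem Acts.one : P.Acts 1 0 (fun _ => 1) := by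
  intro μ v hv
  simp [monomial_zero]

theorem acts_monomial (d : Fin r → ℤ) : P.Acts (P.monomial d : Module.End ℂ F) d (fun _ => 1) := by
  intro μ v hv
  simp

theorem acts_x (i : Fin r) : P.Acts (P.x i : Module.End ℂ F) (Pi.single i 1) (fun _ => 1) := by
  have := acts_monomial (P := P) (Pi.single i 1)
  rwa [monomial_single, zpow_one] at this

theorem acts_x_inv (i : Fin r) :
    P.Acts (↑(P.x i)⁻¹ : Module.End ℂ F) (Pi.single i (-1)) (fun _ => 1) := by
  have := acts_monomial (P := P) (Pi.single i (-1))
  rwa [monomial_single, zpow_neg_one] at this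

theorem acts_qN (h : ℂ) (i : Fin r) (c : ℂ) : P.Acts (P.qN h i c) 0 (fun μ => qExp h (c * μ i)) :=
    by
  intro μ v hv
  rw [monomial_zero]
  exact qPow_apply h _ _ c (μ i) v (hv i)

theorem acts_numN (h : ℂ) (i : Fin r) : P.Acts (P.numN h i) 0 (fun μ => qNum h (μ i)) := by
  intro μ v hv
  have := (((acts_qN (P := P) h i 1).sub (acts_qN h i (-1)) rfl).smul (lam h)⁻¹) μ v hv
  rw [numN, this]
  simp only [one_mul, neg_one_mul, qNum, div_eq_inv_mul]

theorem acts_qWeight (h : ℂ) (a : Fin r → ℂ) :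
    P.Acts (P.qWeight h a) 0 (fun μ => qExp h (∑ i, a i * μ i)) := by
  intro μ v hv
  have key : ∀ l : List (Fin r), (l.map fun i => P.qN h i (a i)).prod v
      = (l.map fun i => qExp h (a i * μ i)).prod • v := by
    intro l
    induction l with
    | nil => simp
    | cons i l ih =>
      have := acts_qN (P := P) h i (a i) μ v hv
      rw [monomial_zero] at this
      rw [List.map_cons, List.prod_cons, List.map_cons, List.prod_cons, Module.End.mul_apply, ih,
        map_smul, this, Units.val_one, Module.End.one_apply, smul_smul, mul_comm]
  rw [qWeight, List.ofFn_eq_map, key, ← List.ofFn_eq_map, List.prod_ofFn, monomial_zero]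
  simp only [qExp, Finset.mul_sum, Complex.exp_sum, Units.val_one, Module.End.one_apply]

end HeisenbergPairs

/-! ### Identities of q-numbers and the Jordan–Schwinger relations. -/

theorem qExp_sub (h a b : ℂ) : qExp h (a - b) = qExp h a * (qExp h b)⁻¹ := by
  rw [sub_eq_add_neg, qExp_add, qExp_neg]

/-- The scalar content of the Jordan–Schwinger Serre relations: the two generators share one
eigenvalue, and the three words of the relation evaluate its q-number at three consecutive
arguments. -/
theorem qNum_serre (h : ℂ) (hl : lam h ≠ 0) (b : ℂ) :
    qNum h (b + 1) + qNum h (b - 1) = (qExp h 1 + qExp h (-1)) * qNum h b := by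
  have h1 := qExp_ne_zero h 1
  have h2 := qExp_ne_zero h b
  simp only [qNum, neg_add, neg_sub, qExp_add, qExp_sub, qExp_neg]
  field_simp
  ring

/-- The scalar content of [e_i, f_i] on a joint eigenvector with N_i = a and N_{i+1} = b. -/
theorem qNum_exchange (h : ℂ) (hl : lam h ≠ 0) (a b : ℂ) :
    qNum h a * qNum h (b + 1) - qNum h b * qNum h (a + 1)
      = (lam h)⁻¹ * (qExp h (a - b) - qExp h (b - a)) := by
  have h1 := qExp_ne_zero h 1
  have h2 := qExp_ne_zero h b
  have h3 := qExp_ne_zero h a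
  simp only [qNum, neg_add, qExp_add, qExp_sub, qExp_neg]
  have : lam h = qExp h 1 - (qExp h 1)⁻¹ := lam_eq h
  field_simp
  rw [this]
  field_simp
  ring

namespace HeisenbergPairs

variable {r : ℕ} {F : Type*} [AddCommGroup F] [Module ℂ F] {P : HeisenbergPairs r F}

theorem Acts.congr {T : Module.End ℂ F} {d d' : Fin r → ℤ} {φ ψ : (Fin r → ℂ) → ℂ}
    (hT : P.Acts T d φ) (hd : d = d') (h : ∀ μ, φ μ = ψ μ) : P.Acts T d' ψ := by
  subst hd
  intro μ v hv
  rw [hT μ v hv, h]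

theorem acts_e (h : ℂ) (i : ℕ) (hi : i + 1 < r) :
    P.Acts ((P.jsData h).e i hi) (Pi.single ⟨i, by omega⟩ 1 + Pi.single ⟨i + 1, hi⟩ (-1))
      (fun μ => qNum h (μ ⟨i + 1, hi⟩)) :=
  (((acts_x _).mul (acts_x_inv _)).mul (acts_numN h _)).congr (by simp) (by simp)

theorem acts_f (h : ℂ) (i : ℕ) (hi : i + 1 < r) :
    P.Acts ((P.jsData h).f i hi) (Pi.single ⟨i + 1, hi⟩ 1 + Pi.single ⟨i, by omega⟩ (-1))
      (fun μ => qNum h (μ ⟨i, by omega⟩)) :=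
  (((acts_x _).mul (acts_x_inv _)).mul (acts_numN h _)).congr (by simp) (by simp)

theorem qN_mul (h : ℂ) (i : Fin r) (c c' : ℂ) : P.qN h i c * P.qN h i c' = P.qN h i (c + c') :=
  ((acts_qN h i c).mul (acts_qN h i c')).eq (acts_qN h i _) (by simp) fun μ => by
    simp only [Pi.zero_apply, Int.cast_zero, add_zero, ← qExp_add]
    ring_nf

theorem qN_comm (h : ℂ) (i j : Fin r) (c c' : ℂ) :
    P.qN h i c * P.qN h j c' = P.qN h j c' * P.qN h i c :=
  ((acts_qN h i c).mul (acts_qN h j c')).eq ((acts_qN h j c').mul (acts_qN h i c)) (by simp)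
    fun μ => by simp [mul_comm]

theorem qN_zero (h : ℂ) (i : Fin r) : P.qN h i 0 = 1 :=
  (acts_qN h i 0).eq Acts.one rfl fun μ => by simp [qExp_zero]

/-- The Jordan-Schwinger operators satisfy the relations of `U_q(gl(r))`. -/
theorem isUq_jsData (P : HeisenbergPairs r F) {h : ℂ} (hl : lam h ≠ 0) : IsUq h (P.jsData h) where
  k_kInv i := by
    show P.qN h i (1 / 2) * P.qN h i (-(1 / 2)) = 1
    rw [qN_mul, add_neg_cancel, qN_zero]
  kInv_k i := by
    show P.qN h i (-(1 / 2)) * P.qN h i (1 / 2) = 1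
    rw [qN_mul, neg_add_cancel, qN_zero]
  k_k i j := qN_comm h i j _ _
  k_e i j hj := by
    refine ((acts_qN h i (1 / 2)).mul (acts_e h j hj)).eq
      (((acts_e h j hj).mul (acts_qN h i (1 / 2))).smul _) (by abel) fun μ => ?_
    simp only [Pi.zero_apply, Int.cast_zero, add_zero, Pi.add_apply, Pi.single_apply, Fin.ext_iff,
      halfWeight]
    split_ifs <;> first | omega | (simp only [mul_add, qExp_add]; push_cast; ring_nf)
  k_f i j hj := by
    refine ((acts_qN h i (1 / 2)).mul (acts_f h j hj)).eq
      (((acts_f h j hj).mul (acts_qN h i (1 / 2))).smul _) (by abel) fun μ => ?_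
    simp only [Pi.zero_apply, Int.cast_zero, add_zero, Pi.add_apply, Pi.single_apply, Fin.ext_iff,
      halfWeight]
    split_ifs <;> first | omega | (simp only [mul_add, qExp_add]; push_cast; ring_nf)
  e_f_self i hi := by
    have e1 : (P.jsData h).k ⟨i, by omega⟩ ^ 2 = P.qN h ⟨i, by omega⟩ 1 := by
      rw [sq]; refine (qN_mul h _ _ _).trans ?_; norm_num
    have e2 : (P.jsData h).k ⟨i + 1, hi⟩ ^ 2 = P.qN h ⟨i + 1, hi⟩ 1 := by
      rw [sq]; refine (qN_mul h _ _ _).trans ?_; norm_num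
    have e3 : (P.jsData h).kInv ⟨i, by omega⟩ ^ 2 = P.qN h ⟨i, by omega⟩ (-1) := by
      rw [sq]; refine (qN_mul h _ _ _).trans ?_; norm_num
    have e4 : (P.jsData h).kInv ⟨i + 1, hi⟩ ^ 2 = P.qN h ⟨i + 1, hi⟩ (-1) := by
      rw [sq]; refine (qN_mul h _ _ _).trans ?_; norm_num
    rw [e1, e2, e3, e4]
    refine (((acts_e h i hi).mul (acts_f h i hi)).sub ((acts_f h i hi).mul (acts_e h i hi))
      (by abel)).eq ((((acts_qN h _ 1).mul (acts_qN h _ (-1))).sub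
      ((acts_qN h _ (-1)).mul (acts_qN h _ 1)) rfl).smul _) ?_ fun μ => ?_
    · simp only [Pi.single_neg]; abel
    · have := qNum_exchange h hl (μ ⟨i, by omega⟩) (μ ⟨i + 1, hi⟩)
      simp only [qExp_sub] at this
      simp [qExp_neg]
      linear_combination this
  e_f_ne i j hi hj hij := by
    refine ((acts_e h i hi).mul (acts_f h j hj)).eq ((acts_f h j hj).mul (acts_e h i hi))
      (by abel) fun μ => ?_
    by_cases h1 : i + 1 = j
    · subst h1; simp []
    · simp [hij, hij.symm, h1, Ne.symm h1, mul_comm]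
  e_e i j hi hj hij := by
    refine ((acts_e h i hi).mul (acts_e h j hj)).eq ((acts_e h j hj).mul (acts_e h i hi))
      (by abel) fun μ => ?_
    have h1 : i + 1 ≠ j := by omega
    have h2 : j + 1 ≠ i := by omega
    have h3 : i ≠ j := by omega
    simp [h1, h2, h3, h3.symm, mul_comm]
  f_f i j hi hj hij := by
    refine ((acts_f h i hi).mul (acts_f h j hj)).eq ((acts_f h j hj).mul (acts_f h i hi))
      (by abel) fun μ => ?_
    have h1 : i ≠ j + 1 := by omega
    have h2 : j ≠ i + 1 := by omega
    have h3 : i ≠ j := by omega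
    simp [h1, h2, h3, h3.symm, mul_comm]
  serre_e i j hi hj hij := by
    rw [sq]
    have E := acts_e (P := P) h i hi
    have E' := acts_e (P := P) h j hj
    refine (((((E.mul E).mul E').sub (((E.mul E').mul E).smul _) (by abel)).add
      (E'.mul (E.mul E)) (by abel))).eq (Acts.zero _) rfl fun μ => ?_
    rcases hij with rfl | rfl
    · have := qNum_serre h hl (μ ⟨i + 1, hi⟩)
      have h1 : ¬ i + 1 + 1 = i := by omega
      have h2 : ¬ i = i + 1 + 1 := by omega
      simp [h1]
      simp only [sub_eq_add_neg, add_assoc, one_add_one_eq_two] at this ⊢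
      linear_combination (qNum h (μ ⟨i + 1 + 1, hj⟩) * qNum h (μ ⟨i + 1, hi⟩)) * this
    · have := qNum_serre h hl (μ ⟨j + 1, hj⟩ + 1)
      have h1 : ¬ j + 1 + 1 = j := by omega
      have h2 : ¬ j = j + 1 + 1 := by omega
      simp [h1]
      simp only [sub_eq_add_neg, add_assoc, add_neg_cancel, add_zero, one_add_one_eq_two] at this ⊢
      linear_combination (qNum h (μ ⟨j + 1 + 1, hi⟩) * qNum h (μ ⟨j + 1 + 1, hi⟩ + -1)) * this
  serre_f i j hi hj hij := by
    rw [sq]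
    have E := acts_f (P := P) h i hi
    have E' := acts_f (P := P) h j hj
    refine (((((E.mul E).mul E').sub (((E.mul E').mul E).smul _) (by abel)).add
      (E'.mul (E.mul E)) (by abel))).eq (Acts.zero _) rfl fun μ => ?_
    rcases hij with rfl | rfl
    · have := qNum_serre h hl (μ ⟨i + 1, by omega⟩ + 1)
      have h1 : ¬ i + 1 + 1 = i := by omega
      have h2 : ¬ i = i + 1 + 1 := by omega
      simp [h2]
      simp only [sub_eq_add_neg, add_assoc, add_neg_cancel, add_zero, one_add_one_eq_two] at this ⊢
      linear_combination (qNum h (μ ⟨i, by omega⟩) * qNum h (μ ⟨i, by omega⟩ + -1)) * this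
    · have := qNum_serre h hl (μ ⟨j + 1, by omega⟩)
      have h1 : ¬ j + 1 + 1 = j := by omega
      have h2 : ¬ j = j + 1 + 1 := by omega
      simp [h2]
      simp only [sub_eq_add_neg, add_assoc] at this ⊢
      linear_combination (qNum h (μ ⟨j, by omega⟩) * qNum h (μ ⟨j + 1, by omega⟩)) * this

end HeisenbergPairs

/-! ### The q-oscillator algebra: closed formulas for the entries of L_±. -/

section Oscillator

variable {A : Type*} [Ring A] [Algebra ℂ A]

/-- The elements `X_0, …, X_n`, their inverses `Y_i`, and the triangular data composed from them
and from `a_i = q ^ N_i`, `b_i = q ^ (-N_i)`. -/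
structure IsOscillator (q : ℂ) (w : ℕ → ℂ) (n : ℕ) (x : TriangularData A) (X Y : ℕ → A) :
    Prop where
  q_ne : q ≠ 0
  w_ne : ∀ k, w k ≠ 0
  w_of_lt : ∀ k, k < n → w k = q
  ab : ∀ i, x.a i * x.b i = 1
  ba : ∀ i, x.b i * x.a i = 1
  a_a : ∀ i j, x.a i * x.a j = x.a j * x.a i
  XY : ∀ i, X i * Y i = 1
  YX : ∀ i, Y i * X i = 1
  a_X_self : ∀ i, i ≤ n → x.a i * X i = q • (X i * x.a i)
  a_X : ∀ i j, i ≠ j → x.a i * X j = X j * x.a i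
  X_X : ∀ i k, i < k → k ≤ n → X k * X i = w k • (X i * X k)
  f_eq : ∀ i, i < n → x.f i = q⁻¹ • (Y i * (x.a i - x.b i) * X (i + 1))
  e_eq : ∀ i, i < n → x.e i = -(q • (Y (i + 1) * (x.a (i + 1) - x.b (i + 1)) * X i))

namespace IsOscillator

variable {q l : ℂ} {w : ℕ → ℂ} {n : ℕ} {x : TriangularData A} {X Y : ℕ → A}

theorem b_a (O : IsOscillator q w n x X Y) (i j : ℕ) : x.b i * x.a j = x.a j * x.b i :=
  inv_comm (O.ab i) (O.ba i) (O.a_a i j)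

theorem b_b (O : IsOscillator q w n x X Y) (i j : ℕ) : x.b i * x.b j = x.b j * x.b i :=
  inv_comm (O.ab i) (O.ba i) (O.b_a j i).symm

theorem X_a_self (O : IsOscillator q w n x X Y) {i : ℕ} (hi : i ≤ n) :
    X i * x.a i = q⁻¹ • (x.a i * X i) :=
  qcomm_symm O.q_ne (O.a_X_self i hi)

theorem X_b_self (O : IsOscillator q w n x X Y) {i : ℕ} (hi : i ≤ n) :
    X i * x.b i = q • (x.b i * X i) := by
  have := qcomm_symm (inv_ne_zero O.q_ne) (inv_qcomm O.q_ne (O.ab i) (O.ba i) (O.a_X_self i hi))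
  rwa [inv_inv] at this

theorem Y_a_self (O : IsOscillator q w n x X Y) {i : ℕ} (hi : i ≤ n) :
    Y i * x.a i = q • (x.a i * Y i) := by
  have := inv_qcomm (inv_ne_zero O.q_ne) (O.XY i) (O.YX i) (O.X_a_self hi)
  rwa [inv_inv] at this

theorem Y_b_self (O : IsOscillator q w n x X Y) {i : ℕ} (hi : i ≤ n) :
    Y i * x.b i = q⁻¹ • (x.b i * Y i) :=
  inv_qcomm O.q_ne (O.XY i) (O.YX i) (O.X_b_self hi)

theorem X_a (O : IsOscillator q w n x X Y) {i j : ℕ} (h : i ≠ j) : X i * x.a j = x.a j * X i :=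
  (O.a_X j i h.symm).symm

theorem X_b (O : IsOscillator q w n x X Y) {i j : ℕ} (h : i ≠ j) : X i * x.b j = x.b j * X i :=
  (inv_comm (O.ab j) (O.ba j) (O.a_X j i h.symm)).symm

theorem Y_a (O : IsOscillator q w n x X Y) {i j : ℕ} (h : i ≠ j) : Y i * x.a j = x.a j * Y i :=
  inv_comm (O.XY i) (O.YX i) (O.X_a h)

theorem Y_b (O : IsOscillator q w n x X Y) {i j : ℕ} (h : i ≠ j) : Y i * x.b j = x.b j * Y i :=
  inv_comm (O.XY i) (O.YX i) (O.X_b h)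

theorem Y_X (O : IsOscillator q w n x X Y) {i k : ℕ} (h : i < k) (hk : k ≤ n) :
    Y k * X i = (w k)⁻¹ • (X i * Y k) :=
  inv_qcomm (O.w_ne k) (O.XY k) (O.YX k) (O.X_X i k h hk)

theorem X_Y (O : IsOscillator q w n x X Y) {i k : ℕ} (h : i < k) (hk : k ≤ n) :
    X k * Y i = (w k)⁻¹ • (Y i * X k) :=
  qcomm_symm (O.w_ne k) (inv_qcomm (inv_ne_zero (O.w_ne k)) (O.XY i) (O.YX i)
    (qcomm_symm (O.w_ne k) (O.X_X i k h hk)) |> fun h => by rwa [inv_inv] at h)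

theorem Y_Y (O : IsOscillator q w n x X Y) {i k : ℕ} (h : i < k) (hk : k ≤ n) :
    Y k * Y i = w k • (Y i * Y k) := by
  have := inv_qcomm (inv_ne_zero (O.w_ne k)) (O.XY k) (O.YX k) (O.X_Y h hk)
  rwa [inv_inv] at this

theorem XY_assoc (O : IsOscillator q w n x X Y) (i : ℕ) (z : A) : X i * (Y i * z) = z := by
  rw [← mul_assoc, O.XY, one_mul]

theorem YX_assoc (O : IsOscillator q w n x X Y) (i : ℕ) (z : A) : Y i * (X i * z) = z := by
  rw [← mul_assoc, O.YX, one_mul]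

theorem ab_assoc (O : IsOscillator q w n x X Y) (i : ℕ) (z : A) : x.a i * (x.b i * z) = z := by
  rw [← mul_assoc, O.ab, one_mul]

theorem ba_assoc (O : IsOscillator q w n x X Y) (i : ℕ) (z : A) : x.b i * (x.a i * z) = z := by
  rw [← mul_assoc, O.ba, one_mul]

/-- Each entry is a factor depending on the row times X_j. In the recursion X_j meets Y_j: one order
gives a_j - b_j, the other q² a_j - b_j. The b_j parts cancel, and q² - 1 = qλ absorbs the λ of the
recursion. -/
theorem upper_eq (O : IsOscillator q w n x X Y) (hlq : l = q - q⁻¹) (hl : l ≠ 0) {s j : ℕ}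
    (h : s < j) (hj : j ≤ n) :
    upper l x.a x.b x.f s j = q⁻¹ • (Y s * (x.a s - x.b s) * X j) := by
  have hq := O.q_ne
  refine upper_induction (P := fun j y => j ≤ n → y = q⁻¹ • (Y s * (x.a s - x.b s) * X j))
    (fun h => O.f_eq s h) (fun j hs ih hjn => ?_) h hj
  have w1 := O.w_ne (j + 1)
  rw [ih (by omega), O.f_eq j hjn]
  simp only [mul_sub, sub_mul, smul_sub, mul_smul_comm, smul_mul_assoc, smul_smul, mul_assoc,
    O.XY_assoc, O.YX_assoc, O.ba_assoc, mul_comm_assoc (O.a_a j s), mul_comm_assoc (O.b_a j s),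
    ← mul_comm_assoc (O.b_a s j), mul_comm_assoc (O.b_b j s),
    mul_comm_assoc (O.X_a (show j + 1 ≠ s by omega)),
    mul_comm_assoc (O.X_b (show j + 1 ≠ s by omega)),
    mul_comm_assoc (O.Y_a (show j ≠ s by omega)), mul_comm_assoc (O.Y_b (show j ≠ s by omega)),
    mul_comm_assoc (O.Y_a (show s ≠ j by omega)), mul_comm_assoc (O.Y_b (show s ≠ j by omega)),
    mul_qcomm_assoc (O.Y_a_self (show j ≤ n by omega)),
    mul_qcomm_assoc (O.Y_b_self (show j ≤ n by omega)),
    mul_qcomm_assoc (O.Y_a_self (show s ≤ n by omega)),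
    mul_qcomm_assoc (O.Y_b_self (show s ≤ n by omega)),
    mul_qcomm_assoc (O.X_a_self (show j ≤ n by omega)),
    mul_qcomm_assoc (O.X_b_self (show j ≤ n by omega)),
    mul_qcomm_assoc (O.X_Y (show s < j + 1 by omega) hjn),
    O.X_X j (j + 1) (by omega) hjn,
    mul_qcomm_assoc (O.Y_Y hs (show j ≤ n by omega)), O.w_of_lt j (by omega)]
  have e : q ^ 2 - 1 = q * l := by rw [hlq]; field_simp
  match_scalars <;> field_simp <;> first | ring1 | linear_combination e | linear_combination -e

/-- The mirror image of `upper_eq`; here the row index is the moving one, so the cancellation takes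
place in the factor Y_j (a_j - b_j). -/
theorem lower_eq (O : IsOscillator q w n x X Y) (hlq : l = q - q⁻¹) (hl : l ≠ 0) {s j : ℕ}
    (h : s < j) (hj : j ≤ n) :
    upper l x.b x.a x.e s j = -(q • (Y j * (x.a j - x.b j) * X s)) := by
  have hq := O.q_ne
  refine upper_induction (P := fun j y => j ≤ n → y = -(q • (Y j * (x.a j - x.b j) * X s)))
    (fun h => O.e_eq s h) (fun j hs ih hjn => ?_) h hj
  have w1 := O.w_ne (j + 1)
  rw [ih (by omega), O.e_eq j hjn]
  simp only [mul_sub, sub_mul, smul_sub, mul_smul_comm, smul_mul_assoc, smul_smul, mul_assoc,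
    mul_neg, neg_mul, smul_neg,
    O.XY_assoc, O.YX_assoc, O.ab_assoc, mul_comm_assoc (O.a_a (j + 1) j),
    mul_comm_assoc (O.b_a (j + 1) j), ← mul_comm_assoc (O.b_a j (j + 1)),
    mul_comm_assoc (O.b_b (j + 1) j),
    mul_comm_assoc (O.X_a (show s ≠ j + 1 by omega)),
    mul_comm_assoc (O.X_b (show s ≠ j + 1 by omega)),
    mul_comm_assoc (O.Y_a (show j + 1 ≠ j by omega)),
    mul_comm_assoc (O.Y_b (show j + 1 ≠ j by omega)),
    mul_comm_assoc (O.Y_a (show j ≠ j + 1 by omega)),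
    mul_comm_assoc (O.Y_b (show j ≠ j + 1 by omega)),
    mul_qcomm_assoc (O.Y_a_self hjn), mul_qcomm_assoc (O.Y_b_self hjn),
    mul_qcomm_assoc (O.Y_a_self (show j ≤ n by omega)),
    mul_qcomm_assoc (O.Y_b_self (show j ≤ n by omega)),
    mul_qcomm_assoc (O.X_a_self (show j ≤ n by omega)),
    mul_qcomm_assoc (O.X_b_self (show j ≤ n by omega)),
    O.Y_X (show s < j + 1 by omega) hjn,
    O.Y_X (show j < j + 1 by omega) hjn,
    mul_qcomm_assoc (O.Y_Y (show j < j + 1 by omega) hjn),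
    mul_qcomm_assoc (O.X_X s j hs (by omega)),
    mul_qcomm_assoc (O.Y_X hs (show j ≤ n by omega)), O.w_of_lt j (by omega)]
  have e : q ^ 2 - 1 = q * l := by rw [hlq]; field_simp
  match_scalars <;> field_simp <;> first | ring1 | linear_combination e | linear_combination -e

end IsOscillator

end Oscillator

/-! ### Exchange of the X_k and of x_n⁻¹ with the generators. -/

section Oscillator

variable {A : Type*} [Ring A] [Algebra ℂ A]

namespace IsOscillator

variable {q l : ℂ} {w : ℕ → ℂ} {n : ℕ} {x v : TriangularData A} {X Y : ℕ → A}

theorem f_X (O : IsOscillator q w n x X Y) {i k : ℕ} (h1 : i ≠ k) (h2 : i + 1 ≠ k)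
    (hi : i + 1 < n) (hk : k < n) : x.f i * X k = X k * x.f i := by
  have hq := O.q_ne
  have w1 := O.w_of_lt (i + 1) hi
  have w2 := O.w_of_lt i (by omega)
  have w3 := O.w_of_lt k hk
  rw [O.f_eq i (by omega)]
  rcases lt_or_ge k i with hki | hki
  · simp only [mul_sub, sub_mul, smul_sub, mul_smul_comm, smul_mul_assoc, smul_smul, mul_assoc,
      mul_comm_assoc (O.X_a (show k ≠ i by omega)), mul_comm_assoc (O.X_b (show k ≠ i by omega)),
      mul_qcomm_assoc (O.Y_a_self (show i ≤ n by omega)),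
      mul_qcomm_assoc (O.Y_b_self (show i ≤ n by omega)),
      O.X_X k (i + 1) (by omega) (by omega), mul_qcomm_assoc (O.Y_X hki (by omega)), w1, w2]
    match_scalars <;> field_simp
  · have h3 := mul_qcomm_assoc (qcomm_symm (O.w_ne _) (O.X_X (i + 1) k (by omega) (by omega)))
    simp only [mul_sub, sub_mul, smul_sub, mul_smul_comm, smul_mul_assoc, smul_smul, mul_assoc,
      mul_comm_assoc (O.X_a (show k ≠ i by omega)), mul_comm_assoc (O.X_b (show k ≠ i by omega)),
      mul_qcomm_assoc (O.Y_a_self (show i ≤ n by omega)),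
      mul_qcomm_assoc (O.Y_b_self (show i ≤ n by omega)),
      O.X_X (i + 1) k (by omega) (by omega), mul_qcomm_assoc (O.X_Y (show i < k by omega) hk.le),
      w3]
    match_scalars <;> field_simp

theorem e_X (O : IsOscillator q w n x X Y) {i k : ℕ} (h1 : i ≠ k) (h2 : i + 1 ≠ k)
    (hi : i + 1 < n) (hk : k < n) : x.e i * X k = X k * x.e i := by
  have hq := O.q_ne
  have w1 := O.w_of_lt (i + 1) hi
  have w2 := O.w_of_lt i (by omega)
  have w3 := O.w_of_lt k hk
  rw [O.e_eq i (by omega)]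
  rcases lt_or_ge k i with hki | hki
  · simp only [mul_sub, sub_mul, smul_sub, mul_smul_comm, smul_mul_assoc, smul_smul, mul_assoc,
      mul_neg, neg_mul, mul_comm_assoc (O.X_a (show k ≠ i + 1 by omega)),
      mul_comm_assoc (O.X_b (show k ≠ i + 1 by omega)),
      mul_qcomm_assoc (O.Y_a_self (show i + 1 ≤ n by omega)),
      mul_qcomm_assoc (O.Y_b_self (show i + 1 ≤ n by omega)),
      O.X_X k i (by omega) (by omega),
      mul_qcomm_assoc (O.Y_X (show k < i + 1 by omega) (by omega)), w1, w2]
    match_scalars <;> field_simp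
  · simp only [mul_sub, sub_mul, smul_sub, mul_smul_comm, smul_mul_assoc, smul_smul, mul_assoc,
      mul_neg, neg_mul, mul_comm_assoc (O.X_a (show k ≠ i + 1 by omega)),
      mul_comm_assoc (O.X_b (show k ≠ i + 1 by omega)),
      mul_qcomm_assoc (O.Y_a_self (show i + 1 ≤ n by omega)),
      mul_qcomm_assoc (O.Y_b_self (show i + 1 ≤ n by omega)),
      O.X_X i k (by omega) (by omega),
      mul_qcomm_assoc (O.X_Y (show i + 1 < k by omega) hk.le), w3]
    match_scalars <;> field_simp

theorem f_X_succ (O : IsOscillator q w n x X Y) {k : ℕ} (hk : k + 1 < n) :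
    x.f k * X (k + 1) = q • (X (k + 1) * x.f k) := by
  have hq := O.q_ne
  have w1 := O.w_of_lt (k + 1) hk
  rw [O.f_eq k (by omega)]
  simp only [mul_sub, sub_mul, smul_sub, mul_smul_comm, smul_mul_assoc, smul_smul, mul_assoc,
    mul_comm_assoc (O.X_a (show k + 1 ≠ k by omega)),
    mul_comm_assoc (O.X_b (show k + 1 ≠ k by omega)),
    mul_qcomm_assoc (O.Y_a_self (show k ≤ n by omega)),
    mul_qcomm_assoc (O.Y_b_self (show k ≤ n by omega)),
    mul_qcomm_assoc (O.X_Y (show k < k + 1 by omega) hk.le), w1]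
  match_scalars <;> field_simp

theorem f_X_self (O : IsOscillator q w n x X Y) (hlq : l = q - q⁻¹) {k : ℕ} (hk : k + 1 < n) :
    x.f k * X k - X k * x.f k = l • (x.a k * X (k + 1)) := by
  have hq := O.q_ne
  have w1 := O.w_of_lt (k + 1) hk
  rw [O.f_eq k (by omega)]
  simp only [mul_sub, sub_mul, smul_sub, mul_smul_comm, smul_mul_assoc, smul_smul, mul_assoc,
    O.X_X k (k + 1) (by omega) (by omega), O.XY_assoc, O.YX_assoc,
    mul_qcomm_assoc (O.X_a_self (show k ≤ n by omega)),
    mul_qcomm_assoc (O.X_b_self (show k ≤ n by omega)),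
    mul_qcomm_assoc (O.Y_a_self (show k ≤ n by omega)),
    mul_qcomm_assoc (O.Y_b_self (show k ≤ n by omega)), w1]
  have e : q ^ 2 - 1 = q * l := by rw [hlq]; field_simp
  match_scalars <;> field_simp <;> first | ring1 | linear_combination e

theorem e_X_self (O : IsOscillator q w n x X Y) {k : ℕ} (hk : k + 1 < n) :
    x.e k * X k = q⁻¹ • (X k * x.e k) := by
  have hq := O.q_ne
  have w1 := O.w_of_lt (k + 1) hk
  rw [O.e_eq k (by omega)]
  simp only [mul_sub, sub_mul, smul_sub, mul_smul_comm, smul_mul_assoc, smul_smul, mul_assoc,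
    mul_neg, neg_mul, mul_comm_assoc (O.X_a (show k ≠ k + 1 by omega)),
    mul_comm_assoc (O.X_b (show k ≠ k + 1 by omega)),
    mul_qcomm_assoc (O.Y_a_self (show k + 1 ≤ n by omega)),
    mul_qcomm_assoc (O.Y_b_self (show k + 1 ≤ n by omega)),
    mul_qcomm_assoc (O.Y_X (show k < k + 1 by omega) hk.le), w1]
  match_scalars <;> field_simp

theorem e_X_succ (O : IsOscillator q w n x X Y) (hlq : l = q - q⁻¹) {k : ℕ} (hk : k + 1 < n) :
    x.e k * X (k + 1) - X (k + 1) * x.e k = -(l • (x.b (k + 1) * X k)) := by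
  have hq := O.q_ne
  have w1 := O.w_of_lt (k + 1) hk
  have h1 := qcomm_symm (O.w_ne _) (O.X_X k (k + 1) (by omega) (by omega))
  rw [O.e_eq k (by omega)]
  simp only [mul_sub, sub_mul, smul_sub, mul_smul_comm, smul_mul_assoc, smul_smul, mul_assoc,
    mul_neg, neg_mul, h1, O.XY_assoc, O.YX_assoc,
    mul_qcomm_assoc (O.X_a_self (show k + 1 ≤ n by omega)),
    mul_qcomm_assoc (O.X_b_self (show k + 1 ≤ n by omega)),
    mul_qcomm_assoc (O.Y_a_self (show k + 1 ≤ n by omega)),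
    mul_qcomm_assoc (O.Y_b_self (show k + 1 ≤ n by omega)), w1]
  have e : q ^ 2 - 1 = q * l := by rw [hlq]; field_simp
  match_scalars <;> field_simp <;> first | ring1 | linear_combination e | linear_combination -e

/-- The exchange relations of `x_n⁻¹` with the raising and lowering elements. -/
theorem Y_f (O : IsOscillator q w n x X Y) {i : ℕ} (hi : i + 1 < n) : Y n * x.f i = x.f i * Y n :=
    by
  have hq := O.q_ne
  have w1 := O.w_ne n
  have h1 := qcomm_symm (inv_ne_zero (O.w_ne _)) (O.Y_X hi le_rfl)
  rw [O.f_eq i (by omega)]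
  simp only [mul_sub, sub_mul, smul_sub, mul_smul_comm, smul_mul_assoc, smul_smul, mul_assoc, h1,
    mul_comm_assoc (O.Y_a (show n ≠ i by omega)), mul_comm_assoc (O.Y_b (show n ≠ i by omega)),
    mul_qcomm_assoc (O.Y_a_self (show i ≤ n by omega)),
    mul_qcomm_assoc (O.Y_b_self (show i ≤ n by omega)),
    mul_qcomm_assoc (O.Y_Y (show i < n by omega) le_rfl)]
  match_scalars <;> field_simp

theorem Y_e (O : IsOscillator q w n x X Y) {i : ℕ} (hi : i + 1 < n) : Y n * x.e i = x.e i * Y n :=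
    by
  have hq := O.q_ne
  have w1 := O.w_ne n
  have h1 := qcomm_symm (inv_ne_zero (O.w_ne _)) (O.Y_X (show i < n by omega) le_rfl)
  rw [O.e_eq i (by omega)]
  simp only [mul_sub, sub_mul, smul_sub, mul_smul_comm, smul_mul_assoc, smul_smul, mul_assoc, h1,
    mul_neg, neg_mul,
    mul_comm_assoc (O.Y_a (show n ≠ i + 1 by omega)),
    mul_comm_assoc (O.Y_b (show n ≠ i + 1 by omega)),
    mul_qcomm_assoc (O.Y_a_self (show i + 1 ≤ n by omega)),
    mul_qcomm_assoc (O.Y_b_self (show i + 1 ≤ n by omega)),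
    mul_qcomm_assoc (O.Y_Y hi le_rfl)]
  match_scalars <;> field_simp

theorem GX_f (O : IsOscillator q w n x X Y) {i k : ℕ} (hk : k < i) (hi : i + 1 = n) :
    x.b n * Y n * X k * x.f i = x.f i * (x.b n * Y n * X k) := by
  subst hi
  have hq := O.q_ne
  have w1 := O.w_ne (i + 1)
  have w2 := O.w_of_lt i (by omega)
  have h1 := qcomm_symm (O.w_ne _) (O.X_X k (i + 1) (by omega) le_rfl)
  rw [O.f_eq i (by omega)]
  simp only [mul_sub, sub_mul, smul_sub, mul_smul_comm, smul_mul_assoc, smul_smul, mul_assoc,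
    O.XY_assoc,
    mul_comm_assoc (O.b_a (i + 1) i), mul_comm_assoc (O.b_b (i + 1) i),
    mul_comm_assoc (O.X_a (show k ≠ i by omega)), mul_comm_assoc (O.X_b (show k ≠ i by omega)),
    mul_comm_assoc (O.Y_a (show i + 1 ≠ i by omega)),
    mul_comm_assoc (O.Y_b (show i + 1 ≠ i by omega)),
    mul_comm_assoc (O.Y_b (show i ≠ i + 1 by omega)),
    mul_qcomm_assoc (O.Y_a_self (show i ≤ i + 1 by omega)),
    mul_qcomm_assoc (O.Y_b_self (show i ≤ i + 1 by omega)),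
    mul_qcomm_assoc (O.X_b_self (show i + 1 ≤ i + 1 by omega)),
    O.Y_X hk (show i ≤ i + 1 by omega),
    mul_qcomm_assoc (O.Y_X (show k < i + 1 by omega) le_rfl),
    mul_qcomm_assoc (O.Y_Y (show i < i + 1 by omega) le_rfl), O.YX, mul_one, w2]
  match_scalars <;> field_simp

theorem GX_f_last (O : IsOscillator q w n x X Y) (hlq : l = q - q⁻¹) {i : ℕ} (hi : i + 1 = n) :
    x.b n * Y n * X i * x.f i - x.f i * (x.b n * Y n * X i) = -(l • (x.a i * x.b (i + 1))) := by
  subst hi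
  have hq := O.q_ne
  have w1 := O.w_ne (i + 1)
  rw [O.f_eq i (by omega)]
  simp only [mul_sub, sub_mul, smul_sub, mul_smul_comm, smul_mul_assoc, smul_smul, mul_assoc,
    O.XY_assoc, O.YX, mul_one,
    O.b_a (i + 1) i,
    O.b_b (i + 1) i,
    mul_comm_assoc (O.Y_a (show i + 1 ≠ i by omega)),
    mul_comm_assoc (O.Y_b (show i + 1 ≠ i by omega)),
    mul_comm_assoc (O.Y_b (show i ≠ i + 1 by omega)),
    mul_qcomm_assoc (O.Y_a_self (show i ≤ i + 1 by omega)),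
    mul_qcomm_assoc (O.Y_b_self (show i ≤ i + 1 by omega)),
    mul_qcomm_assoc (O.X_a_self (show i ≤ i + 1 by omega)),
    mul_qcomm_assoc (O.X_b_self (show i ≤ i + 1 by omega)),
    mul_qcomm_assoc (O.X_b_self (show i + 1 ≤ i + 1 by omega))]
  have e : q ^ 2 - 1 = q * l := by rw [hlq]; field_simp
  match_scalars <;> field_simp <;> first | ring1 | linear_combination e | linear_combination -e

/-- The coefficient q² is the one produced by `lower_eq`, where -q Y_n a_n = -q² a_n Y_n: G and H
are the b_n part and the a_n part of the last row of L_-. -/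
theorem HX_f_last (O : IsOscillator q w n x X Y) (hlq : l = q - q⁻¹) {i : ℕ} (hi : i + 1 = n) :
    q ^ 2 • (x.a n * Y n) * X i * x.f i - x.f i * (q ^ 2 • (x.a n * Y n) * X i)
      = -(l • (x.b i * x.a (i + 1))) := by
  subst hi
  have hq := O.q_ne
  have w1 := O.w_ne (i + 1)
  rw [O.f_eq i (by omega)]
  simp only [mul_sub, sub_mul, smul_sub, mul_smul_comm, smul_mul_assoc, smul_smul, mul_assoc,
    O.XY_assoc, O.YX, mul_one,
    O.a_a (i + 1) i,
    ← O.b_a i (i + 1),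
    mul_comm_assoc (O.Y_a (show i + 1 ≠ i by omega)),
    mul_comm_assoc (O.Y_b (show i + 1 ≠ i by omega)),
    mul_comm_assoc (O.Y_a (show i ≠ i + 1 by omega)),
    mul_qcomm_assoc (O.Y_a_self (show i ≤ i + 1 by omega)),
    mul_qcomm_assoc (O.Y_b_self (show i ≤ i + 1 by omega)),
    mul_qcomm_assoc (O.X_a_self (show i ≤ i + 1 by omega)),
    mul_qcomm_assoc (O.X_b_self (show i ≤ i + 1 by omega)),
    mul_qcomm_assoc (O.X_a_self (show i + 1 ≤ i + 1 by omega))]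
  have e : q ^ 2 - 1 = q * l := by rw [hlq]; field_simp
  match_scalars <;> field_simp <;> first | ring1 | linear_combination e | linear_combination -e

/-- The only properties of X and x_n⁻¹ used by the construction of the reduced product hold in any
q-oscillator algebra. The common scalar c is w_n⁻¹, the factor of Y_n X_k = w_n⁻¹ X_k Y_n for all k
< n. -/
theorem reducedSetting (O : IsOscillator q w n x X Y) (hlq : l = q - q⁻¹)
    (hx : Relations q l n x) (hv : Relations q l n v) (comm : Commuting x v)
    (x_f_last : ∀ i, n ≤ i → x.f i = 0) (x_e_last : ∀ i, n ≤ i → x.e i = 0)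
    (v_f_last : ∀ i, n ≤ i + 1 → v.f i = 0) (v_e_last : ∀ i, n ≤ i + 1 → v.e i = 0)
    (v_a_last : ∀ i, n ≤ i → v.a i = 1) (v_b_last : ∀ i, n ≤ i → v.b i = 1)
    (X_v : ∀ k i, X k * v.a i = v.a i * X k ∧ X k * v.b i = v.b i * X k ∧
      X k * v.e i = v.e i * X k ∧ X k * v.f i = v.f i * X k) :
    ReducedSetting q l (w n)⁻¹ n x v X (x.b n * Y n) (q ^ 2 • (x.a n * Y n)) := by
  have hq := O.q_ne
  have Y_v : ∀ k i, Y k * v.a i = v.a i * Y k ∧ Y k * v.b i = v.b i * Y k ∧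
      Y k * v.e i = v.e i * Y k ∧ Y k * v.f i = v.f i * Y k := fun k i =>
    ⟨inv_comm (O.XY k) (O.YX k) (X_v k i).1, inv_comm (O.XY k) (O.YX k) (X_v k i).2.1,
      inv_comm (O.XY k) (O.YX k) (X_v k i).2.2.1, inv_comm (O.XY k) (O.YX k) (X_v k i).2.2.2⟩
  have a_v : ∀ k i, x.a k * v.a i = v.a i * x.a k ∧ x.a k * v.b i = v.b i * x.a k ∧
      x.a k * v.e i = v.e i * x.a k ∧ x.a k * v.f i = v.f i * x.a k := fun k i =>
    ⟨comm.af.aa k i, inv_comm (O.ba k) (O.ab k) (comm.be.aa k i),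
      inv_comm (O.ba k) (O.ab k) (comm.be.af k i), comm.af.af k i⟩
  have b_v : ∀ k i, x.b k * v.a i = v.a i * x.b k ∧ x.b k * v.b i = v.b i * x.b k ∧
      x.b k * v.e i = v.e i * x.b k ∧ x.b k * v.f i = v.f i * x.b k := fun k i =>
    ⟨inv_comm (O.ab k) (O.ba k) (a_v k i).1, comm.be.aa k i, comm.be.af k i,
      inv_comm (O.ab k) (O.ba k) (a_v k i).2.2.2⟩
  have mul_v : ∀ {g Z : A} (i : ℕ), (g * v.a i = v.a i * g ∧ g * v.b i = v.b i * g ∧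
      g * v.e i = v.e i * g ∧ g * v.f i = v.f i * g) → (Z * v.a i = v.a i * Z ∧
      Z * v.b i = v.b i * Z ∧ Z * v.e i = v.e i * Z ∧ Z * v.f i = v.f i * Z) →
      (g * Z * v.a i = v.a i * (g * Z) ∧ g * Z * v.b i = v.b i * (g * Z) ∧
      g * Z * v.e i = v.e i * (g * Z) ∧ g * Z * v.f i = v.f i * (g * Z)) := by
    rintro g Z i ⟨h1, h2, h3, h4⟩ ⟨k1, k2, k3, k4⟩
    simp only [mul_assoc, k1, k2, k3, k4, mul_comm_assoc h1, mul_comm_assoc h2, mul_comm_assoc h3,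
      mul_comm_assoc h4, and_self]
  have af : ∀ i, i + 1 < n → x.a n * x.f i = x.f i * x.a n := fun i hi =>
    hx.lower.a_f _ _ (by omega) (by omega)
  have bf : ∀ i, i + 1 < n → x.b n * x.f i = x.f i * x.b n := fun i hi =>
    inv_comm (O.ab n) (O.ba n) (af i hi)
  have be : ∀ i, i + 1 < n → x.b n * x.e i = x.e i * x.b n := fun i hi =>
    hx.raise.a_f _ _ (by omega) (by omega)
  have ae : ∀ i, i + 1 < n → x.a n * x.e i = x.e i * x.a n := fun i hi =>
    inv_comm (O.ba n) (O.ab n) (be i hi)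
  exact
  { hx := hx
    hv := hv
    comm := comm
    x_f_last := x_f_last
    x_e_last := x_e_last
    v_f_last := v_f_last
    v_e_last := v_e_last
    v_a_last := v_a_last
    v_b_last := v_b_last
    X_v := X_v
    G_v := fun i => mul_v i (b_v n i) (Y_v n i)
    H_v := fun i => by
      have := mul_v i (a_v n i) (Y_v n i)
      simp only [smul_mul_assoc, mul_smul_comm, this, and_self]
    a_X_self := fun k hk => O.a_X_self k hk.le
    a_X := fun i k h _ => O.a_X i k h
    f_X := fun i k h1 h2 hi hk => O.f_X h1 h2 hi hk
    f_X_succ := fun k hk => O.f_X_succ hk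
    f_X_self := fun k hk => O.f_X_self hlq hk
    e_X := fun i k h1 h2 hi hk => O.e_X h1 h2 hi hk
    e_X_self := fun k hk => O.e_X_self hk
    e_X_succ := fun k hk => O.e_X_succ hlq hk
    X_X := fun i k h hk => by rw [O.X_X i k h hk.le, O.w_of_lt k hk]
    G_a := fun i hi => by
      simp only [mul_assoc, O.Y_a (Ne.symm hi), mul_comm_assoc (O.b_a n i)]
    H_a := fun i hi => by
      simp only [mul_smul_comm, smul_mul_assoc, mul_assoc, O.Y_a (Ne.symm hi),
        mul_comm_assoc (O.a_a n i)]
    G_a_last := by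
      simp only [mul_assoc, O.Y_a_self le_rfl, mul_comm_assoc (O.b_a n n), mul_smul_comm, smul_smul,
        inv_mul_cancel₀ hq, one_smul]
    H_a_last := by
      simp only [mul_assoc, O.Y_a_self le_rfl, mul_smul_comm, smul_mul_assoc, smul_smul]
      match_scalars; field_simp
    G_f := fun i hi => by rw [mul_assoc, O.Y_f hi, ← mul_assoc, bf i hi, mul_assoc]
    H_f := fun i hi => by
      rw [smul_mul_assoc, mul_assoc, O.Y_f hi, ← mul_assoc, af i hi, mul_assoc, mul_smul_comm]
    G_e := fun i hi => by rw [mul_assoc, O.Y_e hi, ← mul_assoc, be i hi, mul_assoc]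
    H_e := fun i hi => by
      rw [smul_mul_assoc, mul_assoc, O.Y_e hi, ← mul_assoc, ae i hi, mul_assoc, mul_smul_comm]
    c_ne := inv_ne_zero (O.w_ne n)
    G_X := fun k hk => by
      simp only [mul_assoc, O.Y_X hk le_rfl, mul_smul_comm, mul_comm_assoc (O.X_b hk.ne)]
    H_X := fun k hk => by
      simp only [mul_assoc, O.Y_X hk le_rfl, mul_smul_comm, smul_mul_assoc,
        mul_comm_assoc (O.X_a hk.ne), smul_comm (q ^ 2)]
    G_H := by
      simp only [mul_assoc, mul_smul_comm, smul_mul_assoc, mul_qcomm_assoc (O.Y_a_self le_rfl),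
        mul_qcomm_assoc (O.Y_b_self le_rfl), O.ab_assoc, O.ba_assoc]
      match_scalars; field_simp
    GX_f := fun k i hk hi => O.GX_f hk hi
    GX_f_last := fun i hi => O.GX_f_last hlq hi
    HX_f_last := fun i hi => O.HX_f_last hlq hi }

end IsOscillator

end Oscillator

/-! ### The operators X_i on joint eigenvectors. -/

namespace HeisenbergPairs

variable {n : ℕ} {F : Type*} [AddCommGroup F] [Module ℂ F] {P : HeisenbergPairs (n + 1) F}

/-- The inverse of `X_i`. -/
def bigXInv (P : HeisenbergPairs (n + 1) F) (h : ℂ) (i : Fin (n + 1)) : Module.End ℂ F :=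
  if i = Fin.last n then ↑(P.x i)⁻¹ else ↑(P.x i)⁻¹ * P.qWeight h (nuWeight i)

/-- The coefficients of the exponent of `X_i`. -/
def nuCoeff (i s : Fin (n + 1)) : ℂ := if i = Fin.last n then 0 else nuWeight i s

/-- The exponent of `X_i` on a joint eigenvector. -/
def nuSum (i : Fin (n + 1)) (μ : Fin (n + 1) → ℂ) : ℂ := ∑ s, nuCoeff i s * μ s

theorem nuSum_add (i : Fin (n + 1)) (μ ν : Fin (n + 1) → ℂ) :
    nuSum i (fun s => μ s + ν s) = nuSum i μ + nuSum i ν := by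
  simp only [nuSum, mul_add, Finset.sum_add_distrib]

theorem nuSum_single (i j : Fin (n + 1)) (k : ℤ) :
    nuSum i (fun s => ((Pi.single j k : Fin (n + 1) → ℤ) s : ℂ)) = nuCoeff i j * k := by
  rw [nuSum, Finset.sum_eq_single j]
  · simp
  · intro s _ hs; simp [hs]
  · simp

theorem nuSum_zero (i : Fin (n + 1)) : nuSum i (fun _ => 0) = 0 := by simp [nuSum]

theorem acts_bigX (h : ℂ) (i : Fin (n + 1)) :
    P.Acts (P.bigX h i) (Pi.single i 1) (fun μ => qExp h (-nuSum i μ - nuCoeff i i)) := by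
  unfold bigX
  split_ifs with hi
  · refine (acts_x i).congr rfl fun μ => ?_
    simp [nuSum, nuCoeff, hi, qExp_zero]
  · refine ((acts_qWeight h _).mul (acts_x i)).congr (zero_add _) fun μ => ?_
    rw [one_mul]
    congr 1
    have := nuSum_add i μ (fun s => ((Pi.single i 1 : Fin (n + 1) → ℤ) s : ℂ))
    rw [nuSum_single] at this
    simp only [neg_mul, Finset.sum_neg_distrib]
    have e : ∀ ν, ∑ s, nuWeight i s * ν s = nuSum i ν := fun ν => by
      simp only [nuSum, nuCoeff, if_neg hi]
    rw [e (fun s => μ s + ((Pi.single i 1 : Fin (n + 1) → ℤ) s : ℂ)), this]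
    push_cast; ring

theorem acts_bigXInv (h : ℂ) (i : Fin (n + 1)) :
    P.Acts (P.bigXInv h i) (Pi.single i (-1)) (fun μ => qExp h (nuSum i μ)) := by
  unfold bigXInv
  split_ifs with hi
  · refine (acts_x_inv i).congr rfl fun μ => ?_
    simp [nuSum, nuCoeff, hi, qExp_zero]
  · refine ((acts_x_inv i).mul (acts_qWeight h _)).congr (add_zero _) fun μ => ?_
    simp [nuSum, nuCoeff, hi]

theorem bigX_mul_inv (h : ℂ) (i : Fin (n + 1)) : P.bigX h i * P.bigXInv h i = 1 :=
  ((acts_bigX h i).mul (acts_bigXInv h i)).eq Acts.one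
    (by rw [← Pi.single_add]; exact Pi.single_zero i) fun μ => by
    rw [nuSum_add, nuSum_single, ← qExp_add, ← qExp_zero h]
    congr 1; push_cast; ring

theorem bigXInv_mul (h : ℂ) (i : Fin (n + 1)) : P.bigXInv h i * P.bigX h i = 1 :=
  ((acts_bigXInv h i).mul (acts_bigX h i)).eq Acts.one
    (by rw [← Pi.single_add]; exact Pi.single_zero i) fun μ => by
    rw [nuSum_add, nuSum_single, ← qExp_add, ← qExp_zero h]
    congr 1; push_cast; ring

theorem qN_bigX_self (h : ℂ) (i : Fin (n + 1)) (c : ℂ) :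
    P.qN h i c * P.bigX h i = qExp h c • (P.bigX h i * P.qN h i c) :=
  ((acts_qN h i c).mul (acts_bigX h i)).eq (((acts_bigX h i).mul (acts_qN h i c)).smul _)
    (by simp) fun μ => by
      simp only [Pi.single_eq_same, Pi.zero_apply, Int.cast_zero, add_zero, ← qExp_add]
      congr 1; push_cast; ring

theorem qN_bigX (h : ℂ) {i j : Fin (n + 1)} (hij : i ≠ j) (c : ℂ) :
    P.qN h i c * P.bigX h j = P.bigX h j * P.qN h i c :=
  ((acts_qN h i c).mul (acts_bigX h j)).eq ((acts_bigX h j).mul (acts_qN h i c))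
    (by simp) fun μ => by
      simp only [Pi.single_eq_of_ne hij, Pi.zero_apply, Int.cast_zero, add_zero, ← qExp_add]
      congr 1; ring

/-- For i < k the exponent in X_k does not involve N_i, while N_k occurs in that of X_i with
coefficient 1, or 1/2 if k is the last index. Moving x_k through it produces the factor. -/
theorem bigX_bigX (h : ℂ) {i k : Fin (n + 1)} (hik : i < k) :
    P.bigX h k * P.bigX h i = (if (k : ℕ) = n then qExp h (1 / 2) else qExp h 1) •
      (P.bigX h i * P.bigX h k) := by
  have e1 : nuCoeff k i = 0 := by
    unfold nuCoeff nuWeight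
    have h1 : i ≠ Fin.last n := (hik.trans_le (Fin.le_last k)).ne
    simp [hik.ne, hik.not_gt, h1]
  have e2 : (if (k : ℕ) = n then qExp h (1 / 2) else qExp h 1) = qExp h (nuCoeff i k) := by
    have h1 : i ≠ Fin.last n := (hik.trans_le (Fin.le_last k)).ne
    unfold nuCoeff nuWeight
    have h2 : (k : ℕ) = n ↔ k = Fin.last n := by simp [Fin.ext_iff]
    simp only [h2, h1, hik.ne', hik, if_false, if_true, false_or]
    split_ifs <;> rfl
  rw [e2]
  refine ((acts_bigX h k).mul (acts_bigX h i)).eq (((acts_bigX h i).mul (acts_bigX h k)).smul _)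
    (add_comm _ _) fun μ => ?_
  rw [nuSum_add, nuSum_add, nuSum_single, nuSum_single, e1]
  simp only [← qExp_add]
  congr 1; push_cast; ring

/-- N_{i,n+1} - N_{i+1,n+1} = (N_i + N_{i+1})/2, also when i+1 is the last index, whose exponent is
zero. This half-sum makes X_i⁻¹ … X_{i+1} absorb the Cartan factor k_i k_{i+1} of L_±. -/
theorem nuCoeff_sub (i : ℕ) (hi : i + 1 < n + 1) (s : Fin (n + 1)) :
    nuCoeff (n := n) ⟨i, by omega⟩ s - nuCoeff ⟨i + 1, hi⟩ s
      = (if s = ⟨i, by omega⟩ then 1 / 2 else 0) + if s = ⟨i + 1, hi⟩ then 1 / 2 else 0 := by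
  obtain ⟨s, hs⟩ := s
  simp only [nuCoeff, nuWeight, Fin.ext_iff, Fin.lt_def, Fin.val_last]
  split_ifs <;> first | omega | norm_num

theorem nuSum_sub (i : ℕ) (hi : i + 1 < n + 1) (μ : Fin (n + 1) → ℂ) :
    nuSum ⟨i, by omega⟩ μ = nuSum ⟨i + 1, hi⟩ μ
      + 1 / 2 * μ ⟨i, by omega⟩ + 1 / 2 * μ ⟨i + 1, hi⟩ := by
  rw [add_assoc, ← sub_eq_iff_eq_add', nuSum, nuSum, ← Finset.sum_sub_distrib]
  simp only [← sub_mul, nuCoeff_sub i hi, add_mul, Finset.sum_add_distrib, ite_mul, zero_mul,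
    Finset.sum_ite_eq', Finset.mem_univ, if_true]

theorem nuCoeff_self_succ (i : ℕ) (hi : i + 1 < n + 1) :
    nuCoeff (n := n) ⟨i, by omega⟩ ⟨i + 1, hi⟩ = nuCoeff ⟨i + 1, hi⟩ ⟨i + 1, hi⟩ + 1 / 2 := by
  have := nuCoeff_sub (n := n) i hi ⟨i + 1, hi⟩
  rw [if_neg (by simp), if_pos rfl] at this
  linear_combination this

theorem nuCoeff_self (i : ℕ) (hi : i + 1 < n + 1) :
    nuCoeff (n := n) ⟨i, by omega⟩ ⟨i, by omega⟩ = nuCoeff ⟨i + 1, hi⟩ ⟨i, by omega⟩ + 1 / 2 := by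
  have := nuCoeff_sub (n := n) i hi ⟨i, by omega⟩
  rw [if_pos rfl, if_neg (by simp)] at this
  linear_combination this

theorem lam_mul_qNum {h : ℂ} (hl : lam h ≠ 0) (z : ℂ) :
    lam h * qNum h z = qExp h z - qExp h (-z) := by
  rw [qNum, mul_div_cancel₀ _ hl]

theorem jsData_f_eq {h : ℂ} (hl : lam h ≠ 0) (i : ℕ) (hi : i + 1 < n + 1) :
    (lam h * qExp h (-(1 / 2))) • (P.qN h ⟨i, by omega⟩ (1 / 2) * P.qN h ⟨i + 1, hi⟩ (1 / 2)
        * (P.jsData h).f i hi)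
      = (qExp h 1)⁻¹ • (P.bigXInv h ⟨i, by omega⟩
        * (P.qN h ⟨i, by omega⟩ 1 - P.qN h ⟨i, by omega⟩ (-1)) * P.bigX h ⟨i + 1, hi⟩) := by
  refine ((((acts_qN h _ _).mul (acts_qN h _ _)).mul (acts_f h i hi)).smul _).eq
    ((((acts_bigXInv h _).mul ((acts_qN h _ _).sub (acts_qN h _ _) rfl)).mul
      (acts_bigX h _)).smul _) (by simp [add_comm]) fun μ => ?_
  have h1 := lam_mul_qNum hl (μ ⟨i, by omega⟩)
  have e : qExp h (-(1 / 2)) * (qExp h (1 / 2 * (μ ⟨i + 1, hi⟩ + 1))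
      * qExp h (1 / 2 * (μ ⟨i, by omega⟩ + -1)))
      = qExp h (-1) * (qExp h (-nuSum ⟨i + 1, hi⟩ μ - nuCoeff ⟨i + 1, hi⟩ ⟨i + 1, hi⟩)
        * qExp h (nuSum ⟨i, by omega⟩ μ + nuCoeff ⟨i, by omega⟩ ⟨i + 1, hi⟩)) := by
    simp only [← qExp_add, nuSum_sub i hi, nuCoeff_self_succ i hi]
    congr 1; ring
  simp only [nuSum_add, nuSum_single]
  simp [nuSum_zero, -one_div]
  rw [← qExp_neg]
  linear_combination (lam h * qNum h (μ ⟨i, by omega⟩)) * e + (qExp h (-1) *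
      (qExp h (-nuSum ⟨i + 1, hi⟩ μ - nuCoeff ⟨i + 1, hi⟩ ⟨i + 1, hi⟩)
        * qExp h (nuSum ⟨i, by omega⟩ μ + nuCoeff ⟨i, by omega⟩ ⟨i + 1, hi⟩))) * h1

theorem jsData_e_eq {h : ℂ} (hl : lam h ≠ 0) (i : ℕ) (hi : i + 1 < n + 1) :
    (-(lam h * qExp h (1 / 2))) • (P.qN h ⟨i + 1, hi⟩ (-(1 / 2))
        * P.qN h ⟨i, by omega⟩ (-(1 / 2)) * (P.jsData h).e i hi)
      = -(qExp h 1 • (P.bigXInv h ⟨i + 1, hi⟩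
        * (P.qN h ⟨i + 1, hi⟩ 1 - P.qN h ⟨i + 1, hi⟩ (-1)) * P.bigX h ⟨i, by omega⟩)) := by
  rw [neg_smul, neg_inj]
  refine ((((acts_qN h _ _).mul (acts_qN h _ _)).mul (acts_e h i hi)).smul _).eq
    ((((acts_bigXInv h _).mul ((acts_qN h _ _).sub (acts_qN h _ _) rfl)).mul
      (acts_bigX h _)).smul _) (by simp [add_comm]) fun μ => ?_
  have h1 := lam_mul_qNum hl (μ ⟨i + 1, hi⟩)
  have e0 := nuCoeff_self (n := n) i hi
  have e : qExp h (1 / 2) * (qExp h (-(1 / 2) * (μ ⟨i + 1, hi⟩ + -1))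
      * qExp h (-(1 / 2) * (μ ⟨i, by omega⟩ + 1)))
      = qExp h 1 * (qExp h (-nuSum (n := n) ⟨i, by omega⟩ μ - nuCoeff (n := n) ⟨i, by omega⟩
          ⟨i, by omega⟩)
        * qExp h (nuSum (n := n) ⟨i + 1, hi⟩ μ + nuCoeff (n := n) ⟨i + 1, hi⟩ ⟨i, by omega⟩)) := by
    simp only [← qExp_add, nuSum_sub i hi, e0]
    congr 1; ring
  simp only [nuSum_add, nuSum_single]
  simp [nuSum_zero, -one_div, -neg_mul]
  rw [neg_one_mul]
  linear_combination (lam h * qNum h (μ ⟨i + 1, hi⟩)) * e + (qExp h 1 *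
      (qExp h (-nuSum (n := n) ⟨i, by omega⟩ μ - nuCoeff (n := n) ⟨i, by omega⟩ ⟨i, by omega⟩)
        * qExp h (nuSum (n := n) ⟨i + 1, hi⟩ μ + nuCoeff (n := n) ⟨i + 1, hi⟩ ⟨i, by omega⟩))) * h1

end HeisenbergPairs

/-- The image of triangular data under an algebra homomorphism. -/
def TriangularData.map {A B : Type*} [Ring A] [Algebra ℂ A] [Ring B] [Algebra ℂ B]
    (x : TriangularData A) (φ : A →ₐ[ℂ] B) : TriangularData B where
  a i := φ (x.a i)
  b i := φ (x.b i)
  e i := φ (x.e i)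
  f i := φ (x.f i)

theorem extendOne_map {m : ℕ} {A B : Type*} [Ring A] [Algebra ℂ A] [Ring B] [Algebra ℂ B]
    (k : Fin m → A) (φ : A →ₐ[ℂ] B) (i : ℕ) :
    φ (extendOne k i) = extendOne (fun i => φ (k i)) i := by
  unfold extendOne; split_ifs <;> simp

theorem extendZero_map {m : ℕ} {A B : Type*} [Ring A] [Algebra ℂ A] [Ring B] [Algebra ℂ B]
    (e : (i : ℕ) → i + 1 < m → A) (φ : A →ₐ[ℂ] B) (i : ℕ) :
    φ (extendZero e i) = extendZero (fun i hi => φ (e i hi)) i := by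
  unfold extendZero; split_ifs <;> simp

theorem triangular_map {m : ℕ} {A B : Type*} [Ring A] [Algebra ℂ A] [Ring B] [Algebra ℂ B]
    (h : ℂ) (c : ChevalleyData m A) (φ : A →ₐ[ℂ] B) :
    (c.map φ).triangular h = (c.triangular h).map φ := by
  simp [ChevalleyData.triangular, TriangularData.map, ChevalleyData.map, extendOne_map,
    extendZero_map]

theorem IsOscillator.map {A B : Type*} [Ring A] [Algebra ℂ A] [Ring B] [Algebra ℂ B] {q : ℂ}
    {w : ℕ → ℂ} {n : ℕ} {x : TriangularData A} {X Y : ℕ → A} (O : IsOscillator q w n x X Y)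
    (φ : A →ₐ[ℂ] B) :
    IsOscillator q w n (x.map φ) (fun i => φ (X i)) (fun i => φ (Y i)) where
  q_ne := O.q_ne
  w_ne := O.w_ne
  w_of_lt := O.w_of_lt
  ab i := by simpa [TriangularData.map] using congrArg φ (O.ab i)
  ba i := by simpa [TriangularData.map] using congrArg φ (O.ba i)
  a_a i j := by simpa [TriangularData.map] using congrArg φ (O.a_a i j)
  XY i := by simpa [TriangularData.map] using congrArg φ (O.XY i)
  YX i := by simpa [TriangularData.map] using congrArg φ (O.YX i)
  a_X_self i hi := by simpa [TriangularData.map] using congrArg φ (O.a_X_self i hi)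
  a_X i j hij := by simpa [TriangularData.map] using congrArg φ (O.a_X i j hij)
  X_X i k hik hk := by simpa [TriangularData.map] using congrArg φ (O.X_X i k hik hk)
  f_eq i hi := by simpa [TriangularData.map] using congrArg φ (O.f_eq i hi)
  e_eq i hi := by simpa [TriangularData.map] using congrArg φ (O.e_eq i hi)

/-! ### The Jordan–Schwinger data as a q-oscillator algebra. -/

namespace HeisenbergPairs

variable {n : ℕ} {F : Type*} [AddCommGroup F] [Module ℂ F] {P : HeisenbergPairs (n + 1) F}

theorem qN_half_sq (h : ℂ) (i : Fin (n + 1)) : P.qN h i (1 / 2) ^ 2 = P.qN h i 1 := by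
  rw [sq, qN_mul]; norm_num

theorem qN_neg_half_sq (h : ℂ) (i : Fin (n + 1)) : P.qN h i (-(1 / 2)) ^ 2 = P.qN h i (-1) := by
  rw [sq, qN_mul]; norm_num

theorem jsData_a (h : ℂ) (i : Fin (n + 1)) : ((P.jsData h).triangular h).a i = P.qN h i 1 := by
  rw [← qN_half_sq]
  simp only [ChevalleyData.triangular, extendOne_of_lt _ i.2]; rfl

theorem jsData_b (h : ℂ) (i : Fin (n + 1)) :
    ((P.jsData h).triangular h).b i = P.qN h i (-1) := by
  rw [← qN_neg_half_sq]
  simp only [ChevalleyData.triangular, extendOne_of_lt _ i.2]; rfl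

/-- The exchange coefficients of `X_k` and `X_i`, `i < k`. -/
def exchangeCoeff (h : ℂ) (n k : ℕ) : ℂ := if k = n then qExp h (1 / 2) else qExp h 1

theorem isOscillator_jsData (P : HeisenbergPairs (n + 1) F) {h : ℂ} (hl : lam h ≠ 0) :
    IsOscillator (qExp h 1) (exchangeCoeff h n) n ((P.jsData h).triangular h)
      (extendOne (P.bigX h)) (extendOne (P.bigXInv h)) := by
  have R := ((isUq_jsData P hl).relations hl).lower
  refine ⟨qExp_ne_zero _ _, fun k => ?_, fun k hk => if_neg hk.ne, R.ab, R.ba, R.a_a, fun i => ?_,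
    fun i => ?_, fun i hi => ?_, fun i j hij => ?_, fun i k hik hk => ?_, fun i hi => ?_,
    fun i hi => ?_⟩
  · unfold exchangeCoeff; split_ifs <;> exact qExp_ne_zero _ _
  · unfold extendOne; split_ifs
    exacts [bigX_mul_inv _ _, one_mul _]
  · unfold extendOne; split_ifs
    exacts [bigXInv_mul _ _, one_mul _]
  · rw [extendOne_of_lt _ (by omega : i < n + 1), jsData_a h ⟨i, by omega⟩]
    exact qN_bigX_self h _ _
  · by_cases hi : i < n + 1
    · by_cases hj : j < n + 1
      · rw [extendOne_of_lt _ hj, jsData_a h ⟨i, hi⟩]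
        exact qN_bigX h (by simpa using hij) _
      · simp [extendOne_of_le _ (not_lt.mp hj)]
    · have : ((P.jsData h).triangular h).a i = 1 := by
        simp [ChevalleyData.triangular, extendOne_of_le _ (not_lt.mp hi)]
      simp [this]
  · rw [extendOne_of_lt _ (by omega : i < n + 1), extendOne_of_lt _ (by omega : k < n + 1)]
    exact bigX_bigX h hik
  · rw [extendOne_of_lt _ (by omega : i < n + 1), extendOne_of_lt _ (by omega : i + 1 < n + 1),
      jsData_a h ⟨i, by omega⟩, jsData_b h ⟨i, by omega⟩, ← jsData_f_eq hl i (by omega)]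
    simp only [ChevalleyData.triangular, extendOne_of_lt _ (show i < n + 1 by omega),
      extendOne_of_lt _ (show i + 1 < n + 1 by omega),
      extendZero_of_lt _ (show i + 1 < n + 1 by omega)]
    rfl
  · rw [extendOne_of_lt _ (by omega : i < n + 1), extendOne_of_lt _ (by omega : i + 1 < n + 1),
      jsData_a h ⟨i + 1, by omega⟩, jsData_b h ⟨i + 1, by omega⟩, ← jsData_e_eq hl i (by omega)]
    simp only [ChevalleyData.triangular, extendOne_of_lt _ (show i < n + 1 by omega),
      extendOne_of_lt _ (show i + 1 < n + 1 by omega),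
      extendZero_of_lt _ (show i + 1 < n + 1 by omega)]
    rfl

end HeisenbergPairs

/-! ### Matrices differing from the unit matrix on the last row -/

section UnipotentRow

variable {n : ℕ} {A : Type*} [Ring A]

/-- The matrix with units on the diagonal and off-diagonal entries `r` on the last row. -/
def unipotentRow (r : Fin n → A) : Matrix (Fin (n + 1)) (Fin (n + 1)) A :=
  Matrix.of (Fin.snoc (fun i => Pi.single i.castSucc 1) (Fin.snoc r 1))

theorem unipotentRow_castSucc (r : Fin n → A) (i : Fin n) :
    unipotentRow r i.castSucc = Pi.single i.castSucc 1 := by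
  funext j
  simp [unipotentRow]

theorem unipotentRow_last_castSucc (r : Fin n → A) (j : Fin n) :
    unipotentRow r (Fin.last n) j.castSucc = r j := by
  simp [unipotentRow]

theorem unipotentRow_last_last (r : Fin n → A) :
    unipotentRow r (Fin.last n) (Fin.last n) = 1 := by
  simp [unipotentRow]

theorem unipotentRow_mul_castSucc (r : Fin n → A) (M : Matrix (Fin (n + 1)) (Fin (n + 1)) A)
    (i : Fin n) (j : Fin (n + 1)) : (unipotentRow r * M) i.castSucc j = M i.castSucc j := by
  rw [Matrix.mul_apply, unipotentRow_castSucc, Finset.sum_eq_single i.castSucc]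
  · simp
  · intro k _ hk; simp [hk]
  · simp

theorem unipotentRow_mul_last (r : Fin n → A) (M : Matrix (Fin (n + 1)) (Fin (n + 1)) A)
    (j : Fin (n + 1)) : (unipotentRow r * M) (Fin.last n) j
      = M (Fin.last n) j + ∑ k : Fin n, r k * M k.castSucc j := by
  rw [Matrix.mul_apply, Fin.sum_univ_castSucc, unipotentRow_last_last, one_mul, add_comm]
  simp only [unipotentRow_last_castSucc]

theorem mul_unipotentRow_castSucc (r : Fin n → A) (M : Matrix (Fin (n + 1)) (Fin (n + 1)) A)
    (i : Fin (n + 1)) (j : Fin n) : (M * unipotentRow r) i j.castSucc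
      = M i j.castSucc + M i (Fin.last n) * r j := by
  rw [Matrix.mul_apply, Fin.sum_univ_castSucc, unipotentRow_last_castSucc,
    Finset.sum_eq_single j]
  · simp [unipotentRow_castSucc]
  · intro k _ hk; simp [unipotentRow_castSucc, hk.symm]
  · simp

theorem mul_unipotentRow_last (r : Fin n → A) (M : Matrix (Fin (n + 1)) (Fin (n + 1)) A)
    (i : Fin (n + 1)) : (M * unipotentRow r) i (Fin.last n) = M i (Fin.last n) := by
  rw [Matrix.mul_apply, Fin.sum_univ_castSucc, unipotentRow_last_last, mul_one,
    Finset.sum_eq_zero, zero_add]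
  intro k _
  have : Fin.last n ≠ k.castSucc := (Fin.castSucc_lt_last k).ne'
  simp [unipotentRow_castSucc, this]

theorem matrix_ext_last {M N : Matrix (Fin (n + 1)) (Fin (n + 1)) A}
    (h1 : ∀ i j : Fin n, M i.castSucc j.castSucc = N i.castSucc j.castSucc)
    (h2 : ∀ i : Fin n, M i.castSucc (Fin.last n) = N i.castSucc (Fin.last n))
    (h3 : ∀ j : Fin n, M (Fin.last n) j.castSucc = N (Fin.last n) j.castSucc)
    (h4 : M (Fin.last n) (Fin.last n) = N (Fin.last n) (Fin.last n)) : M = N := by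
  ext i j
  refine Fin.lastCases ?_ (fun i => ?_) i
  · exact Fin.lastCases h4 h3 j
  · exact Fin.lastCases (h2 i) (h1 i) j

theorem unipotentRow_mul (r r' : Fin n → A) :
    unipotentRow r * unipotentRow r' = unipotentRow (fun j => r j + r' j) := by
  refine matrix_ext_last (fun i j => ?_) (fun i => ?_) (fun j => ?_) ?_
  · rw [unipotentRow_mul_castSucc, unipotentRow_castSucc, unipotentRow_castSucc]
  · rw [unipotentRow_mul_castSucc, unipotentRow_castSucc, unipotentRow_castSucc]
  · rw [mul_unipotentRow_castSucc, unipotentRow_last_castSucc, unipotentRow_last_castSucc,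
      unipotentRow_last_last, one_mul]
  · rw [mul_unipotentRow_last, unipotentRow_last_last, unipotentRow_last_last]

theorem unipotentRow_zero : unipotentRow (fun _ : Fin n => (0 : A)) = 1 := by
  refine matrix_ext_last (fun i j => ?_) (fun i => ?_) (fun j => ?_) ?_
  · rw [unipotentRow_castSucc, Matrix.one_apply, Pi.single_apply]; simp only [eq_comm]
  · rw [unipotentRow_castSucc, Matrix.one_apply, Pi.single_apply]; simp only [eq_comm]
  · rw [unipotentRow_last_castSucc, Matrix.one_apply_ne (Fin.castSucc_lt_last j).ne']
  · rw [unipotentRow_last_last, Matrix.one_apply_eq]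

theorem isLastRowUnitriangular_unipotentRow (r : Fin n → A) :
    IsLastRowUnitriangular (unipotentRow r) := by
  refine ⟨fun i => ?_, fun i j hi hij => ?_⟩
  · refine Fin.lastCases ?_ (fun i => ?_) i
    · exact unipotentRow_last_last r
    · rw [unipotentRow_castSucc, Pi.single_eq_same]
  · obtain ⟨i, rfl⟩ := Fin.exists_castSucc_eq.mpr hi
    rw [unipotentRow_castSucc, Pi.single_eq_of_ne hij.symm]

theorem diagonal_unipotentRow (d d' : Fin (n + 1) → A) (h : ∀ i, d' i * d i = 1) (r : Fin n → A) :
    Matrix.diagonal d' * unipotentRow r * Matrix.diagonal d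
      = unipotentRow (fun j => d' (Fin.last n) * r j * d j.castSucc) := by
  have e : ∀ i j, (Matrix.diagonal d' * unipotentRow r * Matrix.diagonal d) i j
      = d' i * unipotentRow r i j * d j := fun i j => by
    rw [Matrix.mul_diagonal, Matrix.diagonal_mul]
  refine matrix_ext_last (fun i j => ?_) (fun i => ?_) (fun j => ?_) ?_
  · rw [e, unipotentRow_castSucc, unipotentRow_castSucc]
    by_cases hij : j = i
    · subst hij; simp [h]
    · simp [hij]
  · rw [e, unipotentRow_castSucc, unipotentRow_castSucc,
      Pi.single_eq_of_ne (Fin.castSucc_lt_last i).ne']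
    simp
  · rw [e, unipotentRow_last_castSucc, unipotentRow_last_castSucc]
  · rw [e, unipotentRow_last_last, unipotentRow_last_last, mul_one, h]

theorem unipotentRow_map {B : Type*} [Ring B] (φ : A →+* B) (r : Fin n → A) :
    (unipotentRow r).map φ = unipotentRow (fun j => φ (r j)) := by
  refine matrix_ext_last (fun i j => ?_) (fun i => ?_) (fun j => ?_) ?_
  · rw [Matrix.map_apply, unipotentRow_castSucc, unipotentRow_castSucc, Pi.single_apply,
      Pi.single_apply]
    split_ifs <;> simp
  · rw [Matrix.map_apply, unipotentRow_castSucc, unipotentRow_castSucc, Pi.single_apply,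
      Pi.single_apply]
    split_ifs <;> simp
  · rw [Matrix.map_apply, unipotentRow_last_castSucc, unipotentRow_last_castSucc]
  · rw [Matrix.map_apply, unipotentRow_last_last, unipotentRow_last_last, map_one]

theorem inverse_eq_of_mul {R : Type*} [Ring R] {a b : R} (ab : a * b = 1) (ba : b * a = 1) :
    Ring.inverse a = b :=
  Ring.inverse_unit ⟨a, b, ab, ba⟩

theorem inverse_unipotentRow (r : Fin n → A) :
    Ring.inverse (unipotentRow r) = unipotentRow (fun j => -r j) := by
  refine inverse_eq_of_mul ?_ ?_ <;> rw [unipotentRow_mul] <;> simp [unipotentRow_zero]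

theorem inverse_diagonal {d d' : Fin (n + 1) → A} (h : ∀ i, d i * d' i = 1)
    (h' : ∀ i, d' i * d i = 1) : Ring.inverse (Matrix.diagonal d) = Matrix.diagonal d' := by
  refine inverse_eq_of_mul ?_ ?_ <;> rw [Matrix.diagonal_mul_diagonal] <;> simp [h, h']

end UnipotentRow

/-! ### Explicit forms of M_L, M_R and K. -/

namespace HeisenbergPairs

variable {n : ℕ} {F : Type*} [AddCommGroup F] [Module ℂ F] {P : HeisenbergPairs (n + 1) F}

theorem m1_eq : m1 n F = unipotentRow (fun _ => 1) := by
  refine matrix_ext_last (fun i j => ?_) (fun i => ?_) (fun j => ?_) ?_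
  · rw [unipotentRow_castSucc]
    simp [m1, Pi.single_apply, (Fin.castSucc_lt_last i).ne, eq_comm]
  · rw [unipotentRow_castSucc]
    simp [m1, (Fin.castSucc_lt_last i).ne, (Fin.castSucc_lt_last i).ne']
  · rw [unipotentRow_last_castSucc]
    simp [m1]
  · rw [unipotentRow_last_last]
    simp [m1]

theorem inverse_Dx (h : ℂ) : Ring.inverse (P.Dx h) = Matrix.diagonal (P.bigXInv h) :=
  inverse_diagonal (bigX_mul_inv h) (bigXInv_mul h)

theorem qWeight_mul_neg (h : ℂ) (a : Fin (n + 1) → ℂ) :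
    P.qWeight h a * P.qWeight h (fun i => -a i) = 1 :=
  ((acts_qWeight h a).mul (acts_qWeight h _)).eq Acts.one (add_zero _) fun μ => by
    simp only [Pi.zero_apply, Int.cast_zero, add_zero, ← qExp_add, neg_mul,
      Finset.sum_neg_distrib, neg_add_cancel, qExp_zero]

theorem qWeight_neg_mul (h : ℂ) (a : Fin (n + 1) → ℂ) :
    P.qWeight h (fun i => -a i) * P.qWeight h a = 1 := by
  simpa using P.qWeight_mul_neg h (fun i => -a i)

/-- The last row of `D_L⁻¹ m_1⁻¹ D_L`, up to the sign. -/
def leftRow (P : HeisenbergPairs (n + 1) F) (h u : ℂ) (j : Fin n) : Module.End ℂ F :=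
  qExp h (2 * (1 - u)) • P.qWeight h (alphaWeight j.castSucc)

theorem conj_DL (h u : ℂ) : Ring.inverse (P.DL h u) * Ring.inverse (m1 n F) * P.DL h u
    = unipotentRow (fun j => -P.leftRow h u j) := by
  have h1 : Ring.inverse (P.DL h u) = Matrix.diagonal fun i =>
      if i = Fin.last n then 1
      else qExp h (-(2 * (1 - u))) • P.qWeight h (fun s => -alphaWeight i s) := by
    refine inverse_diagonal (fun i => ?_) (fun i => ?_)
    · split_ifs
      · simp
      · rw [smul_mul_smul_comm, qWeight_mul_neg, ← qExp_add, add_neg_cancel, qExp_zero, one_smul]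
    · split_ifs
      · simp
      · rw [smul_mul_smul_comm, qWeight_neg_mul, ← qExp_add, neg_add_cancel, qExp_zero, one_smul]
  rw [h1, m1_eq, inverse_unipotentRow, DL, diagonal_unipotentRow]
  · congr 1; funext j
    simp [leftRow, (Fin.castSucc_lt_last j).ne]
  · intro i
    split_ifs
    · simp
    · rw [smul_mul_smul_comm, qWeight_neg_mul, ← qExp_add, neg_add_cancel, qExp_zero, one_smul]

theorem conj_DR (h u : ℂ) : Ring.inverse (DR n F h u) * m1 n F * DR n F h u
    = unipotentRow (fun _ => qExp h (2 * (1 - u)) • 1) := by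
  have h1 : Ring.inverse (DR n F h u) = Matrix.diagonal fun i =>
      if i = Fin.last n then 1 else qExp h (-(2 * (1 - u))) • 1 := by
    refine inverse_diagonal (fun i => ?_) (fun i => ?_)
    · split_ifs
      · simp
      · rw [smul_mul_smul_comm, mul_one, ← qExp_add, add_neg_cancel, qExp_zero, one_smul]
    · split_ifs
      · simp
      · rw [smul_mul_smul_comm, mul_one, ← qExp_add, neg_add_cancel, qExp_zero, one_smul]
  rw [h1, m1_eq, DR, diagonal_unipotentRow]
  · congr 1; funext j
    simp [(Fin.castSucc_lt_last j).ne]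
  · intro i
    split_ifs
    · simp
    · rw [smul_mul_smul_comm, mul_one, ← qExp_add, neg_add_cancel, qExp_zero, one_smul]

theorem ML_eq (h u : ℂ) : P.ML h u = unipotentRow (fun j =>
    P.bigXInv h (Fin.last n) * -P.leftRow h u j * P.bigX h j.castSucc) := by
  rw [ML, conj_DL, inverse_Dx, Dx, diagonal_unipotentRow _ _ (bigXInv_mul h)]

theorem MR_eq (h u : ℂ) : P.MR h u = unipotentRow (fun j =>
    qExp h (2 * (1 - u)) • (P.bigXInv h (Fin.last n) * P.bigX h j.castSucc)) := by
  rw [MR, conj_DR, inverse_Dx, Dx, diagonal_unipotentRow _ _ (bigXInv_mul h)]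
  congr 1; funext j
  rw [mul_smul_comm, mul_one, smul_mul_assoc]

theorem blockTriangular_K (h u : ℂ) : (P.K h u).BlockTriangular id := by
  intro i j hij
  have hij : j < i := hij
  rw [K, inverse_Dx, Dx, Matrix.mul_diagonal, Matrix.diagonal_mul]
  have : P.Ktilde h u i j = 0 := by
    have h1 : j ≠ Fin.last n := (hij.trans_le (Fin.le_last i)).ne
    simp [Ktilde, h1, hij.ne', hij.not_gt]
  rw [this, mul_zero, zero_mul]

end HeisenbergPairs

/-! ### The factorisation of the Jordan-Schwinger Lax matrix -/

/-- The shape of a column of K̃ under the left factor: entries above the diagonal give consecutive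
differences, and the diagonal entry closes the sum, which is therefore the same for every column j <
n. -/
theorem sum_telescope {n j : ℕ} (hj : j < n) (T : ℕ → ℂ) :
    ∑ i : Fin n, (if (i : ℕ) < j then T i - T (i + 1) else if (i : ℕ) = j then T j else 0)
      = T 0 := by
  rw [Fin.sum_univ_eq_sum_range
    (fun i => if i < j then T i - T (i + 1) else if i = j then T j else 0)]
  have : ∀ i ∈ Finset.range n, (if i < j then T i - T (i + 1) else if i = j then T j else 0)
      = (if i ≤ j then T i else 0) - (if i + 1 ≤ j then T (i + 1) else 0) := by
    intro i _
    rcases lt_trichotomy i j with h | rfl | h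
    · simp [h, h.le, Nat.succ_le_of_lt h]
    · simp
    · simp [h.not_gt, h.ne', h.not_ge, (show ¬ i + 1 ≤ j by omega)]
  rw [Finset.sum_congr rfl this, Finset.sum_range_sub' (fun i => if i ≤ j then T i else 0)]
  simp [hj.not_ge]

namespace HeisenbergPairs

variable {n : ℕ} {F : Type*} [AddCommGroup F] [Module ℂ F] {P : HeisenbergPairs (n + 1) F}

theorem Acts.sum {ι : Type*} (s : Finset ι) {T : ι → Module.End ℂ F} {d : Fin (n + 1) → ℤ}
    {φ : ι → (Fin (n + 1) → ℂ) → ℂ} (hT : ∀ i ∈ s, P.Acts (T i) d (φ i)) :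
    P.Acts (∑ i ∈ s, T i) d (fun μ => ∑ i ∈ s, φ i μ) := by
  intro μ v hv
  rw [LinearMap.sum_apply, Finset.sum_smul]
  exact Finset.sum_congr rfl fun i hi => hT i hi μ v hv

/-- The Lax matrix conjugated by `D^{(x)}`. -/
def Ltilde (P : HeisenbergPairs (n + 1) F) (h u : ℂ) :
    Matrix (Fin (n + 1)) (Fin (n + 1)) (Module.End ℂ F) :=
  Matrix.of fun i j =>
    if i = j then (lam h)⁻¹ • (qExp h (u - 1) • P.qN h i 1 - qExp h (-(u - 1)) • P.qN h i (-1))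
    else if i < j then qExp h (u - 1) • P.numN h i
    else qExp h (-(u - 1)) • P.numN h i

/-- By the oscillator formulas L_± has entries X_i⁻¹ (…) X_j with the bracket depending on the row
only. On the diagonal, conjugation by X_i shifts N_i by one, which shifts u to u - 1. -/
theorem laxMatrix_eq_conj {h : ℂ} (hl : lam h ≠ 0) (u : ℂ) : laxMatrix h (P.jsData h) u
    = Matrix.diagonal (P.bigXInv h) * P.Ltilde h u * Matrix.diagonal (P.bigX h) := by
  have H := isUq_jsData P hl
  have O := isOscillator_jsData P hl
  have hlq := lam_eq h
  ext1 i j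
  rw [laxMatrix_eq h hl, Matrix.mul_diagonal, Matrix.diagonal_mul]
  simp only [spectralCombine, Matrix.smul_apply, Matrix.sub_apply,
    laxPlus_eq_upper hl H.isTorus, laxMinus_eq_upper hl H.isTorus', Ltilde, Matrix.of_apply]
  have e1 : qExp h u = qExp h (u - 1) * qExp h 1 := by rw [← qExp_add]; ring_nf
  have e2 : qExp h (-u) = qExp h (-(u - 1)) * (qExp h 1)⁻¹ := by
    rw [← qExp_neg, ← qExp_add]; ring_nf
  have hq := qExp_ne_zero h 1
  rcases lt_trichotomy i j with hij | rfl | hij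
  · rw [if_neg hij.ne, if_pos hij, upper_of_lt (show (i : ℕ) < j from hij),
      O.upper_eq hlq hl (show (i : ℕ) < j from hij) (by omega), extendOne_of_lt _ i.2,
      extendOne_of_lt _ j.2, jsData_a, jsData_b, e1]
    simp only [numN, smul_zero, sub_zero, smul_smul, mul_smul_comm, smul_mul_assoc]
    congr 1
    field_simp
  · rw [if_pos rfl, upper_self, upper_self, jsData_a, jsData_b, e1, e2]
    have h1 := qcomm_symm (qExp_ne_zero h _) (qN_bigX_self (P := P) h i 1)
    have h2 := qcomm_symm (qExp_ne_zero h _) (qN_bigX_self (P := P) h i (-1))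
    have h3 := mul_qcomm_assoc (qN_bigX_self (P := P) h i 1)
    simp only [smul_sub, mul_sub, sub_mul, smul_mul_assoc, mul_smul_comm, mul_assoc,
      qN_bigX_self (P := P), ← mul_assoc (P.bigXInv h i) (P.bigX h i), bigXInv_mul, one_mul,
      smul_smul, ← qExp_neg]
  · rw [if_neg hij.ne', if_neg hij.not_gt, upper_of_lt (show (j : ℕ) < i from hij),
      O.lower_eq hlq hl (show (j : ℕ) < i from hij) (by omega), extendOne_of_lt _ i.2,
      extendOne_of_lt _ j.2, jsData_a, jsData_b, e2]
    simp only [numN, smul_zero, zero_sub, smul_smul, mul_smul_comm, smul_mul_assoc, smul_neg,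
      neg_neg]
    congr 1
    field_simp

/-- `∑_{s < k} μ_s`. -/
def partialSum (μ : Fin (n + 1) → ℂ) (k : ℕ) : ℂ :=
  ∑ s : Fin n, if (s : ℕ) < k then μ s.castSucc else 0

theorem partialSum_zero (μ : Fin (n + 1) → ℂ) : partialSum μ 0 = 0 := by simp [partialSum]

theorem partialSum_succ (μ : Fin (n + 1) → ℂ) (i : Fin n) :
    partialSum μ (i + 1) = partialSum μ i + μ i.castSucc := by
  have : μ i.castSucc = ∑ s : Fin n, if s = i then μ s.castSucc else 0 := by simp
  rw [partialSum, partialSum, this, ← Finset.sum_add_distrib]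
  refine Finset.sum_congr rfl fun s _ => ?_
  simp only [Fin.ext_iff]
  split_ifs <;> first | omega | simp

theorem partialSum_top (μ : Fin (n + 1) → ℂ) :
    partialSum μ n = ∑ s : Fin n, μ s.castSucc := by
  simp [partialSum]

theorem alphaWeight_sum (μ : Fin (n + 1) → ℂ) (i : Fin n) :
    ∑ s, alphaWeight i.castSucc s * μ s
      = -(μ (Fin.last n)) - μ i.castSucc - 2 * partialSum μ i := by
  have : μ i.castSucc = ∑ s : Fin n, if s = i then μ s.castSucc else 0 := by simp
  rw [Fin.sum_univ_castSucc, this, partialSum, Finset.mul_sum, sub_sub, ← Finset.sum_add_distrib,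
    sub_eq_add_neg, add_comm, ← Finset.sum_neg_distrib]
  congr 1
  · simp [alphaWeight]
  · refine Finset.sum_congr rfl fun s _ => ?_
    have h1 : s.castSucc ≠ Fin.last n := (Fin.castSucc_lt_last s).ne
    simp only [alphaWeight, h1, Fin.ext_iff, Fin.lt_def, Fin.val_castSucc, or_false]
    split_ifs <;> first | omega | ring

theorem acts_leftRow (h u : ℂ) (j : Fin n) : P.Acts (P.leftRow h u j) 0 (fun μ =>
    qExp h (2 * (1 - u)) * qExp h (-(μ (Fin.last n)) - μ j.castSucc - 2 * partialSum μ j)) :=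
  ((acts_qWeight h _).smul _).congr rfl fun μ => by rw [alphaWeight_sum]

/-- The exponentials entering the telescoping sums. -/
def partialExp (h : ℂ) (μ : Fin (n + 1) → ℂ) (k : ℕ) : ℂ := qExp h (-(2 * partialSum μ k))

/-- With S_i = N_1 + … + N_i the product is q^{-N_{n+1}} (q^{-2S_{i-1}} - q^{-2S_i}); the exponents
α_i are those for which this difference is consecutive. -/
theorem leftRow_telescope (h : ℂ) (μ : Fin (n + 1) → ℂ) (i : Fin n) :
    qExp h (-(μ (Fin.last n)) - μ i.castSucc - 2 * partialSum μ i)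
      * (qExp h (μ i.castSucc) - qExp h (-(μ i.castSucc)))
    = qExp h (-(μ (Fin.last n))) * (partialExp h μ i - partialExp h μ (i + 1)) := by
  simp only [partialExp, partialSum_succ, mul_sub, ← qExp_add]
  ring_nf

/-- The factor q^{-N_1-…-N_n} leaves q^{-2(N_1+…+N_n)} only in the second term, where it cancels the
end term of the telescoping sum of `acts_sum_last`. -/
theorem acts_Ktilde_last {h : ℂ} (u : ℂ) :
    P.Acts (P.Ktilde h u (Fin.last n) (Fin.last n)) 0 (fun μ => (lam h)⁻¹ *
      (qExp h (u - 1 + μ (Fin.last n))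
        - qExp h (-(u - 1) - μ (Fin.last n)) * partialExp h μ n)) := by
  simp only [Ktilde, Matrix.of_apply, if_true]
  refine (((((acts_qWeight h _).smul _).sub ((acts_qWeight h _).smul _) rfl).smul _).mul
    (acts_qWeight h _)).congr (add_zero _) fun μ => ?_
  simp only [Pi.zero_apply, Int.cast_zero, add_zero, Fin.sum_univ_castSucc, if_true,
    (Fin.castSucc_lt_last _).ne, if_false, one_mul, zero_mul, neg_mul, Finset.sum_neg_distrib,
    partialExp, partialSum_top, neg_add, neg_sub, qExp_add, qExp_sub, qExp_neg, two_mul]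
  have h1 := qExp_ne_zero h (∑ s : Fin n, μ s.castSucc)
  have h2 := qExp_ne_zero h (μ (Fin.last n))
  have h3 := qExp_ne_zero h u
  have h4 := qExp_ne_zero h 1
  field_simp

theorem acts_Ktilde_castSucc {h : ℂ} (u : ℂ) (i j : Fin n) :
    P.Acts (P.Ktilde h u i.castSucc j.castSucc) 0 (fun μ => if i < j then
      qNum h (u - 1) * (lam h * qNum h (μ i.castSucc))
      else if i = j then qNum h (u - 1) * qExp h (μ i.castSucc) else 0) := by
  simp only [Ktilde, Matrix.of_apply, (Fin.castSucc_lt_last _).ne, if_false,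
    Fin.castSucc_inj, Fin.castSucc_lt_castSucc_iff]
  rcases lt_trichotomy i j with hij | rfl | hij
  · simp only [hij.ne, hij, if_true, if_false]
    exact ((acts_numN h _).smul _).congr rfl fun μ => by ring
  · simp only [if_true, lt_irrefl, if_false]
    exact ((acts_qN h _ _).smul _).congr rfl fun μ => by rw [one_mul]
  · simp only [hij.ne', hij.not_gt, if_false]
    exact Acts.zero _

theorem acts_Ktilde_castSucc_last {h : ℂ} (u : ℂ) (i : Fin n) :
    P.Acts (P.Ktilde h u i.castSucc (Fin.last n)) 0
      (fun μ => qExp h (u - 1) * qNum h (μ i.castSucc)) := by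
  simp only [Ktilde, Matrix.of_apply, (Fin.castSucc_lt_last _).ne, if_false, if_true]
  exact (acts_numN h _).smul _

theorem acts_sum_last {h : ℂ} (hl : lam h ≠ 0) (u : ℂ) :
    P.Acts (∑ i : Fin n, -P.leftRow h u i * P.Ktilde h u i.castSucc (Fin.last n)) 0
      (fun μ => -((lam h)⁻¹ * (qExp h (-(u - 1) - μ (Fin.last n)) * (1 - partialExp h μ n)))) := by
  have h1 := Acts.sum Finset.univ fun (i : Fin n) _ => (((acts_leftRow (P := P) h u i).smul
    (-1)).mul (acts_Ktilde_castSucc_last (h := h) u i))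
  simp only [neg_one_smul] at h1
  refine h1.congr (add_zero _) fun μ => ?_
  have h2 : ∀ i : Fin n, qExp h (u - 1) * qNum h (μ i.castSucc) * (-1 * (qExp h (2 * (1 - u)) *
      qExp h (-(μ (Fin.last n)) - μ i.castSucc - 2 * partialSum μ i)))
      = -((lam h)⁻¹ * qExp h (-(u - 1) - μ (Fin.last n))
        * (partialExp h μ i - partialExp h μ (i + 1))) := by
    intro i
    have h3 := leftRow_telescope h μ i
    rw [← lam_mul_qNum hl] at h3
    have h4 : qExp h (u - 1) * qExp h (2 * (1 - u)) * qExp h (-(μ (Fin.last n)))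
        = qExp h (-(u - 1) - μ (Fin.last n)) := by
      rw [← qExp_add, ← qExp_add]; ring_nf
    rw [← h4]
    field_simp
    linear_combination (-qExp h (u - 1) * qExp h (2 * (1 - u))) * h3
  simp only [Pi.zero_apply, Int.cast_zero, add_zero, h2]
  rw [Finset.sum_neg_distrib, ← Finset.mul_sum,
    Fin.sum_univ_eq_sum_range (fun i => partialExp h μ i - partialExp h μ (i + 1)),
    Finset.sum_range_sub', partialExp, partialSum_zero, mul_zero, neg_zero, qExp_zero, mul_assoc]

theorem acts_sum_castSucc {h : ℂ} (hl : lam h ≠ 0) (u : ℂ) (j : Fin n) :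
    P.Acts (∑ i : Fin n, -P.leftRow h u i * P.Ktilde h u i.castSucc j.castSucc) 0
      (fun μ => -(qNum h (u - 1) * qExp h (2 * (1 - u)) * qExp h (-(μ (Fin.last n))))) := by
  have h1 := Acts.sum Finset.univ fun (i : Fin n) _ => (((acts_leftRow (P := P) h u i).smul
    (-1)).mul (acts_Ktilde_castSucc (h := h) u i j))
  simp only [neg_one_smul] at h1
  refine h1.congr (add_zero _) fun μ => ?_
  have h2 : ∀ i : Fin n, (if i < j then qNum h (u - 1) * (lam h * qNum h (μ i.castSucc))
      else if i = j then qNum h (u - 1) * qExp h (μ i.castSucc) else 0)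
        * (-1 * (qExp h (2 * (1 - u)) *
      qExp h (-(μ (Fin.last n)) - μ i.castSucc - 2 * partialSum μ i)))
      = -(qNum h (u - 1) * qExp h (2 * (1 - u)) * qExp h (-(μ (Fin.last n)))
        * (if (i : ℕ) < j then partialExp h μ i - partialExp h μ (i + 1)
          else if (i : ℕ) = j then partialExp h μ j else 0)) := by
    intro i
    simp only [← Fin.ext_iff, ← Fin.lt_def]
    rcases lt_trichotomy i j with hij | rfl | hij
    · have h3 := leftRow_telescope h μ i
      rw [← lam_mul_qNum hl] at h3
      rw [if_pos hij, if_pos hij]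
      linear_combination (-qNum h (u - 1) * qExp h (2 * (1 - u))) * h3
    · have h3 : qExp h (μ i.castSucc) *
          qExp h (-(μ (Fin.last n)) - μ i.castSucc - 2 * partialSum μ i)
          = qExp h (-(μ (Fin.last n))) * partialExp h μ i := by
        rw [partialExp, ← qExp_add, ← qExp_add]; ring_nf
      simp only [lt_irrefl, if_false, if_true]
      linear_combination (-qNum h (u - 1) * qExp h (2 * (1 - u))) * h3
    · simp only [hij.not_gt, hij.ne', if_false]; ring
  simp only [Pi.zero_apply, Int.cast_zero, add_zero, h2]
  rw [Finset.sum_neg_distrib, ← Finset.mul_sum, sum_telescope j.2 (partialExp h μ), partialExp,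
    partialSum_zero, mul_zero, neg_zero, qExp_zero, mul_one]

theorem acts_numN' {h : ℂ} (i : Fin (n + 1)) : P.Acts (P.numN h i) 0
    (fun μ => (lam h)⁻¹ * (qExp h (μ i) - qExp h (-(μ i)))) :=
  (acts_numN h i).congr rfl fun μ => by rw [qNum, div_eq_inv_mul]

/-- In rows i < n the right factor adds q^{2(1-u)} times the last column: right of the diagonal
λ[u-1] + q^{1-u} = q^{u-1}, on it [u-1] q^{N_i} + q^{1-u}[N_i] = [u-1+N_i]. In the last row the
telescoped sums reduce the claim to [u-1+N] - [u-1] q^{-N} = q^{u-1}[N] with N = N_{n+1}. -/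
theorem Ltilde_eq {h : ℂ} (hl : lam h ≠ 0) (u : ℂ) :
    unipotentRow (fun j => -P.leftRow h u j) * P.Ktilde h u
      * unipotentRow (fun _ => qExp h (2 * (1 - u)) • 1) = P.Ltilde h u := by
  have hu := qExp_ne_zero h (u - 1)
  have e1 : qExp h (-(u - 1)) = (qExp h (u - 1))⁻¹ := qExp_neg _ _
  have e2 : qExp h (2 * (1 - u)) = (qExp h (u - 1))⁻¹ * (qExp h (u - 1))⁻¹ := by
    rw [← qExp_neg, ← qExp_add]; ring_nf
  refine matrix_ext_last (fun i j => ?_) (fun i => ?_) (fun j => ?_) ?_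
  · rw [mul_unipotentRow_castSucc, unipotentRow_mul_castSucc, unipotentRow_mul_castSucc]
    simp only [Ktilde, Ltilde, Matrix.of_apply, (Fin.castSucc_lt_last _).ne, if_false, if_true,
      Fin.castSucc_inj, Fin.castSucc_lt_castSucc_iff, mul_smul_comm, mul_one, smul_smul, numN,
      e1, e2, qNum]
    rcases lt_trichotomy i j with hij | rfl | hij
    · simp only [hij.ne, hij, if_true, if_false, ← add_smul]
      congr 2
      field_simp
      ring
    · simp only [if_true]
      match_scalars <;> field_simp
      ring
    · simp only [hij.ne', hij.not_gt, if_false, zero_add]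
      match_scalars <;> field_simp
  · rw [mul_unipotentRow_last, unipotentRow_mul_castSucc]
    simp only [Ktilde, Ltilde, Matrix.of_apply, (Fin.castSucc_lt_last _).ne, if_false, if_true,
      Fin.castSucc_lt_last]
  · rw [mul_unipotentRow_castSucc, unipotentRow_mul_last, unipotentRow_mul_last]
    have h0 : P.Ktilde h u (Fin.last n) j.castSucc = 0 := by
      simp [Ktilde, (Fin.castSucc_lt_last j).ne]
    have h1 : P.Ltilde h u (Fin.last n) j.castSucc = qExp h (-(u - 1)) • P.numN h (Fin.last n) := by
      simp [Ltilde, (Fin.castSucc_lt_last j).ne', (Fin.castSucc_lt_last j).not_gt]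
    rw [h0, zero_add, h1, mul_smul_comm, mul_one]
    refine ((acts_sum_castSucc hl u j).add (((acts_Ktilde_last u).add (acts_sum_last hl u)
      rfl).smul _) rfl).eq ((acts_numN' _).smul _) rfl fun μ => ?_
    simp only [qExp_add, qExp_sub _ (-(u - 1)), qExp_neg h (μ _), e1, e2, qNum]
    have h2 := qExp_ne_zero h (μ (Fin.last n))
    field_simp
    ring
  · rw [mul_unipotentRow_last, unipotentRow_mul_last]
    refine ((acts_Ktilde_last u).add (acts_sum_last hl u) rfl).eq
      (T := P.Ktilde h u (Fin.last n) (Fin.last n) + _) (S := P.Ltilde h u _ _)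
      (d' := 0) (ψ := fun μ => (lam h)⁻¹ * (qExp h (u - 1) * qExp h (1 * μ (Fin.last n))
        - qExp h (-(u - 1)) * qExp h (-1 * μ (Fin.last n)))) ?_ rfl fun μ => ?_
    · simp only [Ltilde, Matrix.of_apply, if_true]
      exact (((acts_qN h _ _).smul _).sub ((acts_qN h _ _).smul _) rfl).smul _
    · rw [one_mul, neg_one_mul]
      simp only [qExp_add, qExp_sub _ (-(u - 1)), qExp_neg h (μ _)]
      ring

/-- The factorisation of the Jordan-Schwinger Lax matrix. -/
theorem laxMatrix_jsData {h : ℂ} (hl : lam h ≠ 0) (u : ℂ) :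
    laxMatrix h (P.jsData h) u = P.ML h u * P.K h u * P.MR h u := by
  have h1 : P.Dx h * Ring.inverse (P.Dx h) = 1 := by
    rw [inverse_Dx, Dx, Matrix.diagonal_mul_diagonal]
    simp [bigX_mul_inv]
  rw [laxMatrix_eq_conj hl, ← Ltilde_eq hl, ← conj_DL, ← conj_DR, ← inverse_Dx,
    show Matrix.diagonal (P.bigX h) = P.Dx h from rfl, ML, K, MR]
  simp only [Matrix.mul_assoc]
  rw [← Matrix.mul_assoc (P.Dx h) (Ring.inverse (P.Dx h)), h1, Matrix.one_mul,
    ← Matrix.mul_assoc (P.Dx h) (Ring.inverse (P.Dx h)), h1, Matrix.one_mul]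

end HeisenbergPairs

/-! ### The product of the Lax matrices -/

section LaxMap

variable {m : ℕ} {A B : Type*} [Ring A] [Algebra ℂ A] [Ring B] [Algebra ℂ B]

theorem raising_map (h : ℂ) (c : ChevalleyData m A) (φ : A →ₐ[ℂ] B) (i d : ℕ)
    (hd : i + d + 1 < m) : raising h (c.map φ) i d hd = φ (raising h c i d hd) := by
  induction d with
  | zero => rfl
  | succ d ih => simp only [raising, qComm, ih, map_sub, map_mul, map_smul]; rfl

theorem lowering_map (h : ℂ) (c : ChevalleyData m A) (φ : A →ₐ[ℂ] B) (j d : ℕ)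
    (hd : j + d + 1 < m) : lowering h (c.map φ) j d hd = φ (lowering h c j d hd) := by
  induction d with
  | zero => rfl
  | succ d ih => simp only [lowering, qComm, ih, map_sub, map_mul, map_smul]; rfl

theorem cartanWeyl_map (h : ℂ) (c : ChevalleyData m A) (φ : A →ₐ[ℂ] B) (i j : Fin m) :
    cartanWeyl h (c.map φ) i j = φ (cartanWeyl h c i j) := by
  unfold cartanWeyl
  split_ifs
  exacts [raising_map .., lowering_map .., (map_zero φ).symm]

theorem laxMatrix_map (h : ℂ) (c : ChevalleyData m A) (φ : A →ₐ[ℂ] B) (u : ℂ) :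
    laxMatrix h (c.map φ) u = (laxMatrix h c u).map φ := by
  ext1 i j
  simp only [laxMatrix, Matrix.of_apply, Matrix.map_apply, cartanWeyl_map]
  split_ifs <;> simp [ChevalleyData.map]

/-- Expanding in powers of q^u, the two sides differ by λ⁻² times the product in `H`, a term
independent of u. -/
theorem spectralCombine_mul_spectralCombine (h : ℂ) (Lp Lm Mp Mm : Matrix (Fin m) (Fin m) A)
    (H : (qExp h 1 • Lp - qExp h (-1) • Lm) * (Mp - Mm) = 0) (u : ℂ) :
    spectralCombine h Lp Lm (u + 1) * spectralCombine h Mp Mm u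
      = qNum h u • spectralCombine h (Lp * Mp) (Lm * Mm) (u + 1) := by
  have e : -(u + 1) = -u + -1 := by ring
  have e1 : qExp h u * qExp h (-u) = 1 := by rw [← qExp_add, add_neg_cancel, qExp_zero]
  rw [← sub_eq_zero]
  have : spectralCombine h Lp Lm (u + 1) * spectralCombine h Mp Mm u
      - qNum h u • spectralCombine h (Lp * Mp) (Lm * Mm) (u + 1)
      = ((lam h)⁻¹ * (lam h)⁻¹ * (qExp h u * qExp h (-u))) •
        ((qExp h 1 • Lp - qExp h (-1) • Lm) * (Mp - Mm)) := by
    simp only [spectralCombine, qNum, div_eq_inv_mul, e, qExp_add, smul_mul_assoc, mul_smul_comm,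
      sub_mul, mul_sub, smul_sub, smul_smul]
    module
  rw [this, H, smul_zero]

end LaxMap

/-- If the next generator vanishes, so does the entry. This gives the zeros outside the n × n block
of L^n_±. -/
theorem upper_eq_zero {A : Type*} [Ring A] [Algebra ℂ A] {l : ℂ} {a b f : ℕ → A} {s j : ℕ}
    (h : s ≤ j) (hf : f j = 0) : upper l a b f s (j + 1) = 0 := by
  obtain ⟨d, rfl⟩ := Nat.exists_eq_add_of_le h
  cases d with
  | zero => rw [add_zero, upper_succ]; exact hf
  | succ d =>
      rw [show s + (d + 1) + 1 = s + d + 2 by ring, upper_add_two]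
      simp [show s + d + 1 = s + (d + 1) by ring, hf]

theorem extendBlock_castSucc {n : ℕ} {A : Type*} [Zero A] (M : Matrix (Fin n) (Fin n) A) (a : A)
    (i j : Fin n) : extendBlock M a i.castSucc j.castSucc = M i j := by
  simp [extendBlock]

theorem extendBlock_castSucc_last {n : ℕ} {A : Type*} [Zero A] (M : Matrix (Fin n) (Fin n) A)
    (a : A) (i : Fin n) : extendBlock M a i.castSucc (Fin.last n) = 0 := by
  simp [extendBlock]

theorem extendBlock_last_castSucc {n : ℕ} {A : Type*} [Zero A] (M : Matrix (Fin n) (Fin n) A)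
    (a : A) (i : Fin n) : extendBlock M a (Fin.last n) i.castSucc = 0 := by
  simp [extendBlock]

theorem extendBlock_last {n : ℕ} {A : Type*} [Zero A] (M : Matrix (Fin n) (Fin n) A)
    (a : A) : extendBlock M a (Fin.last n) (Fin.last n) = a := by
  simp [extendBlock]

/-! ### The rank-one matrix L^x(1) and the constraint on the second factor. -/

section ReducedFactorisation

variable {n : ℕ} {F V : Type*} [AddCommGroup F] [Module ℂ F] [AddCommGroup V] [Module ℂ V]
  {P : HeisenbergPairs (n + 1) F} {h : ℂ} {ρ : UqGL h n →ₐ[ℂ] Module.End ℂ V}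

theorem isUq_firstData (hl : lam h ≠ 0) : IsUq h (firstData V P h) :=
  (HeisenbergPairs.isUq_jsData P hl).map _

variable (F ρ) in
theorem isUq_secondData : IsUq h (secondData F ρ) := (isUq_gens h n).map _

variable (V) in
theorem isOscillator_firstData (hl : lam h ≠ 0) :
    IsOscillator (qExp h 1) (HeisenbergPairs.exchangeCoeff h n) n ((firstData V P h).triangular h)
      (fun i => onF F V (extendOne (P.bigX h) i)) (fun i => onF F V (extendOne (P.bigXInv h) i)) :=
          by
  rw [firstData, triangular_map]
  exact (HeisenbergPairs.isOscillator_jsData P hl).map _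

theorem bigXInv_last (P : HeisenbergPairs (n + 1) F) (h : ℂ) :
    P.bigXInv h (Fin.last n) = ↑(P.x (Fin.last n))⁻¹ := by
  have h1 := P.bigX_mul_inv h (Fin.last n)
  rw [HeisenbergPairs.bigX, if_pos rfl] at h1
  exact (Units.inv_eq_of_mul_eq_one_right h1).symm

/-- λ L^x(1) has rank one: off the diagonal this is the oscillator formula, and on it Y_i (a_i -
b_i) X_i = q a_i - q⁻¹ b_i. -/
theorem spectral_one_firstData (hl : lam h ≠ 0) (i j : Fin (n + 1)) :
    (qExp h 1 • laxPlus h (firstData V P h) - qExp h (-1) • laxMinus h (firstData V P h)) i j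
      = onF F V (P.bigXInv h i) * (((firstData V P h).triangular h).a i
        - ((firstData V P h).triangular h).b i) * onF F V (P.bigX h j) := by
  have H := isUq_firstData (V := V) (P := P) hl
  have O := isOscillator_firstData V (P := P) hl
  have hlq := lam_eq h
  have hq := qExp_ne_zero h 1
  have eX : ∀ i : Fin (n + 1), extendOne (P.bigX h) i = P.bigX h i := fun i =>
    extendOne_of_lt _ i.2
  have eY : ∀ i : Fin (n + 1), extendOne (P.bigXInv h) i = P.bigXInv h i := fun i =>
    extendOne_of_lt _ i.2
  simp only [Matrix.smul_apply, Matrix.sub_apply, laxPlus_eq_upper hl H.isTorus,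
    laxMinus_eq_upper hl H.isTorus', qExp_neg]
  rcases lt_trichotomy i j with hij | rfl | hij
  · rw [upper_of_lt (show (i : ℕ) < j from hij),
      O.upper_eq hlq hl (show (i : ℕ) < j from hij) (by omega), eX, eY, smul_zero, sub_zero,
      smul_smul, mul_inv_cancel₀ hq, one_smul]
  · rw [upper_self, upper_self]
    have h1 := O.X_a_self (i := i) (by omega)
    have h2 := O.X_b_self (i := i) (by omega)
    have h3 := O.Y_a_self (i := i) (by omega)
    have h4 := O.Y_b_self (i := i) (by omega)
    have h5 := O.YX i
    simp only [eX, eY] at h1 h2 h3 h4 h5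
    rw [mul_sub, sub_mul, h3, h4]
    simp only [smul_mul_assoc, mul_assoc, h5, mul_one]
  · rw [upper_of_lt (show (j : ℕ) < i from hij),
      O.lower_eq hlq hl (show (j : ℕ) < i from hij) (by omega), eX, eY, smul_zero, zero_sub,
      smul_neg, neg_neg, smul_smul, inv_mul_cancel₀ hq, one_smul]

theorem reducedMinus_castSucc (i : Fin n) (j : Fin (n + 1)) :
    reducedMinus P ρ i.castSucc j = LnMinus F ρ i.castSucc j := by
  simp [reducedMinus, (Fin.castSucc_lt_last i).ne]

theorem reducedMinus_last_castSucc (j : Fin n) :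
    reducedMinus P ρ (Fin.last n) j.castSucc = -(lam h • reducedE P ρ j) := by
  simp [reducedMinus]

theorem reducedMinus_last : reducedMinus P ρ (Fin.last n) (Fin.last n) = 1 := by
  simp [reducedMinus, LnMinus, extendBlock]

/-- At u = 0 the spectral decomposition reads λ L(0) = L_+ - L_-. -/
theorem lam_smul_reducedE (hl : lam h ≠ 0) (j : Fin n) : lam h • reducedE P ρ j
    = -(onF F V (P.bigXInv h (Fin.last n)) * ∑ s : Fin n, onF F V (P.bigX h s.castSucc)
      * (laxPlus h (secondData F ρ) s j - laxMinus h (secondData F ρ) s j)) := by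
  rw [reducedE, smul_neg, ← mul_smul_comm, Finset.smul_sum, bigXInv_last]
  simp only [laxMatrix_eq h hl, spectralCombine, neg_zero, qExp_zero, one_smul, Matrix.smul_apply,
    Matrix.sub_apply, mul_smul_comm, smul_smul, mul_inv_cancel₀ hl]

/-- The row X annihilates λ L'(0). In the columns k < n this is the definition of the reduced
entries, solved for the last term of the constraint; in the last column the two units cancel. -/
theorem sum_bigX_reduced (hl : lam h ≠ 0) (k : Fin (n + 1)) :
    ∑ j, onF F V (P.bigX h j) * (reducedPlus F ρ - reducedMinus P ρ) j k = 0 := by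
  have hX : ∀ z, onF F V (P.bigX h (Fin.last n)) * (onF F V (P.bigXInv h (Fin.last n)) * z) = z :=
    fun z => by rw [← mul_assoc, ← map_mul, P.bigX_mul_inv, map_one, one_mul]
  rw [Fin.sum_univ_castSucc]
  simp only [Matrix.sub_apply, reducedMinus_castSucc, reducedPlus, LnPlus, LnMinus]
  induction k using Fin.lastCases with
  | last => simp [extendBlock_castSucc_last, extendBlock_last, reducedMinus_last]
  | cast k =>
    rw [reducedMinus_last_castSucc, lam_smul_reducedE hl]
    simp only [extendBlock_castSucc, extendBlock_last_castSucc, neg_neg, zero_sub]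
    exact (congrArg₂ (· + ·) rfl ((mul_neg _ _).trans (congrArg Neg.neg (hX _)))).trans
      (add_neg_cancel _)

/-- The reduced relation between the product of the Lax matrices and `L^{(12')}`. -/
theorem laxMatrix_mul_reducedSecondLax (hl : lam h ≠ 0) (u : ℂ) :
    laxMatrix h (firstData V P h) (u + 1) * reducedSecondLax P ρ u
      = qNum h u • reducedLax P ρ (u + 1) := by
  rw [laxMatrix_eq h hl]
  refine spectralCombine_mul_spectralCombine h _ _ _ _ ?_ u
  ext1 i k
  rw [Matrix.mul_apply]
  simp only [spectral_one_firstData hl, mul_assoc]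
  rw [← Finset.mul_sum, ← Finset.mul_sum, sum_bigX_reduced hl, mul_zero, mul_zero]
  rfl

/-! ### The factorisation of the reduced Lax matrix -/

/-- The last row of `M_R(u+1)`, acting on the first factor. -/
def rightRow (V : Type*) [AddCommGroup V] [Module ℂ V] (P : HeisenbergPairs (n + 1) F) (h u : ℂ)
    (j : Fin n) : Module.End ℂ (F ⊗[ℂ] V) :=
  qExp h (-(2 * u)) • (onF F V (P.bigXInv h (Fin.last n)) * onF F V (P.bigX h j.castSucc))

theorem MR_map (u : ℂ) : (P.MR h (u + 1)).map (onF F V) = unipotentRow (rightRow V P h u) := by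
  rw [HeisenbergPairs.MR_eq]
  refine (unipotentRow_map (onF F V : Module.End ℂ F →+* Module.End ℂ (F ⊗[ℂ] V)) _).trans ?_
  congr 1
  funext j
  simp only [rightRow, RingHom.coe_coe, map_smul, map_mul]
  congr 2
  ring

theorem neg_row_identity {ι A : Type*} [Fintype ι] [Ring A] (r m : ι → A) (t : A) :
    0 - (∑ s, -r s * m s + t) = (∑ s, r s * m s) - t := by
  simp only [neg_mul, Finset.sum_neg_distrib]
  abel

/-- Let r be the last row of M_R. Conjugating the block diagonal matrix L_-^n by M_R changes only
its last row, to r - r L_-; hence that of M' is r L_- - r, and M' M_R has last row r L_-. -/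
theorem Mprime_eq (u : ℂ) : Mprime P ρ u = unipotentRow fun j =>
    (∑ s, rightRow V P h u s * laxMinus h (secondData F ρ) s j) - rightRow V P h u j := by
  rw [Mprime, MR_map, inverse_unipotentRow]
  refine matrix_ext_last (fun i j => ?_) (fun i => ?_) (fun j => ?_) ?_
  · simp [mul_unipotentRow_castSucc, unipotentRow_mul_castSucc, LnMinus, extendBlock_castSucc,
      extendBlock_castSucc_last, unipotentRow_castSucc, Matrix.one_apply, Pi.single_apply, eq_comm]
  · simp [mul_unipotentRow_last, unipotentRow_mul_castSucc, LnMinus, extendBlock_castSucc_last,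
      unipotentRow_castSucc]
  · have hj : Fin.last n ≠ j.castSucc := (Fin.castSucc_lt_last j).ne'
    simp only [Matrix.add_apply, Matrix.sub_apply, Matrix.one_apply, hj, if_false,
      mul_unipotentRow_castSucc, unipotentRow_mul_last, LnMinus, extendBlock_castSucc,
      extendBlock_castSucc_last, extendBlock_last_castSucc, extendBlock_last,
      unipotentRow_last_castSucc, zero_add, one_mul, mul_zero,
      Finset.sum_const_zero, add_zero]
    exact neg_row_identity _ _ _
  · simp [mul_unipotentRow_last, unipotentRow_mul_last, LnMinus, extendBlock_castSucc_last,
      extendBlock_last, unipotentRow_last_last]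

theorem isLastRowUnitriangular_Mprime (u : ℂ) : IsLastRowUnitriangular (Mprime P ρ u) := by
  rw [Mprime_eq]; exact isLastRowUnitriangular_unipotentRow _

/-- The reduced entry contributes -q^{-u}(p - m) and the row r contributes q^{-2u}(q^u p - q^{-u}
m), both up to λ⁻¹ y a_s. The p terms cancel precisely because r carries q^{-2u}, and the m terms
combine to [u] q^{-2u}. -/
theorem rightRow_identity {ι A : Type*} [Fintype ι] [Ring A] [Algebra ℂ A] (h u : ℂ) (y r : A)
    (a p m : ι → A) :
    (lam h)⁻¹ • (qExp h u • (0 : A) - qExp h (-u) • - -(y * ∑ s, a s * (p s - m s)))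
      + ∑ s, (qExp h (-(2 * u)) • (y * a s)) * ((lam h)⁻¹ • (qExp h u • p s - qExp h (-u) • m s))
    = 0 + (qNum h u • 1) * ((∑ s, (qExp h (-(2 * u)) • (y * a s)) * m s) - r + r) := by
  have e : qExp h (-(2 * u)) = (qExp h u)⁻¹ * (qExp h u)⁻¹ := by
    rw [← qExp_neg, ← qExp_add]; ring_nf
  have hu := qExp_ne_zero h u
  simp only [smul_zero, zero_sub, zero_add, neg_neg, sub_add_cancel, Finset.mul_sum,
    Finset.smul_sum, ← Finset.sum_neg_distrib, ← Finset.sum_add_distrib]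
  refine Finset.sum_congr rfl fun s _ => ?_
  simp only [mul_sub, smul_mul_assoc, mul_smul_comm, one_mul, mul_assoc, smul_sub, e, qNum,
      qExp_neg]
  match_scalars <;> field_simp <;> ring1

/-- The matrices L'(u) and L^n(u) differ only in the last row, and in the other rows all unipotent
factors act trivially. What remains is the equality of last rows, `rightRow_identity`. -/
theorem MR_mul_reducedSecondLax (hl : lam h ≠ 0) (u : ℂ) :
    (P.MR h (u + 1)).map (onF F V) * reducedSecondLax P ρ u
      = Ln F ρ u * Mprime P ρ u * (P.MR h (u + 1)).map (onF F V) := by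
  rw [MR_map, Mprime_eq, Matrix.mul_assoc, unipotentRow_mul]
  refine matrix_ext_last (fun i j => ?_) (fun i => ?_) (fun j => ?_) ?_
  · rw [mul_unipotentRow_castSucc, unipotentRow_mul_castSucc]
    simp [reducedSecondLax, spectralCombine, Ln, reducedPlus, reducedMinus_castSucc, LnPlus,
      LnMinus, extendBlock_castSucc, extendBlock_castSucc_last, laxMatrix_eq h hl]
  · rw [mul_unipotentRow_last, unipotentRow_mul_castSucc]
    simp [reducedSecondLax, spectralCombine, Ln, reducedPlus, reducedMinus_castSucc, LnPlus,
      LnMinus, extendBlock_castSucc_last]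
  · rw [mul_unipotentRow_castSucc, unipotentRow_mul_last]
    simp only [reducedSecondLax, spectralCombine, Ln, reducedPlus, reducedMinus_castSucc, LnPlus,
      LnMinus, extendBlock_castSucc, extendBlock_last_castSucc, extendBlock_last, Matrix.smul_apply,
      Matrix.sub_apply, reducedMinus_last_castSucc, lam_smul_reducedE hl, rightRow]
    exact rightRow_identity h u _ _ _ _ _
  · rw [mul_unipotentRow_last, unipotentRow_mul_last]
    simp [reducedSecondLax, spectralCombine, Ln, reducedPlus, reducedMinus_castSucc, LnPlus,
      LnMinus, extendBlock_castSucc_last, extendBlock_last, reducedMinus_last, qNum]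
    module

/-- The factorisation of `L^{(12')}`. -/
theorem reducedLax_factorisation (hl : lam h ≠ 0) (u : ℂ) : qNum h u • reducedLax P ρ (u + 1)
      = (P.ML h (u + 1)).map (onF F V) * (P.K h (u + 1)).map (onF F V) * Ln F ρ u
          * Mprime P ρ u * (P.MR h (u + 1)).map (onF F V) := by
  rw [← laxMatrix_mul_reducedSecondLax hl, firstData, laxMatrix_map,
    HeisenbergPairs.laxMatrix_jsData hl, Matrix.map_mul, Matrix.map_mul, Matrix.mul_assoc,
    MR_mul_reducedSecondLax hl]
  simp only [Matrix.mul_assoc]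

end ReducedFactorisation

/-! ### Chevalley generators of the reduced tensor product -/

section ReducedData

variable {A : Type*} [Ring A] [Algebra ℂ A]

/-- All elements of the family belong to `S`. -/
structure ChevalleyData.Mem {m : ℕ} (c : ChevalleyData m A) (S : Subalgebra ℂ A) : Prop where
  k : ∀ i, c.k i ∈ S
  kInv : ∀ i, c.kInv i ∈ S
  e : ∀ i hi, c.e i hi ∈ S
  f : ∀ i hi, c.f i hi ∈ S

theorem extendOne_mem {m : ℕ} {k : Fin m → A} {S : Subalgebra ℂ A} (h : ∀ i, k i ∈ S) (i : ℕ) :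
    extendOne k i ∈ S := by
  unfold extendOne
  split_ifs
  exacts [h _, S.one_mem]

theorem extendZero_mem {m : ℕ} {e : (i : ℕ) → i + 1 < m → A} {S : Subalgebra ℂ A}
    (h : ∀ i hi, e i hi ∈ S) (i : ℕ) : extendZero e i ∈ S := by
  unfold extendZero
  split_ifs
  exacts [h _ _, S.zero_mem]

/-- All elements of the family belong to `S`. -/
structure TriangularData.Mem (x : TriangularData A) (S : Subalgebra ℂ A) : Prop where
  a : ∀ i, x.a i ∈ S
  b : ∀ i, x.b i ∈ S
  e : ∀ i, x.e i ∈ S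
  f : ∀ i, x.f i ∈ S

theorem ChevalleyData.Mem.triangular {m : ℕ} {c : ChevalleyData m A} {S : Subalgebra ℂ A}
    (M : c.Mem S) (h : ℂ) : (c.triangular h).Mem S where
  a i := pow_mem (extendOne_mem M.k i) 2
  b i := pow_mem (extendOne_mem M.kInv i) 2
  e i := S.smul_mem (mul_mem (mul_mem (extendOne_mem M.kInv _) (extendOne_mem M.kInv _))
    (extendZero_mem M.e i)) _
  f i := S.smul_mem (mul_mem (mul_mem (extendOne_mem M.k _) (extendOne_mem M.k _))
    (extendZero_mem M.f i)) _

theorem TriangularData.Mem.commuting {x v : TriangularData A} {S₁ S₂ : Subalgebra ℂ A}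
    (hx : x.Mem S₁) (hv : v.Mem S₂) (hS : ∀ y ∈ S₁, ∀ z ∈ S₂, Commute y z) : Commuting x v where
  af := ⟨fun i j => hS _ (hx.a i) _ (hv.a j), fun i j => hS _ (hx.a i) _ (hv.f j),
    fun i j => hS _ (hx.f i) _ (hv.a j), fun i j => hS _ (hx.f i) _ (hv.f j)⟩
  be := ⟨fun i j => hS _ (hx.b i) _ (hv.b j), fun i j => hS _ (hx.b i) _ (hv.e j),
    fun i j => hS _ (hx.e i) _ (hv.b j), fun i j => hS _ (hx.e i) _ (hv.e j)⟩
  ef i j := hS _ (hx.e i) _ (hv.f j)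
  fe i j := hS _ (hx.f i) _ (hv.e j)

/-- Commuting invertible elements for which the `f_i` are weight vectors. -/
theorem isTorus_of_weight {s : ℂ} {k k' f : ℕ → A} (kk' : ∀ i, k i * k' i = 1)
    (k'k : ∀ i, k' i * k i = 1) (k_k : ∀ i j, k i * k j = k j * k i)
    (k_f : ∀ t i, k t * f i = (unitWeight s t (i + 1) * (unitWeight s t i)⁻¹) • (f i * k t)) :
    IsTorus s k k' f where
  kk' := kk'
  k'k := k'k
  k_k := k_k
  k_f_self i := by rw [k_f]; simp [unitWeight]
  k_f_succ i := by rw [k_f]; simp [unitWeight]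
  k_f i j h h' := by rw [k_f]; simp [unitWeight, h.symm, h'.symm]

theorem IsTorus.k'_f_weight {s : ℂ} {k k' f : ℕ → A} (T : IsTorus s k k' f) (hs : s ≠ 0)
    (t i : ℕ) : k' t * f i = (unitWeight s t i * (unitWeight s t (i + 1))⁻¹) • (f i * k' t) := by
  have h1 := unitWeight_ne_zero hs t i
  have h2 := unitWeight_ne_zero hs t (i + 1)
  have := inv_qcomm (mul_ne_zero h2 (inv_ne_zero h1)) (T.kk' t) (T.k'k t) (T.k_f_weight t i)
  rw [this]
  congr 1
  field_simp

/-- Generators of `U_q(gl(n+1))`, given by the co-product except for the last raising one. -/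
def reducedData {n : ℕ} (h : ℂ) (c : ChevalleyData (n + 1) A) (d : ChevalleyData n A) (r : A) :
    ChevalleyData (n + 1) A where
  k i := c.k i * extendOne d.k i
  kInv i := c.kInv i * extendOne d.kInv i
  -- Obtained by solving L_{-,n,n-1} = -λ q^{1/2} q^{-N_n/2} q^{-N_{n-1}/2} e_{n-1} for the
  -- generator, with the prescribed entry r on the left.
  e i hi := if i + 1 = n then (-(lam h * qExp h (1 / 2))⁻¹) •
      (c.k ⟨i, by omega⟩ * extendOne d.k i * (c.k ⟨i + 1, hi⟩ * extendOne d.k (i + 1)) * r)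
    else c.e i hi * (extendOne d.kInv i * extendOne d.k (i + 1))
      + c.k ⟨i, by omega⟩ * c.kInv ⟨i + 1, hi⟩ * extendZero d.e i
  f i hi := c.f i hi * (extendOne d.kInv i * extendOne d.k (i + 1))
    + c.k ⟨i, by omega⟩ * c.kInv ⟨i + 1, hi⟩ * extendZero d.f i

section Coproduct

variable {S₁ S₂ : Subalgebra ℂ A}

/-- The symmetric co-product of Chevalley generators, multiplied by the Cartan factors of L_±,
becomes the triangular one, a f + f a, of `TriangularData.mul`. -/
theorem coproduct_triangular {k₁ k₁' k₂ k₂' : ℕ → A} {g₁ g₂ : A}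
    (hS : ∀ y ∈ S₁, ∀ z ∈ S₂, Commute y z)
    (hk₁ : ∀ i, k₁ i ∈ S₁) (hk₁' : ∀ i, k₁' i ∈ S₁) (hk₂ : ∀ i, k₂ i ∈ S₂) (hg₁ : g₁ ∈ S₁)
    (kk₁ : ∀ i, k₁ i * k₁' i = 1) (k_k₁ : ∀ i j, k₁' i * k₁ j = k₁ j * k₁' i)
    (kk₂ : ∀ i, k₂ i * k₂' i = 1) (k_k₂ : ∀ i j, k₂ i * k₂ j = k₂ j * k₂ i) (i j : ℕ) :
    k₁ i * k₂ i * (k₁ j * k₂ j) * (g₁ * (k₂' i * k₂ j) + k₁ i * k₁' j * g₂)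
      = k₁ i ^ 2 * (k₂ i * k₂ j * g₂) + k₁ i * k₁ j * g₁ * k₂ j ^ 2 := by
  have h1 : k₁ i * k₁ j * (k₁ i * k₁' j) = k₁ i ^ 2 := by
    rw [← k_k₁ j i, mul_assoc, ← mul_assoc (k₁ j), kk₁, one_mul, sq]
  have h2 : k₂ i * k₂ j * (k₂' i * k₂ j) = k₂ j ^ 2 := by
    rw [k_k₂ i j, mul_assoc, ← mul_assoc (k₂ i), kk₂, one_mul, sq]
  rw [(hS _ (hk₁ j) _ (hk₂ i)).symm.mul_mul_mul_comm, mul_add,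
    (hS _ hg₁ _ (mul_mem (hk₂ i) (hk₂ j))).symm.mul_mul_mul_comm,
    (hS _ (mul_mem (hk₁ i) (hk₁' j)) _ (mul_mem (hk₂ i) (hk₂ j))).symm.mul_mul_mul_comm, h1, h2,
    add_comm]

theorem coproduct_weight (hS : ∀ y ∈ S₁, ∀ z ∈ S₂, Commute y z) {u₁ u₂ y z g₁ g₂ : A}
    (hu₁ : u₁ ∈ S₁) (hu₂ : u₂ ∈ S₂) (hy : y ∈ S₁) (hz : z ∈ S₂) (hg₁ : g₁ ∈ S₁) (hg₂ : g₂ ∈ S₂)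
    {w : ℂ} (h1 : u₁ * g₁ = w • (g₁ * u₁)) (h2 : u₂ * g₂ = w • (g₂ * u₂))
    (hyu : Commute u₁ y) (hzu : Commute u₂ z) :
    u₁ * u₂ * (g₁ * z + y * g₂) = w • ((g₁ * z + y * g₂) * (u₁ * u₂)) := by
  rw [mul_add, add_mul, smul_add, (hS _ hg₁ _ hu₂).symm.mul_mul_mul_comm,
    (hS _ hy _ hu₂).symm.mul_mul_mul_comm, (hS _ hu₁ _ hz).symm.mul_mul_mul_comm,
    (hS _ hu₁ _ hg₂).symm.mul_mul_mul_comm, h1, h2, hyu.eq, hzu.eq, smul_mul_assoc,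
    mul_smul_comm]

end Coproduct

variable {n : ℕ} {h : ℂ} {c : ChevalleyData (n + 1) A} {d : ChevalleyData n A} {r : A}

theorem extendOne_reducedData_k (i : ℕ) :
    extendOne (reducedData h c d r).k i = extendOne c.k i * extendOne d.k i := by
  by_cases hi : i < n + 1
  · rw [extendOne_of_lt _ hi, extendOne_of_lt _ hi]; rfl
  · rw [extendOne_of_le _ (by omega), extendOne_of_le _ (by omega), extendOne_of_le _ (by omega),
      one_mul]

theorem extendOne_reducedData_kInv (i : ℕ) :
    extendOne (reducedData h c d r).kInv i = extendOne c.kInv i * extendOne d.kInv i := by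
  by_cases hi : i < n + 1
  · rw [extendOne_of_lt _ hi, extendOne_of_lt _ hi]; rfl
  · rw [extendOne_of_le _ (by omega), extendOne_of_le _ (by omega), extendOne_of_le _ (by omega),
      one_mul]

theorem extendZero_reducedData_f (i : ℕ) : extendZero (reducedData h c d r).f i
    = extendZero c.f i * (extendOne d.kInv i * extendOne d.k (i + 1))
      + extendOne c.k i * extendOne c.kInv (i + 1) * extendZero d.f i := by
  by_cases hi : i + 1 < n + 1
  · rw [extendZero_of_lt _ hi, extendZero_of_lt _ hi, extendOne_of_lt c.k (by omega),
      extendOne_of_lt c.kInv hi]; rfl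
  · rw [extendZero_of_le _ (by omega), extendZero_of_le _ (by omega), extendZero_of_le _ (by omega),
      zero_mul, mul_zero, add_zero]

theorem extendZero_reducedData_e {i : ℕ} (hin : i + 1 ≠ n) : extendZero (reducedData h c d r).e i
    = extendZero c.e i * (extendOne d.kInv i * extendOne d.k (i + 1))
      + extendOne c.k i * extendOne c.kInv (i + 1) * extendZero d.e i := by
  by_cases hi : i + 1 < n + 1
  · rw [extendZero_of_lt _ hi, extendZero_of_lt _ hi, extendOne_of_lt c.k (by omega),
      extendOne_of_lt c.kInv hi]
    exact if_neg hin
  · rw [extendZero_of_le _ (by omega), extendZero_of_le _ (by omega), extendZero_of_le _ (by omega),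
      zero_mul, mul_zero, add_zero]

theorem extendZero_reducedData_e_last {i : ℕ} (hin : i + 1 = n) :
    extendZero (reducedData h c d r).e i = (-(lam h * qExp h (1 / 2))⁻¹) •
      (extendOne c.k i * extendOne d.k i * (extendOne c.k (i + 1) * extendOne d.k (i + 1)) * r) :=
          by
  rw [extendZero_of_lt _ (by omega), extendOne_of_lt c.k (by omega),
    extendOne_of_lt c.k (show i + 1 < n + 1 by omega)]
  exact if_pos hin

variable {S₁ S₂ : Subalgebra ℂ A}

theorem reducedData_k_kInv (hS : ∀ y ∈ S₁, ∀ z ∈ S₂, Commute y z) (M₁ : c.Mem S₁) (M₂ : d.Mem S₂)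
    (H₁ : IsUq h c) (H₂ : IsUq h d) (i : ℕ) :
    extendOne (reducedData h c d r).k i * extendOne (reducedData h c d r).kInv i = 1 := by
  rw [extendOne_reducedData_k, extendOne_reducedData_kInv,
    (hS _ (extendOne_mem M₁.kInv i) _ (extendOne_mem M₂.k i)).symm.mul_mul_mul_comm,
    H₁.isTorus.kk', H₂.isTorus.kk', one_mul]

theorem reducedData_kInv_k (hS : ∀ y ∈ S₁, ∀ z ∈ S₂, Commute y z) (M₁ : c.Mem S₁) (M₂ : d.Mem S₂)
    (H₁ : IsUq h c) (H₂ : IsUq h d) (i : ℕ) :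
    extendOne (reducedData h c d r).kInv i * extendOne (reducedData h c d r).k i = 1 := by
  rw [extendOne_reducedData_k, extendOne_reducedData_kInv,
    (hS _ (extendOne_mem M₁.k i) _ (extendOne_mem M₂.kInv i)).symm.mul_mul_mul_comm,
    H₁.isTorus.k'k, H₂.isTorus.k'k, one_mul]

theorem reducedData_k_k (hS : ∀ y ∈ S₁, ∀ z ∈ S₂, Commute y z) (M₁ : c.Mem S₁) (M₂ : d.Mem S₂)
    (H₁ : IsUq h c) (H₂ : IsUq h d) (i j : ℕ) :
    extendOne (reducedData h c d r).k i * extendOne (reducedData h c d r).k j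
      = extendOne (reducedData h c d r).k j * extendOne (reducedData h c d r).k i := by
  simp only [extendOne_reducedData_k]
  rw [(hS _ (extendOne_mem M₁.k j) _ (extendOne_mem M₂.k i)).symm.mul_mul_mul_comm,
    (hS _ (extendOne_mem M₁.k i) _ (extendOne_mem M₂.k j)).symm.mul_mul_mul_comm,
    H₁.isTorus.k_k, H₂.isTorus.k_k i j]

theorem reducedData_triangular (hl : lam h ≠ 0) (hS : ∀ y ∈ S₁, ∀ z ∈ S₂, Commute y z)
    (M₁ : c.Mem S₁) (M₂ : d.Mem S₂) (H₁ : IsUq h c) (H₂ : IsUq h d) :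
    (reducedData h c d r).triangular h =
      { a := (mul (c.triangular h) (d.triangular h)).a
        b := (mul (c.triangular h) (d.triangular h)).b
        e := fun i => if i + 1 = n then r else (mul (c.triangular h) (d.triangular h)).e i
        f := (mul (c.triangular h) (d.triangular h)).f } := by
  have T₁ := H₁.isTorus
  have T₂ := H₂.isTorus
  have key : ∀ y ∈ S₁, ∀ z ∈ S₂, (y * z) ^ 2 = y ^ 2 * z ^ 2 := fun y hy z hz =>
    (hS y hy z hz).mul_pow 2
  unfold ChevalleyData.triangular mul
  congr 1
  · funext i
    rw [extendOne_reducedData_k, key _ (extendOne_mem M₁.k i) _ (extendOne_mem M₂.k i)]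
  · funext i
    rw [extendOne_reducedData_kInv, key _ (extendOne_mem M₁.kInv i) _ (extendOne_mem M₂.kInv i)]
  · funext i
    by_cases hi : i + 1 = n
    · have hne : lam h * qExp h (1 / 2) ≠ 0 := mul_ne_zero hl (qExp_ne_zero _ _)
      rw [if_pos hi, extendZero_reducedData_e_last hi, ← extendOne_reducedData_k (h := h) (r := r),
        ← extendOne_reducedData_k (h := h) (r := r), mul_smul_comm, smul_smul, neg_mul_neg,
            mul_inv_cancel₀ hne,
        one_smul, ← mul_assoc, mul_assoc (extendOne _ (i + 1)), ← mul_assoc (extendOne _ i) _ _,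
        reducedData_kInv_k hS M₁ M₂ H₁ H₂, one_mul, reducedData_kInv_k hS M₁ M₂ H₁ H₂, one_mul]
    · rw [if_neg hi, extendZero_reducedData_e hi, extendOne_reducedData_kInv,
        extendOne_reducedData_kInv, T₂.k'_k, ← T₁.k'_k,
        coproduct_triangular hS (extendOne_mem M₁.kInv) (extendOne_mem M₁.k)
          (extendOne_mem M₂.kInv) (extendZero_mem M₁.e i) T₁.k'k (fun i j => (T₁.k'_k j i).symm)
          T₂.k'k T₂.k'_k' (i + 1) i, add_comm]
      simp only [smul_add, mul_smul_comm, smul_mul_assoc]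
  · funext i
    rw [extendOne_reducedData_k, extendOne_reducedData_k, extendZero_reducedData_f,
      coproduct_triangular hS (extendOne_mem M₁.k) (extendOne_mem M₁.kInv) (extendOne_mem M₂.k)
        (extendZero_mem M₁.f i) T₁.kk' T₁.k'_k T₂.kk' T₂.k_k]
    simp only [smul_add, mul_smul_comm, smul_mul_assoc]

theorem reducedData_isTorus (hS : ∀ y ∈ S₁, ∀ z ∈ S₂, Commute y z)
    (M₁ : c.Mem S₁) (M₂ : d.Mem S₂) (H₁ : IsUq h c) (H₂ : IsUq h d) :
    IsTorus (qExp h (1 / 2)) (extendOne (reducedData h c d r).k)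
      (extendOne (reducedData h c d r).kInv) (extendZero (reducedData h c d r).f) := by
  have T₁ := H₁.isTorus
  have T₂ := H₂.isTorus
  have hs := qExp_ne_zero h (1 / 2)
  refine isTorus_of_weight (reducedData_k_kInv hS M₁ M₂ H₁ H₂) (reducedData_kInv_k hS M₁ M₂ H₁ H₂)
    (reducedData_k_k hS M₁ M₂ H₁ H₂) fun t i => ?_
  rw [extendOne_reducedData_k, extendZero_reducedData_f]
  exact coproduct_weight hS (extendOne_mem M₁.k t) (extendOne_mem M₂.k t)
    (mul_mem (extendOne_mem M₁.k i) (extendOne_mem M₁.kInv _))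
    (mul_mem (extendOne_mem M₂.kInv i) (extendOne_mem M₂.k _)) (extendZero_mem M₁.f i)
    (extendZero_mem M₂.f i) (T₁.k_f_weight t i) (T₂.k_f_weight t i)
    (Commute.mul_right (T₁.k_k _ _) (T₁.k'_k _ _).symm)
    (Commute.mul_right (T₂.k'_k _ _).symm (T₂.k_k _ _))

theorem reducedData_isTorus' (hS : ∀ y ∈ S₁, ∀ z ∈ S₂, Commute y z)
    (M₁ : c.Mem S₁) (M₂ : d.Mem S₂) (H₁ : IsUq h c) (H₂ : IsUq h d)
    (hr : ∀ t i, i + 1 = n → extendOne c.kInv t * extendOne d.kInv t * r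
      = (unitWeight (qExp h (1 / 2)) t (i + 1) * (unitWeight (qExp h (1 / 2)) t i)⁻¹) •
        (r * (extendOne c.kInv t * extendOne d.kInv t))) :
    IsTorus (qExp h (1 / 2)) (extendOne (reducedData h c d r).kInv)
      (extendOne (reducedData h c d r).k) (extendZero (reducedData h c d r).e) := by
  have T₁ := H₁.isTorus'
  have T₂ := H₂.isTorus'
  have hs := qExp_ne_zero h (1 / 2)
  have kk := reducedData_k_k (r := r) hS M₁ M₂ H₁ H₂
  have k1 := reducedData_k_kInv (r := r) hS M₁ M₂ H₁ H₂
  have k2 := reducedData_kInv_k (r := r) hS M₁ M₂ H₁ H₂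
  have k'k : ∀ i j, extendOne (reducedData h c d r).kInv i * extendOne (reducedData h c d r).k j
      = extendOne (reducedData h c d r).k j * extendOne (reducedData h c d r).kInv i :=
    fun i j => inv_comm (k1 i) (k2 i) (kk i j)
  refine isTorus_of_weight k2 k1
    (fun i j => inv_comm (k1 i) (k2 i) (k'k j i).symm) fun t i => ?_
  by_cases hi : i + 1 = n
  · rw [extendZero_reducedData_e_last hi, ← extendOne_reducedData_k (h := h) (r := r),
      ← extendOne_reducedData_k (h := h) (r := r)]
    have h1 := hr t i hi
    rw [← extendOne_reducedData_kInv (h := h) (r := r)] at h1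
    rw [mul_smul_comm, smul_mul_assoc, smul_comm]
    congr 1
    rw [mul_assoc, mul_assoc, mul_comm_assoc (k'k t i), mul_comm_assoc (k'k t (i + 1)), h1]
    simp only [mul_smul_comm, mul_assoc]
  · rw [extendOne_reducedData_kInv, extendZero_reducedData_e hi]
    exact coproduct_weight hS (extendOne_mem M₁.kInv t) (extendOne_mem M₂.kInv t)
      (mul_mem (extendOne_mem M₁.k i) (extendOne_mem M₁.kInv _))
      (mul_mem (extendOne_mem M₂.kInv i) (extendOne_mem M₂.k _)) (extendZero_mem M₁.e i)
      (extendZero_mem M₂.e i) (T₁.k_f_weight t i) (T₂.k_f_weight t i)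
      (Commute.mul_right (T₁.k'_k _ _).symm (T₁.k_k _ _))
      (Commute.mul_right (T₂.k_k _ _) (T₂.k'_k _ _).symm)

/-- The last row of `L_-` of the reduced tensor product consists of weight vectors. -/
theorem lastRow_weight {l : ℂ} {n : ℕ} {v : TriangularData A} {X : ℕ → A} {G H u : A} {w : ℕ → ℂ}
    (hw : ∀ i, w i ≠ 0) (ua : ∀ i, u * v.a i = v.a i * u) (ub : ∀ i, u * v.b i = v.b i * u)
    (uf : ∀ i, u * v.f i = (w i * (w (i + 1))⁻¹) • (v.f i * u))
    (ue : ∀ i, u * v.e i = (w (i + 1) * (w i)⁻¹) • (v.e i * u))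
    (uX : ∀ k, k < n → u * X k = (w k)⁻¹ • (X k * u)) (uG : u * G = w n • (G * u))
    (uH : u * H = w n • (H * u)) {j : ℕ} (hj : j < n) :
    u * lastRow l n v X G H j = (w n * (w j)⁻¹) • (lastRow l n v X G H j * u) := by
  have hw' : ∀ i, (w i)⁻¹ ≠ 0 := fun i => inv_ne_zero (hw i)
  have h1 : ∀ k ≤ j, u * upper l v.a v.b v.f k j
      = (w k * (w j)⁻¹) • (upper l v.a v.b v.f k j * u) := by
    intro k hk
    rw [upper_weight hw' ua ub (fun i => by rw [uf, inv_inv, mul_comm]) hk, inv_inv, mul_comm]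
  have h2 : ∀ k, j ≤ k → u * upper l v.b v.a v.e j k
      = (w k * (w j)⁻¹) • (upper l v.b v.a v.e j k * u) := fun k hk =>
    upper_weight hw ub ua ue hk
  -- The weight of the summation index k in L_{±} is cancelled by that of X_k, so all terms of
  -- either row have the weight of j alone.
  have h3 : ∀ {k : ℕ} {y : A}, k < n → u * y = (w k * (w j)⁻¹) • (y * u) →
      u * (X k * y) = (w j)⁻¹ • (X k * y * u) := by
    intro k y hk hy
    have := hw k
    rw [mul_qcomm_assoc (uX k hk), hy, mul_smul_comm, smul_smul, mul_assoc]
    congr 1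
    field_simp
  have hp : u * plusRow l v X j = (w j)⁻¹ • (plusRow l v X j * u) :=
    qcomm_sum fun k hk => have hk' := Finset.mem_range.mp hk
      h3 (by omega) (h1 k (by omega))
  have hm : u * minusRow l n v X j = (w j)⁻¹ • (minusRow l n v X j * u) :=
    qcomm_sum fun k hk => h3 (Finset.mem_Ico.mp hk).2 (h2 k (Finset.mem_Ico.mp hk).1)
  rw [lastRow, mul_sub, sub_mul, smul_sub, mul_qcomm_assoc uG, mul_qcomm_assoc uH, hp, hm]
  simp only [mul_smul_comm, smul_smul, mul_assoc]

end ReducedData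

/-! ### The representation on the reduced tensor product -/

theorem sum_fin_eq_sum_range {A : Type*} [AddCommMonoid A] {n j : ℕ} (hj : j < n) (g : ℕ → A)
    (hg : ∀ k, j < k → g k = 0) :
    ∑ k : Fin n, g k = ∑ k ∈ Finset.range (j + 1), g k := by
  rw [Fin.sum_univ_eq_sum_range g]
  exact (Finset.sum_subset (Finset.range_subset_range.mpr (by omega)) fun k _ hk => hg k (by
    rw [Finset.mem_range] at hk; omega)).symm

section TensorRepresentation

variable {n : ℕ} {F V : Type*} [AddCommGroup F] [Module ℂ F] [AddCommGroup V] [Module ℂ V]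
  {P : HeisenbergPairs (n + 1) F} {h : ℂ} {ρ : UqGL h n →ₐ[ℂ] Module.End ℂ V}

theorem commute_onF_onV (y : Module.End ℂ (F ⊗[ℂ] V)) (hy : y ∈ (onF F V).range)
    (z : Module.End ℂ (F ⊗[ℂ] V)) (hz : z ∈ (onV F V).range) : Commute y z := by
  obtain ⟨y, rfl⟩ := hy
  obtain ⟨z, rfl⟩ := hz
  exact TensorProduct.ext' fun a b => rfl

theorem firstData_mem : (firstData V P h).Mem (onF F V).range :=
  ⟨fun _ => ⟨_, rfl⟩, fun _ => ⟨_, rfl⟩, fun _ _ => ⟨_, rfl⟩, fun _ _ => ⟨_, rfl⟩⟩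

theorem secondData_mem : (secondData F ρ).Mem (onV F V).range :=
  ⟨fun _ => ⟨_, rfl⟩, fun _ => ⟨_, rfl⟩, fun _ _ => ⟨_, rfl⟩, fun _ _ => ⟨_, rfl⟩⟩

/-- The triangular data of the first factor. -/
abbrev firstTriangular (V : Type*) [AddCommGroup V] [Module ℂ V] (P : HeisenbergPairs (n + 1) F)
    (h : ℂ) : TriangularData (Module.End ℂ (F ⊗[ℂ] V)) := (firstData V P h).triangular h

/-- The triangular data of the second factor. -/
abbrev secondTriangular (F : Type*) [AddCommGroup F] [Module ℂ F] {h : ℂ}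
    (ρ : UqGL h n →ₐ[ℂ] Module.End ℂ V) : TriangularData (Module.End ℂ (F ⊗[ℂ] V)) :=
  (secondData F ρ).triangular h

/-- `X_i`, acting on the first factor. -/
def firstX (V : Type*) [AddCommGroup V] [Module ℂ V] (P : HeisenbergPairs (n + 1) F) (h : ℂ)
    (i : ℕ) : Module.End ℂ (F ⊗[ℂ] V) := onF F V (extendOne (P.bigX h) i)

/-- `X_i⁻¹`, acting on the first factor. -/
def firstY (V : Type*) [AddCommGroup V] [Module ℂ V] (P : HeisenbergPairs (n + 1) F) (h : ℂ)
    (i : ℕ) : Module.End ℂ (F ⊗[ℂ] V) := onF F V (extendOne (P.bigXInv h) i)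

theorem firstTriangular_relations (hl : lam h ≠ 0) :
    Relations (qExp h 1) (lam h) (n + 1) (firstTriangular V P h) :=
  (isUq_firstData hl).relations hl

theorem triangular_last {m : ℕ} {A : Type*} [Ring A] [Algebra ℂ A] (h : ℂ) (c : ChevalleyData m A)
    (i : ℕ) : (m ≤ i + 1 → (c.triangular h).f i = 0) ∧ (m ≤ i + 1 → (c.triangular h).e i = 0) ∧
    (m ≤ i → (c.triangular h).a i = 1) ∧ (m ≤ i → (c.triangular h).b i = 1) := by
  refine ⟨fun hi => ?_, fun hi => ?_, fun hi => ?_, fun hi => ?_⟩ <;>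
    simp [ChevalleyData.triangular, extendZero_of_le, extendOne_of_le, hi]

theorem reducedSetting_tensor (hl : lam h ≠ 0) :
    ReducedSetting (qExp h 1) (lam h) (HeisenbergPairs.exchangeCoeff h n n)⁻¹ n
      (firstTriangular V P h) (secondTriangular F ρ) (firstX V P h)
      ((firstTriangular V P h).b n * firstY V P h n)
      (qExp h 1 ^ 2 • ((firstTriangular V P h).a n * firstY V P h n)) :=
  have M₁ := (firstData_mem (V := V) (P := P) (h := h)).triangular h
  have M₂ := (secondData_mem (F := F) (ρ := ρ)).triangular h
  (isOscillator_firstData V hl).reducedSetting (lam_eq h)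
    ((firstTriangular_relations hl).mono (Nat.le_succ n)) ((isUq_secondData F ρ).relations hl)
    (M₁.commuting M₂ commute_onF_onV)
    (fun i hi => (triangular_last h _ i).1 (by omega))
    (fun i hi => (triangular_last h _ i).2.1 (by omega))
    (fun i => (triangular_last h _ i).1) (fun i => (triangular_last h _ i).2.1)
    (fun i => (triangular_last h _ i).2.2.1) (fun i => (triangular_last h _ i).2.2.2)
    (fun k i => ⟨commute_onF_onV _ ⟨_, rfl⟩ _ (M₂.a i), commute_onF_onV _ ⟨_, rfl⟩ _ (M₂.b i),
      commute_onF_onV _ ⟨_, rfl⟩ _ (M₂.e i), commute_onF_onV _ ⟨_, rfl⟩ _ (M₂.f i)⟩)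

/-- The last row of `L_-` of the reduced tensor product. -/
def tensorRow (P : HeisenbergPairs (n + 1) F) (ρ : UqGL h n →ₐ[ℂ] Module.End ℂ V) (j : ℕ) :
    Module.End ℂ (F ⊗[ℂ] V) :=
  lastRow (lam h) n (secondTriangular F ρ) (firstX V P h)
    ((firstTriangular V P h).b n * firstY V P h n)
    (qExp h 1 ^ 2 • ((firstTriangular V P h).a n * firstY V P h n)) j

/-- The Chevalley generators acting on the reduced tensor product. -/
def tensorData (P : HeisenbergPairs (n + 1) F) (ρ : UqGL h n →ₐ[ℂ] Module.End ℂ V) :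
    ChevalleyData (n + 1) (Module.End ℂ (F ⊗[ℂ] V)) :=
  reducedData h (firstData V P h) (secondData F ρ) (tensorRow P ρ (n - 1))

theorem tensorData_triangular (hl : lam h ≠ 0) : (tensorData P ρ).triangular h
    = reducedTriangular (lam h) n (firstTriangular V P h) (secondTriangular F ρ) (firstX V P h)
      ((firstTriangular V P h).b n * firstY V P h n)
      (qExp h 1 ^ 2 • ((firstTriangular V P h).a n * firstY V P h n)) := by
  rw [tensorData, reducedData_triangular hl commute_onF_onV firstData_mem secondData_mem
    (isUq_firstData hl) (isUq_secondData F ρ), reducedTriangular]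
  congr 1
  funext i
  split_ifs with hi
  -- The truncated subtraction in `tensorData` is harmless: for n = 0 there is no i with i + 1 = n.
  · obtain rfl : i = n - 1 := by omega
    rfl
  · rfl

theorem kInv_firstX (t : ℕ) {k : ℕ} (hk : k ≤ n) :
    extendOne (firstData V P h).kInv t * firstX V P h k
      = (unitWeight (qExp h (1 / 2)) t k)⁻¹ •
        (firstX V P h k * extendOne (firstData V P h).kInv t) := by
  have e1 : extendOne (firstData V P h).kInv t = onF F V (extendOne (P.jsData h).kInv t) :=
    (extendOne_map _ _ _).symm
  rw [e1, firstX, ← map_mul, ← map_mul, ← map_smul]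
  congr 1
  rw [extendOne_of_lt _ (show k < n + 1 by omega)]
  by_cases ht : t < n + 1
  · rw [extendOne_of_lt _ ht]
    by_cases hkt : k = t
    · subst hkt
      simp only [unitWeight, if_true, ← qExp_neg]
      exact HeisenbergPairs.qN_bigX_self h _ _
    · simp only [unitWeight, hkt, if_false, inv_one, one_smul]
      exact HeisenbergPairs.qN_bigX h (by simpa [Fin.ext_iff] using Ne.symm hkt) _
  · rw [extendOne_of_le _ (by omega), one_mul, mul_one, unitWeight, if_neg (by omega), inv_one,
      one_smul]

/-- `reduced_relations` involves only q^{±N_i}; to recover the Chevalley relations the weight of the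
new generator under the square roots q^{±N_i/2} is needed as well. -/
theorem tensorRow_weight (hl : lam h ≠ 0) (t : ℕ) {j : ℕ} (hj : j < n) :
    extendOne (firstData V P h).kInv t * extendOne (secondData F ρ).kInv t * tensorRow P ρ j
      = (unitWeight (qExp h (1 / 2)) t n * (unitWeight (qExp h (1 / 2)) t j)⁻¹) • (tensorRow P ρ j *
        (extendOne (firstData V P h).kInv t * extendOne (secondData F ρ).kInv t)) := by
  have hs := qExp_ne_zero h (1 / 2)
  have hC := commute_onF_onV (F := F) (V := V)
  have M₁ := firstData_mem (V := V) (P := P) (h := h)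
  have M₂ := secondData_mem (F := F) (ρ := ρ)
  have T := (isUq_secondData F ρ).isTorus
  have T' := (isUq_secondData F ρ).isTorus'
  have T₁ := (isUq_firstData (V := V) (P := P) hl).isTorus
  have N₂ := M₂.triangular h
  have O := isOscillator_firstData V (P := P) hl
  set u₁ := extendOne (firstData V P h).kInv t with hu₁
  set u₂ := extendOne (secondData F ρ).kInv t with hu₂
  have m₁ : u₁ ∈ (onF F V).range := extendOne_mem M₁.kInv t
  have m₂ : u₂ ∈ (onV F V).range := extendOne_mem M₂.kInv t
  have hv : ∀ {w : ℂ} {y : Module.End ℂ (F ⊗[ℂ] V)}, y ∈ (onV F V).range →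
      u₂ * y = w • (y * u₂) → u₁ * u₂ * y = w • (y * (u₁ * u₂)) := by
    intro w y hy h1
    rw [mul_assoc, h1, mul_smul_comm, ← mul_assoc, hC _ m₁ _ hy, mul_assoc]
  have hx : ∀ {w : ℂ} {y : Module.End ℂ (F ⊗[ℂ] V)}, y ∈ (onF F V).range →
      u₁ * y = w • (y * u₁) → u₁ * u₂ * y = w • (y * (u₁ * u₂)) := by
    intro w y hy h1
    rw [mul_assoc, ← hC _ hy _ m₂, ← mul_assoc, h1, smul_mul_assoc, mul_assoc]
  have hY : u₁ * firstY V P h n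
      = unitWeight (qExp h (1 / 2)) t n • (firstY V P h n * u₁) := by
    have h1 := kInv_firstX (V := V) (P := P) (h := h) t (le_refl n)
    have hw := unitWeight_ne_zero hs t n
    have h2 := inv_qcomm hw (O.XY n) (O.YX n) (qcomm_symm (inv_ne_zero hw) h1 |> fun e => by
      rwa [inv_inv] at e)
    have h3 := qcomm_symm (inv_ne_zero hw) h2
    rwa [inv_inv] at h3
  have mY : firstY V P h n ∈ (onF F V).range := ⟨_, rfl⟩
  have N₁ := M₁.triangular h
  refine lastRow_weight (u := u₁ * u₂) (unitWeight_ne_zero hs t) (fun i => ?_) (fun i => ?_)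
    (fun i => ?_) (fun i => ?_) (fun k hk => ?_) ?_ ?_ hj
  · have := hv (w := 1) (N₂.a i) (by
      rw [one_smul]; exact Commute.pow_right (T.k'_k t i) 2)
    rwa [one_smul] at this
  · have := hv (w := 1) (N₂.b i) (by
      rw [one_smul]; exact Commute.pow_right (T.k'_k' t i) 2)
    rwa [one_smul] at this
  · refine hv (N₂.f i) ?_
    simp only [ChevalleyData.triangular, mul_smul_comm, smul_mul_assoc]
    rw [smul_comm]
    congr 1
    rw [mul_assoc, mul_comm_assoc (T.k'_k t i), mul_comm_assoc (T.k'_k t (i + 1)),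
      T.k'_f_weight hs]
    simp only [mul_smul_comm, mul_assoc, hu₂]
  · refine hv (N₂.e i) ?_
    simp only [ChevalleyData.triangular, mul_smul_comm, smul_mul_assoc]
    rw [smul_comm]
    congr 1
    rw [mul_assoc, mul_comm_assoc (T.k'_k' t (i + 1)), mul_comm_assoc (T.k'_k' t i),
      T'.k_f_weight]
    simp only [mul_smul_comm, mul_assoc, hu₂]
  · exact hx ⟨_, rfl⟩ (kInv_firstX t hk.le)
  · refine hx (mul_mem (N₁.b n) mY) ?_
    have hb : u₁ * (firstTriangular V P h).b n = (firstTriangular V P h).b n * u₁ :=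
      Commute.pow_right (T₁.k'_k' t n) 2
    rw [mul_comm_assoc hb, hY, mul_smul_comm, mul_assoc]
  · refine hx (Subalgebra.smul_mem _ (mul_mem (N₁.a n) mY) _) ?_
    have ha : u₁ * (firstTriangular V P h).a n = (firstTriangular V P h).a n * u₁ :=
      Commute.pow_right (T₁.k'_k t n) 2
    rw [mul_smul_comm, mul_comm_assoc ha, hY, mul_smul_comm, smul_mul_assoc, smul_comm, mul_assoc]

theorem isUq_tensorData (hl : lam h ≠ 0) (hq2 : 1 + qExp h 1 ^ 2 ≠ 0) :
    IsUq h (tensorData P ρ) := by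
  have H₁ := isUq_firstData (V := V) (P := P) hl
  have H₂ := isUq_secondData F ρ
  refine isUq_of_relations hl
    (reducedData_isTorus commute_onF_onV firstData_mem secondData_mem H₁ H₂)
    (reducedData_isTorus' commute_onF_onV firstData_mem secondData_mem H₁ H₂ ?_) ?_
  · rintro t i rfl
    exact tensorRow_weight hl t (by omega)
  · rw [tensorData_triangular hl]
    exact (reducedSetting_tensor hl).reduced_relations (lam_eq h) hl (qExp_ne_zero _ _) hq2

/-! ### The Lax matrix of the reduced tensor product -/

/-- Extending the data of V by 1 on the diagonal and 0 elsewhere is the same as adding a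
one-dimensional block with entry 1 to L_±. -/
theorem LnPlus_eq_upper (hl : lam h ≠ 0) (i j : Fin (n + 1)) : LnPlus F ρ i j = upper (lam h)
    (secondTriangular F ρ).a (secondTriangular F ρ).b (secondTriangular F ρ).f i j := by
  have T := (isUq_secondData F ρ).isTorus
  induction i using Fin.lastCases with
  | last =>
    induction j using Fin.lastCases with
    | last =>
      rw [LnPlus, extendBlock_last, upper_self]
      exact ((triangular_last h _ _).2.2.1 le_rfl).symm
    | cast j => rw [LnPlus, extendBlock_last_castSucc, upper_of_lt (by simp)]
  | cast i =>
    induction j using Fin.lastCases with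
    | last =>
      obtain ⟨p, rfl⟩ : ∃ p, n = p + 1 := ⟨n - 1, by have := i.2; omega⟩
      rw [LnPlus, extendBlock_castSucc_last]
      exact (upper_eq_zero (s := i) (j := p) (by omega) ((triangular_last h _ _).1 (by omega))).symm
    | cast j => rw [LnPlus, extendBlock_castSucc, laxPlus_eq_upper hl T]; rfl

theorem LnMinus_eq_upper (hl : lam h ≠ 0) (i j : Fin (n + 1)) : LnMinus F ρ i j = upper (lam h)
    (secondTriangular F ρ).b (secondTriangular F ρ).a (secondTriangular F ρ).e j i := by
  have T := (isUq_secondData F ρ).isTorus'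
  induction i using Fin.lastCases with
  | last =>
    induction j using Fin.lastCases with
    | last =>
      rw [LnMinus, extendBlock_last, upper_self]
      exact ((triangular_last h _ _).2.2.2 le_rfl).symm
    | cast j =>
      obtain ⟨p, rfl⟩ : ∃ p, n = p + 1 := ⟨n - 1, by have := j.2; omega⟩
      rw [LnMinus, extendBlock_last_castSucc]
      exact (upper_eq_zero (s := j) (j := p) (by omega) ((triangular_last h _ _).2.1
          (by omega))).symm
  | cast i =>
    induction j using Fin.lastCases with
    | last => rw [LnMinus, extendBlock_castSucc_last, upper_of_lt (by simp)]
    | cast j => rw [LnMinus, extendBlock_castSucc, laxMinus_eq_upper hl T]; rfl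

theorem laxPlus_tensorData (hl : lam h ≠ 0) (hq2 : 1 + qExp h 1 ^ 2 ≠ 0) :
    laxPlus h (tensorData P ρ) = laxPlus h (firstData V P h) * reducedPlus F ρ := by
  have D := reducedSetting_tensor (V := V) (P := P) (ρ := ρ) hl
  ext1 i j
  rw [laxPlus_eq_upper hl (isUq_tensorData hl hq2).isTorus, tensorData_triangular hl,
    Matrix.mul_apply]
  simp only [reducedPlus, LnPlus_eq_upper hl, laxPlus_eq_upper hl (isUq_firstData hl).isTorus]
  rw [sum_fin_eq_sum_range j.2 (fun k => upper (lam h) (firstTriangular V P h).a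
    (firstTriangular V P h).b (firstTriangular V P h).f i k * upper (lam h) (secondTriangular F ρ).a
    (secondTriangular F ρ).b (secondTriangular F ρ).f k j)
    fun k hk => by rw [upper_of_lt hk, mul_zero]]
  rcases le_or_gt (i : ℕ) j with hij | hij
  · exact upper_coproduct (lam_eq h) hl (qExp_ne_zero _ _) D.hx.lower D.hv.lower D.comm.af hij
  · rw [upper_of_lt hij, Finset.sum_eq_zero]
    intro k hk
    rw [Finset.mem_range] at hk
    rw [upper_of_lt (a := (firstTriangular V P h).a) (by omega), zero_mul]

/-- The last row of L^x_- is (G - H) X_k, by moving a_n and b_n in `lower_eq` to the left of Y_n. -/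
theorem firstTriangular_lower (hl : lam h ≠ 0) {k : ℕ} (hk : k < n) :
    upper (lam h) (firstTriangular V P h).b (firstTriangular V P h).a (firstTriangular V P h).e k n
      = ((firstTriangular V P h).b n * firstY V P h n
        - qExp h 1 ^ 2 • ((firstTriangular V P h).a n * firstY V P h n)) * firstX V P h k := by
  have O := isOscillator_firstData V (P := P) hl
  have hq := qExp_ne_zero h 1
  rw [O.lower_eq (lam_eq h) hl hk le_rfl, mul_sub, O.Y_a_self le_rfl, O.Y_b_self le_rfl, firstX,
    firstY, sub_mul, sub_mul, smul_sub, neg_sub]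
  simp only [smul_mul_assoc, smul_smul, mul_inv_cancel₀ hq, one_smul, sq]

/-- The block part of L^x_- L'_- gives (G - H) X L_-, and b_n times the reduced entry gives G X (L_+
- L_-). The terms G X L_- cancel. -/
theorem lastRow_identity {ι A : Type*} [Fintype ι] [Ring A] (b y H : A) (a p m : ι → A) :
    b * y * (∑ s, a s * p s) - H * ∑ s, a s * m s
      = ∑ s, (b * y - H) * a s * m s + b * - -(y * ∑ s, a s * (p s - m s)) := by
  simp only [neg_neg, Finset.mul_sum, ← Finset.sum_sub_distrib, ← Finset.sum_add_distrib]
  exact Finset.sum_congr rfl fun s _ => by noncomm_ring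

theorem plusRow_eq_sum {A : Type*} [Ring A] [Algebra ℂ A] {l : ℂ} {v : TriangularData A} {j : ℕ}
    (hj : j < n) (X : ℕ → A) :
    plusRow l v X j = ∑ k : Fin n, X k * upper l v.a v.b v.f k j :=
  (sum_fin_eq_sum_range hj (fun k => X k * upper l v.a v.b v.f k j) fun k hk => by
    rw [upper_of_lt hk, mul_zero]).symm

theorem minusRow_eq_sum {A : Type*} [Ring A] [Algebra ℂ A] {l : ℂ} {v : TriangularData A} {j : ℕ}
    (X : ℕ → A) : minusRow l n v X j = ∑ k : Fin n, X k * upper l v.b v.a v.e j k := by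
  rw [Fin.sum_univ_eq_sum_range (fun k => X k * upper l v.b v.a v.e j k)]
  refine Finset.sum_subset (fun k hk => ?_) fun k hk hk' => ?_
  · rw [Finset.mem_range]
    exact (Finset.mem_Ico.mp hk).2
  · rw [Finset.mem_range] at hk
    rw [Finset.mem_Ico] at hk'
    rw [upper_of_lt (by omega), mul_zero]

/-- Rows other than the last contain only co-product generators and come from the matrix product.
The last row is determined by the column recursion, whose solution `lastRow` coincides with the last
row of L^x_- L'_-. -/
theorem laxMinus_tensorData (hl : lam h ≠ 0) (hq2 : 1 + qExp h 1 ^ 2 ≠ 0) :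
    laxMinus h (tensorData P ρ) = laxMinus h (firstData V P h) * reducedMinus P ρ := by
  have D := reducedSetting_tensor (V := V) (P := P) (ρ := ρ) hl
  have hq := qExp_ne_zero h 1
  ext1 i j
  rw [laxMinus_eq_upper hl (isUq_tensorData hl hq2).isTorus', tensorData_triangular hl,
    Matrix.mul_apply]
  simp only [laxMinus_eq_upper hl (isUq_firstData (V := V) (P := P) hl).isTorus']
  change upper (lam h) (mul _ _).b (mul _ _).a _ _ _ = _
  induction i using Fin.lastCases with
  | last =>
    rw [Fin.sum_univ_castSucc]
    simp only [reducedMinus_castSucc, Fin.val_castSucc, Fin.val_last]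
    induction j using Fin.lastCases with
    | last =>
      rw [reducedMinus_last, Finset.sum_eq_zero, zero_add, mul_one, Fin.val_last, upper_self,
        upper_self]
      · exact (congrArg (fun z => (firstTriangular V P h).b n * z)
          ((triangular_last h _ _).2.2.2 le_rfl)).trans (mul_one _)
      · intro k _
        rw [LnMinus, extendBlock_castSucc_last, mul_zero]
    | cast j =>
      have e1 : ∀ k : Fin n, firstX V P h k = onF F V (P.bigX h k.castSucc) := fun k => by
        rw [firstX, extendOne_of_lt _ (show (k : ℕ) < n + 1 by omega)]; rfl
      have e2 : firstY V P h n = onF F V (P.bigXInv h (Fin.last n)) := by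
        rw [firstY, extendOne_of_lt _ (show n < n + 1 by omega)]; rfl
      rw [D.reduced_upper_last (lam_eq h) hl hq hq2 (by simp), reducedMinus_last_castSucc,
        lam_smul_reducedE hl, upper_self]
      simp only [firstTriangular_lower hl (Fin.is_lt _), LnMinus, extendBlock_castSucc]
      simp only [laxPlus_eq_upper hl (isUq_secondData F ρ).isTorus,
        laxMinus_eq_upper hl (isUq_secondData F ρ).isTorus', ← e1, ← e2]
      rw [lastRow, Fin.val_castSucc, plusRow_eq_sum j.2 (firstX V P h), minusRow_eq_sum]
      exact lastRow_identity _ _ _ _ _ _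
  | cast i =>
    have h1 : ∀ k : Fin (n + 1), upper (lam h) (firstTriangular V P h).b (firstTriangular V P h).a
        (firstTriangular V P h).e k i * reducedMinus P ρ k j
        = upper (lam h) (firstTriangular V P h).b (firstTriangular V P h).a
        (firstTriangular V P h).e k i * upper (lam h) (secondTriangular F ρ).b
        (secondTriangular F ρ).a (secondTriangular F ρ).e j k := by
      intro k
      induction k using Fin.lastCases with
      | last => rw [upper_of_lt (by simp), zero_mul, zero_mul]
      | cast k => rw [reducedMinus_castSucc, LnMinus_eq_upper hl]
    simp only [Fin.val_castSucc]
    rw [Finset.sum_congr rfl fun k _ => h1 k, sum_fin_eq_sum_range (j := i) (by omega) (fun k =>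
      upper (lam h) (firstTriangular V P h).b (firstTriangular V P h).a
        (firstTriangular V P h).e k i * upper (lam h) (secondTriangular F ρ).b
        (secondTriangular F ρ).a (secondTriangular F ρ).e j k)
      fun k hk => by rw [upper_of_lt hk, zero_mul]]
    rcases le_or_gt (j : ℕ) i with hij | hij
    · exact D.reduced_upper_of_lt (lam_eq h) hl hq hij i.2
    · rw [upper_of_lt hij, Finset.sum_eq_zero]
      intro k hk
      rw [Finset.mem_range] at hk
      rw [upper_of_lt (a := (secondTriangular F ρ).b) (by omega), mul_zero]

theorem laxMatrix_tensorData (hl : lam h ≠ 0) (hq2 : 1 + qExp h 1 ^ 2 ≠ 0) (u : ℂ) :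
    laxMatrix h (tensorData P ρ) u = reducedLax P ρ u := by
  rw [laxMatrix_eq h hl, laxPlus_tensorData hl hq2, laxMinus_tensorData hl hq2]
  rfl

/-- q⁴ - 1 = (q² - 1)(q² + 1); the two factors account for the two nondegeneracy conditions, λ ≠ 0
here and 1 + q² ≠ 0 in the next lemma. -/
theorem lam_ne_zero (hq : Complex.exp h ^ 4 ≠ 1) : lam h ≠ 0 := by
  intro h0
  have h1 := qExp_ne_zero h 1
  have h2 : qExp h 1 = Complex.exp h := by rw [qExp, mul_one]
  rw [lam_eq, sub_eq_zero] at h0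
  have h3 := mul_inv_cancel₀ h1
  rw [← h0, h2] at h3
  exact hq (by linear_combination (Complex.exp h ^ 2 + 1) * h3)

theorem one_add_sq_ne_zero (hq : Complex.exp h ^ 4 ≠ 1) : 1 + qExp h 1 ^ 2 ≠ 0 := by
  intro h0
  have h2 : qExp h 1 = Complex.exp h := by rw [qExp, mul_one]
  rw [h2] at h0
  exact hq (by linear_combination (Complex.exp h ^ 2 - 1) * h0)

end TensorRepresentation

end QLax

end

open QLax
theorem mainTheorem1 (h : ℂ) (hq : Complex.exp h ^ 4 ≠ 1) (n : ℕ)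
    {F V : Type*} [AddCommGroup F] [Module ℂ F] [AddCommGroup V] [Module ℂ V]
    (P : HeisenbergPairs (n + 1) F) (ρ : UqGL h n →ₐ[ℂ] Module.End ℂ V) :
    -- the Jordan-Schwinger operators define a representation of `U_q(gl(n+1))` on `F`
    (∃ ρJ : UqGL h (n + 1) →ₐ[ℂ] Module.End ℂ F, (gens h (n + 1)).map ρJ = P.jsData h) ∧
    -- its Lax matrix factorises, with factors of the stated shape
    (∀ u : ℂ, laxMatrix h (P.jsData h) u = P.ML h u * P.K h u * P.MR h u) ∧
    (∀ u : ℂ, IsLastRowUnitriangular (P.ML h u) ∧ IsLastRowUnitriangular (P.MR h u) ∧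
      (P.K h u).BlockTriangular id) ∧
    -- `L^{(12')}` is the Lax matrix of a representation of `U_q(gl(n+1))` on `F ⊗ V`
    (∃ ρ' : UqGL h (n + 1) →ₐ[ℂ] Module.End ℂ (TensorProduct ℂ F V),
      (∀ i : Fin n, ρ' ((gens h (n + 1)).k i.castSucc)
        = (firstData V P h).k i.castSucc * (secondData F ρ).k i) ∧
      ρ' ((gens h (n + 1)).k (Fin.last n)) = (firstData V P h).k (Fin.last n) ∧
      -- on the generators of `U_q(gl(n))` it is given by the co-product
      (∀ (i : ℕ) (hi : i + 1 < n),
        ρ' ((gens h (n + 1)).e i (by omega))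
          = (firstData V P h).e i (by omega)
              * ((secondData F ρ).kInv ⟨i, by omega⟩ * (secondData F ρ).k ⟨i + 1, hi⟩)
            + (firstData V P h).k ⟨i, by omega⟩ * (firstData V P h).kInv ⟨i + 1, by omega⟩
              * (secondData F ρ).e i hi ∧
        ρ' ((gens h (n + 1)).f i (by omega))
          = (firstData V P h).f i (by omega)
              * ((secondData F ρ).kInv ⟨i, by omega⟩ * (secondData F ρ).k ⟨i + 1, hi⟩)
            + (firstData V P h).k ⟨i, by omega⟩ * (firstData V P h).kInv ⟨i + 1, by omega⟩
              * (secondData F ρ).f i hi) ∧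
      ∀ u : ℂ, laxMatrix h ((gens h (n + 1)).map ρ') u = reducedLax P ρ u) ∧
    -- the reduced relation between the product of Lax matrices and `L^{(12')}`
    (∀ u : ℂ, laxMatrix h (firstData V P h) (u + 1) * reducedSecondLax P ρ u
      = qNum h u • reducedLax P ρ (u + 1)) ∧
    -- the factorisation of `L^{(12')}`
    (∀ u : ℂ, qNum h u • reducedLax P ρ (u + 1)
      = (P.ML h (u + 1)).map (onF F V) * (P.K h (u + 1)).map (onF F V) * Ln F ρ u
          * Mprime P ρ u * (P.MR h (u + 1)).map (onF F V)) ∧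
    (∀ u : ℂ, IsLastRowUnitriangular (Mprime P ρ u)) := by
  have hl := lam_ne_zero hq
  have hq2 := one_add_sq_ne_zero hq
  refine ⟨(HeisenbergPairs.isUq_jsData P hl).exists_hom, HeisenbergPairs.laxMatrix_jsData hl,
    fun u => ⟨?_, ?_, HeisenbergPairs.blockTriangular_K h u⟩, ?_,
    laxMatrix_mul_reducedSecondLax hl, reducedLax_factorisation hl, isLastRowUnitriangular_Mprime⟩
  · rw [HeisenbergPairs.ML_eq]; exact isLastRowUnitriangular_unipotentRow _
  · rw [HeisenbergPairs.MR_eq]; exact isLastRowUnitriangular_unipotentRow _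
  obtain ⟨ρ', hρ'⟩ := (isUq_tensorData (P := P) (ρ := ρ) hl hq2).exists_hom
  have hk : ∀ i, ρ' ((gens h (n + 1)).k i) = (tensorData P ρ).k i := fun i =>
    congrFun (congrArg ChevalleyData.k hρ') i
  have he : ∀ i hi, ρ' ((gens h (n + 1)).e i hi) = (tensorData P ρ).e i hi := fun i hi =>
    congrFun (congrFun (congrArg ChevalleyData.e hρ') i) hi
  have hf : ∀ i hi, ρ' ((gens h (n + 1)).f i hi) = (tensorData P ρ).f i hi := fun i hi =>
    congrFun (congrFun (congrArg ChevalleyData.f hρ') i) hi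
  refine ⟨ρ', fun i => ?_, ?_, fun i hi => ⟨?_, ?_⟩, fun u => ?_⟩
  · rw [hk, ← extendOne_of_lt (secondData F ρ).k i.2]
    rfl
  · rw [hk]
    -- V has no Cartan generator at the last index; the extension by 1 makes it act through F only.
    exact (congrArg (fun z => (firstData V P h).k (Fin.last n) * z)
      (extendOne_of_le (secondData F ρ).k le_rfl)).trans (mul_one _)
  · rw [he, ← extendOne_of_lt (secondData F ρ).kInv, ← extendOne_of_lt (secondData F ρ).k hi,
      ← extendZero_of_lt (secondData F ρ).e hi]
    exact if_neg hi.ne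
  · rw [hf, ← extendOne_of_lt (secondData F ρ).kInv, ← extendOne_of_lt (secondData F ρ).k hi,
      ← extendZero_of_lt (secondData F ρ).f hi]
    rfl
  · rw [hρ', laxMatrix_tensorData hl hq2]
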